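/- Consider near spatial infinity of Minkowski space the conformal representation with coordinates $(\tau,\rho,\omega)$, $-1<\tau<1$, $\rho\ge 0$, $\omega\in\mathbb S^2$, in which spatial infinity is the cylinder $\mathcal I=\{\rho=0\}$ and the critical sets $\mathcal I^\pm$ are $\{\rho=0,\ \tau=\pm1\}$. With $\dot{}=\partial_\tau$, ${}'=\partial_\rho$, and $\eth,\bar\eth$ the spin-raising and spin-lowering operators of the unit sphere, put $$\blacksquare\zeta=(1-\tau^2)\ddot\zeta+2\tau\rho\,\dot\zeta'-\rho^2\zeta''-2\tau\dot\zeta-\tfrac12(\eth\bar\eth+\bar\eth\eth)\zeta .$$ The Maxwell-scalar system with charge $\mathfrak q\in\mathbb R$, in the Lorenz gauge, for the complex scalar field $\phi$ and the components $\alpha,\alpha_1$ (spin weight $0$), $\alpha_0$ (spin weight $1$), $\alpha_2$ (spin weight $-1$) of the gauge potential, is $$\blacksquare\phi=\mathfrak q^2\phi(\tfrac12\alpha^2-2\alpha_1^2+2\alpha_0\alpha_2)+\mathrm i\sqrt2\,\mathfrak q(2\alpha_1\rho\phi'+\alpha\dot\phi-2\tau\alpha_1\dot\phi+\alpha_0\bar\eth\phi-\alpha_2\eth\phi),$$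 $$\blacksquare\alpha-4\dot\alpha_1=2\mathfrak q^2\alpha|\phi|^2+\mathrm i\sqrt2\,\mathfrak q(\dot\phi\bar\phi-\dot{\bar\phi}\phi),$$ $$\blacksquare\alpha_0+\alpha_0=2\mathfrak q^2\alpha_0|\phi|^2+\tfrac{\mathrm i\mathfrak q}{\sqrt2}(\phi\,\eth\bar\phi-\bar\phi\,\eth\phi),$$ $$\blacksquare\alpha_1-\dot\alpha=2\mathfrak q^2\alpha_1|\phi|^2+\tfrac{\mathrm i\mathfrak q\rho}{\sqrt2}(\phi\bar\phi'-\bar\phi\phi')+\tfrac{\mathrm i\mathfrak q\tau}{\sqrt2}(\bar\phi\dot\phi-\phi\dot{\bar\phi}),$$ $$\blacksquare\alpha_2+\alpha_2=2\mathfrak q^2\alpha_2|\phi|^2+\tfrac{\mathrm i\mathfrak q}{\sqrt2}(\bar\phi\,\bar\eth\phi-\phi\,\bar\eth\bar\phi);$$ put $\alpha_\pm=\alpha\pm2\alpha_1$. *Initial data.* On $\tau=0$ let $\alpha=0$ and $\dot\phi=\dot\alpha=\dot\alpha_1=\dot\alpha_0=\dot\alpha_2=0$, and let $\phi,\alpha_1,\alpha_0,\alpha_2$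 be given by series $\sum_{n\ge0}\sum_{|s|\le\ell\le n}\sum_{|m|\le\ell}\frac1{n!}c_{n;\ell,m}\,{}_sY_{\ell m}\,\rho^n$ ($s$ the spin weight) that are analytic near $\rho=0$, i.e. $|c_{n;\ell,m}|\le M\,n!\,r^{-n}$ for some $M$ and $r>0$, such that $\alpha_1$ is real, $\alpha_2=-\overline{\alpha_0}$, $\alpha_1|_{\rho=0}=0$ (hence the whole potential vanishes at $\rho=0$), and the Lorenz constraint $2\rho\alpha_1'-2\alpha_1+\bar\eth\alpha_0-\eth\alpha_2=0$ holds. (The asymptotic conditions for finite energy at spatial infinity are then satisfied.) A set of data is called open and dense if it is so with respect to each of the distances given, for $r>0$, by the norms $\sup_{n,\ell,m}\frac{r^n}{n!}|c_{n;\ell,m}|$. *Solution jets.* The jet $J^p[\phi,\boldsymbol\alpha]$ consists of $\partial_\rho^p\phi$, $\partial_\rho^p\alpha_\pm$, $\partial_\rho^p\alpha_0$, $\partial_\rho^p\alpha_2$ at $\rho=0$, expanded as $\sum_{|s|\le\ell\le p}\sum_{|m|\le\ell}c_{p;\ell,m}(\tau)\,{}_sY_{\ell m}$ with $c_{p;\ell,m}$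 smooth on $(-1,1)$; solution jets satisfy the equations obtained by applying $\partial_\rho^p$, $p=0,1,2,\dots$, to the system at $\rho=0$, and assume the initial data at $\tau=0$. **Theorem.** 1. For every $\mathfrak q\in\mathbb R$ and all such data, solution jets of all orders exist, and near each of $\tau=\pm1$ every coefficient $c_{p;\ell,m}(\tau)$ of any component has, with $x=1\mp\tau$, the form $\sum_{j=0}^{N}a_j(x)\ln^jx$ with $a_j$ analytic at $x=0$. So all its singularities at $\mathcal I^\pm$ come from terms $(1\mp\tau)^{\mu_1}\ln^{\mu_2}(1\mp\tau)$ with non-negative integers $\mu_1,\mu_2$. 2. Let $\mathfrak q\ne0$. For every $p\ge1$ there is an open and dense set of data for which $J^p[\phi,\boldsymbol\alpha]$ has logarithmic divergences at both $\tau=1$ and $\tau=-1$ in every spherical-harmonic sector: for all $0\le\ell\le p$, $|m|\le\ell$, the coefficients of $\alpha_+$ and $\alpha_-$, and, if $\ell\ge1$, also those of $\alpha_0$ and $\alpha_2$, contain a term $(1\mp\tau)^{\mu_1}\ln^{\mu_2}(1\mp\tau)$ with non-zero coefficient and $\mu_2\ge1$ at $\tau=\pm1$. 3. Let $\mathfrak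 q\ne0$. For an open and dense set of data, $J^2[\phi,\boldsymbol\alpha]$ has, at each of $\tau=\pm1$, a coefficient containing such a term with $\mu_2\ge2$. In the decoupled case $\mathfrak q=0$, in contrast, no term with $\mu_2\ge2$ occurs in the jet of any order for any of the data. -/

import Mathlib

open Set Filter Topology
open scoped ContDiff ComplexConjugate

noncomputable section

namespace MaxwellScalar

/-! ### Functions on the cylinder at spatial infinity

The cylinder is `(-1, 1) × S²`.  Spin-weighted functions on `S²` are represented in the usual way by
functions on `SU(2) ≅ S³ = {(z, w) ∈ ℂ² : |z|² + |w|² = 1}`, where `(z, w)` is the first column of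
the matrix `[[z, -w̄], [w, z̄]]`; spin weight `s` means `f (e^{iψ/2} z, e^{iψ/2} w) = e^{isψ} f (z, w)`,
and in spherical coordinates `z = cos (θ/2) e^{iϕ/2}`, `w = sin (θ/2) e^{-iϕ/2}`.
Only the values for `-1 < τ < 1` and `|z|² + |w|² = 1` matter. -/

/-- Functions `f τ z w` on `(-1, 1) × SU(2)`. -/
abbrev Fn : Type := ℝ → ℂ → ℂ → ℂ

/-- Derivative of `f` along the left-invariant vector field on `SU(2)` which generates the right
multiplication by `[[cos (t/2), -c̄ sin (t/2)], [c sin (t/2), cos (t/2)]]` (with `|c| = 1`). -/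
def flowDeriv (c : ℂ) (f : Fn) : Fn := fun τ z w =>
  deriv (fun t : ℝ =>
    f τ (z * (Real.cos (t / 2) : ℂ) - conj w * (c * (Real.sin (t / 2) : ℂ)))
      (w * (Real.cos (t / 2) : ℂ) + conj z * (c * (Real.sin (t / 2) : ℂ)))) 0

/-- The operator `ð` (unit sphere; it raises the spin weight by one). -/
def eth (f : Fn) : Fn := fun τ z w =>
  -(flowDeriv 1 f τ z w + Complex.I * flowDeriv Complex.I f τ z w)

/-- The operator `ð̄` (unit sphere; it lowers the spin weight by one). -/
def ethBar (f : Fn) : Fn := fun τ z w =>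
  -(flowDeriv 1 f τ z w - Complex.I * flowDeriv Complex.I f τ z w)

/-- The derivative `∂_τ`. -/
def dtau (f : Fn) : Fn := fun τ z w => deriv (fun t : ℝ => f t z w) τ

/-- The spin-weighted spherical harmonic `ₛY_{ℓm}`, orthonormal on the unit sphere, for
`|s| ≤ ℓ`, `|m| ≤ ℓ`.  Up to normalisation it is the coefficient of `u^{ℓ+m} v^{ℓ-m}` in
`(z u + w v)^{ℓ+s} (-w̄ u + z̄ v)^{ℓ-s}`. -/
def sY (s : ℤ) (l : ℕ) (m : ℤ) (z w : ℂ) : ℂ :=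
  (Real.sqrt ((2 * (l : ℝ) + 1) / (4 * Real.pi) *
      (((l + m).toNat.factorial : ℝ) * ((l - m).toNat.factorial : ℝ)) /
      (((l + s).toNat.factorial : ℝ) * ((l - s).toNat.factorial : ℝ))) : ℂ) *
    ((Polynomial.C z * Polynomial.X + Polynomial.C w) ^ (l + s).toNat *
      (Polynomial.C (-conj w) * Polynomial.X + Polynomial.C (conj z)) ^ (l - s).toNat).coeff
        (l + m).toNat

/-- The harmonic sectors `(ℓ, m)` of spin weight `s` that occur at order `n`:
`|s| ≤ ℓ ≤ n` and `-ℓ ≤ m ≤ ℓ`. -/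
def modes (s : ℤ) (n : ℕ) : Finset (ℕ × ℤ) :=
  (Finset.Icc s.natAbs n ×ˢ Finset.Icc (-(n : ℤ)) n).filter (fun k => |k.2| ≤ (k.1 : ℤ))

/-! ### Expansions in powers of `ρ`

A field near the cylinder is given by its Taylor series at `ρ = 0`, a power series in `ρ` with
coefficients in `Fn`. -/

/-- The field `∑ₙ (1/n!) ∑_{ℓ,m} c_{n;ℓ,m}(τ) ₛY_{ℓm} ρⁿ`. -/
def field (s : ℤ) (c : ℕ → ℕ × ℤ → ℝ → ℂ) : PowerSeries Fn :=
  PowerSeries.mk fun n => fun τ z w =>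
    (n.factorial : ℂ)⁻¹ * ∑ k ∈ modes s n, c n k τ * sY s k.1 k.2 z w

/-- Application of an operator on functions of `(τ, ω)` to all coefficients of a field. -/
def lift (D : Fn → Fn) (F : PowerSeries Fn) : PowerSeries Fn :=
  PowerSeries.mk fun n => D (PowerSeries.coeff n F)

/-- Complex conjugation of a field (`ρ` is real). -/
def cj (F : PowerSeries Fn) : PowerSeries Fn := PowerSeries.map (starRingEnd Fn) F

/-- The coordinate `τ`. -/
def tau : PowerSeries Fn := PowerSeries.C (fun τ _ _ => (τ : ℂ))

/-- The coordinate `ρ`. -/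
def rho : PowerSeries Fn := PowerSeries.X

/-- The derivative `∂_τ`. -/
def dT (F : PowerSeries Fn) : PowerSeries Fn := lift dtau F

/-- The derivative `∂_ρ`. -/
def dR (F : PowerSeries Fn) : PowerSeries Fn := PowerSeries.derivative Fn F

/-- The F-reduced wave operator. -/
def box (F : PowerSeries Fn) : PowerSeries Fn :=
  (1 - tau ^ 2) * dT (dT F) + 2 * tau * rho * dR (dT F) - rho ^ 2 * dR (dR F) - 2 * tau * dT F
    - (1 / 2 : ℂ) • (lift eth (lift ethBar F)) - (1 / 2 : ℂ) • (lift ethBar (lift eth F))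

/-- Equality of two fields to all orders at `ρ = 0`, on the whole cylinder `(-1, 1) × SU(2)`. -/
def EqOnCylinder (F G : PowerSeries Fn) : Prop :=
  ∀ (n : ℕ) (τ : ℝ) (z w : ℂ), -1 < τ → τ < 1 → ‖z‖ ^ 2 + ‖w‖ ^ 2 = 1 →
    PowerSeries.coeff n F τ z w = PowerSeries.coeff n G τ z w

/-! ### The Maxwell-scalar system -/

/-- The Maxwell-scalar system with charge `q` in the Lorenz gauge, for the scalar field `φ` and the
components `α` (time component) and `α₁`, `α₀`, `α₂` (spatial components; spin weights `0, 1, -1`)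
of the gauge potential, written in the F-gauge. -/
structure System (q : ℝ) (φ α α₁ α₀ α₂ : PowerSeries Fn) : Prop where
  phi : EqOnCylinder (box φ)
    ((q ^ 2 : ℂ) • (φ * ((1 / 2 : ℂ) • α ^ 2 - 2 * α₁ ^ 2 + 2 * α₀ * α₂))
      + (Complex.I * Real.sqrt 2 * q) •
        (2 * α₁ * rho * dR φ + α * dT φ - 2 * tau * α₁ * dT φ
          + α₀ * lift ethBar φ - α₂ * lift eth φ))
  alpha : EqOnCylinder (box α - 4 * dT α₁)
    ((2 * q ^ 2 : ℂ) • (α * (φ * cj φ))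
      + (Complex.I * Real.sqrt 2 * q) • (dT φ * cj φ - dT (cj φ) * φ))
  alpha0 : EqOnCylinder (box α₀ + α₀)
    ((2 * q ^ 2 : ℂ) • (α₀ * (φ * cj φ))
      + (Complex.I * q / Real.sqrt 2) • (φ * lift eth (cj φ) - cj φ * lift eth φ))
  alpha1 : EqOnCylinder (box α₁ - dT α)
    ((2 * q ^ 2 : ℂ) • (α₁ * (φ * cj φ))
      + (Complex.I * q / Real.sqrt 2) • (rho * (φ * dR (cj φ) - cj φ * dR φ))
      + (Complex.I * q / Real.sqrt 2) • (tau * (cj φ * dT φ - φ * dT (cj φ))))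
  alpha2 : EqOnCylinder (box α₂ + α₂)
    ((2 * q ^ 2 : ℂ) • (α₂ * (φ * cj φ))
      + (Complex.I * q / Real.sqrt 2) • (cj φ * lift ethBar φ - φ * lift ethBar (cj φ)))

/-! ### Initial data -/

/-- The field on the initial hypersurface `τ = 0` with constant harmonic coefficients `c n (ℓ, m)`
(regarded as independent of `τ`). -/
def dataField (s : ℤ) (c : ℕ → ℕ × ℤ → ℂ) : PowerSeries Fn := field s (fun n k _ => c n k)

/-- Convergence of `∑ₙ (1/n!) ∑_{ℓ,m} c_{n;ℓ,m} ₛY_{ℓm} ρⁿ` for small `ρ`. -/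
def IsAnalyticData (s : ℤ) (c : ℕ → ℕ × ℤ → ℂ) : Prop :=
  ∃ r > (0 : ℝ), ∃ M : ℝ, ∀ n, ∀ k ∈ modes s n, r ^ n / (n.factorial : ℝ) * ‖c n k‖ ≤ M

/-- Analytic time-symmetric initial data on `τ = 0`: the harmonic coefficients of `φ`, `α₁`, `α₀`,
`α₂`; the component `α` and all first `τ`-derivatives vanish initially.
Coefficients outside of `modes` are irrelevant. -/
structure InitialData where
  phi : ℕ → ℕ × ℤ → ℂ
  alpha1 : ℕ → ℕ × ℤ → ℂ
  alpha0 : ℕ → ℕ × ℤ → ℂ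
  alpha2 : ℕ → ℕ × ℤ → ℂ
  analytic_phi : IsAnalyticData 0 phi
  analytic_alpha1 : IsAnalyticData 0 alpha1
  analytic_alpha0 : IsAnalyticData 1 alpha0
  analytic_alpha2 : IsAnalyticData (-1) alpha2
  /-- the gauge potential is real -/
  real_alpha1 : EqOnCylinder (cj (dataField 0 alpha1)) (dataField 0 alpha1)
  real_alpha02 : EqOnCylinder (dataField (-1) alpha2) (-cj (dataField 1 alpha0))
  /-- the Lorenz gauge condition on the initial hypersurface -/
  lorenz : EqOnCylinder
    (2 * (rho * dR (dataField 0 alpha1)) - 2 * dataField 0 alpha1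
      + lift ethBar (dataField 1 alpha0) - lift eth (dataField (-1) alpha2)) 0
  /-- the gauge potential vanishes at leading order (for `alpha0`, `alpha2` this is automatic) -/
  leading : alpha1 0 (0, 0) = 0

/-- `d` and `d'` have distance at most `ε` in the norm
`sup_{n,ℓ,m} (rⁿ/n!) |c_{n;ℓ,m}|` of data that are analytic in `ρ`. -/
def InitialData.Near (r ε : ℝ) (d d' : InitialData) : Prop :=
  (∀ n, ∀ k ∈ modes 0 n, r ^ n / (n.factorial : ℝ) * ‖d.phi n k - d'.phi n k‖ ≤ ε) ∧
  (∀ n, ∀ k ∈ modes 0 n, r ^ n / (n.factorial : ℝ) * ‖d.alpha1 n k - d'.alpha1 n k‖ ≤ ε) ∧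
  (∀ n, ∀ k ∈ modes 1 n, r ^ n / (n.factorial : ℝ) * ‖d.alpha0 n k - d'.alpha0 n k‖ ≤ ε) ∧
  (∀ n, ∀ k ∈ modes (-1) n, r ^ n / (n.factorial : ℝ) * ‖d.alpha2 n k - d'.alpha2 n k‖ ≤ ε)

/-- The set `S` of data is open and dense with respect to every one of the norms of
`InitialData.Near`, `r > 0`. -/
def OpenDense (S : Set InitialData) : Prop :=
  ∀ r > (0 : ℝ),
    (∀ d ∈ S, ∃ ε > (0 : ℝ), ∀ d', InitialData.Near r ε d d' → d' ∈ S) ∧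
    (∀ d, ∀ ε > (0 : ℝ), ∃ d' ∈ S, InitialData.Near r ε d d')

/-! ### Solution jets -/

/-- The components of a jet. -/
inductive Component
  | phi | alphaPlus | alphaMinus | alpha0 | alpha2

/-- The spin weight of a component. -/
def Component.weight : Component → ℤ
  | .phi => 0
  | .alphaPlus => 0
  | .alphaMinus => 0
  | .alpha0 => 1
  | .alpha2 => -1

/-- The sequence of jets at the cylinder, through the harmonic coefficients
`φ_{p;ℓ,m}(τ)`, … of `∂_ρ^p φ`, `∂_ρ^p α`, `∂_ρ^p α₁`, `∂_ρ^p α₀`, `∂_ρ^p α₂` at `ρ = 0`. -/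
structure Jets where
  phi : ℕ → ℕ × ℤ → ℝ → ℂ
  alpha : ℕ → ℕ × ℤ → ℝ → ℂ
  alpha1 : ℕ → ℕ × ℤ → ℝ → ℂ
  alpha0 : ℕ → ℕ × ℤ → ℝ → ℂ
  alpha2 : ℕ → ℕ × ℤ → ℝ → ℂ

/-- The coefficient in the sector `k = (ℓ, m)` of a component of the jet of order `p`, where
`α_± = α ± 2 α₁`. -/
def Jets.elt (J : Jets) (c : Component) (p : ℕ) (k : ℕ × ℤ) (τ : ℝ) : ℂ :=
  match c with
  | .phi => J.phi p k τ
  | .alphaPlus => J.alpha p k τ + 2 * J.alpha1 p k τ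
  | .alphaMinus => J.alpha p k τ - 2 * J.alpha1 p k τ
  | .alpha0 => J.alpha0 p k τ
  | .alpha2 => J.alpha2 p k τ

/-- The coefficients `c p (ℓ, m)` are smooth on `(-1, 1)`, with values `v` and vanishing derivative
at `τ = 0`. -/
def HasStaticData (s : ℤ) (c : ℕ → ℕ × ℤ → ℝ → ℂ) (v : ℕ → ℕ × ℤ → ℂ) : Prop :=
  ∀ p, ∀ k ∈ modes s p, ContDiffOn ℝ ∞ (c p k) (Ioo (-1) 1) ∧ c p k 0 = v p k ∧
    deriv (c p k) 0 = 0

/-- `J` consists of the solution jets of the Maxwell-scalar system with charge `q` for the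
data `d`. -/
structure IsSolutionJet (q : ℝ) (d : InitialData) (J : Jets) : Prop where
  data_phi : HasStaticData 0 J.phi d.phi
  data_alpha : HasStaticData 0 J.alpha 0
  data_alpha1 : HasStaticData 0 J.alpha1 d.alpha1
  data_alpha0 : HasStaticData 1 J.alpha0 d.alpha0
  data_alpha2 : HasStaticData (-1) J.alpha2 d.alpha2
  system : System q (field 0 J.phi) (field 0 J.alpha) (field 0 J.alpha1) (field 1 J.alpha0)
    (field (-1) J.alpha2)

/-! ### Logarithmic divergences -/

/-- Near `τ = e` (`e = ±1`), with `x = 1 - e τ > 0`, one has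
`f(τ) = ∑_{j ≤ N} a_j(x) (ln x)^j` where the `a_j` are analytic at `x = 0`; so `f` is a
convergent sum of terms `(1 - e τ)^i ln^j (1 - e τ)` with non-negative integers `i`, `j ≤ N`. -/
def HasLogExpansion (f : ℝ → ℂ) (e : ℝ) (N : ℕ) (a : ℕ → ℝ → ℂ) : Prop :=
  (∀ j, AnalyticAt ℝ (a j) 0) ∧
  ∀ᶠ x : ℝ in 𝓝[>] 0, f (e * (1 - x)) =
    ∑ j ∈ Finset.range (N + 1), a j x * ((Real.log x ^ j : ℝ) : ℂ)

/-- The expansion of `f` at `τ = e` contains, with a non-zero coefficient, a term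
`(1 - e τ)^{μ₁} ln^{μ₂} (1 - e τ)` with `μ₂ ≥ K`. -/
def HasLogTerm (f : ℝ → ℂ) (e : ℝ) (K : ℕ) : Prop :=
  ∃ (N : ℕ) (a : ℕ → ℝ → ℂ), HasLogExpansion f e N a ∧
    ∃ μ₁ μ₂ : ℕ, K ≤ μ₂ ∧ μ₂ ≤ N ∧ iteratedDeriv μ₁ (a μ₂) 0 ≠ 0

end MaxwellScalar

end

open Set Filter Topology
open scoped ContDiff ComplexConjugate
open Finset (sum_congr mul_sum sum_add_distrib sum_eq_zero single_le_sum smul_sum sum_nonneg sum_sub_distrib sum_range_succ)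
open Complex (I real_smul conj_ofReal ofReal_one norm_real mul_conj conj_I conj_conj normSq_eq_norm_sq re_ofReal_mul)

noncomputable section

set_option linter.unusedSectionVars false

namespace MaxwellScalar

/-- The range of `τ`. -/
notation "𝕀" => Ioo (-1 : ℝ) 1

/-- The values of `τ` at the critical sets. -/
notation "𝕊" => ({1, -1} : Set ℝ)

/-- The filter of the limit `x → 0`, `x > 0`. -/
notation "𝓝₊" => 𝓝[>] (0 : ℝ)

/-! ### Linear ordinary differential equations -/

section LinearODE

open MeasureTheory intervalIntegral Interval

variable {E : Type*} [NormedAddCommGroup E] [NormedSpace ℝ E]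

/-- A function with `‖z'‖ ≤ K ‖z‖` for a locally bounded `K` which vanishes at one point
vanishes. -/
theorem eq_zero_of_norm_deriv_le {a b t₀ : ℝ} {z z' : ℝ → E} {K : ℝ → ℝ}
    (hz : ∀ t ∈ Ioo a b, HasDerivAt z (z' t) t) (hK : ContinuousOn K (Ioo a b))
    (hle : ∀ t ∈ Ioo a b, ‖z' t‖ ≤ K t * ‖z t‖) (ht₀ : t₀ ∈ Ioo a b) (h0 : z t₀ = 0) :
    ∀ t ∈ Ioo a b, z t = 0 := by
  intro t ht
  rcases le_total t₀ t with h | h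
  · have hsub : Icc t₀ t ⊆ Ioo a b := fun s hs => ⟨ht₀.1.trans_le hs.1, hs.2.trans_lt ht.2⟩
    obtain ⟨M, hM⟩ := isCompact_Icc.exists_bound_of_continuousOn (hK.mono hsub)
    refine eq_zero_of_abs_deriv_le_mul_abs_self_of_eq_zero_right (f := z) (f' := z') (K := M)
      (a := t₀) (b := t)
      (fun s hs => (hz s (hsub hs)).continuousAt.continuousWithinAt)
      (fun s hs => (hz s (hsub (Ico_subset_Icc_self hs))).hasDerivWithinAt) h0 ?_ t ⟨h, le_rfl⟩
    intro s hs
    have hs' := Ico_subset_Icc_self hs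
    refine (hle s (hsub hs')).trans ?_
    gcongr
    exact (le_abs_self _).trans (hM s hs')
  · have hsub : Icc t t₀ ⊆ Ioo a b := fun s hs => ⟨ht.1.trans_le hs.1, hs.2.trans_lt ht₀.2⟩
    obtain ⟨M, hM⟩ := isCompact_Icc.exists_bound_of_continuousOn (hK.mono hsub)
    have hneg : ∀ s ∈ Icc (-t₀) (-t), -s ∈ Icc t t₀ := fun s hs =>
      ⟨by linarith [hs.2], by linarith [hs.1]⟩
    have hd : ∀ s ∈ Icc (-t₀) (-t), HasDerivAt (fun s => z (-s)) (-(z' (-s))) s := by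
      intro s hs
      have := (hz (-s) (hsub (hneg s hs))).scomp s (hasDerivAt_neg s)
      simpa [Function.comp_def] using this
    have := eq_zero_of_abs_deriv_le_mul_abs_self_of_eq_zero_right (f := fun s => z (-s))
      (f' := fun s => -(z' (-s))) (K := M) (a := -t₀) (b := -t)
      (fun s hs => (hd s hs).continuousAt.continuousWithinAt)
      (fun s hs => (hd s (Ico_subset_Icc_self hs)).hasDerivWithinAt) (by simpa using h0) ?_ (-t)
      ⟨by linarith, le_rfl⟩
    · simpa using this
    intro s hs
    have hs' := hneg s (Ico_subset_Icc_self hs)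
    rw [norm_neg]
    refine (hle _ (hsub hs')).trans ?_
    gcongr
    exact (le_abs_self _).trans (hM _ hs')

/-- The terms of the Volterra series of `y' = A y + b`, `y 0 = c`. -/
def volterraTerm (A : ℝ → E →L[ℝ] E) (b : ℝ → E) (c : E) : ℕ → ℝ → E
  | 0 => fun t => c + ∫ s in (0 : ℝ)..t, b s
  | k + 1 => fun t => ∫ s in (0 : ℝ)..t, A s (volterraTerm A b c k s)

theorem hasDerivAt_integral_of_continuousOn [CompleteSpace E] {g : ℝ → E}
    (hg : ContinuousOn g 𝕀) {t : ℝ} (ht : t ∈ 𝕀) :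
    HasDerivAt (fun t => ∫ s in (0 : ℝ)..t, g s) (g t) t := by
  apply integral_hasDerivAt_right
  · apply ContinuousOn.intervalIntegrable
    apply hg.mono
    rintro s hs
    rw [uIcc, mem_Icc] at hs
    have h1 := ht.1
    have h2 := ht.2
    constructor
    · exact lt_of_lt_of_le (lt_min (by norm_num) h1) hs.1
    · exact lt_of_le_of_lt hs.2 (max_lt (by norm_num) h2)
  · exact hg.stronglyMeasurableAtFilter isOpen_Ioo t ht
  · exact hg.continuousAt (isOpen_Ioo.mem_nhds ht)

variable [CompleteSpace E] {A : ℝ → E →L[ℝ] E} {b : ℝ → E}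

theorem continuousOn_volterraTerm (hA : ContinuousOn A 𝕀)
    (hb : ContinuousOn b 𝕀) (c : E) (k : ℕ) :
    ContinuousOn (volterraTerm A b c k) 𝕀 := by
  induction k with
  | zero =>
    intro t ht
    exact (((hasDerivAt_integral_of_continuousOn hb ht).const_add c).continuousAt).continuousWithinAt
  | succ k ih =>
    intro t ht
    exact (hasDerivAt_integral_of_continuousOn (hA.clm_apply ih) ht).continuousAt.continuousWithinAt

theorem norm_volterraTerm_le (hA : ContinuousOn A 𝕀)
    (hb : ContinuousOn b 𝕀) (c : E) {T M C : ℝ} (hT : T < 1) (hM : 0 ≤ M)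
    (hAM : ∀ t, |t| ≤ T → ‖A t‖ ≤ M) (hC : ∀ t, |t| ≤ T → ‖volterraTerm A b c 0 t‖ ≤ C)
    (k : ℕ) : ∀ t, |t| ≤ T → ‖volterraTerm A b c k t‖ ≤ C * M ^ k * |t| ^ k / k.factorial := by
  induction k with
  | zero => intro t ht; simpa using hC t ht
  | succ k ih =>
    intro t ht
    have hsub : ∀ s ∈ Ι (0 : ℝ) t, |s| ≤ T := by
      intro s hs
      rw [uIoc, mem_Ioc] at hs
      rw [abs_le] at ht ⊢
      rcases le_total 0 t with h | h
      · rw [min_eq_left h, max_eq_right h] at hs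
        constructor <;> linarith
      · rw [min_eq_right h, max_eq_left h] at hs
        constructor <;> linarith
    have hint : IntegrableOn (fun s => ‖A s (volterraTerm A b c k s)‖) (Ι (0 : ℝ) t) := by
      have h1 : IntervalIntegrable (fun s => A s (volterraTerm A b c k s)) volume 0 t := by
        apply ContinuousOn.intervalIntegrable
        apply (hA.clm_apply (continuousOn_volterraTerm hA hb c k)).mono
        intro s hs
        rw [uIcc, mem_Icc] at hs
        have h2 := abs_le.mp ht
        constructor
        · exact lt_of_lt_of_le (lt_min (by norm_num) (by linarith)) hs.1
        · exact lt_of_le_of_lt hs.2 (max_lt (by norm_num) (by linarith))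
      exact (intervalIntegrable_iff.mp h1).norm
    calc ‖∫ s in (0 : ℝ)..t, A s (volterraTerm A b c k s)‖
        ≤ ∫ s in Ι (0 : ℝ) t, ‖A s (volterraTerm A b c k s)‖ :=
          norm_integral_le_integral_norm_uIoc
      _ ≤ ∫ s in Ι (0 : ℝ) t, C * M ^ (k + 1) / k.factorial * |s - 0| ^ k := by
          apply setIntegral_mono_on hint
          · have : Continuous fun s : ℝ => C * M ^ (k + 1) / k.factorial * |s - 0| ^ k := by
              fun_prop
            exact (intervalIntegrable_iff.mp (this.intervalIntegrable 0 t))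
          · exact measurableSet_uIoc
          · intro s hs
            calc ‖A s (volterraTerm A b c k s)‖
                ≤ ‖A s‖ * ‖volterraTerm A b c k s‖ := (A s).le_opNorm _
              _ ≤ M * (C * M ^ k * |s| ^ k / k.factorial) := by
                  gcongr
                  · exact hAM s (hsub s hs)
                  · exact ih s (hsub s hs)
              _ = C * M ^ (k + 1) / k.factorial * |s - 0| ^ k := by
                  rw [sub_zero]; ring
      _ = C * M ^ (k + 1) * |t| ^ (k + 1) / (k + 1).factorial := by
          rw [MeasureTheory.integral_const_mul, integral_pow_abs_sub_uIoc, sub_zero, Nat.factorial_succ]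
          push_cast
          field_simp

/-- Solutions of linear equations on `(-1, 1)` exist globally. -/
theorem exists_linearODE_solution (hA : ContinuousOn A 𝕀)
    (hb : ContinuousOn b 𝕀) (c : E) :
    ∃ y : ℝ → E, y 0 = c ∧ ∀ t ∈ 𝕀, HasDerivAt y (A t (y t) + b t) t := by
  have hkey : ∀ t ∈ 𝕀, ∃ T, |t| < T ∧ 0 < T ∧ T < 1 ∧ ∃ M, 0 ≤ M ∧ ∃ C, 0 ≤ C ∧
      (∀ t, |t| ≤ T → ‖A t‖ ≤ M) ∧ (∀ t, |t| ≤ T → ‖b t‖ ≤ C) ∧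
      (∀ t, |t| ≤ T → ‖volterraTerm A b c 0 t‖ ≤ C) := by
    intro t ht
    have h1 : |t| < 1 := abs_lt.mpr ht
    have h0 : 0 ≤ |t| := abs_nonneg t
    refine ⟨(|t| + 1) / 2, by linarith, by linarith, by linarith, ?_⟩
    set T := (|t| + 1) / 2 with hTdef
    have hsub : Icc (-T) T ⊆ 𝕀 := by
      intro s hs
      constructor <;> linarith [hs.1, hs.2]
    obtain ⟨M, hM⟩ := isCompact_Icc.exists_bound_of_continuousOn (hA.mono hsub)
    obtain ⟨C, hC⟩ := isCompact_Icc.exists_bound_of_continuousOn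
      ((continuousOn_volterraTerm hA hb c 0).mono hsub)
    obtain ⟨C', hC'⟩ := isCompact_Icc.exists_bound_of_continuousOn (hb.mono hsub)
    refine ⟨max M 0, le_max_right _ _, max (max C C') 0, le_max_right _ _, ?_, ?_, ?_⟩
    · intro s hs
      exact (hM s (abs_le.mp hs)).trans (le_max_left _ _)
    · intro s hs
      exact (hC' s (abs_le.mp hs)).trans ((le_max_right _ _).trans (le_max_left _ _))
    · intro s hs
      exact (hC s (abs_le.mp hs)).trans ((le_max_left _ _).trans (le_max_left _ _))
  have hsum : ∀ t ∈ 𝕀, Summable fun k => volterraTerm A b c k t := by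
    intro t ht
    obtain ⟨T, htT, hT0, hT1, M, hM0, C, hC0, hAM, -, hC⟩ := hkey t ht
    apply Summable.of_norm_bounded (g := fun k => C * ((M * |t|) ^ k / k.factorial))
    · exact (Real.summable_pow_div_factorial _).mul_left C
    · intro k
      refine (norm_volterraTerm_le hA hb c hT1 hM0 hAM hC k t htT.le).trans (le_of_eq ?_)
      rw [mul_pow]; ring
  refine ⟨fun t => ∑' k, volterraTerm A b c k t, ?_, ?_⟩
  · change ∑' k, volterraTerm A b c k 0 = c
    rw [tsum_eq_single 0]
    · simp [volterraTerm]
    · intro k hk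
      obtain ⟨k, rfl⟩ := Nat.exists_eq_succ_of_ne_zero hk
      simp [volterraTerm]
  · intro t ht
    obtain ⟨T, htT, hT0, hT1, M, hM0, C, hC0, hAM, hbC, hC⟩ := hkey t ht
    set g' : ℕ → ℝ → E := fun k s => Nat.casesOn k (b s) fun k => A s (volterraTerm A b c k s)
      with hg'
    have hmain : HasDerivAt (fun t => ∑' k, volterraTerm A b c k t) (∑' k, g' k t) t := by
      apply hasDerivAt_tsum_of_isPreconnected (t := Ioo (-T) T) (y₀ := t)
        (u := fun k => Nat.casesOn k C fun k => M * (C * ((M * T) ^ k / k.factorial)))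
      · rw [← summable_nat_add_iff 1]
        exact ((Real.summable_pow_div_factorial _).mul_left C).mul_left M
      · exact isOpen_Ioo
      · exact isPreconnected_Ioo
      · intro k s hs
        have hs' : s ∈ 𝕀 := ⟨by linarith [hs.1], by linarith [hs.2]⟩
        cases k with
        | zero => exact (hasDerivAt_integral_of_continuousOn hb hs').const_add c
        | succ k =>
          exact hasDerivAt_integral_of_continuousOn
            (hA.clm_apply (continuousOn_volterraTerm hA hb c k)) hs'
      · intro k s hs
        have hsT : |s| ≤ T := (abs_lt.mpr hs).le
        cases k with
        | zero => exact hbC s hsT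
        | succ k =>
          calc ‖A s (volterraTerm A b c k s)‖ ≤ ‖A s‖ * ‖volterraTerm A b c k s‖ :=
                (A s).le_opNorm _
            _ ≤ M * (C * M ^ k * |s| ^ k / k.factorial) := by
                gcongr
                · exact hAM s hsT
                · exact norm_volterraTerm_le hA hb c hT1 hM0 hAM hC k s hsT
            _ ≤ M * (C * ((M * T) ^ k / k.factorial)) := by
                rw [mul_pow, mul_div_assoc, mul_assoc C, mul_div_assoc]
                have h1 : |s| ^ k ≤ T ^ k := by gcongr
                have h2 : (0 : ℝ) ≤ M ^ k := by positivity
                have h3 : (M ^ k * |s| ^ k) / k.factorial ≤ M ^ k * T ^ k / k.factorial := by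
                  gcongr
                have h4 := mul_le_mul_of_nonneg_left h3 (mul_nonneg hM0 hC0)
                refine (le_of_eq ?_).trans (h4.trans (le_of_eq ?_)) <;> ring
      · exact abs_lt.mp htT
      · exact hsum t ht
      · exact abs_lt.mp htT
    convert hmain using 1
    have hs := hsum t ht
    have hs' : Summable fun k => g' k t := by
      rw [← summable_nat_add_iff 1]
      exact hs.mapL (A t)
    rw [hs'.tsum_eq_zero_add, add_comm, (A t).map_tsum hs]
    rfl

end LinearODE

section SecondOrder

variable {A : Type*} [NormedCommRing A] [NormedAlgebra ℂ A]

/-- Uniqueness for linear second order equations. -/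
theorem eq_zero_of_secondOrder {a b t₀ : ℝ} {y y' : ℝ → A} {P : ℝ → ℝ} {Q : ℝ → A}
    (hy : ∀ t ∈ Ioo a b, HasDerivAt y (y' t) t)
    (hy' : ∀ t ∈ Ioo a b, HasDerivAt y' (P t • y' t + Q t * y t) t)
    (hP : ContinuousOn P (Ioo a b)) (hQ : ContinuousOn Q (Ioo a b))
    (ht₀ : t₀ ∈ Ioo a b) (h0 : y t₀ = 0) (h0' : y' t₀ = 0) :
    ∀ t ∈ Ioo a b, y t = 0 ∧ y' t = 0 := by
  have := eq_zero_of_norm_deriv_le (z := fun t => (y t, y' t))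
    (z' := fun t => (y' t, P t • y' t + Q t * y t)) (K := fun t => 1 + |P t| + ‖Q t‖)
    (fun t ht => (hy t ht).prodMk (hy' t ht))
    (by exact (continuousOn_const.add hP.abs).add hQ.norm) ?_ ht₀ (by simp [h0, h0'])
  · intro t ht
    simpa using this t ht
  intro t ht
  have h1 : ‖y t‖ ≤ ‖(y t, y' t)‖ := norm_fst_le (y t, y' t)
  have h2 : ‖y' t‖ ≤ ‖(y t, y' t)‖ := norm_snd_le (y t, y' t)
  have h3 := norm_nonneg (y t, y' t)
  rw [Prod.norm_def]
  apply max_le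
  · nlinarith [abs_nonneg (P t), norm_nonneg (Q t)]
  · calc ‖P t • y' t + Q t * y t‖ ≤ ‖P t • y' t‖ + ‖Q t * y t‖ := norm_add_le _ _
      _ ≤ |P t| * ‖(y t, y' t)‖ + ‖Q t‖ * ‖(y t, y' t)‖ := by
          rw [norm_smul, Real.norm_eq_abs]
          gcongr
          exact (norm_mul_le _ _).trans (by gcongr)
      _ ≤ (1 + |P t| + ‖Q t‖) * ‖(y t, y' t)‖ := by nlinarith

/-- The operator `(1 - τ²) ∂² + (β τ + γ) ∂ - κ`. -/
def sing (β γ : ℝ) (κ : A) (f : ℝ → A) (τ : ℝ) : A :=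
  (1 - τ ^ 2) • deriv (deriv f) τ + (β * τ + γ) • deriv f τ - κ * f τ

theorem one_sub_sq_pos {τ : ℝ} (h : τ ∈ 𝕀) : 0 < 1 - τ ^ 2 := by
  nlinarith [h.1, h.2]

theorem contDiffOn_of_secondOrder [CompleteSpace A] {f f' g : ℝ → A} {β γ : ℝ} {κ : A}
    (hf : ∀ t ∈ 𝕀, HasDerivAt f (f' t) t)
    (hf' : ∀ t ∈ 𝕀, HasDerivAt f'
      ((1 - t ^ 2)⁻¹ • (g t + κ * f t - (β * t + γ) • f' t)) t)
    (hg : ContDiffOn ℝ ∞ g 𝕀) : ContDiffOn ℝ ∞ f 𝕀 := by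
  have hU : UniqueDiffOn ℝ 𝕀 := isOpen_Ioo.uniqueDiffOn
  suffices h : ∀ n : ℕ, ContDiffOn ℝ n f 𝕀 ∧ ContDiffOn ℝ n f' 𝕀 by
    exact contDiffOn_infty.mpr fun n => (h n).1
  intro n
  induction n with
  | zero =>
    simp only [Nat.cast_zero, contDiffOn_zero]
    exact ⟨fun t ht => (hf t ht).continuousAt.continuousWithinAt,
      fun t ht => (hf' t ht).continuousAt.continuousWithinAt⟩
  | succ n ih =>
    push_cast
    constructor
    · rw [contDiffOn_succ_iff_deriv_of_isOpen isOpen_Ioo]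
      refine ⟨fun t ht => (hf t ht).differentiableAt.differentiableWithinAt, by simp, ?_⟩
      exact ih.2.congr fun t ht => (hf t ht).deriv
    · rw [contDiffOn_succ_iff_deriv_of_isOpen isOpen_Ioo]
      refine ⟨fun t ht => (hf' t ht).differentiableAt.differentiableWithinAt, by simp, ?_⟩
      have h1 : ContDiffOn ℝ n (fun t : ℝ => (1 - t ^ 2)⁻¹) 𝕀 := by
        apply ContDiffOn.inv
        · fun_prop
        · intro t ht; exact (one_sub_sq_pos ht).ne'
      have h2 : ContDiffOn ℝ n g 𝕀 := hg.of_le (by exact_mod_cast le_top)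
      refine ContDiffOn.congr (f := fun t => (1 - t ^ 2)⁻¹ • (g t + κ * f t - (β * t + γ) • f' t))
        ?_ fun t ht => (hf' t ht).deriv
      apply h1.smul
      apply (h2.add (contDiffOn_const.mul ih.1)).sub
      exact (by fun_prop : ContDiffOn ℝ n (fun t : ℝ => β * t + γ) 𝕀).smul ih.2

/-- Existence of solutions of the singular second order equation on `(-1, 1)`. -/
theorem exists_sing_solution [CompleteSpace A] (β γ : ℝ) (κ : A) {g : ℝ → A}
    (hg : ContDiffOn ℝ ∞ g 𝕀) (c c' : A) :
    ∃ f : ℝ → A, ContDiffOn ℝ ∞ f 𝕀 ∧ f 0 = c ∧ deriv f 0 = c' ∧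
      ∀ τ ∈ 𝕀, sing β γ κ f τ = g τ := by
  let F : ℝ → A × A →L[ℝ] A × A := fun t =>
    (ContinuousLinearMap.snd ℝ A A).prod
      ((1 - t ^ 2)⁻¹ • ((ContinuousLinearMap.mul ℝ A κ).comp (ContinuousLinearMap.fst ℝ A A)
        - (β * t + γ) • ContinuousLinearMap.snd ℝ A A))
  have hinv : ContinuousOn (fun t : ℝ => (1 - t ^ 2)⁻¹) 𝕀 := by
    apply ContinuousOn.inv₀
    · fun_prop
    · intro t ht; exact (one_sub_sq_pos ht).ne'
  have hF : ContinuousOn F 𝕀 := by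
    have h1 : ContinuousOn (fun t : ℝ => (1 - t ^ 2)⁻¹ •
      ((ContinuousLinearMap.mul ℝ A κ).comp (ContinuousLinearMap.fst ℝ A A)
        - (β * t + γ) • ContinuousLinearMap.snd ℝ A A)) 𝕀 := by
      apply hinv.smul
      fun_prop
    have h2 : F = fun t => (ContinuousLinearMap.prodₗᵢ ℝ)
      ((ContinuousLinearMap.snd ℝ A A), ((1 - t ^ 2)⁻¹ •
      ((ContinuousLinearMap.mul ℝ A κ).comp (ContinuousLinearMap.fst ℝ A A)
        - (β * t + γ) • ContinuousLinearMap.snd ℝ A A))) := rfl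
    rw [h2]
    exact (LinearIsometryEquiv.continuous _).comp_continuousOn (continuousOn_const.prodMk h1)
  have hb : ContinuousOn (fun t : ℝ => ((0 : A), (1 - t ^ 2)⁻¹ • g t)) 𝕀 :=
    continuousOn_const.prodMk (hinv.smul hg.continuousOn)
  obtain ⟨y, hy0, hy⟩ := exists_linearODE_solution hF hb (c, c')
  have hf : ∀ t ∈ 𝕀, HasDerivAt (fun t => (y t).1) ((y t).2) t := by
    intro t ht
    have := (ContinuousLinearMap.fst ℝ A A).hasFDerivAt.comp_hasDerivAt t (hy t ht)
    simpa [F, Function.comp_def] using this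
  have hf' : ∀ t ∈ 𝕀, HasDerivAt (fun t => (y t).2)
      ((1 - t ^ 2)⁻¹ • (g t + κ * (y t).1 - (β * t + γ) • (y t).2)) t := by
    intro t ht
    have := (ContinuousLinearMap.snd ℝ A A).hasFDerivAt.comp_hasDerivAt t (hy t ht)
    convert! this using 1
    simp only [F, ContinuousLinearMap.coe_snd', Prod.snd_add, ContinuousLinearMap.prod_apply,
      smul_apply, sub_apply, ContinuousLinearMap.comp_apply,
      ContinuousLinearMap.coe_fst', ContinuousLinearMap.mul_apply', ← smul_add]
    congr 1
    abel
  have hd : ∀ t ∈ 𝕀, deriv (deriv fun t => (y t).1) t =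
      (1 - t ^ 2)⁻¹ • (g t + κ * (y t).1 - (β * t + γ) • (y t).2) := by
    intro t ht
    rw [← (hf' t ht).deriv]
    apply Filter.EventuallyEq.deriv_eq
    filter_upwards [isOpen_Ioo.mem_nhds ht] with s hs using (hf s hs).deriv
  refine ⟨fun t => (y t).1, contDiffOn_of_secondOrder hf hf' hg, by simp [hy0], ?_, ?_⟩
  · rw [(hf 0 (by norm_num)).deriv, hy0]
  · intro τ hτ
    rw [sing, hd τ hτ, (hf τ hτ).deriv, smul_inv_smul₀ (one_sub_sq_pos hτ).ne']
    abel

theorem hasDerivAt_of_contDiffOn {E : Type*} [NormedAddCommGroup E] [NormedSpace ℝ E] {f : ℝ → E}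
    (hf : ContDiffOn ℝ ∞ f 𝕀) {τ : ℝ} (hτ : τ ∈ 𝕀) :
    HasDerivAt f (deriv f τ) τ :=
  ((hf.contDiffAt (isOpen_Ioo.mem_nhds hτ)).differentiableAt (by simp)).hasDerivAt

theorem contDiffOn_deriv {E : Type*} [NormedAddCommGroup E] [NormedSpace ℝ E] {f : ℝ → E}
    (hf : ContDiffOn ℝ ∞ f 𝕀) : ContDiffOn ℝ ∞ (deriv f) 𝕀 :=
  ((contDiffOn_infty_iff_deriv_of_isOpen isOpen_Ioo).mp hf).2

/-- Uniqueness of solutions of the singular second order equation. -/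
theorem sing_unique {β γ : ℝ} {κ : A} {f g : ℝ → A} (hf : ContDiffOn ℝ ∞ f 𝕀)
    (hg : ContDiffOn ℝ ∞ g 𝕀) (h : ∀ τ ∈ 𝕀, sing β γ κ f τ = sing β γ κ g τ)
    (h0 : f 0 = g 0) (h0' : deriv f 0 = deriv g 0) : EqOn f g 𝕀 := by
  intro τ hτ
  have hinv : ContinuousOn (fun t : ℝ => (1 - t ^ 2)⁻¹) 𝕀 := by
    apply ContinuousOn.inv₀
    · fun_prop
    · intro t ht; exact (one_sub_sq_pos ht).ne'
  have := eq_zero_of_secondOrder (y := fun t => f t - g t) (y' := fun t => deriv f t - deriv g t)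
    (P := fun t => -((1 - t ^ 2)⁻¹ * (β * t + γ))) (Q := fun t => (1 - t ^ 2)⁻¹ • κ)
    (t₀ := 0) (a := -1) (b := 1)
    (fun t ht => (hasDerivAt_of_contDiffOn hf ht).sub (hasDerivAt_of_contDiffOn hg ht)) ?_
    ?_ ?_ (by norm_num) (by simp [h0]) (by simp [h0']) τ hτ
  · exact sub_eq_zero.mp this.1
  · intro t ht
    refine ((hasDerivAt_of_contDiffOn (contDiffOn_deriv hf) ht).sub
      (hasDerivAt_of_contDiffOn (contDiffOn_deriv hg) ht)).congr_deriv ?_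
    have h1 := h t ht
    have h2 := (one_sub_sq_pos ht).ne'
    rw [sing, sing] at h1
    apply smul_right_injective A h2
    dsimp only
    rw [smul_add, smul_smul, smul_mul_assoc, smul_smul, mul_neg, ← mul_assoc, mul_inv_cancel₀ h2,
      one_mul, one_smul, smul_sub, neg_smul, smul_sub, mul_sub]
    linear_combination (exp := 1) h1
  · apply ContinuousOn.neg
    apply hinv.mul
    fun_prop
  · exact hinv.smul continuousOn_const

end SecondOrder

/-! ### Power series in one real variable -/

section PowerSer

variable {E : Type*} [NormedAddCommGroup E] [NormedSpace ℝ E]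

/-- Geometrically bounded sequences of coefficients. -/
def GeomBdd (c : ℕ → E) : Prop := ∃ C R : ℝ, 0 ≤ C ∧ 0 < R ∧ ∀ i, ‖c i‖ ≤ C * R ^ i

/-- The sum of a power series. -/
def powSer (c : ℕ → E) (x : ℝ) : E := ∑' i, x ^ i • c i

theorem GeomBdd.of_le {c : ℕ → E} {s : ℕ → ℝ} {C R : ℝ} (hR : 0 < R) (hs : ∀ i, s i ≤ C * R ^ i)
    (h : ∀ i, ‖c i‖ ≤ s i) : GeomBdd c := by
  refine ⟨C, R, ?_, hR, fun i => (h i).trans (hs i)⟩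
  have := (norm_nonneg _).trans ((h 0).trans (hs 0))
  simpa using this

theorem GeomBdd.add {c d : ℕ → E} (hc : GeomBdd c) (hd : GeomBdd d) :
    GeomBdd (fun i => c i + d i) := by
  obtain ⟨C, R, hC, hR, h⟩ := hc
  obtain ⟨C', R', hC', hR', h'⟩ := hd
  refine ⟨C + C', max R R', by positivity, by positivity, fun i => ?_⟩
  calc ‖c i + d i‖ ≤ ‖c i‖ + ‖d i‖ := norm_add_le _ _
    _ ≤ C * R ^ i + C' * R' ^ i := add_le_add (h i) (h' i)
    _ ≤ C * (max R R') ^ i + C' * (max R R') ^ i := by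
        gcongr
        · exact le_max_left _ _
        · exact le_max_right _ _
    _ = _ := by ring

theorem GeomBdd.map {F : Type*} [NormedAddCommGroup F] [NormedSpace ℝ F] {c : ℕ → E}
    (hc : GeomBdd c) (T : E →L[ℝ] F) : GeomBdd (fun i => T (c i)) := by
  obtain ⟨C, R, hC, hR, h⟩ := hc
  refine ⟨‖T‖ * C, R, by positivity, hR, fun i => ?_⟩
  calc ‖T (c i)‖ ≤ ‖T‖ * ‖c i‖ := T.le_opNorm _
    _ ≤ ‖T‖ * (C * R ^ i) := by gcongr; exact h i
    _ = _ := by ring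

theorem GeomBdd.smul {c : ℕ → E} (hc : GeomBdd c) (a : ℝ) : GeomBdd (fun i => a • c i) :=
  hc.map (a • ContinuousLinearMap.id ℝ E)

theorem GeomBdd.zero : GeomBdd (fun _ => (0 : E)) := ⟨0, 1, le_rfl, one_pos, by simp⟩

theorem GeomBdd.nat_smul {c : ℕ → E} (hc : GeomBdd c) : GeomBdd (fun i => (i : ℝ) • c i) := by
  obtain ⟨C, R, hC, hR, h⟩ := hc
  refine ⟨C, 2 * R, hC, by positivity, fun i => ?_⟩
  have h2 : (i : ℝ) ≤ 2 ^ i := by exact_mod_cast Nat.lt_two_pow_self.le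
  rw [norm_smul, Real.norm_natCast, mul_pow]
  calc (i : ℝ) * ‖c i‖ ≤ 2 ^ i * (C * R ^ i) := by gcongr; exact h i
    _ = _ := by ring

theorem GeomBdd.shift_left {c : ℕ → E} (hc : GeomBdd c) (n : ℕ) : GeomBdd (fun i => c (i + n)) := by
  obtain ⟨C, R, hC, hR, h⟩ := hc
  refine ⟨C * R ^ n, R, by positivity, hR, fun i => (h _).trans (le_of_eq ?_)⟩
  rw [pow_add]; ring

/-- Multiplication of a power series by the variable. -/
def shiftR (c : ℕ → E) : ℕ → E
  | 0 => 0
  | i + 1 => c i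

theorem GeomBdd.shiftR {c : ℕ → E} (hc : GeomBdd c) : GeomBdd (shiftR c) := by
  obtain ⟨C, R, hC, hR, h⟩ := hc
  refine ⟨C * R⁻¹, R, by positivity, hR, fun i => ?_⟩
  cases i with
  | zero => simp only [MaxwellScalar.shiftR, norm_zero]; positivity
  | succ i =>
    refine (h i).trans (le_of_eq ?_)
    rw [pow_succ]; field_simp

theorem GeomBdd.eventually_summable_norm {c : ℕ → E} (hc : GeomBdd c) :
    ∀ᶠ x : ℝ in 𝓝 0, Summable fun i => ‖x ^ i • c i‖ := by
  obtain ⟨C, R, hC, hR, h⟩ := hc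
  have : ∀ᶠ x : ℝ in 𝓝 0, |x| < (2 * R)⁻¹ := by
    have := Metric.ball_mem_nhds (0 : ℝ) (ε := (2 * R)⁻¹) (by positivity)
    filter_upwards [this] with x hx
    simpa [Real.dist_eq] using hx
  filter_upwards [this] with x hx
  apply Summable.of_nonneg_of_le (fun i => norm_nonneg _) (f := fun i => C * (1 / 2) ^ i)
  · intro i
    rw [norm_smul, norm_pow, Real.norm_eq_abs]
    calc |x| ^ i * ‖c i‖ ≤ ((2 * R)⁻¹) ^ i * (C * R ^ i) := by gcongr; exact h i
      _ = C * (1 / 2) ^ i := by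
        rw [show (1 / 2 : ℝ) = (2 * R)⁻¹ * R by field_simp, mul_pow]; ring
  · exact (summable_geometric_two).mul_left C

variable [CompleteSpace E]

theorem GeomBdd.eventually_summable {c : ℕ → E} (hc : GeomBdd c) :
    ∀ᶠ x : ℝ in 𝓝 0, Summable fun i => x ^ i • c i :=
  hc.eventually_summable_norm.mono fun _ h => h.of_norm

theorem GeomBdd.analyticAt {c : ℕ → E} (hc : GeomBdd c) : AnalyticAt ℝ (powSer c) 0 := by
  let p : FormalMultilinearSeries ℝ ℝ E :=
    fun n => ContinuousMultilinearMap.mkPiRing ℝ (Fin n) (c n)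
  have hp : ∀ n, p.coeff n = c n := fun n => by simp [p, FormalMultilinearSeries.coeff]
  refine ⟨p, hasFPowerSeriesAt_iff.mpr ?_⟩
  filter_upwards [hc.eventually_summable] with x hx
  simpa [hp, powSer] using hx.hasSum

theorem exists_powSer_of_analyticAt {a : ℝ → E} (ha : AnalyticAt ℝ a 0) :
    ∃ c, GeomBdd c ∧ ∀ᶠ x in 𝓝 0, a x = powSer c x := by
  obtain ⟨p, hp⟩ := ha
  rw [hasFPowerSeriesAt_iff] at hp
  refine ⟨p.coeff, ?_, hp.mono fun x hx => ?_⟩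
  · have hp' : ∀ᶠ x : ℝ in 𝓝[>] 0, HasSum (fun n => x ^ n • p.coeff n) (a (0 + x)) :=
      nhdsWithin_le_nhds hp
    obtain ⟨x, hx, hx0⟩ := (hp'.and self_mem_nhdsWithin).exists
    replace hx0 : 0 < x := hx0
    obtain ⟨C, hC⟩ := hx.summable.tendsto_atTop_zero.norm.bddAbove_range
    refine GeomBdd.of_le (R := x⁻¹) (C := C) (s := fun i => ‖p.coeff i‖) (by positivity) ?_
      (fun _ => le_rfl)
    intro i
    have := hC ⟨i, rfl⟩
    simp only [norm_smul, norm_pow, Real.norm_eq_abs, abs_of_pos hx0] at this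
    rw [inv_pow, ← div_eq_mul_inv, le_div_iff₀ (by positivity), mul_comm]
    exact this
  · simpa [powSer] using hx.tsum_eq.symm

theorem powSer_zero (c : ℕ → E) : powSer c 0 = c 0 := by
  rw [powSer, tsum_eq_single 0]
  · simp
  · intro i hi; simp [hi]

theorem norm_deriv_term_le {c : ℕ → E} {C R : ℝ} (hR : 0 < R)
    (h : ∀ i, ‖c i‖ ≤ C * R ^ i) {x : ℝ} (hx : |x| ≤ (2 * R)⁻¹) (i : ℕ) :
    ‖((i : ℝ) * x ^ (i - 1)) • c i‖ ≤ (2 * R * C) * ((i : ℝ) ^ 1 * (1 / 2) ^ i) := by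
  rw [norm_smul, norm_mul, Real.norm_natCast, norm_pow, Real.norm_eq_abs]
  cases i with
  | zero => simp
  | succ i =>
    simp only [add_tsub_cancel_right]
    calc ((i + 1 : ℕ) : ℝ) * |x| ^ i * ‖c (i + 1)‖
        ≤ ((i + 1 : ℕ) : ℝ) * ((2 * R)⁻¹) ^ i * (C * R ^ (i + 1)) := by
          gcongr; exact h _
      _ = _ := by
          rw [pow_succ (1 / 2 : ℝ), show (1 / 2 : ℝ) ^ i = ((2 * R)⁻¹ * R) ^ i by
            congr 1; field_simp, mul_pow]; ring

theorem GeomBdd.hasDerivAt {c : ℕ → E} (hc : GeomBdd c) :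
    ∀ᶠ x : ℝ in 𝓝 0, HasDerivAt (powSer c) (powSer (fun i => ((i + 1 : ℕ) : ℝ) • c (i + 1)) x) x := by
  obtain ⟨C, R, hC, hR, h⟩ := id hc
  have hball := Metric.ball_mem_nhds (0 : ℝ) (ε := (2 * R)⁻¹) (by positivity)
  have hu : Summable fun i : ℕ => (2 * R * C) * ((i : ℝ) ^ 1 * (1 / 2) ^ i) :=
    (summable_pow_mul_geometric_of_norm_lt_one (R := ℝ) 1 (by norm_num)).mul_left _
  have hb : ∀ x ∈ Metric.ball (0 : ℝ) (2 * R)⁻¹, |x| ≤ (2 * R)⁻¹ := fun x hx => by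
    rw [Metric.mem_ball, Real.dist_eq, sub_zero] at hx; exact hx.le
  filter_upwards [hball, hc.eventually_summable] with x hx hxs
  have hd : HasDerivAt (fun x : ℝ => ∑' i : ℕ, x ^ i • c i)
      (∑' i : ℕ, ((i : ℝ) * x ^ (i - 1)) • c i) x :=
    hasDerivAt_tsum_of_isPreconnected (t := Metric.ball (0 : ℝ) (2 * R)⁻¹) hu
      Metric.isOpen_ball (convex_ball _ _).isPreconnected
      (fun i y _ => (hasDerivAt_pow i y).smul_const (c i))
      (fun i y hy => norm_deriv_term_le hR h (hb y hy) i) hx hxs hx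
  have hs : Summable fun i : ℕ => ((i : ℝ) * x ^ (i - 1)) • c i :=
    Summable.of_norm_bounded hu fun i => norm_deriv_term_le hR h (hb x hx) i
  refine hd.congr_deriv ?_
  rw [powSer, hs.tsum_eq_zero_add]
  simp only [CharP.cast_eq_zero, zero_mul, zero_smul, zero_add, add_tsub_cancel_right]
  congr 1; ext i
  rw [smul_smul, mul_comm]

theorem GeomBdd.powSer_eq_add {c : ℕ → E} (hc : GeomBdd c) :
    ∀ᶠ x : ℝ in 𝓝 0, powSer c x = c 0 + x • powSer (fun i => c (i + 1)) x := by
  filter_upwards [hc.eventually_summable, (hc.shift_left 1).eventually_summable] with x hx hx'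
  rw [powSer, hx.tsum_eq_zero_add, powSer, ← hx'.tsum_const_smul]
  simp [smul_smul, pow_succ, mul_comm]

theorem GeomBdd.powSer_shiftR {c : ℕ → E} (hc : GeomBdd c) :
    ∀ᶠ x : ℝ in 𝓝 0, powSer (MaxwellScalar.shiftR c) x = x • powSer c x := by
  filter_upwards [hc.shiftR.powSer_eq_add] with x hx
  rw [hx]; simp [MaxwellScalar.shiftR]

theorem GeomBdd.powSer_nat_smul {c : ℕ → E} (hc : GeomBdd c) :
    ∀ᶠ x : ℝ in 𝓝 0, powSer (fun i => (i : ℝ) • c i) x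
      = x • powSer (fun i => ((i + 1 : ℕ) : ℝ) • c (i + 1)) x := by
  filter_upwards [hc.nat_smul.powSer_eq_add] with x hx
  rw [hx]; simp

theorem powSer_pow_smul {c : ℕ → E} {n : ℕ} (h0 : ∀ i < n, c i = 0) (x : ℝ) :
    powSer c x = x ^ n • powSer (fun i => c (i + n)) x := by
  rcases eq_or_ne x 0 with rfl | hx
  · cases n with
    | zero => simp
    | succ n => rw [powSer_zero, h0 0 (by omega)]; simp
  rw [powSer, powSer, ← tsum_const_smul'' ]
  have hinj : Function.Injective fun i : ℕ => i + n := add_left_injective n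
  rw [← hinj.tsum_eq (f := fun i => x ^ i • c i)]
  · congr 1; ext i; rw [smul_smul, pow_add, mul_comm]
  · intro i hi
    by_cases hin : i < n
    · exact absurd (by simp [h0 i hin]) hi
    · exact ⟨i - n, by simp; omega⟩

theorem GeomBdd.powSer_add {c d : ℕ → E} (hc : GeomBdd c) (hd : GeomBdd d) :
    ∀ᶠ x : ℝ in 𝓝 0, powSer (fun i => c i + d i) x = powSer c x + powSer d x := by
  filter_upwards [hc.eventually_summable, hd.eventually_summable] with x hx hx'
  rw [powSer, powSer, powSer, ← hx.tsum_add hx']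
  simp

theorem GeomBdd.powSer_map {F : Type*} [NormedAddCommGroup F] [NormedSpace ℝ F] {c : ℕ → E}
    (hc : GeomBdd c) (T : E →L[ℝ] F) :
    ∀ᶠ x : ℝ in 𝓝 0, powSer (fun i => T (c i)) x = T (powSer c x) := by
  filter_upwards [hc.eventually_summable] with x hx
  rw [powSer, powSer, T.map_tsum hx]
  simp

theorem GeomBdd.tendsto_powSer {c : ℕ → E} (hc : GeomBdd c) :
    Tendsto (powSer c) (𝓝[>] 0) (𝓝 (c 0)) := by
  have := hc.analyticAt.continuousAt.tendsto
  rw [powSer_zero] at this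
  exact this.mono_left nhdsWithin_le_nhds

theorem GeomBdd.of_recursion {s t : ℕ → ℝ} {C R K : ℝ} (hC : 0 ≤ C) (hR : 0 < R) (hK : 0 ≤ K)
    {i₀ : ℕ} (ht : ∀ i, t i ≤ C * R ^ i)
    (hs : ∀ i, i₀ ≤ i → s (i + 1) ≤ K * (t (i + 1) + s i)) :
    ∃ C' R' : ℝ, 0 < R' ∧ ∀ i, s i ≤ C' * R' ^ i := by
  set R' := max (max R (2 * K)) 1 with hR'
  have h1 : 1 ≤ R' := le_max_right _ _
  have hRR : R ≤ R' := (le_max_left _ _).trans (le_max_left _ _)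
  have hKR : 2 * K ≤ R' := (le_max_right _ _).trans (le_max_left _ _)
  set C' := 2 * K * C + ∑ i ∈ Finset.range (i₀ + 1), |s i| with hC'
  have hsum : 0 ≤ ∑ i ∈ Finset.range (i₀ + 1), |s i| := sum_nonneg fun _ _ => abs_nonneg _
  have hKC : 2 * K * C ≤ C' := by linarith
  have hC'0 : 0 ≤ C' := by positivity
  refine ⟨C', R', by linarith, fun i => ?_⟩
  rcases le_total i i₀ with hi | hi
  · have h2 : |s i| ≤ ∑ i ∈ Finset.range (i₀ + 1), |s i| :=
      single_le_sum (f := fun i => |s i|) (fun _ _ => abs_nonneg _)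
        (Finset.mem_range.mpr (by omega))
    have h3 : 1 ≤ R' ^ i := one_le_pow₀ h1
    have h4 : 0 ≤ 2 * K * C := by positivity
    calc s i ≤ |s i| := le_abs_self _
      _ ≤ C' := by linarith
      _ ≤ C' * R' ^ i := by nlinarith
  · induction i, hi using Nat.le_induction with
    | base =>
      have h2 : |s i₀| ≤ ∑ i ∈ Finset.range (i₀ + 1), |s i| :=
        single_le_sum (f := fun i => |s i|) (fun _ _ => abs_nonneg _)
          (Finset.mem_range.mpr (by omega))
      have h3 : 1 ≤ R' ^ i₀ := one_le_pow₀ h1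
      have h4 : 0 ≤ 2 * K * C := by positivity
      calc s i₀ ≤ |s i₀| := le_abs_self _
        _ ≤ C' := by linarith
        _ ≤ C' * R' ^ i₀ := by nlinarith
    | succ i hi ih =>
      have h5 : 0 ≤ R' ^ i := by positivity
      calc s (i + 1) ≤ K * (t (i + 1) + s i) := hs i hi
        _ ≤ K * (C * R' ^ (i + 1) + C' * R' ^ i) := by
            gcongr
            exact (ht _).trans (by gcongr)
        _ = (K * C) * R' ^ (i + 1) + K * (C' * R' ^ i) := by ring
        _ ≤ (C' / 2) * R' ^ (i + 1) + (R' / 2) * (C' * R' ^ i) := by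
            gcongr
            · linarith
            · linarith
        _ = C' * R' ^ (i + 1) := by rw [pow_succ]; ring

end PowerSer

/-! ### Log series: power series in `x` with coefficients that are polynomials in `log x` -/

section LogSer

open Polynomial

variable {A : Type*} [NormedCommRing A] [NormedAlgebra ℂ A]

/-- Vanishing of the coefficients of index at least `M`. -/
def DegLT (M : ℕ) (P : A[X]) : Prop := ∀ j, M ≤ j → P.coeff j = 0

/-- A log series with powers of the logarithm below `M` and geometrically bounded coefficients. -/
structure IsLogSer (M : ℕ) (F : ℕ → A[X]) : Prop where
  deg : ∀ i, DegLT M (F i)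
  bdd : ∀ j, GeomBdd fun i => (F i).coeff j

/-- The sum of a log series. -/
def lev (M : ℕ) (F : ℕ → A[X]) (x : ℝ) : A :=
  ∑ j ∈ Finset.range M, (Real.log x) ^ j • powSer (fun i => (F i).coeff j) x

/-- The operator `c + d/dL`. -/
def dil (c : ℝ) (P : A[X]) : A[X] := c • P + derivative P

/-- The operator `x d/dx` on log series. -/
def theta (F : ℕ → A[X]) : ℕ → A[X] := fun i => dil i (F i)

/-- Multiplication by `x` on log series. -/
def xmul (F : ℕ → A[X]) : ℕ → A[X]
  | 0 => 0
  | i + 1 => F i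

theorem coeff_dil (c : ℝ) (P : A[X]) (j : ℕ) :
    (dil c P).coeff j = c • P.coeff j + ((j + 1 : ℕ) : ℝ) • P.coeff (j + 1) := by
  rw [dil, coeff_add, coeff_smul, coeff_derivative, mul_comm]
  congr 1
  rw [← Nat.cast_succ, ← nsmul_eq_mul, Nat.cast_smul_eq_nsmul]

theorem DegLT.mono {M M' : ℕ} {P : A[X]} (h : DegLT M P) (hM : M ≤ M') : DegLT M' P :=
  fun j hj => h j (hM.trans hj)

theorem DegLT.add {M : ℕ} {P Q : A[X]} (h : DegLT M P) (h' : DegLT M Q) : DegLT M (P + Q) :=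
  fun j hj => by rw [coeff_add, h j hj, h' j hj, add_zero]

theorem DegLT.smul {M : ℕ} {P : A[X]} (h : DegLT M P) (c : ℝ) : DegLT M (c • P) :=
  fun j hj => by rw [coeff_smul, h j hj, smul_zero]

theorem DegLT.C_mul {M : ℕ} {P : A[X]} (h : DegLT M P) (c : A) : DegLT M (C c * P) :=
  fun j hj => by rw [coeff_C_mul, h j hj, mul_zero]

theorem DegLT.dil {M : ℕ} {P : A[X]} (h : DegLT M P) (c : ℝ) : DegLT M (dil c P) :=
  fun j hj => by rw [coeff_dil, h j hj, h (j + 1) (by omega)]; simp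

theorem DegLT.derivative {M : ℕ} {P : A[X]} (h : DegLT (M + 1) P) : DegLT M (derivative P) :=
  fun j hj => by rw [coeff_derivative, h (j + 1) (by omega), zero_mul]

theorem DegLT.eq_zero {P : A[X]} (h : DegLT 0 P) : P = 0 := by
  ext j; simpa using h j (Nat.zero_le j)

theorem exists_dil_eq {c : ℝ} (hc : c ≠ 0) (M : ℕ) : ∀ r : A[X], DegLT M r →
    ∃ f, DegLT M f ∧ dil c f = r := by
  induction M with
  | zero => intro r hr; exact ⟨0, fun _ _ => by simp, by rw [hr.eq_zero]; simp [dil]⟩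
  | succ M ih =>
    intro r hr
    obtain ⟨g, hg, hgr⟩ := ih (-(c⁻¹ • derivative r))
      (fun j hj => by rw [coeff_neg, (hr.derivative.smul c⁻¹) j hj, neg_zero])
    refine ⟨c⁻¹ • r + g, (hr.smul _).add (hg.mono (by omega)), ?_⟩
    have : dil c (c⁻¹ • r + g) = r + c⁻¹ • derivative r + dil c g := by
      simp only [dil, smul_add, derivative_add, derivative_smul, smul_inv_smul₀ hc]
      abel
    rw [this, hgr]; abel

theorem exists_derivative_eq {M : ℕ} {r : A[X]} (hr : DegLT M r) :
    ∃ f, DegLT (M + 1) f ∧ derivative f = r ∧ f.coeff 0 = 0 := by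
  refine ⟨∑ j ∈ Finset.range M, monomial (j + 1) (((j + 1 : ℕ) : ℝ)⁻¹ • r.coeff j), ?_, ?_, ?_⟩
  · intro k hk
    rw [finsetSum_coeff]
    apply sum_eq_zero
    intro j hj
    rw [coeff_monomial, if_neg]
    have := Finset.mem_range.mp hj
    omega
  · ext k
    rw [derivative_sum, finsetSum_coeff]
    simp only [derivative_monomial, coeff_monomial, add_tsub_cancel_right]
    have hcast : ∀ (j : ℕ), (((j + 1 : ℕ) : ℝ)⁻¹ • r.coeff j) * ((j + 1 : ℕ) : A) = r.coeff j := by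
      intro j
      rw [mul_comm, ← nsmul_eq_mul, ← Nat.cast_smul_eq_nsmul ℝ, smul_inv_smul₀]
      positivity
    rw [Finset.sum_ite_eq']
    split_ifs with h
    · exact hcast k
    · exact (hr k (by simpa using h)).symm
  · rw [finsetSum_coeff]
    apply sum_eq_zero
    intro j _
    rw [coeff_monomial, if_neg (by omega)]

theorem dil_zero (P : A[X]) : dil 0 P = derivative P := by simp [dil]

/-- The sum of the norms of the first `M` coefficients. -/
def coeffNorm (M : ℕ) (P : A[X]) : ℝ := ∑ j ∈ Finset.range M, ‖P.coeff j‖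

theorem coeffNorm_nonneg (M : ℕ) (P : A[X]) : 0 ≤ coeffNorm M P :=
  sum_nonneg fun _ _ => norm_nonneg _

theorem coeffNorm_add_le (M : ℕ) (P Q : A[X]) :
    coeffNorm M (P + Q) ≤ coeffNorm M P + coeffNorm M Q := by
  rw [coeffNorm, coeffNorm, coeffNorm, ← sum_add_distrib]
  exact Finset.sum_le_sum fun j _ => by rw [coeff_add]; exact norm_add_le _ _

theorem coeffNorm_smul (M : ℕ) (c : ℝ) (P : A[X]) :
    coeffNorm M (c • P) = |c| * coeffNorm M P := by
  rw [coeffNorm, coeffNorm, mul_sum]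
  exact sum_congr rfl fun j _ => by rw [coeff_smul, norm_smul, Real.norm_eq_abs]

theorem coeffNorm_C_mul_le (M : ℕ) (c : A) (P : A[X]) :
    coeffNorm M (C c * P) ≤ ‖c‖ * coeffNorm M P := by
  rw [coeffNorm, coeffNorm, mul_sum]
  exact Finset.sum_le_sum fun j _ => by rw [coeff_C_mul]; exact norm_mul_le _ _

theorem norm_coeff_le_coeffNorm {M : ℕ} {P : A[X]} (h : DegLT M P) (j : ℕ) :
    ‖P.coeff j‖ ≤ coeffNorm M P := by
  by_cases hj : j < M
  · exact single_le_sum (f := fun j => ‖P.coeff j‖) (fun _ _ => norm_nonneg _)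
      (Finset.mem_range.mpr hj)
  · rw [h j (by omega), norm_zero]; exact coeffNorm_nonneg _ _

theorem coeffNorm_derivative_le {M : ℕ} {P : A[X]} (h : DegLT M P) :
    coeffNorm M (derivative P) ≤ M * coeffNorm M P := by
  have h0 : ∀ j, ‖(derivative P).coeff j‖ = (j + 1 : ℕ) * ‖P.coeff (j + 1)‖ := by
    intro j
    rw [coeff_derivative, mul_comm, ← Nat.cast_succ, ← nsmul_eq_mul, ← Nat.cast_smul_eq_nsmul ℝ,
      norm_smul, Real.norm_natCast]
  rw [coeffNorm]
  simp_rw [h0]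
  calc ∑ j ∈ Finset.range M, ((j + 1 : ℕ) : ℝ) * ‖P.coeff (j + 1)‖
      ≤ ∑ j ∈ Finset.range M, (M : ℝ) * ‖P.coeff (j + 1)‖ := by
        apply Finset.sum_le_sum
        intro j hj
        have := Finset.mem_range.mp hj
        gcongr
        omega
    _ ≤ M * ∑ j ∈ Finset.range (M + 1), ‖P.coeff j‖ := by
        rw [← mul_sum, Finset.sum_range_succ' _ M]
        gcongr
        linarith [norm_nonneg (P.coeff 0)]
    _ = M * coeffNorm M P := by
        rw [sum_range_succ, h M le_rfl, norm_zero, add_zero, coeffNorm]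

theorem coeffNorm_dil_le {M : ℕ} {P : A[X]} (h : DegLT M P) (c : ℝ) :
    coeffNorm M (dil c P) ≤ (|c| + M) * coeffNorm M P := by
  calc coeffNorm M (dil c P) ≤ coeffNorm M (c • P) + coeffNorm M (derivative P) :=
        coeffNorm_add_le _ _ _
    _ ≤ |c| * coeffNorm M P + M * coeffNorm M P := by
        rw [coeffNorm_smul]
        gcongr
        exact coeffNorm_derivative_le h
    _ = _ := by ring

theorem le_coeffNorm_dil {M : ℕ} {P : A[X]} (h : DegLT M P) (c : ℝ) :
    (|c| - M) * coeffNorm M P ≤ coeffNorm M (dil c P) := by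
  have h1 : c • P = dil c P + (-1 : ℝ) • derivative P := by simp [dil]
  have h2 : |c| * coeffNorm M P ≤ coeffNorm M (dil c P) + M * coeffNorm M P := by
    rw [← coeffNorm_smul, h1]
    refine (coeffNorm_add_le _ _ _).trans ?_
    rw [coeffNorm_smul, abs_neg, abs_one, one_mul]
    gcongr
    exact coeffNorm_derivative_le h
  linarith

/-- The indicial operator at the power `i`. -/
def indicial (n : ℕ) (i : ℕ) (P : A[X]) : A[X] := (2 : ℝ) • dil i (dil ((i : ℝ) - n) P)

/-- The contribution of the power `i` to the next one. -/
def lowerOp (b : ℝ) (κ : A) (i : ℕ) (P : A[X]) : A[X] :=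
  dil i (dil i P) + (-b) • dil i P + C κ * P

/-- The recursion of Frobenius for the equation `2θ(θ - n)f = h + x(θ² - bθ + κ)f`. -/
def IsFrobenius (n : ℕ) (b : ℝ) (κ : A) (h F : ℕ → A[X]) : Prop :=
  indicial n 0 (F 0) = h 0 ∧ ∀ i, indicial n (i + 1) (F (i + 1)) = h (i + 1) + lowerOp b κ i (F i)

theorem DegLT.lowerOp {M : ℕ} {P : A[X]} (h : DegLT M P) (b : ℝ) (κ : A) (i : ℕ) :
    DegLT M (lowerOp b κ i P) :=
  (((h.dil _).dil _).add ((h.dil _).smul _)).add (h.C_mul _)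

theorem coeffNorm_lowerOp_le {M : ℕ} {P : A[X]} (h : DegLT M P) (b : ℝ) (κ : A) (i : ℕ) :
    coeffNorm M (lowerOp b κ i P) ≤ ((i + M) ^ 2 + |b| * (i + M) + ‖κ‖) * coeffNorm M P := by
  have hi : |(i : ℝ)| = i := abs_of_nonneg (by positivity)
  have h1 := coeffNorm_dil_le h i
  have h2 := coeffNorm_dil_le (h.dil i) i
  rw [hi] at h1 h2
  calc coeffNorm M (MaxwellScalar.lowerOp b κ i P)
      ≤ coeffNorm M (dil i (dil i P)) + coeffNorm M ((-b) • dil i P) + coeffNorm M (C κ * P) :=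
        (coeffNorm_add_le _ _ _).trans (by gcongr; exact coeffNorm_add_le _ _ _)
    _ ≤ (i + M) * ((i + M) * coeffNorm M P) + |b| * ((i + M) * coeffNorm M P)
          + ‖κ‖ * coeffNorm M P := by
        rw [coeffNorm_smul, abs_neg]
        gcongr
        · exact h2.trans (by gcongr)
        · exact coeffNorm_C_mul_le _ _ _
    _ = _ := by ring

/-- Degrees of the coefficients of the Frobenius solution. -/
def frobDeg (n N i : ℕ) : ℕ := if i < n then N + 1 else N + 2

theorem exists_indicial_eq (n N : ℕ) (c₀ c₁ : A) (i : ℕ) (r : A[X])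
    (hr : DegLT (if i = 0 then N else frobDeg n N (i - 1)) r) :
    ∃ f : A[X], DegLT (frobDeg n N i) f ∧ indicial n i f = r ∧ (i = 0 → f.coeff 0 = c₀) ∧
      (i = n → f.coeff (if n = 0 then 1 else 0) = c₁) := by
  have hhalf : ∀ s : A[X], (2 : ℝ) • ((1 / 2 : ℝ) • s) = s := fun s => by
    rw [smul_smul]; norm_num
  have hDC : ∀ (c : A) {M : ℕ}, DegLT (M + 1) (C c) := fun c M j hj => by
    rw [coeff_C, if_neg (by omega)]
  rcases eq_or_ne i 0 with rfl | hi
  · rw [if_pos rfl] at hr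
    rcases eq_or_ne n 0 with rfl | hn
    · obtain ⟨g, hg, hgr, hg0⟩ := exists_derivative_eq (hr.smul (1 / 2))
      obtain ⟨f, hf, hfr, hf0⟩ := exists_derivative_eq hg
      refine ⟨f + C c₀ + C c₁ * X, ?_, ?_, fun _ => by simp [hf0], fun _ => ?_⟩
      · have : frobDeg 0 N 0 = N + 1 + 1 := by simp [frobDeg]
        rw [this]
        refine (hf.add (hDC _)).add fun j hj => ?_
        rw [coeff_C_mul, coeff_X, if_neg (by omega), mul_zero]
      · simp only [indicial, Nat.cast_zero, sub_zero, dil_zero, derivative_add, derivative_C, hfr,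
          derivative_mul, zero_mul, derivative_X, mul_one, hgr, add_zero, zero_add, hhalf]
      · have : f.coeff 1 = 0 := by
          have h1 : (derivative f).coeff 0 = f.coeff 1 := by simp [coeff_derivative]
          rw [← h1, hfr, hg0]
        simp [this, coeff_C]
    · have hn' : ((0 : ℕ) : ℝ) - n ≠ 0 := by simpa using hn
      obtain ⟨g, hg, hgr, -⟩ := exists_derivative_eq (hr.smul (1 / 2))
      obtain ⟨f, hf, hfr⟩ := exists_dil_eq hn' (N + 1) _ hg
      have hdilC : dil (((0 : ℕ) : ℝ) - n) (C (c₀ - f.coeff 0)) =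
          C ((((0 : ℕ) : ℝ) - n) • (c₀ - f.coeff 0)) := by
        simp [dil, smul_C, smul_sub]
      refine ⟨f + C (c₀ - f.coeff 0), ?_, ?_, fun _ => by simp, fun h => absurd h.symm hn⟩
      · have : frobDeg n N 0 = N + 1 := by simp [frobDeg, Nat.pos_of_ne_zero hn]
        rw [this]
        exact hf.add (hDC _)
      · have : dil (((0 : ℕ) : ℝ) - n) (f + C (c₀ - f.coeff 0)) =
            g + C ((((0 : ℕ) : ℝ) - n) • (c₀ - f.coeff 0)) := by
          rw [← hfr, ← hdilC]
          simp only [dil, smul_add, derivative_add]; abel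
        rw [indicial, this, Nat.cast_zero, dil_zero, derivative_add, derivative_C, add_zero, hgr,
          hhalf]
  · rw [if_neg hi] at hr
    have hi' : (i : ℝ) ≠ 0 := by exact_mod_cast hi
    rcases eq_or_ne i n with rfl | hin
    · obtain ⟨g, hg, hgr⟩ := exists_dil_eq hi' _ _ (hr.smul (1 / 2))
      obtain ⟨f, hf, hfr, hf0⟩ := exists_derivative_eq hg
      have h1 : frobDeg i N (i - 1) = N + 1 := by
        rw [frobDeg, if_pos (by omega)]
      rw [h1] at hf
      refine ⟨f + C c₁, ?_, ?_, fun h => absurd h hi, fun _ => by simp [hi, hf0]⟩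
      · have : frobDeg i N i = N + 2 := by simp [frobDeg]
        rw [this]
        exact hf.add (hDC _)
      · rw [indicial, sub_self, dil_zero, derivative_add, derivative_C, add_zero, hfr, hgr, hhalf]
    · have hin' : (i : ℝ) - n ≠ 0 := by
        rw [sub_ne_zero]; exact_mod_cast hin
      obtain ⟨g, hg, hgr⟩ := exists_dil_eq hi' _ _ (hr.smul (1 / 2))
      obtain ⟨f, hf, hfr⟩ := exists_dil_eq hin' _ _ hg
      refine ⟨f, hf.mono ?_, ?_, fun h => absurd h hi, fun h => absurd h hin⟩
      · rw [frobDeg, frobDeg]; split_ifs <;> omega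
      · rw [indicial, hfr, hgr, hhalf]

theorem frobenius_bound {i M n b k x y t u v : ℝ} (hM : 0 ≤ M) (hn : 0 ≤ n)
    (hi : 2 * (M + n) + 2 ≤ i) (hb : 0 ≤ b) (hk : 0 ≤ k) (hx : 0 ≤ x) (hy : 0 ≤ y) (ht : 0 ≤ t)
    (hu : 0 ≤ u) (f1 : (i + 1 - n - M) * x ≤ u) (f2 : (i + 1 - M) * u ≤ v)
    (f3 : 2 * v ≤ t + ((i + M) ^ 2 + b * (i + M) + k) * y) :
    x ≤ (8 + 2 * b + k) * (t + y) := by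
  have hi2 : 2 ≤ i := by linarith
  have hii : 1 ≤ i ^ 2 / 2 := by nlinarith
  have hii' : i ≤ i ^ 2 / 2 := by nlinarith
  have g1 : i / 2 * x ≤ u := le_trans (by gcongr; linarith) f1
  have g2 : i / 2 * u ≤ v := le_trans (by gcongr; linarith) f2
  have g3 : i ^ 2 / 2 * x ≤ 2 * v := by
    have : i / 2 * (i / 2 * x) ≤ i / 2 * u := by gcongr
    linarith
  have g4 : (i + M) ^ 2 + b * (i + M) + k ≤ (8 + 2 * b + k) * (i ^ 2 / 2) := by
    have e1 : i + M ≤ 2 * i := by linarith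
    have e2 : (i + M) ^ 2 ≤ (2 * i) ^ 2 := by gcongr
    have e3 : b * (i + M) ≤ b * (2 * (i ^ 2 / 2)) := by gcongr; linarith
    have e4 : k * 1 ≤ k * (i ^ 2 / 2) := by gcongr
    linarith
  have g5 : ((i + M) ^ 2 + b * (i + M) + k) * y ≤ (8 + 2 * b + k) * (i ^ 2 / 2) * y := by gcongr
  have g6 : 1 * t ≤ (8 + 2 * b + k) * (i ^ 2 / 2) * t := by
    gcongr
    nlinarith
  have g7 : i ^ 2 / 2 * x ≤ i ^ 2 / 2 * ((8 + 2 * b + k) * (t + y)) := by linarith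
  exact le_of_mul_le_mul_left g7 (by linarith)

theorem exists_frobenius (n : ℕ) (b : ℝ) (κ : A) (N : ℕ) {h : ℕ → A[X]} (hh : IsLogSer N h)
    (c₀ c₁ : A) : ∃ F : ℕ → A[X], IsLogSer (N + 2) F ∧ IsFrobenius n b κ h F ∧
      (∀ i, DegLT (frobDeg n N i) (F i)) ∧
      (F 0).coeff 0 = c₀ ∧ (F n).coeff (if n = 0 then 1 else 0) = c₁ := by
  have hstep := exists_indicial_eq (A := A) n N c₀ c₁
  choose! sol hsol using hstep
  let F : ℕ → A[X] := fun i => Nat.rec (sol 0 (h 0))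
    (fun i P => sol (i + 1) (h (i + 1) + lowerOp b κ i P)) i
  have hF0 : F 0 = sol 0 (h 0) := rfl
  have hFs : ∀ i, F (i + 1) = sol (i + 1) (h (i + 1) + lowerOp b κ i (F i)) := fun i => rfl
  have hN : ∀ i, N ≤ frobDeg n N i := fun i => by rw [frobDeg]; split_ifs <;> omega
  have hdeg : ∀ i, DegLT (frobDeg n N i) (F i) := by
    intro i
    induction i with
    | zero => rw [hF0]; exact (hsol 0 (h 0) (by simpa using hh.deg 0)).1
    | succ i ih =>
      rw [hFs]
      refine (hsol (i + 1) _ ?_).1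
      rw [if_neg (by omega), Nat.add_sub_cancel]
      exact ((hh.deg _).mono (hN i)).add (ih.lowerOp _ _ _)
  have hs : ∀ i, indicial n (i + 1) (F (i + 1)) = h (i + 1) + lowerOp b κ i (F i) ∧
      (i + 1 = n → (F (i + 1)).coeff (if n = 0 then 1 else 0) = c₁) := by
    intro i
    rw [hFs]
    have := hsol (i + 1) (h (i + 1) + lowerOp b κ i (F i)) (by
      rw [if_neg (by omega), Nat.add_sub_cancel]
      exact ((hh.deg _).mono (hN i)).add ((hdeg i).lowerOp _ _ _))
    exact ⟨this.2.1, this.2.2.2⟩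
  have hz := hsol 0 (h 0) (by simpa using hh.deg 0)
  have hdeg' : ∀ i, DegLT (N + 2) (F i) := fun i => (hdeg i).mono (by
    rw [frobDeg]; split_ifs <;> omega)
  refine ⟨F, ⟨hdeg', ?_⟩, ⟨hz.2.1, fun i => (hs i).1⟩, hdeg, hz.2.2.1 rfl, ?_⟩
  · -- bounds
    set M := N + 2 with hM
    have hbh : ∃ C R : ℝ, 0 ≤ C ∧ 0 < R ∧ ∀ i, coeffNorm M (h i) ≤ C * R ^ i := by
      have hb := hh.bdd
      choose C R hC hR hCR using hb
      refine ⟨∑ j ∈ Finset.range M, C j, 1 + ∑ j ∈ Finset.range M, R j,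
        sum_nonneg fun j _ => hC j,
        add_pos_of_pos_of_nonneg one_pos (sum_nonneg fun j _ => (hR j).le), fun i => ?_⟩
      rw [coeffNorm, Finset.sum_mul]
      apply Finset.sum_le_sum
      intro j hj
      refine (hCR j i).trans ?_
      have : R j ≤ 1 + ∑ j ∈ Finset.range M, R j := by
        have := single_le_sum (f := R) (fun j _ => (hR j).le) hj
        linarith
      have := hC j
      have := (hR j).le
      gcongr
    obtain ⟨C, R, hC, hR, hCR⟩ := hbh
    suffices hrec : ∀ i, 2 * (M + n) + 2 ≤ i → coeffNorm M (F (i + 1)) ≤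
        (8 + 2 * |b| + ‖κ‖) * (coeffNorm M (h (i + 1)) + coeffNorm M (F i)) by
      obtain ⟨C', R', hR', hb⟩ := GeomBdd.of_recursion (s := fun i => coeffNorm M (F i))
        (t := fun i => coeffNorm M (h i)) hC hR (by positivity) hCR hrec
      exact fun j => GeomBdd.of_le hR' hb fun i => norm_coeff_le_coeffNorm (hdeg' i) j
    intro i hi
    have hiR : (2 : ℝ) * (M + n) + 2 ≤ i := by exact_mod_cast hi
    have hM0 : (0 : ℝ) ≤ M := by positivity
    have hn0 : (0 : ℝ) ≤ n := by positivity
    have e1 := le_coeffNorm_dil (hdeg' (i + 1)) (((i + 1 : ℕ) : ℝ) - n)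
    have e2 := le_coeffNorm_dil ((hdeg' (i + 1)).dil (((i + 1 : ℕ) : ℝ) - n)) ((i + 1 : ℕ) : ℝ)
    have e3 : 2 * coeffNorm M (dil ((i + 1 : ℕ) : ℝ) (dil (((i + 1 : ℕ) : ℝ) - n) (F (i + 1))))
        = coeffNorm M (h (i + 1) + lowerOp b κ i (F i)) := by
      rw [← (hs i).1, indicial, coeffNorm_smul]; norm_num
    have e4 := coeffNorm_add_le M (h (i + 1)) (lowerOp b κ i (F i))
    have e5 := coeffNorm_lowerOp_le (hdeg' i) b κ i
    have ha1 : |((i + 1 : ℕ) : ℝ) - n| = i + 1 - n := by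
      rw [abs_of_nonneg] <;> push_cast <;> linarith
    have ha2 : |((i + 1 : ℕ) : ℝ)| = i + 1 := by
      rw [abs_of_nonneg] <;> push_cast <;> linarith
    rw [ha1] at e1
    rw [ha2] at e2
    refine frobenius_bound hM0 hn0 hiR (abs_nonneg b) (norm_nonneg κ) (coeffNorm_nonneg M _)
      (coeffNorm_nonneg M _) (coeffNorm_nonneg M _) (coeffNorm_nonneg M _) e1 e2 (e3.le.trans ?_)
    linarith
  · rcases Nat.eq_zero_or_eq_succ_pred n with h0 | h0
    · rw [h0] at hz ⊢
      exact hz.2.2.2 rfl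
    · have := (hs (n - 1)).2 (by omega)
      rwa [show n - 1 + 1 = n by omega] at this

end LogSer

section LogGerm

open Polynomial

variable {A : Type*} [NormedCommRing A] [NormedAlgebra ℂ A]

theorem eventually_nhdsGT {p : ℝ → Prop} (h : ∀ᶠ x in 𝓝 (0 : ℝ), p x) : ∀ᶠ x in 𝓝₊, p x :=
  nhdsWithin_le_nhds h

theorem eventually_pos : ∀ᶠ x in 𝓝₊, 0 < x := self_mem_nhdsWithin

theorem eventually_lt_one : ∀ᶠ x in 𝓝₊, x < 1 :=
  eventually_nhdsGT (Iio_mem_nhds one_pos)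

theorem IsLogSer.mono {M M' : ℕ} {F : ℕ → A[X]} (h : IsLogSer M F) (hM : M ≤ M') : IsLogSer M' F :=
  ⟨fun i => (h.deg i).mono hM, h.bdd⟩

theorem IsLogSer.add {M : ℕ} {F G : ℕ → A[X]} (h : IsLogSer M F) (h' : IsLogSer M G) :
    IsLogSer M (fun i => F i + G i) :=
  ⟨fun i => (h.deg i).add (h'.deg i), fun j => by
    simpa only [coeff_add] using (h.bdd j).add (h'.bdd j)⟩

theorem IsLogSer.smul {M : ℕ} {F : ℕ → A[X]} (h : IsLogSer M F) (c : ℝ) :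
    IsLogSer M (fun i => c • F i) :=
  ⟨fun i => (h.deg i).smul c, fun j => by
    simpa only [coeff_smul] using (h.bdd j).smul c⟩

theorem IsLogSer.C_mul {M : ℕ} {F : ℕ → A[X]} (h : IsLogSer M F) (c : A) :
    IsLogSer M (fun i => C c * F i) :=
  ⟨fun i => (h.deg i).C_mul c, fun j => by
    simpa only [coeff_C_mul, ContinuousLinearMap.mul_apply'] using
      (h.bdd j).map (ContinuousLinearMap.mul ℝ A c)⟩

theorem IsLogSer.theta {M : ℕ} {F : ℕ → A[X]} (h : IsLogSer M F) : IsLogSer M (theta F) :=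
  ⟨fun i => (h.deg i).dil i, fun j => by
    simpa only [MaxwellScalar.theta, coeff_dil] using
      ((h.bdd j).nat_smul).add ((h.bdd (j + 1)).smul _)⟩

theorem coeff_xmul (F : ℕ → A[X]) (j : ℕ) :
    (fun i => (xmul F i).coeff j) = shiftR fun i => (F i).coeff j := by
  ext i; cases i <;> simp [xmul, shiftR]

theorem IsLogSer.xmul {M : ℕ} {F : ℕ → A[X]} (h : IsLogSer M F) : IsLogSer M (xmul F) :=
  ⟨fun i => by
    cases i with
    | zero => intro j _; simp [MaxwellScalar.xmul]
    | succ i => exact h.deg i, fun j => by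
    rw [coeff_xmul]; exact (h.bdd j).shiftR⟩

theorem IsLogSer.shift {M : ℕ} {F : ℕ → A[X]} (h : IsLogSer M F) (n : ℕ) :
    IsLogSer M (fun i => F (i + n)) :=
  ⟨fun i => h.deg _, fun j => (h.bdd j).shift_left n⟩

theorem powSer_const_zero (x : ℝ) : powSer (fun _ => (0 : A)) x = 0 := by simp [powSer]

theorem IsLogSer.lev_mono {M M' : ℕ} {F : ℕ → A[X]} (h : IsLogSer M F) (hM : M ≤ M') (x : ℝ) :
    lev M' F x = lev M F x := by
  rw [lev, lev]
  refine (Finset.sum_subset (Finset.range_mono hM) fun j _ hj => ?_).symm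
  have : (fun i => (F i).coeff j) = fun _ => 0 := by
    ext i; exact h.deg i j (by simpa using hj)
  rw [this, powSer_const_zero, smul_zero]

variable [CompleteSpace A]

theorem IsLogSer.lev_add {M : ℕ} {F G : ℕ → A[X]} (h : IsLogSer M F) (h' : IsLogSer M G) :
    ∀ᶠ x in 𝓝₊, lev M (fun i => F i + G i) x = lev M F x + lev M G x := by
  have : ∀ᶠ x in 𝓝 (0 : ℝ), ∀ j ∈ Finset.range M, powSer (fun i => (F i).coeff j + (G i).coeff j) x =
      powSer (fun i => (F i).coeff j) x + powSer (fun i => (G i).coeff j) x :=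
    (Filter.eventually_all_finset _).mpr fun j _ => (h.bdd j).powSer_add (h'.bdd j)
  filter_upwards [eventually_nhdsGT this] with x hx
  rw [lev, lev, lev, ← sum_add_distrib]
  refine sum_congr rfl fun j hj => ?_
  simp only [coeff_add]
  rw [hx j hj, smul_add]

theorem IsLogSer.lev_map {B : Type*} [NormedCommRing B] [NormedAlgebra ℂ B] [CompleteSpace B] {M : ℕ}
    {F : ℕ → A[X]} {G : ℕ → B[X]} (h : IsLogSer M F) (T : A →L[ℝ] B)
    (hG : ∀ i j, (G i).coeff j = T ((F i).coeff j)) :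
    IsLogSer M G ∧ ∀ᶠ x in 𝓝₊, lev M G x = T (lev M F x) := by
  refine ⟨⟨fun i j hj => by rw [hG, h.deg i j hj, map_zero], fun j => ?_⟩, ?_⟩
  · simp only [hG]; exact (h.bdd j).map T
  have : ∀ᶠ x in 𝓝 (0 : ℝ), ∀ j ∈ Finset.range M, powSer (fun i => T ((F i).coeff j)) x =
      T (powSer (fun i => (F i).coeff j) x) :=
    (Filter.eventually_all_finset _).mpr fun j _ => (h.bdd j).powSer_map T
  filter_upwards [eventually_nhdsGT this] with x hx
  rw [lev, lev, map_sum]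
  refine sum_congr rfl fun j hj => ?_
  simp only [hG]
  rw [hx j hj, map_smul]

theorem IsLogSer.lev_smul {M : ℕ} {F : ℕ → A[X]} (h : IsLogSer M F) (c : ℝ) :
    ∀ᶠ x in 𝓝₊, lev M (fun i => c • F i) x = c • lev M F x :=
  (h.lev_map (c • ContinuousLinearMap.id ℝ A) (by simp)).2

theorem IsLogSer.lev_C_mul {M : ℕ} {F : ℕ → A[X]} (h : IsLogSer M F) (c : A) :
    ∀ᶠ x in 𝓝₊, lev M (fun i => C c * F i) x = c * lev M F x :=
  (h.lev_map (ContinuousLinearMap.mul ℝ A c) (by simp)).2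

theorem IsLogSer.lev_xmul {M : ℕ} {F : ℕ → A[X]} (h : IsLogSer M F) :
    ∀ᶠ x in 𝓝₊, lev M (MaxwellScalar.xmul F) x = x • lev M F x := by
  have : ∀ᶠ x in 𝓝 (0 : ℝ), ∀ j ∈ Finset.range M, powSer (shiftR fun i => (F i).coeff j) x =
      x • (powSer (fun i => (F i).coeff j) x) :=
    (Filter.eventually_all_finset _).mpr fun j _ => (h.bdd j).powSer_shiftR
  filter_upwards [eventually_nhdsGT this] with x hx
  rw [lev, lev, smul_sum]
  refine sum_congr rfl fun j hj => ?_
  rw [coeff_xmul, hx j hj, smul_comm]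

theorem IsLogSer.lev_eq_add {M : ℕ} {F : ℕ → A[X]} (h : IsLogSer M F) :
    ∀ᶠ x in 𝓝₊, lev M F x = ∑ j ∈ Finset.range M, Real.log x ^ j • (F 0).coeff j
      + x • lev M (fun i => F (i + 1)) x := by
  have : ∀ᶠ x in 𝓝 (0 : ℝ), ∀ j ∈ Finset.range M, powSer (fun i => (F i).coeff j) x =
      (F 0).coeff j + x • (powSer (fun i => (F (i + 1)).coeff j) x) :=
    (Filter.eventually_all_finset _).mpr fun j _ => (h.bdd j).powSer_eq_add
  filter_upwards [eventually_nhdsGT this] with x hx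
  rw [lev, lev, smul_sum, ← sum_add_distrib]
  refine sum_congr rfl fun j hj => ?_
  rw [hx j hj, smul_add, smul_comm]

theorem lev_pow_smul {M n : ℕ} {F : ℕ → A[X]} (h0 : ∀ i < n, F i = 0) (x : ℝ) :
    lev M F x = x ^ n • lev M (fun i => F (i + n)) x := by
  rw [lev, lev, smul_sum]
  refine sum_congr rfl fun j _ => ?_
  rw [powSer_pow_smul (n := n) (fun i hi => by rw [h0 i hi, coeff_zero]), smul_comm]

theorem tendsto_mul_log_pow (k : ℕ) :
    Tendsto (fun x : ℝ => x * Real.log x ^ k) (𝓝[>] 0) (𝓝 0) := by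
  have h1 := (Real.isLittleO_pow_log_id_atTop (n := k)).tendsto_div_nhds_zero
  have h2 := (h1.comp tendsto_inv_nhdsGT_zero).const_mul ((-1 : ℝ) ^ k)
  rw [mul_zero] at h2
  refine h2.congr fun x => ?_
  simp only [Function.comp, id, Real.log_inv, div_inv_eq_mul, neg_pow (Real.log x) k]
  rw [← mul_assoc, ← mul_assoc, ← mul_pow]
  simp [mul_comm]

theorem IsLogSer.tendsto_mul_log_pow_lev {M : ℕ} {F : ℕ → A[X]} (h : IsLogSer M F) (k : ℕ) :
    Tendsto (fun x : ℝ => (x * Real.log x ^ k) • lev M F x) (𝓝[>] 0) (𝓝 0) := by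
  have : ∀ j ∈ Finset.range M, Tendsto (fun x : ℝ => (x * Real.log x ^ (k + j)) •
      powSer (fun i => (F i).coeff j) x) (𝓝[>] 0) (𝓝 0) := by
    intro j _
    have := (tendsto_mul_log_pow (k + j)).smul (h.bdd j).tendsto_powSer
    rwa [zero_smul] at this
  have h2 := tendsto_finsetSum _ this
  rw [Finset.sum_const_zero] at h2
  refine h2.congr fun x => ?_
  rw [lev, smul_sum]
  refine sum_congr rfl fun j _ => ?_
  rw [smul_smul, mul_assoc, pow_add]

theorem IsLogSer.tendsto_lev {M : ℕ} {F : ℕ → A[X]} (h : IsLogSer M F) {c : A} (hF : F 0 = C c) :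
    Tendsto (lev M F) (𝓝[>] 0) (𝓝 c) := by
  have h1 := (h.shift 1).tendsto_mul_log_pow_lev 0
  have h2 := (h1.const_add c)
  rw [add_zero] at h2
  refine h2.congr' ?_
  filter_upwards [(h.mono (Nat.le_succ M)).lev_eq_add] with x hx
  rw [← h.lev_mono (Nat.le_succ M), hx, (h.shift 1).lev_mono (Nat.le_succ M), hF,
    Finset.sum_range_succ']
  simp [coeff_C]

theorem IsLogSer.hasDerivAt_lev {M : ℕ} {F : ℕ → A[X]} (h : IsLogSer M F) :
    ∀ᶠ x in 𝓝₊, HasDerivAt (lev M F) (x⁻¹ • lev M (MaxwellScalar.theta F) x) x := by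
  set p : ℕ → ℝ → A := fun j => powSer fun i => (F i).coeff j with hp
  set p' : ℕ → ℝ → A := fun j => powSer fun i => ((i + 1 : ℕ) : ℝ) • (F (i + 1)).coeff j with hp'
  have e1 : ∀ᶠ x in 𝓝 (0 : ℝ), ∀ j ∈ Finset.range M, HasDerivAt (p j) (p' j x) x :=
    (Filter.eventually_all_finset _).mpr fun j _ => (h.bdd j).hasDerivAt
  have e2 : ∀ᶠ x in 𝓝 (0 : ℝ), ∀ j ∈ Finset.range M,
      powSer (fun i => (MaxwellScalar.theta F i).coeff j) x =
        x • p' j x + ((j + 1 : ℕ) : ℝ) • p (j + 1) x := by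
    refine (Filter.eventually_all_finset _).mpr fun j _ => ?_
    filter_upwards [(h.bdd j).powSer_nat_smul, (h.bdd (j + 1)).powSer_map
      (((j + 1 : ℕ) : ℝ) • ContinuousLinearMap.id ℝ A),
      (h.bdd j).nat_smul.powSer_add ((h.bdd (j + 1)).smul ((j + 1 : ℕ) : ℝ))] with x h1 h2 h3
    simp only [MaxwellScalar.theta, coeff_dil]
    rw [h3, h1]
    congr 1
  have hpM : ∀ x, p M x = 0 := fun x => by
    have : (fun i => (F i).coeff M) = fun _ => 0 := by
      ext i; exact h.deg i M le_rfl
    simp only [hp, this, powSer_const_zero]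
  filter_upwards [eventually_nhdsGT e1, eventually_nhdsGT e2, eventually_pos] with x h1 h2 hx
  have hd : HasDerivAt (lev M F) (∑ j ∈ Finset.range M, (Real.log x ^ j • p' j x
      + ((j : ℝ) * Real.log x ^ (j - 1) * x⁻¹) • p j x)) x := by
    exact HasDerivAt.fun_sum (u := Finset.range M) (x := x) (A := fun j y => Real.log y ^ j • p j y)
      fun j hj => ((Real.hasDerivAt_log hx.ne').pow j).smul (h1 j hj)
  refine hd.congr_deriv ?_
  have h4 : lev M (MaxwellScalar.theta F) x = ∑ j ∈ Finset.range M,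
      Real.log x ^ j • (x • p' j x + ((j + 1 : ℕ) : ℝ) • p (j + 1) x) :=
    sum_congr rfl fun j hj => by rw [h2 j hj]
  rw [h4, sum_add_distrib]
  simp only [smul_add, sum_add_distrib, smul_sum]
  congr 1
  · refine sum_congr rfl fun j _ => ?_
    rw [smul_comm (Real.log x ^ j) x, inv_smul_smul₀ hx.ne']
  · have h3 : ∑ j ∈ Finset.range M, ((j : ℝ) * Real.log x ^ (j - 1) * x⁻¹) • p j x =
        ∑ j ∈ Finset.range (M + 1), ((j : ℝ) * Real.log x ^ (j - 1) * x⁻¹) • p j x := by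
      rw [sum_range_succ, hpM, smul_zero, add_zero]
    rw [h3, Finset.sum_range_succ']
    simp only [Nat.cast_zero, zero_mul, zero_smul, add_zero, Nat.add_sub_cancel]
    refine sum_congr rfl fun j _ => ?_
    simp only [smul_smul]
    congr 1; ring

/-- Functions which are represented by a log series near `0+`. -/
def LogGerm (G : ℝ → A) : Prop :=
  ∃ M F, IsLogSer M F ∧ ∀ᶠ x in 𝓝₊, G x = lev M F x

theorem LogGerm.congr {G H : ℝ → A} (h : LogGerm G) (he : ∀ᶠ x in 𝓝₊, H x = G x) :
    LogGerm H := by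
  obtain ⟨M, F, hF, hG⟩ := h
  exact ⟨M, F, hF, by filter_upwards [hG, he] with x h1 h2; rw [h2, h1]⟩

theorem LogGerm.add {G H : ℝ → A} (hG : LogGerm G) (hH : LogGerm H) :
    LogGerm fun x => G x + H x := by
  obtain ⟨M, F, hF, h⟩ := hG
  obtain ⟨M', F', hF', h'⟩ := hH
  have h1 := hF.mono (le_max_left M M')
  have h2 := hF'.mono (le_max_right M M')
  refine ⟨max M M', _, h1.add h2, ?_⟩
  filter_upwards [h, h', h1.lev_add h2] with x e1 e2 e3
  rw [e3, e1, e2, hF.lev_mono (le_max_left M M'), hF'.lev_mono (le_max_right M M')]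

theorem logGerm_zero : LogGerm fun _ => (0 : A) :=
  ⟨0, fun _ => 0, ⟨fun _ _ _ => by simp, fun j => by simpa using GeomBdd.zero⟩, by simp [lev]⟩

theorem logGerm_sum {ι : Type*} (s : Finset ι) {G : ι → ℝ → A} (h : ∀ i ∈ s, LogGerm (G i)) :
    LogGerm fun x => ∑ i ∈ s, G i x := by
  classical
  induction s using Finset.induction_on with
  | empty => simpa using logGerm_zero
  | insert i s hi ih =>
    simp only [Finset.sum_insert hi]
    exact (h i (by simp)).add (ih fun j hj => h j (by simp [hj]))

theorem logGerm_log_pow_smul (k : ℕ) {a : ℝ → A} (ha : AnalyticAt ℝ a 0) :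
    LogGerm fun x => Real.log x ^ k • a x := by
  obtain ⟨c, hc, hac⟩ := exists_powSer_of_analyticAt ha
  refine ⟨k + 1, fun i => monomial k (c i), ⟨fun i j hj => ?_, fun j => ?_⟩, ?_⟩
  · rw [coeff_monomial, if_neg (by omega)]
  · simp only [coeff_monomial]
    by_cases hj : k = j
    · simpa [hj] using hc
    · simpa [hj] using GeomBdd.zero
  · filter_upwards [eventually_nhdsGT hac] with x hx
    rw [lev, Finset.sum_eq_single k]
    · simp [hx]
    · intro j _ hj
      simp [coeff_monomial, hj.symm, powSer_const_zero]
    · simp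

theorem LogGerm.exists_analytic {G : ℝ → A} (hG : LogGerm G) : ∃ (M : ℕ) (a : ℕ → ℝ → A),
    (∀ j, AnalyticAt ℝ (a j) 0) ∧
      ∀ᶠ x in 𝓝₊, G x = ∑ j ∈ Finset.range M, Real.log x ^ j • a j x := by
  obtain ⟨M, F, hF, h⟩ := hG
  exact ⟨M, fun j => powSer fun i => (F i).coeff j, fun j => (hF.bdd j).analyticAt, h⟩

theorem LogGerm.mul {G H : ℝ → A} (hG : LogGerm G) (hH : LogGerm H) :
    LogGerm fun x => G x * H x := by
  obtain ⟨M, a, ha, h⟩ := hG.exists_analytic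
  obtain ⟨M', a', ha', h'⟩ := hH.exists_analytic
  refine (logGerm_sum (Finset.range M) (G := fun j x => ∑ k ∈ Finset.range M',
    Real.log x ^ (j + k) • (a j x * a' k x)) fun j _ => logGerm_sum _ fun k _ =>
    logGerm_log_pow_smul _ ((ha j).mul (ha' k))).congr ?_
  filter_upwards [h, h'] with x e1 e2
  rw [e1, e2, Finset.sum_mul_sum]
  refine sum_congr rfl fun j _ => sum_congr rfl fun k _ => ?_
  rw [smul_mul_smul_comm, pow_add]

theorem logGerm_of_analyticAt {a : ℝ → A} (ha : AnalyticAt ℝ a 0) : LogGerm a := by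
  simpa using logGerm_log_pow_smul 0 ha

theorem LogGerm.analytic_smul {G : ℝ → A} (hG : LogGerm G) {a : ℝ → ℝ} (ha : AnalyticAt ℝ a 0) :
    LogGerm fun x => a x • G x := by
  have h1 : AnalyticAt ℝ (fun x => a x • (1 : A)) 0 := ha.smul analyticAt_const
  refine ((logGerm_of_analyticAt h1).mul hG).congr (Eventually.of_forall fun x => ?_)
  rw [smul_mul_assoc, one_mul]

theorem LogGerm.map {B : Type*} [NormedCommRing B] [NormedAlgebra ℂ B] [CompleteSpace B] {G : ℝ → A}
    (hG : LogGerm G) (T : A →L[ℝ] B) : LogGerm fun x => T (G x) := by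
  classical
  obtain ⟨M, F, hF, h⟩ := hG
  have hc : ∀ i j, (∑ k ∈ Finset.range M, monomial k (T ((F i).coeff k))).coeff j =
      T ((F i).coeff j) := by
    intro i j
    rw [finsetSum_coeff]
    simp only [coeff_monomial, Finset.sum_ite_eq']
    split_ifs with hj
    · rfl
    · rw [hF.deg i j (by simpa using hj), map_zero]
  obtain ⟨h1, h2⟩ := hF.lev_map (G := fun i => ∑ k ∈ Finset.range M, monomial k (T ((F i).coeff k)))
    T hc
  refine ⟨M, _, h1, ?_⟩
  filter_upwards [h, h2] with x e1 e2
  rw [e2, e1]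

theorem eventually_nhds_of_nhdsGT {p : ℝ → Prop} (h : ∀ᶠ x in 𝓝₊, p x) :
    ∀ᶠ x in 𝓝₊, ∀ᶠ y in 𝓝 x, p y := by
  have := eventually_eventually_nhdsWithin.mpr h
  filter_upwards [this, eventually_pos] with x hx hx0
  rwa [nhdsWithin_eq_nhds.mpr (Ioi_mem_nhds hx0)] at hx

theorem LogGerm.smul_deriv {G G' : ℝ → A} (hG : LogGerm G)
    (hd : ∀ᶠ x in 𝓝₊, HasDerivAt G (G' x) x) : LogGerm fun x => x • G' x := by
  obtain ⟨M, F, hF, h⟩ := hG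
  refine ⟨M, theta F, hF.theta, ?_⟩
  filter_upwards [eventually_nhds_of_nhdsGT h, hd, hF.hasDerivAt_lev, eventually_pos]
    with x e1 e2 e3 hx
  have := e2.unique (e3.congr_of_eventuallyEq e1)
  rw [this, smul_inv_smul₀ hx.ne']

theorem theta_theta_of_isFrobenius {n : ℕ} {b : ℝ} {κ : A} {h F : ℕ → A[X]}
    (hF : IsFrobenius n b κ h F) (i : ℕ) :
    (2 : ℝ) • theta (theta F) i + (-(2 * n) : ℝ) • theta F i =
      h i + xmul (fun i => theta (theta F) i + (-b) • theta F i + C κ * F i) i := by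
  have key : ∀ i, indicial n i (F i) =
      (2 : ℝ) • theta (theta F) i + (-(2 * n) : ℝ) • theta F i := by
    intro i
    simp only [indicial, theta, dil, derivative_add, derivative_smul]
    module
  rw [← key]
  cases i with
  | zero => simpa [xmul] using hF.1
  | succ i => simpa [xmul, lowerOp, theta] using hF.2 i

/-- Log series which solve the Frobenius recursion solve the differential equation. -/
theorem hasDerivAt_of_isFrobenius {n N M : ℕ} {b : ℝ} {κ : A} {h F : ℕ → A[X]} {g : ℝ → A}
    (hh : IsLogSer N h) (hg : ∀ᶠ x in 𝓝₊, x • g x = lev N h x) (hF : IsLogSer M F)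
    (hNM : N ≤ M) (hfr : IsFrobenius n b κ h F) :
    ∀ᶠ x in 𝓝₊, HasDerivAt (lev M F) (x⁻¹ • lev M (theta F) x) x ∧
      HasDerivAt (fun x => x⁻¹ • lev M (theta F) x) ((x * (2 - x))⁻¹ • (g x + κ * lev M F x
        + (2 * (n - 1) - (b - 1) * x) • (x⁻¹ • lev M (theta F) x))) x := by
  have hh' := hh.mono hNM
  have t1 := hF.theta
  have t2 := t1.theta
  have q1 := (t2.add (t1.smul (-b)))
  have q := q1.add (hF.C_mul κ)
  have hid : (fun i => (2 : ℝ) • theta (theta F) i + (-(2 * n) : ℝ) • theta F i) =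
      fun i => h i + xmul (fun i => theta (theta F) i + (-b) • theta F i + C κ * F i) i :=
    funext (theta_theta_of_isFrobenius hfr)
  filter_upwards [hF.hasDerivAt_lev, t1.hasDerivAt_lev, hg, eventually_pos, eventually_lt_one,
    (t2.smul 2).lev_add (t1.smul (-(2 * n))), t2.lev_smul 2, t1.lev_smul (-(2 * n) : ℝ),
    hh'.lev_add q.xmul, q.lev_xmul, q1.lev_add (hF.C_mul κ), t2.lev_add (t1.smul (-b)),
    t1.lev_smul (-b), hF.lev_C_mul κ] with x d1 d2 hgx hx hx1 e1 e2 e3 e4 e5 e6 e7 e8 e9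
  refine ⟨d1, ((hasDerivAt_inv hx.ne').smul d2).congr_deriv ?_⟩
  rw [e2, e3, hid, e4, e5, e6, e7, e8, e9, hh.lev_mono hNM, ← hgx] at e1
  set L0 := lev M F x
  set L1 := lev M (theta F) x
  set L2 := lev M (theta (theta F)) x
  have h2x : 2 - x ≠ 0 := by linarith
  have hxx : x * (2 - x) ≠ 0 := mul_ne_zero hx.ne' h2x
  apply smul_right_injective A (mul_ne_zero hx.ne' hxx)
  dsimp only
  have a1 : (x * (x * (2 - x))) • (x⁻¹ • x⁻¹ • L2 + (-(x ^ 2)⁻¹) • L1) = (2 - x) • (L2 - L1) := by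
    rw [smul_add, smul_smul, smul_smul, smul_smul,
      show x * (x * (2 - x)) * x⁻¹ * x⁻¹ = 2 - x by field_simp,
      show x * (x * (2 - x)) * (-(x ^ 2)⁻¹) = -(2 - x) by field_simp]
    module
  have a2 : (x * (x * (2 - x))) • (x * (2 - x))⁻¹ • (g x + κ * L0 +
      (2 * ((n : ℝ) - 1) - (b - 1) * x) • x⁻¹ • L1) = x • g x + x • (κ * L0)
      + (2 * ((n : ℝ) - 1) - (b - 1) * x) • L1 := by
    rw [smul_smul, show x * (x * (2 - x)) * (x * (2 - x))⁻¹ = x by field_simp, smul_add, smul_add,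
      smul_comm x, smul_inv_smul₀ hx.ne']
  rw [a1, a2]
  linear_combination (norm := module) -e1

/-- The fundamental solutions of the homogeneous equation are independent near `0+`. -/
theorem eventually_isUnit_wronskian {n M : ℕ} {U V : ℕ → A[X]} (hU : IsLogSer M U)
    (hV : IsLogSer M V) (hU0 : U 0 = C 1)
    (hVn : ∀ i < n, V i = 0) (hV0 : V n = if n = 0 then X else C 1) :
    ∀ᶠ x in 𝓝₊, IsUnit (lev M U x * lev M (theta V) x - lev M V x * lev M (theta U) x) := by
  have hθU0 : theta U 0 = C 0 := by simp [theta, hU0, dil]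
  have hθV : ∀ i < n, theta V i = 0 := fun i hi => by simp [theta, hVn i hi, dil]
  obtain ⟨r, hr, hlim⟩ : ∃ r : ℝ, r ≠ 0 ∧ Tendsto (fun x : ℝ => lev M U x *
      lev M (fun i => theta V (i + n)) x - lev M (fun i => V (i + n)) x * lev M (theta U) x)
      (𝓝[>] 0) (𝓝 (r • (1 : A))) := by
    rcases eq_or_ne n 0 with rfl | hn
    · refine ⟨1, one_ne_zero, ?_⟩
      rw [if_pos rfl] at hV0
      have h1 : Tendsto (lev M (theta V)) (𝓝[>] 0) (𝓝 1) :=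
        hV.theta.tendsto_lev (by simp [theta, hV0, dil])
      have h2 := (hU.tendsto_lev hU0).mul h1
      have h3 : Tendsto (fun x => lev M V x * lev M (theta U) x) (𝓝[>] 0) (𝓝 0) := by
        have k1 := (hU.theta.shift 1).tendsto_mul_log_pow_lev 1
        have k2 := ((hV.shift 1).tendsto_mul_log_pow_lev 0).mul
          (hU.theta.tendsto_lev hθU0)
        have k3 := k1.add k2
        rw [zero_mul, add_zero] at k3
        have m1 := (hV.mono (show M ≤ M + 2 by omega))
        have m2 := (hU.theta.mono (show M ≤ M + 2 by omega))
        refine k3.congr' ?_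
        filter_upwards [m1.lev_eq_add, m2.lev_eq_add] with x e1 e2
        rw [hV.lev_mono (show M ≤ M + 2 by omega),
          (hV.shift 1).lev_mono (show M ≤ M + 2 by omega), hV0] at e1
        rw [hU.theta.lev_mono (show M ≤ M + 2 by omega),
          (hU.theta.shift 1).lev_mono (show M ≤ M + 2 by omega), hθU0] at e2
        have s1 : ∑ j ∈ Finset.range (M + 2), Real.log x ^ j • (X : A[X]).coeff j
            = Real.log x • 1 := by
          rw [Finset.sum_eq_single 1]
          · simp
          · intro j _ hj; simp [coeff_X, hj.symm]
          · simp
        have s2 : ∑ j ∈ Finset.range (M + 2), Real.log x ^ j • (C 0 : A[X]).coeff j = 0 := by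
          simp
        rw [s1] at e1
        rw [s2, zero_add] at e2
        rw [e1, add_mul, smul_one_mul, pow_zero, mul_one, pow_one]
        congr 1
        rw [e2, smul_smul, mul_comm]
      have h4 := h2.sub h3
      simpa using h4
    · refine ⟨n, by exact_mod_cast hn, ?_⟩
      rw [if_neg hn] at hV0
      have h1 : Tendsto (lev M (fun i => theta V (i + n))) (𝓝[>] 0) (𝓝 ((n : ℝ) • 1)) :=
        (hV.theta.shift n).tendsto_lev (by
          simp only [theta, zero_add, hV0, dil, derivative_C, add_zero, smul_C])
      have h2 := (hU.tendsto_lev hU0).mul h1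
      have h3 := ((hV.shift n).tendsto_lev (c := 1) (by simpa using hV0)).mul
        (hU.theta.tendsto_lev hθU0)
      have h4 := h2.sub h3
      simpa using h4
  have hunit : IsUnit (r • (1 : A)) :=
    ⟨⟨r • 1, r⁻¹ • 1, by simp [smul_smul, hr], by simp [smul_smul, hr]⟩, rfl⟩
  have := hlim.eventually (Units.isOpen.mem_nhds hunit)
  filter_upwards [this, eventually_pos] with x hx hx0
  rw [lev_pow_smul hVn, lev_pow_smul hθV, mul_smul_comm, smul_mul_assoc, ← smul_sub]
  have hp : x ^ n ≠ 0 := (pow_pos hx0 n).ne'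
  have hu2 : IsUnit (x ^ n • (1 : A)) :=
    ⟨⟨x ^ n • 1, (x ^ n)⁻¹ • 1, by simp [smul_smul, hp], by simp [smul_smul, hp]⟩, rfl⟩
  have := hu2.mul hx
  rwa [smul_mul_assoc, one_mul] at this

theorem eq_zero_of_indicial {n i : ℕ} (hi : i ≠ 0) (hin : i ≠ n) {P : A[X]} (hP : DegLT 1 P)
    (h : indicial n i P = 0) : P = 0 := by
  have hd : ∀ c : ℝ, dil c P = c • P := fun c => by
    have : derivative P = 0 := by
      ext j; rw [coeff_derivative, hP (j + 1) (by omega)]; simp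
    rw [dil, this, add_zero]
  have hd' : ∀ c c' : ℝ, dil c (c' • P) = c • c' • P := fun c c' => by
    have h1 : dil c (c' • P) = c' • dil c P := by
      simp only [dil, derivative_smul, smul_add, smul_comm c c']
    rw [h1, hd, smul_comm]
  rw [indicial, hd, hd', smul_smul, smul_smul] at h
  have h1 : (2 * ((i : ℝ) * ((i : ℝ) - n))) ≠ 0 := by
    refine mul_ne_zero two_ne_zero (mul_ne_zero (by exact_mod_cast hi) ?_)
    rw [sub_ne_zero]; exact_mod_cast hin
  exact (smul_eq_zero_iff_right h1).mp (by rwa [mul_assoc] at h |> fun _ => by simpa [mul_assoc] using h)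

/-- The two fundamental solutions of the homogeneous equation. -/
theorem exists_fundamental (n : ℕ) (b : ℝ) (κ : A) : ∃ U V : ℕ → A[X], IsLogSer 2 U ∧ IsLogSer 2 V ∧
    IsFrobenius n b κ (fun _ => 0) U ∧ IsFrobenius n b κ (fun _ => 0) V ∧ U 0 = C 1 ∧
    (∀ i < n, V i = 0) ∧ V n = if n = 0 then X else C 1 := by
  have h0 : IsLogSer 0 (fun _ => (0 : A[X])) :=
    ⟨fun _ _ _ => by simp, fun j => by simpa using GeomBdd.zero⟩
  obtain ⟨V, hV, hVf, hVd, hV0, hVn⟩ := exists_frobenius n b κ 0 h0 0 1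
  have hV' : ∀ i < n, V i = 0 := by
    intro i
    induction i with
    | zero =>
      intro hn
      have hd : DegLT 1 (V 0) := by simpa [frobDeg, hn] using hVd 0
      ext j
      rcases Nat.eq_zero_or_pos j with rfl | hj
      · simpa using hV0
      · simpa using hd j hj
    | succ i ih =>
      intro hi
      have hd : DegLT 1 (V (i + 1)) := by simpa [frobDeg, hi] using hVd (i + 1)
      refine eq_zero_of_indicial (n := n) (i := i + 1) (by omega) (by omega) hd ?_
      rw [hVf.2 i, ih (by omega)]
      simp [lowerOp, dil]
  rcases eq_or_ne n 0 with rfl | hn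
  · obtain ⟨U, hU, hUf, hUd, hU0, hUn⟩ := exists_frobenius 0 b κ 0 h0 1 0
    refine ⟨U, V, hU, hV, hUf, hVf, ?_, hV', ?_⟩
    · ext j
      rcases Nat.lt_trichotomy j 1 with h | h | h
      · obtain rfl : j = 0 := by omega
        simpa using hU0
      · subst h; rw [coeff_C, if_neg one_ne_zero]; exact hUn
      · rw [hU.deg 0 j (by omega), coeff_C, if_neg (by omega)]
    · ext j
      rcases Nat.lt_trichotomy j 1 with h | h | h
      · obtain rfl : j = 0 := by omega
        simpa using hV0
      · subst h; simpa using hVn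
      · rw [hV.deg 0 j (by omega), if_pos rfl, coeff_X, if_neg (by omega)]
  · obtain ⟨U, hU, hUf, hUd, hU0, hUn⟩ := exists_frobenius n b κ 0 h0 1 0
    refine ⟨U, V, hU, hV, hUf, hVf, ?_, hV', ?_⟩
    · have hd : DegLT 1 (U 0) := by simpa [frobDeg, Nat.pos_of_ne_zero hn] using hUd 0
      ext j
      rcases Nat.eq_zero_or_pos j with rfl | hj
      · simpa using hU0
      · rw [hd j hj, coeff_C, if_neg (by omega)]
    · obtain ⟨m, rfl⟩ := Nat.exists_eq_succ_of_ne_zero hn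
      have h1 := hVf.2 m
      rw [hV' m (by omega)] at h1
      have h2 : indicial (m + 1) (m + 1) (V (m + 1)) = 0 := by
        rw [h1]; simp [lowerOp, dil]
      have h3 := hV.deg (m + 1)
      have h4 := congrArg (fun P => P.coeff 0) h2
      simp only [indicial, sub_self, coeff_smul, coeff_dil, coeff_zero, h3 2 le_rfl, zero_smul,
        smul_zero, zero_add, add_zero, smul_smul] at h4
      have h5 : (V (m + 1)).coeff 1 = 0 := by
        refine (smul_eq_zero_iff_right ?_).mp h4
        have : ((m + 1 : ℕ) : ℝ) ≠ 0 := by positivity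
        simp only [Nat.cast_add, Nat.cast_one] at this ⊢
        simpa using this
      ext j
      rcases Nat.lt_trichotomy j 1 with h | h | h
      · obtain rfl : j = 0 := by omega
        simpa using hVn
      · subst h; rw [if_neg hn, coeff_C, if_neg one_ne_zero]; exact h5
      · rw [h3 j (by omega), if_neg hn, coeff_C, if_neg (by omega)]

/-- Solutions of a linear equation with a regular singular point at `0` are represented by log
series if the source is. -/
theorem exists_logSer_of_ode {n N : ℕ} {b δ : ℝ} {κ : A} {y y' g : ℝ → A} {h : ℕ → A[X]} (hδ : 0 < δ)
    (hy : ∀ x ∈ Ioo 0 δ, HasDerivAt y (y' x) x)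
    (hy' : ∀ x ∈ Ioo 0 δ, HasDerivAt y'
      ((x * (2 - x))⁻¹ • (g x + κ * y x + (2 * (n - 1) - (b - 1) * x) • y' x)) x)
    (hh : IsLogSer N h) (hg : ∀ᶠ x in 𝓝₊, x • g x = lev N h x) :
    ∃ F, IsLogSer (N + 2) F ∧ ∀ᶠ x in 𝓝₊, y x = lev (N + 2) F x := by
  obtain ⟨U, V, hU, hV, hUf, hVf, hU0, hVn, hV0⟩ := exists_fundamental n b κ
  obtain ⟨P, hP, hPf, -, -, -⟩ := exists_frobenius n b κ N hh 0 0
  have h0 : IsLogSer 0 (fun _ => (0 : A[X])) :=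
    ⟨fun _ _ _ => by simp, fun j => by simpa using GeomBdd.zero⟩
  have g0 : ∀ᶠ x in 𝓝₊, x • (fun _ => (0 : A)) x = lev 0 (fun _ => (0 : A[X])) x := by
    simp [lev]
  have hU' := hU.mono (show 2 ≤ N + 2 by omega)
  have hV' := hV.mono (show 2 ≤ N + 2 by omega)
  have all := (hasDerivAt_of_isFrobenius h0 g0 hU' (by omega) hUf).and
    ((hasDerivAt_of_isFrobenius h0 g0 hV' (by omega) hVf).and
    ((hasDerivAt_of_isFrobenius hh hg hP (by omega) hPf).and
    ((eventually_isUnit_wronskian hU' hV' hU0 hVn hV0).and eventually_lt_one)))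
  obtain ⟨ε, hε, hall⟩ := mem_nhdsGT_iff_exists_Ioo_subset.mp all
  rw [mem_Ioi] at hε
  set η := min ε δ with hη
  have hη0 : 0 < η := lt_min hε hδ
  set x₀ := η / 2 with hx₀
  have hx₀m : x₀ ∈ Ioo 0 η := ⟨by positivity, by linarith⟩
  have hmem : ∀ x ∈ Ioo 0 η, x ∈ Ioo 0 ε ∧ x ∈ Ioo 0 δ := fun x hx =>
    ⟨⟨hx.1, hx.2.trans_le (min_le_left _ _)⟩, ⟨hx.1, hx.2.trans_le (min_le_right _ _)⟩⟩
  have hx₀0 : x₀ ≠ 0 := hx₀m.1.ne'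
  obtain ⟨w, hw⟩ := (hall (hmem x₀ hx₀m).1).2.2.2.1
  set M := N + 2 with hM
  set α := y x₀ - lev M P x₀ with hα
  set β := x₀ • y' x₀ - lev M (theta P) x₀ with hβ
  set C₁ := (α * lev M (theta V) x₀ - β * lev M V x₀) * (↑w⁻¹ : A) with hC₁
  set C₂ := (β * lev M U x₀ - α * lev M (theta U) x₀) * (↑w⁻¹ : A) with hC₂
  have hww : (w : A) * (↑w⁻¹ : A) = 1 := w.mul_inv
  have i1 : C₁ * lev M U x₀ + C₂ * lev M V x₀ = α := by
    rw [hC₁, hC₂]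
    rw [hw] at hww
    linear_combination α * hww
  have i2 : C₁ * lev M (theta U) x₀ + C₂ * lev M (theta V) x₀ = β := by
    rw [hC₁, hC₂]
    rw [hw] at hww
    linear_combination β * hww
  have hz := eq_zero_of_secondOrder (a := 0) (b := η) (t₀ := x₀)
    (y := fun x => y x - (C₁ * lev M U x + C₂ * lev M V x + lev M P x))
    (y' := fun x => y' x - (C₁ * (x⁻¹ • lev M (theta U) x) + C₂ * (x⁻¹ • lev M (theta V) x)
      + x⁻¹ • lev M (theta P) x))
    (P := fun x => (x * (2 - x))⁻¹ * (2 * (n - 1) - (b - 1) * x))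
    (Q := fun x => (x * (2 - x))⁻¹ • κ) ?_ ?_ ?_ ?_ hx₀m ?_ ?_
  · refine ⟨fun i => (C C₁ * U i + C C₂ * V i) + P i,
      ((hU'.C_mul C₁).add (hV'.C_mul C₂)).add hP, ?_⟩
    filter_upwards [Ioo_mem_nhdsGT hη0, ((hU'.C_mul C₁).add (hV'.C_mul C₂)).lev_add hP,
      (hU'.C_mul C₁).lev_add (hV'.C_mul C₂), hU'.lev_C_mul C₁, hV'.lev_C_mul C₂]
      with x hx e1 e2 e3 e4
    rw [e1, e2, e3, e4]
    exact sub_eq_zero.mp (hz x hx).1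
  · intro x hx
    have := hall (hmem x hx).1
    exact (hy x (hmem x hx).2).sub
      (((this.1.1.const_mul C₁).add (this.2.1.1.const_mul C₂)).add this.2.2.1.1)
  · intro x hx
    have := hall (hmem x hx).1
    refine ((hy' x (hmem x hx).2).sub
      (((this.1.2.const_mul C₁).add (this.2.1.2.const_mul C₂)).add this.2.2.1.2)).congr_deriv ?_
    simp only [zero_add, mul_smul_comm, smul_mul_assoc, ← smul_smul, ← smul_add, ← smul_sub]
    congr 1
    simp only [mul_add, mul_sub, smul_sub, smul_add, mul_smul_comm]
    ring
  · apply ContinuousOn.mul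
    · apply ContinuousOn.inv₀ (by fun_prop)
      intro x hx
      have : x < 1 := (hall (hmem x hx).1).2.2.2.2
      exact mul_ne_zero hx.1.ne' (by linarith)
    · fun_prop
  · have h1 : ContinuousOn (fun x : ℝ => (x * (2 - x))⁻¹) (Ioo 0 η) := by
      apply ContinuousOn.inv₀ (by fun_prop)
      intro x hx
      have : x < 1 := (hall (hmem x hx).1).2.2.2.2
      exact mul_ne_zero hx.1.ne' (by linarith)
    exact h1.smul continuousOn_const
  · rw [i1, hα]; abel
  · rw [mul_smul_comm, mul_smul_comm, ← smul_add, ← smul_add, i2, hβ, sub_add_cancel,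
      inv_smul_smul₀ hx₀0, sub_self]

end LogGerm

section LogAt

open Polynomial

variable {A : Type*} [NormedCommRing A] [NormedAlgebra ℂ A] [CompleteSpace A]

/-- Functions which are represented by a log series in `1 - e τ` near `τ = e`. -/
def LogAt (e : ℝ) (f : ℝ → A) : Prop := LogGerm fun x => f (e * (1 - x))

theorem mem_Ioo_of_endpoint {e : ℝ} (he : e ∈ 𝕊) {x : ℝ} (hx : x ∈ Ioo (0 : ℝ) 1) :
    e * (1 - x) ∈ 𝕀 := by
  rcases he with rfl | rfl <;> exact ⟨by linarith [hx.1, hx.2], by linarith [hx.1, hx.2]⟩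

theorem endpoint_mul_self {e : ℝ} (he : e ∈ 𝕊) : e * e = 1 := by
  rcases he with rfl | rfl <;> norm_num

theorem Ioo_zero_one_mem_nhdsGT : Ioo (0 : ℝ) 1 ∈ 𝓝₊ := Ioo_mem_nhdsGT one_pos

theorem LogAt.add {e : ℝ} {f g : ℝ → A} (hf : LogAt e f) (hg : LogAt e g) :
    LogAt e fun τ => f τ + g τ := LogGerm.add hf hg

theorem LogAt.mul {e : ℝ} {f g : ℝ → A} (hf : LogAt e f) (hg : LogAt e g) :
    LogAt e fun τ => f τ * g τ := LogGerm.mul hf hg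

theorem LogAt.map {B : Type*} [NormedCommRing B] [NormedAlgebra ℂ B] [CompleteSpace B] {e : ℝ}
    {f : ℝ → A} (hf : LogAt e f) (T : A →L[ℝ] B) : LogAt e fun τ => T (f τ) := LogGerm.map hf T

theorem LogAt.analytic_smul {e : ℝ} {f : ℝ → A} (hf : LogAt e f) {a : ℝ → ℝ}
    (ha : AnalyticAt ℝ (fun x => a (e * (1 - x))) 0) : LogAt e fun τ => a τ • f τ :=
  LogGerm.analytic_smul hf ha

theorem logAt_const (e : ℝ) (c : A) : LogAt e fun _ => c := logGerm_of_analyticAt analyticAt_const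

theorem LogAt.linear_smul {e : ℝ} {f : ℝ → A} (hf : LogAt e f) (a b : ℝ) :
    LogAt e fun τ => (a + b * τ) • f τ :=
  hf.analytic_smul (a := fun τ => a + b * τ) (by fun_prop)

theorem hasDerivAt_comp_endpoint {e : ℝ} (he : e ∈ 𝕊) {f : ℝ → A}
    (hf : ContDiffOn ℝ ∞ f 𝕀) {x : ℝ} (hx : x ∈ Ioo (0 : ℝ) 1) :
    HasDerivAt (fun x => f (e * (1 - x))) ((-e) • deriv f (e * (1 - x))) x := by
  have h1 : HasDerivAt (fun x : ℝ => e * (1 - x)) (-e) x := by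
    simpa using ((hasDerivAt_id x).const_sub 1).const_mul e
  simpa [Function.comp_def] using
    (hasDerivAt_of_contDiffOn hf (mem_Ioo_of_endpoint he hx)).scomp x h1

/-- Log series are stable under `(1 - e τ) ∂_τ`. -/
theorem LogAt.smul_deriv {e : ℝ} (he : e ∈ 𝕊) {f : ℝ → A}
    (hf : ContDiffOn ℝ ∞ f 𝕀) (h : LogAt e f) :
    LogAt e fun τ => (1 - e * τ) • deriv f τ := by
  have h1 : LogGerm fun x : ℝ => x • ((-e) • deriv f (e * (1 - x))) := by
    refine LogGerm.smul_deriv h ?_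
    filter_upwards [Ioo_zero_one_mem_nhdsGT] with x hx using hasDerivAt_comp_endpoint he hf hx
  refine (h1.analytic_smul (a := fun _ => -e) analyticAt_const).congr
    (Eventually.of_forall fun x => ?_)
  have he2 := endpoint_mul_self he
  dsimp only
  rw [smul_smul, smul_smul]
  congr 1
  linear_combination -he2

theorem exists_logSer_of_sing {e : ℝ} (he : e ∈ 𝕊) {n N : ℕ} {β γ : ℝ} {κ : A}
    {f g : ℝ → A} {h : ℕ → A[X]} (hn : β + e * γ = 2 * (n - 1))
    (hf : ContDiffOn ℝ ∞ f 𝕀) (hs : ∀ τ ∈ 𝕀, sing β γ κ f τ = g τ)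
    (hh : IsLogSer N h) (hg : ∀ᶠ x in 𝓝₊, x • g (e * (1 - x)) = lev N h x) :
    ∃ F, IsLogSer (N + 2) F ∧ ∀ᶠ x in 𝓝₊, f (e * (1 - x)) = lev (N + 2) F x := by
  refine exists_logSer_of_ode (n := n) (b := β + 1) (κ := κ) (y := fun x => f (e * (1 - x)))
    (y' := fun x => (-e) • deriv f (e * (1 - x))) (g := fun x => g (e * (1 - x))) one_pos
    (fun x hx => hasDerivAt_comp_endpoint he hf hx) (fun x hx => ?_) hh hg
  refine ((hasDerivAt_comp_endpoint he (contDiffOn_deriv hf) hx).const_smul (-e)).congr_deriv ?_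
  rw [← hs _ (mem_Ioo_of_endpoint he hx), sing]
  set τ := e * (1 - x) with hτ
  have he2 := endpoint_mul_self he
  have hx2 : x * (2 - x) ≠ 0 := mul_ne_zero hx.1.ne' (by linarith [hx.2])
  have h1 : 1 - τ ^ 2 = x * (2 - x) := by
    rw [hτ]; linear_combination (-(1 - x) ^ 2) * he2
  have h2 : β * τ + γ + (2 * ((n : ℝ) - 1) - (β + 1 - 1) * x) * (-e) = 0 := by
    rw [hτ]; linear_combination e * hn + (-γ) * he2
  have h3 : β * τ + γ = -((2 * ((n : ℝ) - 1) - (β + 1 - 1) * x) * (-e)) := by linarith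
  rw [h1, h3, smul_smul (-e), smul_smul, neg_mul_neg, he2, one_smul]
  have h4 : (x * (2 - x)) • deriv (deriv f) τ + (-((2 * ((n : ℝ) - 1) - (β + 1 - 1) * x) * (-e))) •
      deriv f τ - κ * f τ + κ * f τ + ((2 * ((n : ℝ) - 1) - (β + 1 - 1) * x) * (-e)) • deriv f τ =
      (x * (2 - x)) • deriv (deriv f) τ := by module
  rw [h4, inv_smul_smul₀ hx2]

theorem logAt_of_sing {e : ℝ} (he : e ∈ 𝕊) {n : ℕ} {β γ : ℝ} {κ : A} {f g : ℝ → A}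
    (hn : β + e * γ = 2 * (n - 1)) (hf : ContDiffOn ℝ ∞ f 𝕀)
    (hs : ∀ τ ∈ 𝕀, sing β γ κ f τ = g τ) (hg : LogAt e fun τ => (1 - e * τ) • g τ) :
    LogAt e f := by
  obtain ⟨N, h, hh, hg⟩ := hg
  obtain ⟨F, hF, hf⟩ := exists_logSer_of_sing he hn hf hs hh (by
    have he2 := endpoint_mul_self he
    filter_upwards [hg] with x hx
    rw [← hx]
    congr 1
    linear_combination (1 - x) * he2)
  exact ⟨_, F, hF, hf⟩

end LogAt

section Uniqueness

open Polynomial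

theorem polynomial_eq_zero_of_tendsto_log {P : ℂ[X]}
    (h : Tendsto (fun x : ℝ => P.eval (Real.log x : ℂ)) (𝓝[>] 0) (𝓝 0)) : P = 0 := by
  by_cases hd : 0 < P.degree
  · exfalso
    have h1 : Tendsto (fun x : ℝ => ‖(Real.log x : ℂ)‖) (𝓝[>] 0) atTop := by
      simp only [norm_real, Real.norm_eq_abs]
      exact tendsto_abs_atBot_atTop.comp Real.tendsto_log_nhdsGT_zero
    have h2 := P.tendsto_norm_atTop hd h1
    exact not_tendsto_atTop_of_tendsto_nhds h.norm h2
  · rw [not_lt, ← Polynomial.natDegree_eq_zero_iff_degree_le_zero] at hd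
    rw [Polynomial.eq_C_of_natDegree_eq_zero hd] at h ⊢
    simp only [eval_C] at h
    rw [tendsto_nhds_unique tendsto_const_nhds h, C_0]

theorem IsLogSer.eq_zero_of_lev {M : ℕ} {F : ℕ → ℂ[X]} (hF : IsLogSer M F)
    (h : ∀ᶠ x in 𝓝₊, lev M F x = 0) (i : ℕ) : F i = 0 := by
  have h0 : ∀ {F : ℕ → ℂ[X]}, IsLogSer M F → (∀ᶠ x in 𝓝₊, lev M F x = 0) →
      F 0 = 0 ∧ ∀ᶠ x in 𝓝₊, lev M (fun k => F (k + 1)) x = 0 := by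
    intro F hF h
    have e1 : F 0 = 0 := by
      apply polynomial_eq_zero_of_tendsto_log
      have h1 := ((hF.shift 1).tendsto_mul_log_pow_lev 0).neg
      rw [neg_zero] at h1
      refine h1.congr' ?_
      filter_upwards [h, hF.lev_eq_add] with x hx hx2
      rw [hx] at hx2
      have hd : (F 0).natDegree < M ∨ F 0 = 0 := by
        by_contra! hc
        exact hc.2 (leadingCoeff_eq_zero.mp (hF.deg 0 _ hc.1))
      have h2 : (F 0).eval (Real.log x : ℂ) =
          ∑ j ∈ Finset.range M, Real.log x ^ j • (F 0).coeff j := by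
        rcases hd with hd | hd
        · rw [eval_eq_sum_range' hd]
          refine sum_congr rfl fun j _ => ?_
          rw [real_smul, mul_comm, Complex.ofReal_pow]
        · simp [hd]
      rw [h2, pow_zero, mul_one]
      exact neg_eq_of_add_eq_zero_left hx2.symm
    refine ⟨e1, ?_⟩
    filter_upwards [h, hF.lev_eq_add, eventually_pos] with x hx hx2 hx0
    rw [hx, e1] at hx2
    simpa [hx0.ne'] using hx2.symm
  have key : ∀ i, ∀ᶠ x in 𝓝₊, lev M (fun k => F (k + i)) x = 0 := by
    intro i
    induction i with
    | zero => exact h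
    | succ i ih =>
      have := (h0 (hF.shift i) ih).2
      simpa only [add_assoc, add_comm 1] using this
  simpa using (h0 (hF.shift i) (key i)).1

theorem IsLogSer.congr_of_lev {M M' : ℕ} {F F' : ℕ → ℂ[X]} (hF : IsLogSer M F) (hF' : IsLogSer M' F')
    (h : ∀ᶠ x in 𝓝₊, lev M F x = lev M' F' x) : F = F' := by
  have h1 := hF.mono (le_max_left M M')
  have h2 := hF'.mono (le_max_right M M')
  have h3 := h1.add (h2.smul (-1))
  ext1 i
  have := h3.eq_zero_of_lev (by
    filter_upwards [h, h1.lev_add (h2.smul (-1)), h2.lev_smul (-1)] with x e1 e2 e3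
    rw [e2, e3, hF.lev_mono (le_max_left M M'), hF'.lev_mono (le_max_right M M'), e1]
    simp) i
  rw [neg_one_smul] at this
  exact add_neg_eq_zero.mp this

theorem hasLogExpansion_of_lev {e : ℝ} {M N : ℕ} {f : ℝ → ℂ} {F : ℕ → ℂ[X]} (hF : IsLogSer M F)
    (hMN : M ≤ N + 1) (h : ∀ᶠ x in 𝓝₊, f (e * (1 - x)) = lev M F x) :
    HasLogExpansion f e N fun j => powSer fun i => (F i).coeff j := by
  refine ⟨fun j => (hF.bdd j).analyticAt, ?_⟩
  filter_upwards [h] with x hx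
  rw [hx, ← hF.lev_mono hMN, lev]
  refine sum_congr rfl fun j _ => ?_
  rw [real_smul, mul_comm]

theorem HasLogExpansion.exists_lev {e : ℝ} {N : ℕ} {f : ℝ → ℂ} {a : ℕ → ℝ → ℂ}
    (h : HasLogExpansion f e N a) : ∃ F, IsLogSer (N + 1) F ∧
      (∀ᶠ x in 𝓝₊, f (e * (1 - x)) = lev (N + 1) F x) ∧
      ∀ j ≤ N, ∀ᶠ x in 𝓝 (0 : ℝ), a j x = powSer (fun i => (F i).coeff j) x := by
  choose c hc hac using fun j => exists_powSer_of_analyticAt (h.1 j)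
  have hcoeff : ∀ i j, (∑ k ∈ Finset.range (N + 1), monomial k (c k i)).coeff j =
      if j < N + 1 then c j i else 0 := by
    intro i j
    rw [finsetSum_coeff]
    simp only [coeff_monomial, Finset.sum_ite_eq', Finset.mem_range]
  have hN : ∀ j ≤ N, ∀ᶠ x in 𝓝 (0 : ℝ), a j x = powSer (fun i =>
      (∑ k ∈ Finset.range (N + 1), monomial k (c k i)).coeff j) x := by
    intro j hj
    filter_upwards [hac j] with x hx
    rw [hx]
    simp only [hcoeff, Nat.lt_succ_of_le hj, if_true]
  refine ⟨fun i => ∑ k ∈ Finset.range (N + 1), monomial k (c k i), ⟨fun i j hj => ?_, fun j => ?_⟩,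
    ?_, hN⟩
  · rw [hcoeff, if_neg (by omega)]
  · simp only [hcoeff]
    by_cases hj : j < N + 1
    · simpa [hj] using hc j
    · simpa [hj] using GeomBdd.zero
  · have : ∀ᶠ x in 𝓝 (0 : ℝ), ∀ j ∈ Finset.range (N + 1), a j x = powSer (fun i =>
        (∑ k ∈ Finset.range (N + 1), monomial k (c k i)).coeff j) x :=
      (Filter.eventually_all_finset _).mpr fun j hj =>
        hN j (Nat.lt_succ_iff.mp (Finset.mem_range.mp hj))
    filter_upwards [h.2, eventually_nhdsGT this] with x hx h2
    rw [hx, lev]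
    refine sum_congr rfl fun j hj => ?_
    rw [h2 j hj, real_smul, mul_comm]

theorem HasLogTerm.exists_coeff_ne_zero {e : ℝ} {K M : ℕ} {f : ℝ → ℂ} {F : ℕ → ℂ[X]}
    (h : HasLogTerm f e K) (hF : IsLogSer M F)
    (hf : ∀ᶠ x in 𝓝₊, f (e * (1 - x)) = lev M F x) : ∃ i j, K ≤ j ∧ (F i).coeff j ≠ 0 := by
  obtain ⟨N, a, ha, μ₁, μ₂, hK, hN, hne⟩ := h
  obtain ⟨F', hF', hf', ha'⟩ := ha.exists_lev
  obtain rfl : F = F' := hF.congr_of_lev hF' (by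
    filter_upwards [hf, hf'] with x h1 h2
    rw [← h1, h2])
  by_contra! hc
  refine hne ?_
  have : a μ₂ =ᶠ[𝓝 0] fun _ => 0 := by
    filter_upwards [ha' μ₂ hN] with x hx
    rw [hx]
    have : (fun i => (F i).coeff μ₂) = fun _ => 0 := funext fun i => hc i μ₂ hK
    rw [this, powSer_const_zero]
  rw [(this.iteratedDeriv μ₁).eq_of_nhds]
  simp

theorem hasLogTerm_of_coeff_ne_zero {e : ℝ} {K M : ℕ} {f : ℝ → ℂ} {F : ℕ → ℂ[X]}
    (hF : IsLogSer M F) (hf : ∀ᶠ x in 𝓝₊, f (e * (1 - x)) = lev M F x) {i j : ℕ}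
    (hj : K ≤ j) (hne : (F i).coeff j ≠ 0) : HasLogTerm f e K := by
  refine ⟨max M j, _, hasLogExpansion_of_lev hF ((le_max_left M j).trans (Nat.le_succ _)) hf, ?_⟩
  by_contra! hc
  have h0 : ∀ n, iteratedDeriv n (powSer fun i => (F i).coeff j) 0 = 0 :=
    fun n => hc n j hj (le_max_right _ _)
  have han : AnalyticAt ℝ (powSer fun i => (F i).coeff j) 0 := (hF.bdd j).analyticAt
  have htop : analyticOrderAt (powSer fun i => (F i).coeff j) (0 : ℝ) = ⊤ := by
    refine ENat.eq_top_iff_forall_ge.mpr fun n => ?_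
    exact (natCast_le_analyticOrderAt_iff_iteratedDeriv_eq_zero han).mpr fun i _ => h0 i
  rw [analyticOrderAt_eq_top] at htop
  have hG : IsLogSer 1 (fun i => C ((F i).coeff j)) :=
    ⟨fun i k hk => by rw [coeff_C, if_neg (by omega)], fun k => by
      by_cases hk : k = 0
      · simpa [hk] using hF.bdd j
      · simpa [coeff_C, hk] using GeomBdd.zero⟩
  have := hG.eq_zero_of_lev (by
    filter_upwards [eventually_nhdsGT htop] with x hx
    simpa [lev] using hx) i
  exact hne (by simpa using congrArg (fun P => P.coeff 0) this)

theorem LogAt.exists_hasLogExpansion {e : ℝ} {f : ℝ → ℂ} (hf : LogAt e f) :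
    ∃ N a, HasLogExpansion f e N a := by
  obtain ⟨M, F, hF, h⟩ := hf
  exact ⟨M, _, hasLogExpansion_of_lev hF (Nat.le_succ M) h⟩

theorem HasLogTerm.congr {e : ℝ} (he : e ∈ 𝕊) {K : ℕ} {f g : ℝ → ℂ}
    (h : HasLogTerm f e K) (hfg : EqOn g f 𝕀) : HasLogTerm g e K := by
  obtain ⟨N, a, ⟨ha, hf⟩, hN⟩ := h
  refine ⟨N, a, ⟨ha, ?_⟩, hN⟩
  filter_upwards [hf, Ioo_zero_one_mem_nhdsGT] with x hx hx1
  rw [hfg (mem_Ioo_of_endpoint he hx1), hx]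

end Uniqueness

/-! ### Spin-weighted spherical harmonics -/

section Harmonics

open Polynomial

/-- The group `SU(2)`. -/
abbrev Sph : Type := {p : ℂ × ℂ // ‖p.1‖ ^ 2 + ‖p.2‖ ^ 2 = 1}

/-- The linear factor `z u + w` of the generating polynomial of the harmonics. -/
def pU (z w : ℂ) : ℂ[X] := C z * X + C w

/-- The linear factor `-w̄ u + z̄` of the generating polynomial of the harmonics. -/
def pV (z w : ℂ) : ℂ[X] := C (-conj w) * X + C (conj z)

/-- The unnormalised harmonics. -/
def gH (a b k : ℕ) (z w : ℂ) : ℂ := (pU z w ^ a * pV z w ^ b).coeff k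

/-- The flow on `SU(2)` which defines `flowDeriv`, first component. -/
def flowZ (c z w : ℂ) (t : ℝ) : ℂ :=
  z * (Real.cos (t / 2) : ℂ) - conj w * (c * (Real.sin (t / 2) : ℂ))

/-- The flow on `SU(2)` which defines `flowDeriv`, second component. -/
def flowW (c z w : ℂ) (t : ℝ) : ℂ :=
  w * (Real.cos (t / 2) : ℂ) + conj z * (c * (Real.sin (t / 2) : ℂ))

theorem hasDerivAt_flowZ (c z w : ℂ) : HasDerivAt (flowZ c z w) (-(c / 2) * conj w) 0 ∧
    HasDerivAt (flowW c z w) (c / 2 * conj z) 0 := by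
  have h1 : HasDerivAt (fun t : ℝ => (Real.cos (t / 2) : ℂ)) 0 0 := by
    simpa using ((Real.hasDerivAt_cos (0 / 2)).comp (0 : ℝ)
      ((hasDerivAt_id (0 : ℝ)).div_const 2)).ofReal_comp
  have h2 : HasDerivAt (fun t : ℝ => (Real.sin (t / 2) : ℂ)) (1 / 2) 0 := by
    simpa using ((Real.hasDerivAt_sin (0 / 2)).comp (0 : ℝ)
      ((hasDerivAt_id (0 : ℝ)).div_const 2)).ofReal_comp
  constructor
  · refine ((h1.const_mul z).sub ((h2.const_mul c).const_mul (conj w))).congr_deriv ?_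
    ring
  · refine ((h1.const_mul w).add ((h2.const_mul c).const_mul (conj z))).congr_deriv ?_
    ring

theorem flow_zero (c z w : ℂ) : flowZ c z w 0 = z ∧ flowW c z w 0 = w := by
  simp [flowZ, flowW]

theorem hasDerivAt_conj_comp {f : ℝ → ℂ} {f' : ℂ} {t : ℝ} (h : HasDerivAt f f' t) :
    HasDerivAt (fun t => conj (f t)) (conj f') t := by
  exact Complex.conjCLE.toContinuousLinearMap.hasFDerivAt.comp_hasDerivAt t h

/-- Coefficientwise derivative at `0` of a curve of polynomials. -/
def HasCoeffDeriv (P : ℝ → ℂ[X]) (P' : ℂ[X]) : Prop :=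
  ∀ k, HasDerivAt (fun t => (P t).coeff k) (P'.coeff k) 0

theorem HasCoeffDeriv.mul {P Q : ℝ → ℂ[X]} {P' Q' : ℂ[X]} (hP : HasCoeffDeriv P P')
    (hQ : HasCoeffDeriv Q Q') : HasCoeffDeriv (fun t => P t * Q t) (P' * Q 0 + P 0 * Q') := by
  intro k
  simp only [coeff_mul, coeff_add, ← sum_add_distrib]
  exact HasDerivAt.fun_sum fun x _ => (hP x.1).mul (hQ x.2)

theorem HasCoeffDeriv.pow {P : ℝ → ℂ[X]} {P' : ℂ[X]} (hP : HasCoeffDeriv P P') (n : ℕ) :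
    HasCoeffDeriv (fun t => P t ^ n) ((n : ℂ[X]) * P 0 ^ (n - 1) * P') := by
  induction n with
  | zero => intro k; simpa using hasDerivAt_const (0 : ℝ) ((1 : ℂ[X]).coeff k)
  | succ n ih =>
    have := ih.mul hP
    simp only [← pow_succ] at this
    have e : ((n : ℂ[X]) * P 0 ^ (n - 1) * P') * P 0 + P 0 ^ n * P' =
        ((n + 1 : ℕ) : ℂ[X]) * P 0 ^ (n + 1 - 1) * P' := by
      rcases n with _ | n
      · simp
      · simp only [Nat.add_sub_cancel]
        push_cast
        ring
    rwa [e] at this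

theorem hasCoeffDeriv_pU (c z w : ℂ) :
    HasCoeffDeriv (fun t => pU (flowZ c z w t) (flowW c z w t)) (C (c / 2) * pV z w) ∧
    HasCoeffDeriv (fun t => pV (flowZ c z w t) (flowW c z w t)) (C (-(conj c / 2)) * pU z w) := by
  obtain ⟨h1, h2⟩ := hasDerivAt_flowZ c z w
  have h3 := hasDerivAt_conj_comp h1
  have h4 := (hasDerivAt_conj_comp h2).neg
  have key : ∀ {f g : ℝ → ℂ} {f' g' : ℂ}, HasDerivAt f f' 0 → HasDerivAt g g' 0 →
      HasCoeffDeriv (fun t => C (f t) * X + C (g t)) (C f' * X + C g') := by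
    intro f g f' g' hf hg k
    simp only [coeff_add, coeff_C_mul, coeff_X, coeff_C]
    refine (hf.mul_const _).add ?_
    split_ifs
    · exact hg
    · exact hasDerivAt_const _ _
  constructor
  · have e : C (c / 2) * pV z w = C (-(c / 2) * conj w) * X + C (c / 2 * conj z) := by
      simp only [pV, C_mul, C_neg]; ring
    rw [e]; exact key h1 h2
  · have e : C (-(conj c / 2)) * pU z w =
        C (-conj (c / 2 * conj z)) * X + C (conj (-(c / 2) * conj w)) := by
      simp only [pU, map_mul, map_neg, map_div₀, conj_conj, map_ofNat]
      ring
    rw [e]; exact key h4 h3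

/-- `h` is a function on `SU(2)` with `ð h = e` and `ð̄ h = b`. -/
def HasEth (h e b : ℂ → ℂ → ℂ) : Prop := ∀ c z w : ℂ,
  HasDerivAt (fun t : ℝ => h (flowZ c z w t) (flowW c z w t))
    (-(1 / 2) * (c * b z w + conj c * e z w)) 0

theorem hasEth_gH (a b k : ℕ) : HasEth (gH a b k) (fun z w => b * gH (a + 1) (b - 1) k z w)
    (fun z w => -a * gH (a - 1) (b + 1) k z w) := by
  intro c z w
  obtain ⟨h1, h2⟩ := hasCoeffDeriv_pU c z w
  have h3 := ((h1.pow a).mul (h2.pow b)) k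
  simp only [flow_zero] at h3
  refine h3.congr_deriv ?_
  have : (a : ℂ[X]) * pU z w ^ (a - 1) * (C (c / 2) * pV z w) * pV z w ^ b +
      pU z w ^ a * ((b : ℂ[X]) * pV z w ^ (b - 1) * (C (-(conj c / 2)) * pU z w)) =
      C (c / 2 * a) * (pU z w ^ (a - 1) * pV z w ^ (b + 1)) +
      C (-(conj c / 2) * b) * (pU z w ^ (a + 1) * pV z w ^ (b - 1)) := by
    simp only [C_mul, C_eq_natCast]
    ring
  rw [this]
  simp only [coeff_add, coeff_C_mul, gH]
  ring

theorem HasEth.conj {h e b : ℂ → ℂ → ℂ} (H : HasEth h e b) :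
    HasEth (fun z w => conj (h z w)) (fun z w => conj (b z w)) (fun z w => conj (e z w)) := by
  intro c z w
  refine (hasDerivAt_conj_comp (H c z w)).congr_deriv ?_
  simp only [map_mul, map_add, map_neg, map_div₀, map_one, map_ofNat, conj_conj]
  ring

theorem HasEth.const_mul {h e b : ℂ → ℂ → ℂ} (H : HasEth h e b) (a : ℂ) :
    HasEth (fun z w => a * h z w) (fun z w => a * e z w) (fun z w => a * b z w) := by
  intro c z w
  refine ((H c z w).const_mul a).congr_deriv ?_
  ring

theorem HasEth.sum {ι : Type*} {s : Finset ι} {h e b : ι → ℂ → ℂ → ℂ}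
    (H : ∀ i ∈ s, HasEth (h i) (e i) (b i)) :
    HasEth (fun z w => ∑ i ∈ s, h i z w) (fun z w => ∑ i ∈ s, e i z w)
      (fun z w => ∑ i ∈ s, b i z w) := by
  intro c z w
  refine (HasDerivAt.fun_sum fun i hi => H i hi c z w).congr_deriv ?_
  simp only [← mul_sum, sum_add_distrib]

theorem HasEth.eth_eq {f : Fn} {τ : ℝ} {e b : ℂ → ℂ → ℂ} (H : HasEth (f τ) e b) (z w : ℂ) :
    eth f τ z w = e z w ∧ ethBar f τ z w = b z w := by
  have h1 : flowDeriv 1 f τ z w = _ := (H 1 z w).deriv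
  have h2 : flowDeriv I f τ z w = _ := (H I z w).deriv
  rw [eth, ethBar, h1, h2]
  simp only [map_one, conj_I]
  constructor
  · linear_combination (b z w - e z w) / 2 * Complex.I_mul_I
  · linear_combination (e z w - b z w) / 2 * Complex.I_mul_I

theorem norm_flow (c z w : ℂ) (hc : ‖c‖ = 1) (h : ‖z‖ ^ 2 + ‖w‖ ^ 2 = 1) (t : ℝ) :
    ‖flowZ c z w t‖ ^ 2 + ‖flowW c z w t‖ ^ 2 = 1 := by
  have key : ∀ a : ℂ, ((‖a‖ ^ 2 : ℝ) : ℂ) = a * conj a := fun a => by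
    rw [mul_conj, normSq_eq_norm_sq]
  have hc' : c * conj c = 1 := by rw [← key, hc]; simp
  have h' : z * conj z + w * conj w = 1 := by rw [← key, ← key, ← Complex.ofReal_add, h]; simp
  have ht : (Real.cos (t / 2) : ℂ) ^ 2 + (Real.sin (t / 2) : ℂ) ^ 2 = 1 := by
    rw [← Complex.ofReal_pow, ← Complex.ofReal_pow, ← Complex.ofReal_add, Real.cos_sq_add_sin_sq]
    simp
  apply Complex.ofReal_injective
  rw [Complex.ofReal_add, key, key]
  simp only [flowZ, flowW, map_add, map_sub, map_mul, conj_ofReal, conj_conj,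
    ofReal_one]
  set C := (Real.cos (t / 2) : ℂ)
  set S := (Real.sin (t / 2) : ℂ)
  linear_combination (C ^ 2 + S ^ 2 * c * conj c) * h' + S ^ 2 * hc' + ht

/-- A function that vanishes on `SU(2)` has vanishing `ð` and `ð̄` there. -/
theorem HasEth.eq_zero {h e b : ℂ → ℂ → ℂ} (H : HasEth h e b)
    (h0 : ∀ z w, ‖z‖ ^ 2 + ‖w‖ ^ 2 = 1 → h z w = 0) (z w : ℂ) (hzw : ‖z‖ ^ 2 + ‖w‖ ^ 2 = 1) :
    e z w = 0 := by
  have h1 : ∀ c : ℂ, ‖c‖ = 1 → -(1 / 2) * (c * b z w + conj c * e z w) = 0 := fun c hc => by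
    refine (H c z w).unique ?_
    have : (fun t : ℝ => h (flowZ c z w t) (flowW c z w t)) = fun _ => 0 :=
      funext fun t => h0 _ _ (norm_flow c z w hc hzw t)
    rw [this]; exact hasDerivAt_const _ _
  have a1 := h1 1 (by simp)
  have a2 := h1 I (by simp)
  simp only [map_one, conj_I] at a1 a2
  linear_combination -a1 - I * a2 + (e z w - b z w) / 2 * Complex.I_mul_I

theorem modes_eq_empty {s : ℤ} {n : ℕ} (h : n < s.natAbs) : modes s n = ∅ := by
  rw [modes, Finset.Icc_eq_empty (by omega)]; simp

theorem mem_modes {s : ℤ} {n : ℕ} {k : ℕ × ℤ} :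
    k ∈ modes s n ↔ s.natAbs ≤ k.1 ∧ k.1 ≤ n ∧ |k.2| ≤ (k.1 : ℤ) := by
  simp only [modes, Finset.mem_filter, Finset.mem_product, Finset.mem_Icc, abs_le]
  omega

theorem modes_succ {s : ℤ} {n : ℕ} (h : s.natAbs ≤ n + 1) :
    modes s (n + 1) = modes s n ∪ ({n + 1} ×ˢ Finset.Icc (-((n + 1 : ℕ) : ℤ)) ((n + 1 : ℕ) : ℤ)) := by
  ext ⟨l, m⟩
  simp only [mem_modes, Finset.mem_union, Finset.mem_product, Finset.mem_singleton,
    Finset.mem_Icc, abs_le]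
  omega

theorem disjoint_modes_succ {s : ℤ} {n : ℕ} :
    Disjoint (modes s n) ({n + 1} ×ˢ Finset.Icc (-((n + 1 : ℕ) : ℤ)) ((n + 1 : ℕ) : ℤ)) := by
  rw [Finset.disjoint_left]
  rintro ⟨l, m⟩ h1 h2
  simp only [mem_modes, Finset.mem_product, Finset.mem_singleton] at h1 h2
  omega

theorem card_modes {s : ℤ} {n : ℕ} (h : s.natAbs ≤ n) :
    (modes s n).card = ((n + s).toNat + 1) * ((n - s).toNat + 1) := by
  have key : ∀ n : ℕ, s.natAbs ≤ n + 1 → ((modes s n).card : ℤ) = (n + 1) ^ 2 - s ^ 2 := by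
    intro n
    induction n with
    | zero =>
      intro h
      rcases Nat.lt_or_ge 0 s.natAbs with h1 | h1
      · rw [modes_eq_empty h1, ← Int.natAbs_sq s, show s.natAbs = 1 by omega]; simp
      · obtain rfl : s = 0 := by omega
        rfl
    | succ n ih =>
      intro h
      rcases Nat.lt_or_ge (n + 1) s.natAbs with h1 | h1
      · rw [modes_eq_empty h1, ← Int.natAbs_sq s, show s.natAbs = n + 2 by omega]
        push_cast; simp
        ring
      · rw [modes_succ h1, Finset.card_union_of_disjoint disjoint_modes_succ, Nat.cast_add, ih h1]
        rw [Finset.card_product, Finset.card_singleton, one_mul, Int.card_Icc, Int.toNat_of_nonneg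
          (by omega)]
        push_cast; ring
  have h1 := key n (by omega)
  zify
  rw [h1, Int.toNat_of_nonneg (by omega), Int.toNat_of_nonneg (by omega)]
  ring

end Harmonics

section Independence

open Polynomial

theorem gH_top (N k : ℕ) (r t : ℂ) : gH N 0 k (r * t) r = r ^ N * (N.choose k * t ^ k) := by
  have : pU (r * t) r = C r * (X + 1 : ℂ[X]).comp (C t * X) := by
    simp [pU, C_mul]; ring
  rw [gH, pow_zero, mul_one, this, mul_pow, ← C_pow, coeff_C_mul, ← pow_comp, comp_C_mul_X_coeff,
    coeff_X_add_one_pow]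

theorem coeff_gH_eq_zero {s : ℤ} {n : ℕ} (hs : s.natAbs ≤ n) {c : ℕ × ℤ → ℂ}
    (h : ∀ z w : ℂ, ‖z‖ ^ 2 + ‖w‖ ^ 2 = 1 → ∑ k ∈ modes s n,
      c k * gH (k.1 + s).toNat (k.1 - s).toNat (k.1 + k.2).toNat z w = 0) (m : ℤ) (hm : |m| ≤ n) :
    c (n, m) = 0 := by
  have key : ∀ j : ℕ, ∀ z w : ℂ, ‖z‖ ^ 2 + ‖w‖ ^ 2 = 1 → ∑ k ∈ modes s n,
      (c k * (k.1 - s).toNat.descFactorial j) *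
        gH ((k.1 + s).toNat + j) ((k.1 - s).toNat - j) (k.1 + k.2).toNat z w = 0 := by
    intro j
    induction j with
    | zero => simpa using h
    | succ j ih =>
      have H := HasEth.sum (s := modes s n) fun k _ =>
        (hasEth_gH ((k.1 + s).toNat + j) ((k.1 - s).toNat - j) (k.1 + k.2).toNat).const_mul
          (c k * (k.1 - s).toNat.descFactorial j)
      intro z w hzw
      refine (sum_congr rfl fun k _ => ?_).trans (H.eq_zero ih z w hzw)
      rw [Nat.descFactorial_succ, Nat.cast_mul, Nat.sub_sub, Nat.add_assoc]
      ring
  set j := (n - s).toNat with hj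
  set P : ℂ[X] := ∑ k ∈ modes s n, if k.1 = n then monomial (n + k.2).toNat
    ((c k * j.descFactorial j) * ((2 * n).choose (n + k.2).toNat : ℂ)) else 0 with hP
  have hroot : ∀ t : ℝ, P.eval (t : ℂ) = 0 := by
    intro t
    set r : ℝ := (Real.sqrt (1 + t ^ 2))⁻¹ with hr
    have ht : 0 < 1 + t ^ 2 := by positivity
    have hr0 : r ≠ 0 := inv_ne_zero (Real.sqrt_ne_zero'.mpr ht)
    have hr2 : r ^ 2 * (1 + t ^ 2) = 1 := by
      rw [hr, inv_pow, Real.sq_sqrt ht.le, inv_mul_cancel₀ ht.ne']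
    have h1 := key j (r * t) r (by
      rw [norm_mul, norm_real, norm_real, mul_pow, Real.norm_eq_abs,
        Real.norm_eq_abs, sq_abs, sq_abs]
      linarith)
    have h2 : ((r : ℂ) ^ (2 * n)) * P.eval (t : ℂ) = 0 := by
      rw [← h1, hP, eval_finsetSum, mul_sum]
      refine sum_congr rfl fun k hk => ?_
      rw [mem_modes] at hk
      split_ifs with hkn
      · rw [hkn, ← hj, eval_monomial, show (n + s).toNat + j = 2 * n by omega, Nat.sub_self, gH_top]
        ring
      · rw [Nat.descFactorial_of_lt (by omega)]; simp
    exact (mul_eq_zero.mp h2).resolve_left (pow_ne_zero _ (by exact_mod_cast hr0))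
  have hP0 : P = 0 := by
    refine eq_zero_of_infinite_isRoot P (Set.Infinite.mono ?_
      (Set.infinite_range_of_injective Complex.ofReal_injective))
    rintro _ ⟨t, rfl⟩
    exact hroot t
  have h3 := congrArg (fun p => p.coeff (n + m).toNat) hP0
  simp only [hP, finsetSum_coeff, coeff_zero] at h3
  have hm' := abs_le.mp hm
  rw [Finset.sum_eq_single ((n, m) : ℕ × ℤ)] at h3
  · rw [if_pos rfl, coeff_monomial, if_pos rfl] at h3
    have h4 : ((j.descFactorial j : ℕ) : ℂ) ≠ 0 := by
      rw [Nat.descFactorial_self]; exact_mod_cast j.factorial_ne_zero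
    have h5 : (((2 * n).choose (n + m).toNat : ℕ) : ℂ) ≠ 0 := by
      exact_mod_cast (Nat.choose_pos (by omega)).ne'
    simpa [h4, h5] using h3
  · rintro ⟨l, m'⟩ hk hne
    rw [mem_modes] at hk
    have hk2 := abs_le.mp hk.2.2
    simp only at hk hk2 ⊢
    split_ifs with hl
    · rw [coeff_monomial, if_neg]
      intro h6
      apply hne
      rw [Prod.mk.injEq]
      omega
    · rfl
  · intro hn
    have : ((n, m) : ℕ × ℤ) ∈ modes s n := by
      rw [mem_modes]; exact ⟨hs, le_refl n, hm⟩
    exact absurd this hn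

theorem gH_independent (s : ℤ) (n : ℕ) {c : ℕ × ℤ → ℂ}
    (h : ∀ z w : ℂ, ‖z‖ ^ 2 + ‖w‖ ^ 2 = 1 → ∑ k ∈ modes s n,
      c k * gH (k.1 + s).toNat (k.1 - s).toNat (k.1 + k.2).toNat z w = 0) :
    ∀ k ∈ modes s n, c k = 0 := by
  induction n with
  | zero =>
    rintro ⟨l, m⟩ hk
    have hk' := mem_modes.mp hk
    obtain rfl : l = 0 := by simpa using hk'.2.1
    exact coeff_gH_eq_zero hk'.1 h m hk'.2.2
  | succ n ih =>
    rintro ⟨l, m⟩ hk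
    have hk' := mem_modes.mp hk
    have htop := coeff_gH_eq_zero (hk'.1.trans hk'.2.1) h
    rcases Nat.lt_or_ge l (n + 1) with hl | hl
    · refine ih (fun z w hzw => ?_) _ (mem_modes.mpr ⟨hk'.1, by simp only at hk' ⊢; omega, hk'.2.2⟩)
      rw [← h z w hzw, modes_succ (hk'.1.trans hk'.2.1),
        Finset.sum_union disjoint_modes_succ, left_eq_add]
      refine sum_eq_zero fun k hk => ?_
      obtain ⟨l', m'⟩ := k
      simp only [Finset.mem_product, Finset.mem_singleton, Finset.mem_Icc] at hk
      rw [hk.1, htop m' (abs_le.mpr hk.2), zero_mul]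
    · obtain rfl : l = n + 1 := by simp only at hk'; omega
      exact htop m hk'.2.2

/-- The normalisation of the harmonics. -/
def nrm (s : ℤ) (k : ℕ × ℤ) : ℂ :=
  (Real.sqrt ((2 * (k.1 : ℝ) + 1) / (4 * Real.pi) *
    (((k.1 + k.2).toNat.factorial : ℝ) * ((k.1 - k.2).toNat.factorial : ℝ)) /
    (((k.1 + s).toNat.factorial : ℝ) * ((k.1 - s).toNat.factorial : ℝ))) : ℂ)

theorem sY_eq (s : ℤ) (k : ℕ × ℤ) (z w : ℂ) :
    sY s k.1 k.2 z w = nrm s k * gH (k.1 + s).toNat (k.1 - s).toNat (k.1 + k.2).toNat z w := rfl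

theorem nrm_ne_zero (s : ℤ) (k : ℕ × ℤ) : nrm s k ≠ 0 := by
  rw [nrm, Complex.ofReal_ne_zero, Real.sqrt_ne_zero']
  positivity

/-- The harmonics as functions on `SU(2)`. -/
def Y (s : ℤ) (k : ℕ × ℤ) (o : Sph) : ℂ := sY s k.1 k.2 o.1.1 o.1.2

/-- `ð ₛY`. -/
def ethY (s : ℤ) (k : ℕ × ℤ) (z w : ℂ) : ℂ := nrm s k * ((k.1 - s).toNat *
  gH ((k.1 + s).toNat + 1) ((k.1 - s).toNat - 1) (k.1 + k.2).toNat z w)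

/-- `ð̄ ₛY`. -/
def ethBarY (s : ℤ) (k : ℕ × ℤ) (z w : ℂ) : ℂ := nrm s k * (-(k.1 + s).toNat *
  gH ((k.1 + s).toNat - 1) ((k.1 - s).toNat + 1) (k.1 + k.2).toNat z w)

theorem hasEth_sY (s : ℤ) (k : ℕ × ℤ) : HasEth (sY s k.1 k.2) (ethY s k) (ethBarY s k) :=
  (hasEth_gH _ _ _).const_mul _

theorem exists_hasEth_ethY {s : ℤ} {k : ℕ × ℤ} (hk : s.natAbs ≤ k.1) : ∃ e b e' b',
    HasEth (ethY s k) e b ∧ HasEth (ethBarY s k) e' b' ∧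
    ∀ z w, -(1 / 2) * (e' z w + b z w) = (k.1 * (k.1 + 1) - s ^ 2) * sY s k.1 k.2 z w := by
  refine ⟨_, _, _, _, ((hasEth_gH _ _ _).const_mul _).const_mul _,
    ((hasEth_gH _ _ _).const_mul _).const_mul _, fun z w => ?_⟩
  have ha : (((k.1 + s).toNat : ℕ) : ℂ) = k.1 + s := by
    have : (((k.1 + s).toNat : ℕ) : ℤ) = k.1 + s := Int.toNat_of_nonneg (by omega)
    exact_mod_cast congrArg (Int.cast (R := ℂ)) this
  have hb : (((k.1 - s).toNat : ℕ) : ℂ) = k.1 - s := by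
    have : (((k.1 - s).toNat : ℕ) : ℤ) = k.1 - s := Int.toNat_of_nonneg (by omega)
    exact_mod_cast congrArg (Int.cast (R := ℂ)) this
  rw [sY_eq]
  set a := (k.1 + s).toNat
  set b := (k.1 - s).toNat
  have h1 : (a : ℂ) * gH (a - 1 + 1) b (k.1 + k.2).toNat z w =
      a * gH a b (k.1 + k.2).toNat z w := by
    rcases Nat.eq_zero_or_pos a with h | h
    · simp [h]
    · rw [Nat.sub_add_cancel h]
  have h2 : (b : ℂ) * gH a (b - 1 + 1) (k.1 + k.2).toNat z w =
      b * gH a b (k.1 + k.2).toNat z w := by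
    rcases Nat.eq_zero_or_pos b with h | h
    · simp [h]
    · rw [Nat.sub_add_cancel h]
  have hk2 : (k.1 : ℂ) = (a + b) / 2 := by rw [ha, hb]; ring
  have hs2 : (s : ℂ) = (a - b) / 2 := by rw [ha, hb]; ring
  rw [hk2, hs2]
  simp only [Nat.add_sub_cancel]
  push_cast
  linear_combination (nrm s k * (b + 1) / 2) * h1 + (nrm s k * (a + 1) / 2) * h2

theorem Y_independent {s : ℤ} {n : ℕ} {c : ℕ × ℤ → ℂ}
    (h : ∀ o : Sph, ∑ k ∈ modes s n, c k * Y s k o = 0) : ∀ k ∈ modes s n, c k = 0 := by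
  have := gH_independent s n (c := fun k => c k * nrm s k) (fun z w hzw => by
    rw [← h ⟨(z, w), hzw⟩]
    refine sum_congr rfl fun k _ => ?_
    rw [Y, sY_eq, mul_assoc])
  intro k hk
  exact (mul_eq_zero.mp (this k hk)).resolve_right (nrm_ne_zero s k)

/-- Evaluation functionals on `SU(2)` which extract the coefficient of a harmonic. -/
theorem exists_dual (s : ℤ) (n : ℕ) (k : ℕ × ℤ) : ∃ W : Sph →₀ ℂ, k ∈ modes s n →
    ∀ k' ∈ modes s n, ∑ o ∈ W.support, W o * Y s k' o = if k' = k then 1 else 0 := by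
  classical
  by_cases hk : k ∈ modes s n
  swap
  · exact ⟨0, fun h => absurd h hk⟩
  let ev : Sph → (modes s n → ℂ) := fun o k => Y s k o
  have hspan : Submodule.span ℂ (Set.range ev) = ⊤ := by
    by_contra hne
    obtain ⟨f, hf, hle⟩ := Submodule.exists_le_ker_of_lt_top _ (lt_top_iff_ne_top.mpr hne)
    refine hf (LinearMap.pi_ext' fun k => LinearMap.ext_ring ?_)
    have h0 := Y_independent (s := s) (n := n)
      (c := fun k => if hk : k ∈ modes s n then f (Pi.single ⟨k, hk⟩ 1) else 0) (fun o => ?_) k.1 k.2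
    · simpa using h0
    · have h1 : f (ev o) = 0 := hle (Submodule.subset_span ⟨o, rfl⟩)
      rw [← Finset.univ_sum_single (ev o), map_sum] at h1
      rw [← h1, ← Finset.sum_coe_sort]
      refine sum_congr rfl fun k _ => ?_
      have : Pi.single k (ev o k) = (Y s k o) • (Pi.single k 1 : modes s n → ℂ) := by
        rw [← Pi.single_smul, smul_eq_mul, mul_one]
      rw [this, map_smul, smul_eq_mul, mul_comm]
      simp
  have hmem : Pi.single ⟨k, hk⟩ 1 ∈ Submodule.span ℂ (Set.range ev) := hspan ▸ Submodule.mem_top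
  obtain ⟨W, hW⟩ := Finsupp.mem_span_range_iff_exists_finsupp.mp hmem
  refine ⟨W, fun _ k' hk' => ?_⟩
  have := congrFun hW ⟨k', hk'⟩
  rw [Finsupp.sum, Finset.sum_apply] at this
  simp only [Pi.smul_apply, smul_eq_mul, Pi.single_apply, Subtype.mk.injEq] at this
  exact this

end Independence

section HarmonicSpaces

open Polynomial

/-- Monomials in `z`, `w`, `z̄`, `w̄` on `SU(2)`. -/
def mono (a b c d : ℕ) (o : Sph) : ℂ :=
  o.1.1 ^ a * o.1.2 ^ b * (conj o.1.1 ^ c * conj o.1.2 ^ d)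

/-- Restrictions to `SU(2)` of bihomogeneous polynomials. -/
def Bi (p q : ℕ) : Submodule ℂ (Sph → ℂ) :=
  Submodule.span ℂ (Set.range fun i : Fin (p + 1) × Fin (q + 1) => mono i.1 (p - i.1) i.2 (q - i.2))

theorem mono_mem (a b c d : ℕ) : mono a b c d ∈ Bi (a + b) (c + d) := by
  refine Submodule.subset_span ⟨(⟨a, by omega⟩, ⟨c, by omega⟩), ?_⟩
  simp only [Nat.add_sub_cancel_left]

theorem Bi_mul {p q p' q' : ℕ} {f g : Sph → ℂ} (hf : f ∈ Bi p q) (hg : g ∈ Bi p' q') :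
    f * g ∈ Bi (p + p') (q + q') := by
  have h := Submodule.mul_mem_mul hf hg
  rw [Bi, Bi, Submodule.span_mul_span] at h
  refine Submodule.span_le.mpr ?_ h
  rintro _ ⟨_, ⟨⟨⟨a, ha⟩, ⟨c, hc⟩⟩, rfl⟩, _, ⟨⟨⟨a', ha'⟩, ⟨c', hc'⟩⟩, rfl⟩, rfl⟩
  have := mono_mem (a + a') (p - a + (p' - a')) (c + c') (q - c + (q' - c'))
  rw [show a + a' + (p - a + (p' - a')) = p + p' by omega,
    show c + c' + (q - c + (q' - c')) = q + q' by omega] at this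
  refine (congrArg (· ∈ Bi (p + p') (q + q')) ?_).mp this
  ext o
  simp only [mono, Pi.mul_apply, pow_add]
  ring

theorem one_mem_Bi : (1 : Sph → ℂ) ∈ Bi 0 0 := by
  convert mono_mem 0 0 0 0 using 1
  ext o; simp [mono]

theorem one_mem_Bi_one : (1 : Sph → ℂ) ∈ Bi 1 1 := by
  convert add_mem (mono_mem 1 0 1 0) (mono_mem 0 1 0 1) using 1
  ext o
  have := o.2
  simp only [mono, Pi.add_apply, Pi.one_apply, pow_one, pow_zero, mul_one, one_mul]
  rw [mul_conj, mul_conj, normSq_eq_norm_sq, normSq_eq_norm_sq,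
    ← Complex.ofReal_add, this, ofReal_one]

theorem Bi_le (p q j : ℕ) : Bi p q ≤ Bi (p + j) (q + j) := by
  induction j with
  | zero => exact le_rfl
  | succ j ih =>
    refine ih.trans fun f hf => ?_
    rw [← mul_one f]
    have := Bi_mul hf one_mem_Bi_one
    exact this

theorem Bi_conj {p q : ℕ} {f : Sph → ℂ} (hf : f ∈ Bi p q) : (fun o => conj (f o)) ∈ Bi q p := by
  refine Submodule.span_induction (p := fun f _ => (fun o => conj (f o)) ∈ Bi q p) ?_ ?_ ?_ ?_ hf
  · rintro _ ⟨⟨⟨a, ha⟩, ⟨c, hc⟩⟩, rfl⟩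
    have := mono_mem c (q - c) a (p - a)
    rw [show c + (q - c) = q by omega, show a + (p - a) = p by omega] at this
    convert this using 1
    ext o
    simp only [mono, map_mul, map_pow, conj_conj]
    ring
  · simp only [Pi.zero_apply, map_zero]; exact (Bi q p).zero_mem
  · intro f g _ _ h1 h2
    convert add_mem h1 h2 using 1
    ext o; simp
  · intro c f _ h
    convert (Bi q p).smul_mem (conj c) h using 1
    ext o; simp

/-- Polynomials whose coefficients are bihomogeneous. -/
def CoefIn (p q : ℕ) (P : Sph → ℂ[X]) : Prop := ∀ k, (fun o => (P o).coeff k) ∈ Bi p q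

theorem CoefIn.mul {p q p' q' : ℕ} {P Q : Sph → ℂ[X]} (hP : CoefIn p q P) (hQ : CoefIn p' q' Q) :
    CoefIn (p + p') (q + q') (P * Q) := by
  intro k
  have := Submodule.sum_mem (Bi (p + p') (q + q')) (t := Finset.HasAntidiagonal.antidiagonal k)
    (f := fun x => (fun o => (P o).coeff x.1) * fun o => (Q o).coeff x.2)
    fun x _ => Bi_mul (hP x.1) (hQ x.2)
  refine (congrArg (· ∈ Bi (p + p') (q + q')) ?_).mp this
  ext o
  simp [coeff_mul]

theorem coefIn_one : CoefIn 0 0 1 := by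
  intro k
  refine (congrArg (· ∈ Bi 0 0) ?_).mp ((Bi 0 0).smul_mem ((1 : ℂ[X]).coeff k) one_mem_Bi)
  ext o; simp

theorem CoefIn.pow {p q : ℕ} {P : Sph → ℂ[X]} (hP : CoefIn p q P) (a : ℕ) :
    CoefIn (a * p) (a * q) (P ^ a) := by
  induction a with
  | zero => simpa using coefIn_one
  | succ a ih =>
    rw [pow_succ, Nat.succ_mul, Nat.succ_mul]
    exact ih.mul hP

theorem coefIn_pU : CoefIn 1 0 (fun o => pU o.1.1 o.1.2) := by
  intro k
  refine (congrArg (· ∈ Bi 1 0) ?_).mp (add_mem ((Bi 1 0).smul_mem ((X : ℂ[X]).coeff k)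
    (mono_mem 1 0 0 0)) ((Bi 1 0).smul_mem ((1 : ℂ[X]).coeff k) (mono_mem 0 1 0 0)))
  ext o
  simp only [pU, mono, coeff_add, coeff_C_mul, coeff_C, coeff_one, Pi.add_apply, Pi.smul_apply,
    smul_eq_mul, pow_zero, pow_one, mul_one, one_mul]
  split_ifs <;> ring

theorem coefIn_pV : CoefIn 0 1 (fun o => pV o.1.1 o.1.2) := by
  intro k
  refine (congrArg (· ∈ Bi 0 1) ?_).mp (add_mem ((Bi 0 1).smul_mem (-(X : ℂ[X]).coeff k)
    (mono_mem 0 0 0 1)) ((Bi 0 1).smul_mem ((1 : ℂ[X]).coeff k) (mono_mem 0 0 1 0)))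
  ext o
  simp only [pV, mono, coeff_add, coeff_C_mul, coeff_C, coeff_one, Pi.add_apply, Pi.smul_apply,
    smul_eq_mul, pow_zero, pow_one, mul_one, one_mul]
  split_ifs <;> ring

theorem gH_mem (a b k : ℕ) : (fun o : Sph => gH a b k o.1.1 o.1.2) ∈ Bi a b := by
  have := ((coefIn_pU.pow a).mul (coefIn_pV.pow b)) k
  rwa [mul_one, mul_zero, mul_zero, mul_one, add_zero, zero_add] at this

/-- The span of the harmonics which occur at order `n`. -/
def Hs (s : ℤ) (n : ℕ) : Submodule ℂ (Sph → ℂ) :=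
  Submodule.span ℂ (Set.range fun k : modes s n => Y s k)

theorem Hs_eq {s : ℤ} {n : ℕ} (h : s.natAbs ≤ n) : Hs s n = Bi (n + s).toNat (n - s).toNat := by
  have : FiniteDimensional ℂ (Bi (n + s).toNat (n - s).toNat) :=
    FiniteDimensional.span_of_finite ℂ (Set.finite_range _)
  refine Submodule.eq_of_le_of_finrank_le (Submodule.span_le.mpr ?_) ?_
  · rintro _ ⟨⟨k, hk⟩, rfl⟩
    rw [mem_modes] at hk
    have h1 := gH_mem (k.1 + s).toNat (k.1 - s).toNat (k.1 + k.2).toNat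
    have h2 := Bi_le _ _ (n - k.1) h1
    rw [show (k.1 + s).toNat + (n - k.1) = (n + s).toNat by omega,
      show (k.1 - s).toNat + (n - k.1) = (n - s).toNat by omega] at h2
    exact Submodule.smul_mem _ (nrm s k) h2
  · have hli : LinearIndependent ℂ (fun k : modes s n => Y s k) := by
      rw [Fintype.linearIndependent_iff]
      intro g hg k
      have := Y_independent (s := s) (n := n)
        (c := fun k => if hk : k ∈ modes s n then g ⟨k, hk⟩ else 0) (fun o => ?_) k.1 k.2
      · simpa using this
      · rw [← Finset.sum_coe_sort]
        have := congrFun hg o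
        rw [Finset.sum_apply] at this
        rw [← show (0 : Sph → ℂ) o = 0 from rfl, ← this]
        refine sum_congr rfl fun k _ => ?_
        simp
    rw [Hs, finrank_span_eq_card hli, Fintype.card_coe, card_modes h]
    refine (finrank_range_le_card _).trans ?_
    simp

theorem Hs_eq_bot {s : ℤ} {n : ℕ} (h : n < s.natAbs) : Hs s n = ⊥ := by
  rw [Hs, Submodule.span_eq_bot]
  rintro _ ⟨⟨k, hk⟩, rfl⟩
  simp [modes_eq_empty h] at hk

theorem Hs_mul {s s' : ℤ} {n n' : ℕ} {f g : Sph → ℂ} (hf : f ∈ Hs s n) (hg : g ∈ Hs s' n') :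
    f * g ∈ Hs (s + s') (n + n') := by
  rcases Nat.lt_or_ge n s.natAbs with h | h
  · rw [Hs_eq_bot h, Submodule.mem_bot] at hf
    rw [hf, zero_mul]; exact Submodule.zero_mem _
  rcases Nat.lt_or_ge n' s'.natAbs with h' | h'
  · rw [Hs_eq_bot h', Submodule.mem_bot] at hg
    rw [hg, mul_zero]; exact Submodule.zero_mem _
  rw [Hs_eq h] at hf
  rw [Hs_eq h'] at hg
  rw [Hs_eq (by omega)]
  have := Bi_mul hf hg
  rwa [show (n + s).toNat + (n' + s').toNat = (((n + n' : ℕ) : ℤ) + (s + s')).toNat by omega,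
    show (n - s).toNat + (n' - s').toNat = (((n + n' : ℕ) : ℤ) - (s + s')).toNat by omega] at this

theorem Y_mem_Hs {s : ℤ} {n : ℕ} {k : ℕ × ℤ} (hk : k ∈ modes s n) : Y s k ∈ Hs s n :=
  Submodule.subset_span ⟨⟨k, hk⟩, rfl⟩

theorem ethY_mem_Hs {s : ℤ} {n : ℕ} {k : ℕ × ℤ} (hk : k ∈ modes s n) :
    (fun o : Sph => ethY s k o.1.1 o.1.2) ∈ Hs (s + 1) n := by
  rw [mem_modes] at hk
  rcases Nat.eq_zero_or_pos (k.1 - s).toNat with h | h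
  · simp only [ethY, h, Nat.cast_zero, zero_mul, mul_zero]
    exact Submodule.zero_mem _
  · rw [Hs_eq (by omega)]
    have h2 := Bi_le _ _ (n - k.1)
      (gH_mem ((k.1 + s).toNat + 1) ((k.1 - s).toNat - 1) (k.1 + k.2).toNat)
    rw [show (k.1 + s).toNat + 1 + (n - k.1) = (n + (s + 1)).toNat by omega,
      show (k.1 - s).toNat - 1 + (n - k.1) = (n - (s + 1)).toNat by omega] at h2
    exact Submodule.smul_mem _ (nrm s k) (Submodule.smul_mem _ _ h2)

theorem ethBarY_mem_Hs {s : ℤ} {n : ℕ} {k : ℕ × ℤ} (hk : k ∈ modes s n) :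
    (fun o : Sph => ethBarY s k o.1.1 o.1.2) ∈ Hs (s - 1) n := by
  rw [mem_modes] at hk
  rcases Nat.eq_zero_or_pos (k.1 + s).toNat with h | h
  · simp only [ethBarY, h, Nat.cast_zero, neg_zero, zero_mul, mul_zero]
    exact Submodule.zero_mem _
  · rw [Hs_eq (by omega)]
    have h2 := Bi_le _ _ (n - k.1)
      (gH_mem ((k.1 + s).toNat - 1) ((k.1 - s).toNat + 1) (k.1 + k.2).toNat)
    rw [show (k.1 + s).toNat - 1 + (n - k.1) = (n + (s - 1)).toNat by omega,
      show (k.1 - s).toNat + 1 + (n - k.1) = (n - (s - 1)).toNat by omega] at h2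
    exact Submodule.smul_mem _ (nrm s k) (Submodule.smul_mem _ _ h2)

theorem conj_mem_Hs {s : ℤ} {n : ℕ} {f : Sph → ℂ} (hf : f ∈ Hs s n) :
    (fun o => conj (f o)) ∈ Hs (-s) n := by
  rcases Nat.lt_or_ge n s.natAbs with h | h
  · rw [Hs_eq_bot h, Submodule.mem_bot] at hf
    subst hf
    simp only [Pi.zero_apply, map_zero]; exact (Hs (-s) n).zero_mem
  · rw [Hs_eq h] at hf
    rw [Hs_eq (by omega)]
    have := Bi_conj hf
    rwa [show (n - s).toNat = (n + -s).toNat by omega,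
      show (n + s).toNat = (n - -s).toNat by omega] at this

variable {A : Type*} [NormedCommRing A] [NormedAlgebra ℂ A]

/-- `A`-valued combinations of the harmonics of spin weight `s` which occur at order `n`. -/
def HarmA (s : ℤ) (n : ℕ) (g : Sph → A) : Prop :=
  ∃ v : ℕ × ℤ → A, ∀ o, g o = ∑ k ∈ modes s n, Y s k o • v k

theorem harmA_zero (s : ℤ) (n : ℕ) : HarmA s n fun _ => (0 : A) := ⟨0, by simp⟩

theorem HarmA.add {s : ℤ} {n : ℕ} {g h : Sph → A} (hg : HarmA s n g) (hh : HarmA s n h) :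
    HarmA s n fun o => g o + h o := by
  obtain ⟨v, hv⟩ := hg
  obtain ⟨v', hv'⟩ := hh
  exact ⟨v + v', fun o => by simp [hv, hv', sum_add_distrib]⟩

theorem HarmA.smul {s : ℤ} {n : ℕ} {g : Sph → A} (hg : HarmA s n g) (c : ℂ) :
    HarmA s n fun o => c • g o := by
  obtain ⟨v, hv⟩ := hg
  exact ⟨c • v, fun o => by simp [hv, smul_sum, smul_comm c]⟩

theorem harmA_sum {ι : Type*} {s : ℤ} {n : ℕ} (t : Finset ι) {g : ι → Sph → A}
    (h : ∀ i ∈ t, HarmA s n (g i)) : HarmA s n fun o => ∑ i ∈ t, g i o := by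
  classical
  induction t using Finset.induction_on with
  | empty => simpa using harmA_zero s n
  | insert i t hi ih =>
    simp only [Finset.sum_insert hi]
    exact (h i (by simp)).add (ih fun j hj => h j (by simp [hj]))

theorem harmA_of_mem {s : ℤ} {n : ℕ} {f : Sph → ℂ} (hf : f ∈ Hs s n) (a : A) :
    HarmA s n fun o => f o • a := by
  obtain ⟨c, rfl⟩ := (Submodule.mem_span_range_iff_exists_fun ℂ).mp hf
  refine ⟨fun k => if hk : k ∈ modes s n then c ⟨k, hk⟩ • a else 0, fun o => ?_⟩
  refine Eq.trans ?_ (Finset.sum_coe_sort (modes s n) _)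
  dsimp only
  rw [Finset.sum_apply, Finset.sum_smul]
  refine sum_congr rfl fun k _ => ?_
  simp [smul_smul, mul_comm]

theorem HarmA.mul {s s' : ℤ} {n n' : ℕ} {g h : Sph → A} (hg : HarmA s n g) (hh : HarmA s' n' h) :
    HarmA (s + s') (n + n') fun o => g o * h o := by
  obtain ⟨v, hv⟩ := hg
  obtain ⟨v', hv'⟩ := hh
  simp only [hv, hv', Finset.sum_mul_sum, smul_mul_smul_comm]
  exact harmA_sum _ fun k hk => harmA_sum _ fun k' hk' =>
    harmA_of_mem (Hs_mul (Y_mem_Hs hk) (Y_mem_Hs hk')) _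

/-- The functional of `exists_dual`. -/
def dual (s : ℤ) (n : ℕ) (k : ℕ × ℤ) : Sph →₀ ℂ := (exists_dual s n k).choose

/-- The coefficient of a harmonic in an `A`-valued function. -/
def modeCoeff (s : ℤ) (n : ℕ) (k : ℕ × ℤ) (g : Sph → A) : A :=
  ∑ o ∈ (dual s n k).support, dual s n k o • g o

theorem modeCoeff_expansion {s : ℤ} {n : ℕ} {k : ℕ × ℤ} (hk : k ∈ modes s n) (v : ℕ × ℤ → A) :
    modeCoeff s n k (fun o => ∑ k' ∈ modes s n, Y s k' o • v k') = v k := by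
  simp only [modeCoeff, smul_sum, smul_smul]
  rw [Finset.sum_comm]
  simp only [← Finset.sum_smul]
  rw [sum_congr rfl fun k' hk' => by rw [dual, (exists_dual s n k).choose_spec hk k' hk']]
  simp [hk]

theorem HarmA.eq_sum_modeCoeff {s : ℤ} {n : ℕ} {g : Sph → A} (hg : HarmA s n g) (o : Sph) :
    g o = ∑ k ∈ modes s n, Y s k o • modeCoeff s n k g := by
  obtain ⟨v, hv⟩ := hg
  obtain rfl : g = _ := funext hv
  exact sum_congr rfl fun k hk => by rw [modeCoeff_expansion hk]

theorem expansion_injective {s : ℤ} {n : ℕ} {v v' : ℕ × ℤ → A}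
    (h : ∀ o, ∑ k ∈ modes s n, Y s k o • v k = ∑ k ∈ modes s n, Y s k o • v' k) :
    ∀ k ∈ modes s n, v k = v' k := fun k hk => by
  rw [← modeCoeff_expansion hk v, ← modeCoeff_expansion hk v', funext h]

end HarmonicSpaces

/-! ### The source terms of the system -/

section Source

open PowerSeries (coeff coeff_smul)

/-- The values at a point of the cylinder of the fields and of those of their derivatives which occur
in the source terms, as power series in `ρ`. -/
structure Vals (A : Type*) where
  φ : PowerSeries A
  φt : PowerSeries A
  eφ : PowerSeries A
  bφ : PowerSeries A
  χ : PowerSeries A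
  χt : PowerSeries A
  eχ : PowerSeries A
  bχ : PowerSeries A
  p : PowerSeries A
  m : PowerSeries A
  a0 : PowerSeries A
  a2 : PowerSeries A

/-- The value of a component. -/
def Vals.comp {A : Type*} (V : Vals A) : Component → PowerSeries A
  | .phi => V.φ
  | .alphaPlus => V.p
  | .alphaMinus => V.m
  | .alpha0 => V.a0
  | .alpha2 => V.a2

variable {A : Type*} [NormedCommRing A] [NormedAlgebra ℂ A]

/-- The operator `ρ ∂_ρ`. -/
def xD (F : PowerSeries A) : PowerSeries A := PowerSeries.X * PowerSeries.derivative A F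

theorem coeff_xD (F : PowerSeries A) (n : ℕ) : coeff n (xD F) = (n : ℂ) • coeff n F := by
  rcases n with _ | n
  · simp [xD]
  · rw [xD, PowerSeries.coeff_succ_X_mul, PowerSeries.coeff_derivative, mul_comm, Nat.cast_smul_eq_nsmul,
      nsmul_eq_mul]
    push_cast; rfl

/-- The coupling constant. -/
def coup (q : ℝ) : ℂ := I * Real.sqrt 2 * q

theorem ofReal_sqrt_two_sq : ((Real.sqrt 2 : ℝ) : ℂ) ^ 2 = 2 := by
  rw [← Complex.ofReal_pow, Real.sq_sqrt (by norm_num)]; norm_num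

/-- The part of the source terms which is quadratic in the derivatives of the scalar field. -/
def current (q τ : ℝ) (V : Vals A) : Component → PowerSeries A
  | .phi => coup q • ((1 / 2 : ℂ) • (V.p * (((1 - τ : ℝ) : ℂ) • V.φt + xD V.φ))
      + (1 / 2 : ℂ) • (V.m * (((1 + τ : ℝ) : ℂ) • V.φt + (-1 : ℂ) • xD V.φ))
      + V.a0 * V.bφ + (-1 : ℂ) • (V.a2 * V.eφ))
  | .alphaPlus => coup q • (((1 + τ : ℝ) : ℂ) • (V.χ * V.φt + (-1 : ℂ) • (V.φ * V.χt))
      + (V.φ * xD V.χ + (-1 : ℂ) • (V.χ * xD V.φ)))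
  | .alphaMinus => coup q • (((1 - τ : ℝ) : ℂ) • (V.χ * V.φt + (-1 : ℂ) • (V.φ * V.χt))
      + (-1 : ℂ) • (V.φ * xD V.χ + (-1 : ℂ) • (V.χ * xD V.φ)))
  | .alpha0 => (coup q / 2) • (V.φ * V.eχ + (-1 : ℂ) • (V.χ * V.eφ))
  | .alpha2 => (coup q / 2) • (V.χ * V.bφ + (-1 : ℂ) • (V.φ * V.bχ))

/-- The cubic part of the source terms. -/
def cubic (q : ℝ) (V : Vals A) : Component → PowerSeries A
  | .phi => (q ^ 2 : ℂ) • (V.φ * ((1 / 2 : ℂ) • (V.p * V.m) + (2 : ℂ) • (V.a0 * V.a2)))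
  | c => (2 * q ^ 2 : ℂ) • (V.comp c * (V.φ * V.χ))

/-- The source terms of the system. -/
def src (q τ : ℝ) (V : Vals A) (c : Component) : PowerSeries A := cubic q V c + current q τ V c

/-- Equality of the coefficients of order less than `n`. -/
def Cong (n : ℕ) (F F' : PowerSeries A) : Prop := ∀ m < n, coeff m F = coeff m F'

theorem cong_iff {n : ℕ} {F F' : PowerSeries A} : Cong n F F' ↔ PowerSeries.X ^ n ∣ F - F' := by
  rw [PowerSeries.X_pow_dvd_iff]
  simp only [Cong, map_sub, sub_eq_zero]

theorem Cong.add {n : ℕ} {F F' G G' : PowerSeries A} (h : Cong n F F') (h' : Cong n G G') :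
    Cong n (F + G) (F' + G') := fun m hm => by rw [map_add, map_add, h m hm, h' m hm]

theorem Cong.smul {n : ℕ} {F F' : PowerSeries A} (h : Cong n F F') (c : ℂ) :
    Cong n (c • F) (c • F') := fun m hm => by
  rw [coeff_smul, coeff_smul, h m hm]

theorem Cong.xD {n : ℕ} {F F' : PowerSeries A} (h : Cong n F F') : Cong n (xD F) (xD F') :=
  fun m hm => by rw [coeff_xD, coeff_xD, h m hm]

theorem Cong.mul {n : ℕ} {F F' G G' : PowerSeries A} (h : Cong n F F') (h' : Cong n G G') :
    Cong n (F * G) (F' * G') := by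
  rw [cong_iff] at *
  rw [show F * G - F' * G' = F * (G - G') + (F - F') * G' by ring]
  exact dvd_add (dvd_mul_of_dvd_right h' _) (dvd_mul_of_dvd_left h _)

theorem X_dvd_of_coeff {F : PowerSeries A} (h : coeff 0 F = 0) : PowerSeries.X ∣ F := by
  rw [PowerSeries.X_dvd_iff, ← PowerSeries.coeff_zero_eq_constantCoeff_apply, h]

/-- A product whose second factor vanishes at order zero. -/
theorem Cong.mul_succ {n : ℕ} {F F' G G' : PowerSeries A} (h : Cong n F F')
    (h' : Cong (n + 1) G G') (hG : coeff 0 G = 0) : Cong (n + 1) (F * G) (F' * G') := by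
  have hG' := X_dvd_of_coeff ((h' 0 (by omega)).symm.trans hG)
  rw [cong_iff] at *
  rw [show F * G - F' * G' = F * (G - G') + (F - F') * G' by ring]
  refine dvd_add (dvd_mul_of_dvd_right h' _) ?_
  rw [pow_succ]
  exact mul_dvd_mul h hG'

/-- A product both factors of which vanish at order zero. -/
theorem Cong.mul_of_zero {n : ℕ} {F F' G G' : PowerSeries A} (hn : n ≠ 0) (h : Cong n F F')
    (h' : Cong n G G') (hF : coeff 0 F = 0) (hG : coeff 0 G = 0) :
    Cong (n + 1) (F * G) (F' * G') := by
  have hG' := X_dvd_of_coeff ((h' 0 (by omega)).symm.trans hG)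
  have hF' := X_dvd_of_coeff hF
  rw [cong_iff] at *
  rw [show F * G - F' * G' = (G - G') * F + (F - F') * G' by ring, pow_succ]
  exact dvd_add (mul_dvd_mul h' hF') (mul_dvd_mul h hG')

theorem coeff_zero_mul (F G : PowerSeries A) : coeff 0 (F * G) = coeff 0 F * coeff 0 G := by
  simp [PowerSeries.coeff_mul]

theorem coeff_mul_of_cong {n : ℕ} {F F' : PowerSeries A} (h : Cong n F F') (G : PowerSeries A) :
    coeff n (F * G) = coeff n (F' * G) + (coeff n F - coeff n F') * coeff 0 G := by
  obtain ⟨D, hD⟩ := cong_iff.mp h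
  rw [show F * G = F' * G + PowerSeries.X ^ n * (D * G) by linear_combination G * hD, map_add,
    ← map_sub, hD, PowerSeries.coeff_X_pow_mul', PowerSeries.coeff_X_pow_mul', if_pos le_rfl,
    if_pos le_rfl, Nat.sub_self, coeff_zero_mul]

/-- Agreement of the scalar field to order less than `n`. -/
structure AgreePhi (n : ℕ) (V V' : Vals A) : Prop where
  φ : Cong n V.φ V'.φ
  φt : Cong n V.φt V'.φt
  eφ : Cong n V.eφ V'.eφ
  bφ : Cong n V.bφ V'.bφ
  χ : Cong n V.χ V'.χ
  χt : Cong n V.χt V'.χt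
  eχ : Cong n V.eχ V'.eχ
  bχ : Cong n V.bχ V'.bχ

/-- The fields are constant at order zero, and the potential vanishes there. -/
structure Vals.Static (V : Vals A) : Prop where
  φt : coeff 0 V.φt = 0
  eφ : coeff 0 V.eφ = 0
  bφ : coeff 0 V.bφ = 0
  p : coeff 0 V.p = 0
  m : coeff 0 V.m = 0
  a0 : coeff 0 V.a0 = 0
  a2 : coeff 0 V.a2 = 0

theorem coeff_zero_xD (F : PowerSeries A) : coeff 0 (xD F) = 0 := by simp [coeff_xD]

theorem coeff_src_phi_congr {q τ : ℝ} {n : ℕ} (hn : n ≠ 0) {V V' : Vals A} (h : AgreePhi n V V')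
    (hc : ∀ c, Cong n (V.comp c) (V'.comp c)) (h0 : V.Static) :
    coeff n (src q τ V .phi) = coeff n (src q τ V' .phi) := by
  have hp : Cong n V.p V'.p := hc .alphaPlus
  have hm : Cong n V.m V'.m := hc .alphaMinus
  have ha0 : Cong n V.a0 V'.a0 := hc .alpha0
  have ha2 : Cong n V.a2 V'.a2 := hc .alpha2
  refine Cong.add (n := n + 1) ?_ ?_ n (Nat.lt_succ_self n)
  · refine Cong.smul (h.φ.mul_succ (((hp.mul_of_zero hn hm h0.p h0.m).smul _).add
      ((ha0.mul_of_zero hn ha2 h0.a0 h0.a2).smul _)) ?_) _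
    simp only [map_add, coeff_smul, coeff_zero_mul, h0.p, h0.a0, zero_mul, smul_zero,
      add_zero]
  · refine Cong.smul (Cong.add (Cong.add (Cong.add (Cong.smul ?_ _) (Cong.smul ?_ _)) ?_)
      (Cong.smul ?_ _)) _
    · refine hp.mul_of_zero hn ((h.φt.smul _).add h.φ.xD) h0.p ?_
      simp only [map_add, coeff_smul, h0.φt, coeff_zero_xD, smul_zero, add_zero]
    · refine hm.mul_of_zero hn ((h.φt.smul _).add (h.φ.xD.smul _)) h0.m ?_
      simp only [map_add, coeff_smul, h0.φt, coeff_zero_xD, smul_zero, add_zero]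
    · exact ha0.mul_of_zero hn h.bφ h0.a0 h0.bφ
    · exact ha2.mul_of_zero hn h.eφ h0.a2 h0.eφ

theorem coeff_src_congr {q τ : ℝ} {n : ℕ} {V V' : Vals A} (h : AgreePhi (n + 1) V V')
    {c : Component} (hc : c ≠ .phi) (h' : Cong n (V.comp c) (V'.comp c)) :
    coeff n (src q τ V c) = coeff n (src q τ V' c) + (2 * q ^ 2 : ℂ) •
      ((coeff n (V.comp c) - coeff n (V'.comp c)) * (coeff 0 V.φ * coeff 0 V.χ)) := by
  have h1 : coeff n (current q τ V c) = coeff n (current q τ V' c) := by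
    refine (?_ : Cong (n + 1) _ _) n (Nat.lt_succ_self n)
    cases c with
    | phi => exact absurd rfl hc
    | alphaPlus => exact ((((h.χ.mul h.φt).add ((h.φ.mul h.χt).smul _)).smul _).add
        ((h.φ.mul h.χ.xD).add ((h.χ.mul h.φ.xD).smul _))).smul _
    | alphaMinus => exact ((((h.χ.mul h.φt).add ((h.φ.mul h.χt).smul _)).smul _).add
        (((h.φ.mul h.χ.xD).add ((h.χ.mul h.φ.xD).smul _)).smul _)).smul _
    | alpha0 => exact ((h.φ.mul h.eχ).add ((h.χ.mul h.eφ).smul _)).smul _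
    | alpha2 => exact ((h.χ.mul h.bφ).add ((h.φ.mul h.bχ).smul _)).smul _
  have h2 : coeff n (V.comp c * (V.φ * V.χ)) = coeff n (V'.comp c * (V'.φ * V'.χ)) +
      (coeff n (V.comp c) - coeff n (V'.comp c)) * (coeff 0 V.φ * coeff 0 V.χ) := by
    rw [coeff_mul_of_cong h', coeff_zero_mul]
    congr 1
    have : Cong (n + 1) (V'.comp c * (V.φ * V.χ)) (V'.comp c * (V'.φ * V'.χ)) :=
      Cong.mul (fun _ _ => rfl) (h.φ.mul h.χ)
    exact this n (Nat.lt_succ_self n)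
  have h3 : ∀ V : Vals A, coeff n (cubic q V c) =
      (2 * q ^ 2 : ℂ) • coeff n (V.comp c * (V.φ * V.χ)) := by
    intro V
    cases c with
    | phi => exact absurd rfl hc
    | _ => rfl
  rw [src, src, map_add, map_add, h1, h3, h3, h2, smul_add]
  abel

/-! #### Harmonic content of the source terms -/

/-- Series of functions on `SU(2)` with spin weight `s`. -/
def SHarm (s : ℤ) (F : Sph → PowerSeries A) : Prop := ∀ n, HarmA s n fun o => coeff n (F o)

theorem SHarm.add {s : ℤ} {F G : Sph → PowerSeries A} (hF : SHarm s F) (hG : SHarm s G) :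
    SHarm s fun o => F o + G o := fun n => by simpa only [map_add] using (hF n).add (hG n)

theorem SHarm.smul {s : ℤ} {F : Sph → PowerSeries A} (hF : SHarm s F) (c : ℂ) :
    SHarm s fun o => c • F o := fun n => by
  simpa only [coeff_smul] using (hF n).smul c

theorem SHarm.xD {s : ℤ} {F : Sph → PowerSeries A} (hF : SHarm s F) :
    SHarm s fun o => xD (F o) := fun n => by
  simpa only [coeff_xD] using (hF n).smul n

theorem SHarm.mul {s s' t : ℤ} {F G : Sph → PowerSeries A} (hF : SHarm s F) (hG : SHarm s' G)
    (ht : s + s' = t) : SHarm t fun o => F o * G o := fun n => by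
  subst ht
  simp only [PowerSeries.coeff_mul]
  refine harmA_sum _ fun x hx => ?_
  rw [← Finset.HasAntidiagonal.mem_antidiagonal.mp hx]
  exact (hF x.1).mul (hG x.2)

/-- Values all whose constituents have the appropriate spin weight. -/
structure VHarm (V : Sph → Vals A) : Prop where
  φ : SHarm 0 fun o => (V o).φ
  φt : SHarm 0 fun o => (V o).φt
  eφ : SHarm 1 fun o => (V o).eφ
  bφ : SHarm (-1) fun o => (V o).bφ
  χ : SHarm 0 fun o => (V o).χ
  χt : SHarm 0 fun o => (V o).χt
  eχ : SHarm 1 fun o => (V o).eχ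
  bχ : SHarm (-1) fun o => (V o).bχ
  p : SHarm 0 fun o => (V o).p
  m : SHarm 0 fun o => (V o).m
  a0 : SHarm 1 fun o => (V o).a0
  a2 : SHarm (-1) fun o => (V o).a2

theorem VHarm.src {V : Sph → Vals A} (h : VHarm V) (q τ : ℝ) (c : Component) :
    SHarm c.weight fun o => src q τ (V o) c := by
  refine SHarm.add ?_ ?_
  · have h1 := h.φ.mul h.χ (t := 0) rfl
    cases c with
    | phi => exact (h.φ.mul (((h.p.mul h.m (t := 0) rfl).smul _).add
        ((h.a0.mul h.a2 (t := 0) rfl).smul _)) rfl).smul _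
    | alphaPlus => exact (h.p.mul h1 rfl).smul _
    | alphaMinus => exact (h.m.mul h1 rfl).smul _
    | alpha0 => exact (h.a0.mul h1 rfl).smul _
    | alpha2 => exact (h.a2.mul h1 rfl).smul _
  · have h1 := (h.χ.mul h.φt (t := 0) rfl).add ((h.φ.mul h.χt (t := 0) rfl).smul (-1))
    have h2 := (h.φ.mul h.χ.xD (t := 0) rfl).add ((h.χ.mul h.φ.xD (t := 0) rfl).smul (-1))
    cases c with
    | phi => exact (((((h.p.mul ((h.φt.smul _).add h.φ.xD) (t := 0) rfl).smul _).add
        ((h.m.mul ((h.φt.smul _).add (h.φ.xD.smul _)) (t := 0) rfl).smul _)).add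
        (h.a0.mul h.bφ (t := 0) rfl)).add ((h.a2.mul h.eφ (t := 0) rfl).smul _)).smul _
    | alphaPlus => exact ((h1.smul _).add h2).smul _
    | alphaMinus => exact ((h1.smul _).add (h2.smul _)).smul _
    | alpha0 => exact ((h.φ.mul h.eχ (t := 1) rfl).add
        ((h.χ.mul h.eφ (t := 1) rfl).smul _)).smul _
    | alpha2 => exact ((h.χ.mul h.bφ (t := -1) rfl).add
        ((h.φ.mul h.bχ (t := -1) rfl).smul _)).smul _

/-! #### Regularity of the source terms -/

/-- A class `P` of functions of `τ` which is closed under the operations in the source terms, and a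
class `P₁` of functions which contains the sources. -/
structure SrcClass (P P₁ : (ℝ → A) → Prop) : Prop where
  zero : P fun _ => 0
  add : ∀ f g, P f → P g → P fun τ => f τ + g τ
  mul : ∀ f g, P f → P g → P fun τ => f τ * g τ
  smul : ∀ (c : ℂ) f, P f → P fun τ => c • f τ
  le : ∀ f, P f → P₁ f
  add₁ : ∀ f g, P₁ f → P₁ g → P₁ fun τ => f τ + g τ
  mul₁ : ∀ f g, P f → P₁ g → P₁ fun τ => f τ * g τ
  smul₁ : ∀ (c : ℂ) f, P₁ f → P₁ fun τ => c • f τ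
  lin₁ : ∀ (a b : ℝ) f, P₁ f → P₁ fun τ => ((a + b * τ : ℝ) : ℂ) • f τ

/-- All coefficients of a series of functions of `τ` belong to a class. -/
def SerP (P : (ℝ → A) → Prop) (F : ℝ → PowerSeries A) : Prop := ∀ n, P fun τ => coeff n (F τ)

variable {P P₁ : (ℝ → A) → Prop}

theorem SrcClass.sum (h : SrcClass P P₁) {ι : Type*} (t : Finset ι) {g : ι → ℝ → A}
    (hg : ∀ i ∈ t, P (g i)) : P fun τ => ∑ i ∈ t, g i τ := by
  classical
  induction t using Finset.induction_on with
  | empty => simpa using h.zero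
  | insert i t hi ih =>
    simp only [Finset.sum_insert hi]
    exact h.add _ _ (hg i (by simp)) (ih fun j hj => hg j (by simp [hj]))

theorem SrcClass.sum₁ (h : SrcClass P P₁) {ι : Type*} (t : Finset ι) {g : ι → ℝ → A}
    (hg : ∀ i ∈ t, P₁ (g i)) : P₁ fun τ => ∑ i ∈ t, g i τ := by
  classical
  induction t using Finset.induction_on with
  | empty => simpa using h.le _ h.zero
  | insert i t hi ih =>
    simp only [Finset.sum_insert hi]
    exact h.add₁ _ _ (hg i (by simp)) (ih fun j hj => hg j (by simp [hj]))

theorem SrcClass.ser_add₁ (h : SrcClass P P₁) {F G : ℝ → PowerSeries A} (hF : SerP P₁ F)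
    (hG : SerP P₁ G) : SerP P₁ fun τ => F τ + G τ := fun n => by
  simpa only [map_add] using h.add₁ _ _ (hF n) (hG n)

theorem SrcClass.ser_smul (h : SrcClass P P₁) {F : ℝ → PowerSeries A} (hF : SerP P F) (c : ℂ) :
    SerP P fun τ => c • F τ := fun n => by
  simpa only [coeff_smul] using h.smul c _ (hF n)

theorem SrcClass.ser_smul₁ (h : SrcClass P P₁) {F : ℝ → PowerSeries A} (hF : SerP P₁ F) (c : ℂ) :
    SerP P₁ fun τ => c • F τ := fun n => by
  simpa only [coeff_smul] using h.smul₁ c _ (hF n)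

theorem SrcClass.ser_lin₁ (h : SrcClass P P₁) {F : ℝ → PowerSeries A} (hF : SerP P₁ F) (a b : ℝ) :
    SerP P₁ fun τ => ((a + b * τ : ℝ) : ℂ) • F τ := fun n => by
  simpa only [coeff_smul] using h.lin₁ a b _ (hF n)

theorem SrcClass.ser_mul (h : SrcClass P P₁) {F G : ℝ → PowerSeries A} (hF : SerP P F)
    (hG : SerP P G) : SerP P fun τ => F τ * G τ := fun n => by
  simp only [PowerSeries.coeff_mul]
  exact h.sum _ fun x _ => h.mul _ _ (hF _) (hG _)

theorem SrcClass.ser_mul₁ (h : SrcClass P P₁) {F G : ℝ → PowerSeries A} (hF : SerP P F)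
    (hG : SerP P₁ G) : SerP P₁ fun τ => F τ * G τ := fun n => by
  simp only [PowerSeries.coeff_mul]
  exact h.sum₁ _ fun x _ => h.mul₁ _ _ (hF _) (hG _)

theorem SrcClass.ser_xD (h : SrcClass P P₁) {F : ℝ → PowerSeries A} (hF : SerP P F) :
    SerP P fun τ => xD (F τ) := fun n => by
  simpa only [coeff_xD] using h.smul n _ (hF n)

/-- Values all whose constituents have the appropriate regularity. -/
structure VReg (P P₁ : (ℝ → A) → Prop) (V : ℝ → Vals A) : Prop where
  φ : SerP P fun o => (V o).φ
  φt : SerP P₁ fun o => (V o).φt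
  eφ : SerP P fun o => (V o).eφ
  bφ : SerP P fun o => (V o).bφ
  χ : SerP P fun o => (V o).χ
  χt : SerP P₁ fun o => (V o).χt
  eχ : SerP P fun o => (V o).eχ
  bχ : SerP P fun o => (V o).bχ
  p : SerP P fun o => (V o).p
  m : SerP P fun o => (V o).m
  a0 : SerP P fun o => (V o).a0
  a2 : SerP P fun o => (V o).a2

theorem VReg.src {V : ℝ → Vals A} (h : VReg P P₁ V) (H : SrcClass P P₁) (q : ℝ) (c : Component) :
    SerP P₁ fun τ => src q τ (V τ) c := by
  have le : ∀ {F : ℝ → PowerSeries A}, SerP P F → SerP P₁ F := fun hF n => H.le _ (hF n)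
  have cub : ∀ F : ℝ → PowerSeries A, SerP P F →
      SerP P₁ fun τ => (2 * q ^ 2 : ℂ) • (F τ * ((V τ).φ * (V τ).χ)) := fun F hF =>
    le (H.ser_smul (H.ser_mul hF (H.ser_mul h.φ h.χ)) _)
  have l1 : ∀ {F : ℝ → PowerSeries A}, SerP P₁ F → SerP P₁ fun τ => ((1 + τ : ℝ) : ℂ) • F τ :=
    fun hF => by simpa only [one_mul] using H.ser_lin₁ hF 1 1
  have l2 : ∀ {F : ℝ → PowerSeries A}, SerP P₁ F → SerP P₁ fun τ => ((1 - τ : ℝ) : ℂ) • F τ :=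
    fun hF => by simpa only [neg_one_mul, ← sub_eq_add_neg] using H.ser_lin₁ hF 1 (-1)
  have hx := H.ser_xD h.φ
  have hy := H.ser_xD h.χ
  refine H.ser_add₁ ?_ ?_
  · cases c with
    | phi => exact le (H.ser_smul (H.ser_mul h.φ (fun n => by
        simpa only [map_add] using H.add _ _ (H.ser_smul (H.ser_mul h.p h.m) (1 / 2) n)
          (H.ser_smul (H.ser_mul h.a0 h.a2) 2 n))) _)
    | alphaPlus => exact cub _ h.p
    | alphaMinus => exact cub _ h.m
    | alpha0 => exact cub _ h.a0
    | alpha2 => exact cub _ h.a2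
  · have h1 := H.ser_add₁ (H.ser_mul₁ h.χ h.φt) (H.ser_smul₁ (H.ser_mul₁ h.φ h.χt) (-1))
    have h2 := H.ser_add₁ (le (H.ser_mul h.φ hy)) (H.ser_smul₁ (le (H.ser_mul h.χ hx)) (-1))
    cases c with
    | phi => exact H.ser_smul₁ (H.ser_add₁ (H.ser_add₁ (H.ser_add₁
        (H.ser_smul₁ (H.ser_mul₁ h.p (H.ser_add₁ (l2 h.φt) (le hx))) _)
        (H.ser_smul₁ (H.ser_mul₁ h.m (H.ser_add₁ (l1 h.φt) (H.ser_smul₁ (le hx) _))) _))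
        (le (H.ser_mul h.a0 h.bφ))) (H.ser_smul₁ (le (H.ser_mul h.a2 h.eφ)) _)) _
    | alphaPlus => exact H.ser_smul₁ (H.ser_add₁ (l1 h1) h2) _
    | alphaMinus => exact H.ser_smul₁ (H.ser_add₁ (l2 h1) (H.ser_smul₁ h2 _)) _
    | alpha0 => exact H.ser_smul₁ (H.ser_add₁ (le (H.ser_mul h.φ h.eχ))
        (H.ser_smul₁ (le (H.ser_mul h.χ h.eφ)) _)) _
    | alpha2 => exact H.ser_smul₁ (H.ser_add₁ (le (H.ser_mul h.χ h.bφ))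
        (H.ser_smul₁ (le (H.ser_mul h.φ h.bχ)) _)) _

end Source

/-! ### Solution jets with values in a Banach algebra -/

section JetA

open PowerSeries (coeff coeff_mk coeff_smul)

/-- Construction of a sequence by recursion along its history. -/
theorem exists_seq {α : Type*} [Inhabited α] (Q : ℕ → (ℕ → α) → α → Prop)
    (hdep : ∀ n h h' x, (∀ m < n, h m = h' m) → Q n h x → Q n h' x)
    (hex : ∀ n h, (∀ m < n, Q m h (h m)) → ∃ x, Q n h x) : ∃ u : ℕ → α, ∀ n, Q n u (u n) := by
  classical
  let F : ℕ → (ℕ → α) → α := fun n h => if H : ∃ x, Q n h x then H.choose else default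
  let S : ℕ → ℕ → α := fun n => Nat.rec (fun _ => default) (fun n h => Function.update h n (F n h)) n
  have hS : ∀ n, S (n + 1) = Function.update (S n) n (F n (S n)) := fun _ => rfl
  let u : ℕ → α := fun n => F n (S n)
  have hu : ∀ n, ∀ m < n, S n m = u m := by
    intro n
    induction n with
    | zero => intro m hm; omega
    | succ n ih =>
      intro m hm
      rw [hS]
      rcases Nat.lt_succ_iff_lt_or_eq.mp hm with h | rfl
      · rw [Function.update_of_ne h.ne, ih m h]
      · rw [Function.update_self]
  refine ⟨u, fun n => ?_⟩
  induction n using Nat.strong_induction_on with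
  | _ n ih =>
    have h1 : ∃ x, Q n (S n) x := by
      refine hex n (S n) fun m hm => ?_
      rw [hu n m hm]
      exact hdep m u (S n) (u m) (fun k hk => (hu n k (hk.trans hm)).symm) (ih m hm)
    refine hdep n (S n) u (u n) (fun m hm => hu n m hm) ?_
    have : u n = h1.choose := dif_pos h1
    rw [this]
    exact h1.choose_spec

variable {A : Type*} [NormedCommRing A] [NormedAlgebra ℂ A]

/-- Coefficients of all orders, components and sectors. -/
abbrev Coeffs (A : Type*) : Type _ := ℕ → Component → ℕ × ℤ → A

/-- The vanishing of the potential at the order zero. -/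
abbrev NoPotential {A : Type*} [Zero A] (v : Coeffs A) : Prop := ∀ c ≠ Component.phi, ∀ k, v 0 c k = 0

/-- Coefficients which are functions of `τ`. -/
abbrev Fam (A : Type*) : Type _ := Coeffs (ℝ → A)

/-- A series in `ρ` with given angular dependence and coefficients. -/
def ser (s : ℤ) (b : ℕ × ℤ → ℂ) (v : ℕ → ℕ × ℤ → A) : PowerSeries A :=
  PowerSeries.mk fun n => ∑ k ∈ modes s n, b k • v n k

theorem coeff_ser (s : ℤ) (b : ℕ × ℤ → ℂ) (v : ℕ → ℕ × ℤ → A) (n : ℕ) :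
    coeff n (ser s b v) = ∑ k ∈ modes s n, b k • v n k := coeff_mk _ _

/-- The values at a point of the fields with given coefficients. -/
def vals (σ : A →L[ℝ] A) (u : Fam A) (τ : ℝ) (o : Sph) : Vals A where
  φ := ser 0 (fun k => Y 0 k o) fun n k => u n .phi k τ
  φt := ser 0 (fun k => Y 0 k o) fun n k => deriv (u n .phi k) τ
  eφ := ser 0 (fun k => ethY 0 k o.1.1 o.1.2) fun n k => u n .phi k τ
  bφ := ser 0 (fun k => ethBarY 0 k o.1.1 o.1.2) fun n k => u n .phi k τ
  χ := ser 0 (fun k => conj (Y 0 k o)) fun n k => σ (u n .phi k τ)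
  χt := ser 0 (fun k => conj (Y 0 k o)) fun n k => σ (deriv (u n .phi k) τ)
  eχ := ser 0 (fun k => conj (ethBarY 0 k o.1.1 o.1.2)) fun n k => σ (u n .phi k τ)
  bχ := ser 0 (fun k => conj (ethY 0 k o.1.1 o.1.2)) fun n k => σ (u n .phi k τ)
  p := ser 0 (fun k => Y 0 k o) fun n k => u n .alphaPlus k τ
  m := ser 0 (fun k => Y 0 k o) fun n k => u n .alphaMinus k τ
  a0 := ser 1 (fun k => Y 1 k o) fun n k => u n .alpha0 k τ
  a2 := ser (-1) (fun k => Y (-1) k o) fun n k => u n .alpha2 k τ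

theorem vals_comp (σ : A →L[ℝ] A) (u : Fam A) (τ : ℝ) (o : Sph) (c : Component) :
    (vals σ u τ o).comp c = ser c.weight (fun k => Y c.weight k o) fun n k => u n c k τ := by
  cases c <;> rfl

theorem sHarm_ser {s s' : ℤ} {b : ℕ × ℤ → Sph → ℂ} (hb : ∀ n, ∀ k ∈ modes s n, b k ∈ Hs s' n)
    (v : ℕ → ℕ × ℤ → A) : SHarm s' fun o => ser s (fun k => b k o) v := fun n => by
  simp only [coeff_ser]
  exact harmA_sum _ fun k hk => harmA_of_mem (hb n k hk) _

theorem vHarm_vals (σ : A →L[ℝ] A) (u : Fam A) (τ : ℝ) : VHarm (vals σ u τ) := by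
  have y0 : ∀ n, ∀ k ∈ modes 0 n, Y 0 k ∈ Hs 0 n := fun n k hk => Y_mem_Hs hk
  have e0 : ∀ n, ∀ k ∈ modes 0 n, (fun o : Sph => ethY 0 k o.1.1 o.1.2) ∈ Hs 1 n := fun n k hk => by
    have := ethY_mem_Hs hk
    rwa [zero_add] at this
  have b0 : ∀ n, ∀ k ∈ modes 0 n, (fun o : Sph => ethBarY 0 k o.1.1 o.1.2) ∈ Hs (-1) n :=
    fun n k hk => by
      have := ethBarY_mem_Hs hk
      rwa [zero_sub] at this
  have cy : ∀ n, ∀ k ∈ modes 0 n, (fun o => conj (Y 0 k o)) ∈ Hs 0 n := fun n k hk => by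
    have := conj_mem_Hs (y0 n k hk)
    rwa [neg_zero] at this
  have ce : ∀ n, ∀ k ∈ modes 0 n, (fun o : Sph => conj (ethY 0 k o.1.1 o.1.2)) ∈ Hs (-1) n :=
    fun n k hk => conj_mem_Hs (e0 n k hk)
  have cb : ∀ n, ∀ k ∈ modes 0 n, (fun o : Sph => conj (ethBarY 0 k o.1.1 o.1.2)) ∈ Hs 1 n :=
    fun n k hk => by
      have := conj_mem_Hs (b0 n k hk)
      rwa [neg_neg] at this
  exact
    { φ := sHarm_ser y0 fun n k => u n .phi k τ
      φt := sHarm_ser y0 fun n k => deriv (u n .phi k) τ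
      eφ := sHarm_ser e0 fun n k => u n .phi k τ
      bφ := sHarm_ser b0 fun n k => u n .phi k τ
      χ := sHarm_ser cy fun n k => σ (u n .phi k τ)
      χt := sHarm_ser cy fun n k => σ (deriv (u n .phi k) τ)
      eχ := sHarm_ser cb fun n k => σ (u n .phi k τ)
      bχ := sHarm_ser ce fun n k => σ (u n .phi k τ)
      p := sHarm_ser y0 fun n k => u n .alphaPlus k τ
      m := sHarm_ser y0 fun n k => u n .alphaMinus k τ
      a0 := sHarm_ser (s := 1) (fun _ _ hk => Y_mem_Hs hk) fun n k => u n .alpha0 k τ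
      a2 := sHarm_ser (s := -1) (fun _ _ hk => Y_mem_Hs hk) fun n k => u n .alpha2 k τ }

theorem vReg_vals {P P₁ : (ℝ → A) → Prop} (H : SrcClass P P₁) {σ : A →L[ℝ] A} {u : Fam A}
    (hu : ∀ n c k, P (u n c k)) (hσ : ∀ n k, P fun τ => σ (u n .phi k τ))
    (hd : ∀ n k, P₁ (deriv (u n .phi k))) (hσd : ∀ n k, P₁ fun τ => σ (deriv (u n .phi k) τ))
    (o : Sph) : VReg P P₁ fun τ => vals σ u τ o := by
  have h0 : ∀ (s : ℤ) (b : ℕ × ℤ → ℂ) (v : ℕ → ℕ × ℤ → ℝ → A), (∀ n k, P (v n k)) →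
      SerP P fun τ => ser s b fun n k => v n k τ := fun s b v hv n => by
    simp only [coeff_ser]
    exact H.sum _ fun k _ => H.smul _ _ (hv n k)
  have h1 : ∀ (s : ℤ) (b : ℕ × ℤ → ℂ) (v : ℕ → ℕ × ℤ → ℝ → A), (∀ n k, P₁ (v n k)) →
      SerP P₁ fun τ => ser s b fun n k => v n k τ := fun s b v hv n => by
    simp only [coeff_ser]
    exact H.sum₁ _ fun k _ => H.smul₁ _ _ (hv n k)
  exact
    { φ := h0 _ _ (fun n k => u n .phi k) fun n k => hu n _ k
      φt := h1 _ _ (fun n k => deriv (u n .phi k)) hd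
      eφ := h0 _ _ (fun n k => u n .phi k) fun n k => hu n _ k
      bφ := h0 _ _ (fun n k => u n .phi k) fun n k => hu n _ k
      χ := h0 _ _ (fun n k τ => σ (u n .phi k τ)) hσ
      χt := h1 _ _ (fun n k τ => σ (deriv (u n .phi k) τ)) hσd
      eχ := h0 _ _ (fun n k τ => σ (u n .phi k τ)) hσ
      bχ := h0 _ _ (fun n k τ => σ (u n .phi k τ)) hσ
      p := h0 _ _ (fun n k => u n .alphaPlus k) fun n k => hu n _ k
      m := h0 _ _ (fun n k => u n .alphaMinus k) fun n k => hu n _ k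
      a0 := h0 _ _ (fun n k => u n .alpha0 k) fun n k => hu n _ k
      a2 := h0 _ _ (fun n k => u n .alpha2 k) fun n k => hu n _ k }

theorem ser_cong {s : ℤ} {b : ℕ × ℤ → ℂ} {v v' : ℕ → ℕ × ℤ → A} {n : ℕ}
    (h : ∀ m < n, ∀ k ∈ modes s m, v m k = v' m k) : Cong n (ser s b v) (ser s b v') :=
  fun m hm => by
    rw [coeff_ser, coeff_ser]
    exact sum_congr rfl fun k hk => by rw [h m hm k hk]

theorem agreePhi_vals {σ : A →L[ℝ] A} {u u' : Fam A} {n : ℕ}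
    (h : ∀ m < n, ∀ k ∈ modes 0 m, EqOn (u m .phi k) (u' m .phi k) 𝕀) {τ : ℝ}
    (hτ : τ ∈ 𝕀) (o : Sph) : AgreePhi n (vals σ u τ o) (vals σ u' τ o) := by
  have hd : ∀ m < n, ∀ k ∈ modes 0 m, deriv (u m .phi k) τ = deriv (u' m .phi k) τ :=
    fun m hm k hk => (Filter.eventuallyEq_of_mem (isOpen_Ioo.mem_nhds hτ) (h m hm k hk)).deriv_eq
  exact
    { φ := ser_cong fun m hm k hk => h m hm k hk hτ
      φt := ser_cong hd
      eφ := ser_cong fun m hm k hk => h m hm k hk hτ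
      bφ := ser_cong fun m hm k hk => h m hm k hk hτ
      χ := ser_cong fun m hm k hk => congrArg σ (h m hm k hk hτ)
      χt := ser_cong fun m hm k hk => congrArg σ (hd m hm k hk)
      eχ := ser_cong fun m hm k hk => congrArg σ (h m hm k hk hτ)
      bχ := ser_cong fun m hm k hk => congrArg σ (h m hm k hk hτ) }

theorem cong_vals_comp {σ : A →L[ℝ] A} {u u' : Fam A} {n : ℕ} {c : Component}
    (h : ∀ m < n, ∀ k ∈ modes c.weight m, EqOn (u m c k) (u' m c k) 𝕀) {τ : ℝ}
    (hτ : τ ∈ 𝕀) (o : Sph) :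
    Cong n ((vals σ u τ o).comp c) ((vals σ u' τ o).comp c) := by
  rw [vals_comp, vals_comp]
  exact ser_cong fun m hm k hk => h m hm k hk hτ

theorem modes_zero_zero : modes 0 0 = {((0, 0) : ℕ × ℤ)} := rfl

theorem mem_modes_zero {s : ℤ} {k : ℕ × ℤ} (hk : k ∈ modes s 0) : s = 0 ∧ k = (0, 0) := by
  rw [mem_modes] at hk
  obtain ⟨l, m⟩ := k
  have h := abs_le.mp hk.2.2
  simp only at hk h
  refine ⟨by omega, ?_⟩
  rw [Prod.mk.injEq]
  omega

/-- At order zero the scalar field is constant in `τ` and the potential vanishes. -/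
structure StaticLevel (x : Component → ℕ × ℤ → ℝ → A) : Prop where
  phi : ∀ τ ∈ 𝕀, deriv (x .phi (0, 0)) τ = 0
  zero : ∀ c ≠ Component.phi, ∀ k ∈ modes c.weight 0, ∀ τ ∈ 𝕀, x c k τ = 0

theorem StaticLevel.static {σ : A →L[ℝ] A} {u : Fam A} (h : StaticLevel (u 0)) {τ : ℝ}
    (hτ : τ ∈ 𝕀) (o : Sph) : (vals σ u τ o).Static ∧ coeff 0 (vals σ u τ o).χt = 0 ∧
      coeff 0 (vals σ u τ o).eχ = 0 ∧ coeff 0 (vals σ u τ o).bχ = 0 := by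
  have hc : ∀ c ≠ Component.phi, coeff 0 ((vals σ u τ o).comp c) = 0 := by
    intro c hc
    rw [vals_comp, coeff_ser]
    exact sum_eq_zero fun k hk => by rw [h.zero c hc k hk τ hτ, smul_zero]
  refine ⟨⟨?_, ?_, ?_, hc .alphaPlus (by simp), hc .alphaMinus (by simp), hc .alpha0 (by simp),
    hc .alpha2 (by simp)⟩, ?_, ?_, ?_⟩
  all_goals simp [vals, coeff_ser, modes_zero_zero, h.phi τ hτ, ethY, ethBarY]

theorem coeff_zero_src {q τ : ℝ} {V : Vals A} (h : V.Static) (h1 : coeff 0 V.χt = 0)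
    (h2 : coeff 0 V.eχ = 0) (h3 : coeff 0 V.bχ = 0) (c : Component) : coeff 0 (src q τ V c) = 0 := by
  cases c <;> simp only [src, cubic, current, Vals.comp, map_add, coeff_smul,
    coeff_zero_mul, h.φt, h.eφ, h.bφ, h.p, h.m, h.a0, h.a2, h1, h2, h3, coeff_zero_xD, smul_zero,
    mul_zero, zero_mul, add_zero]

/-- The drift of a component, i.e. the coefficient of `-2 ∂_τ` in its equation. -/
def Component.drift : Component → ℝ
  | .alphaPlus => 1
  | .alphaMinus => -1
  | _ => 0

/-- The zeroth order term in the equation of order `n` for a harmonic of degree `l`. -/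
def kap (A : Type*) [NormedCommRing A] [NormedAlgebra ℂ A] (n l : ℕ) : A :=
  algebraMap ℂ A (n * (n - 1) - l * (l + 1))

/-- Solution jets with values in `A`, where the continuous map `σ` plays the role of complex
conjugation. -/
structure IsJetA (σ : A →L[ℝ] A) (q : ℝ) (v : Coeffs A) (u : Fam A) : Prop where
  smooth : ∀ n c, ∀ k ∈ modes c.weight n, ContDiffOn ℝ ∞ (u n c k) 𝕀
  init : ∀ n c, ∀ k ∈ modes c.weight n, u n c k 0 = v n c k
  init_deriv : ∀ n c, ∀ k ∈ modes c.weight n, deriv (u n c k) 0 = 0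
  eq : ∀ n c, ∀ τ ∈ 𝕀, ∀ o : Sph, ∑ k ∈ modes c.weight n, Y c.weight k o •
    sing (2 * (n - 1)) (-2 * c.drift) (kap A n k.1) (u n c k) τ =
      coeff n (src q τ (vals σ u τ o) c)

theorem srcClass_contDiff : SrcClass (A := A) (fun f => ContDiffOn ℝ ∞ f 𝕀)
    (fun f => ContDiffOn ℝ ∞ f 𝕀) where
  zero := contDiffOn_const
  add _ _ hf hg := hf.add hg
  mul _ _ hf hg := hf.mul hg
  smul c _ hf := hf.const_smul c
  le _ hf := hf
  add₁ _ _ hf hg := hf.add hg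
  mul₁ _ _ hf hg := hf.mul hg
  smul₁ c _ hf := hf.const_smul c
  lin₁ a b f hf := by
    have h : ContDiffOn ℝ ∞ (fun τ : ℝ => a + b * τ) 𝕀 := by fun_prop
    exact (h.smul hf).congr fun τ _ => Complex.coe_smul _ _

variable [CompleteSpace A]

theorem LogAt.const_smul {e : ℝ} {f : ℝ → A} (hf : LogAt e f) (c : ℂ) : LogAt e fun τ => c • f τ :=
  hf.map ((c • ContinuousLinearMap.id ℂ A).restrictScalars ℝ)

theorem srcClass_logAt (e : ℝ) : SrcClass (A := A) (LogAt e)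
    (fun f => LogAt e fun τ => (1 - e * τ) • f τ) where
  zero := logAt_const e 0
  add _ _ hf hg := hf.add hg
  mul _ _ hf hg := hf.mul hg
  smul c _ hf := hf.const_smul c
  le f hf := by simpa only [neg_mul, ← sub_eq_add_neg] using hf.linear_smul 1 (-e)
  add₁ _ _ hf hg := by simpa only [smul_add] using hf.add hg
  mul₁ _ _ hf hg := by simpa only [mul_smul_comm] using hf.mul hg
  smul₁ c _ hf := by simpa only [smul_comm c] using hf.const_smul c
  lin₁ a b f hf := by
    simpa only [Complex.coe_smul, smul_comm (a + b * _)] using hf.linear_smul a b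

/-- The family with history `h` below order `n`, given level `x` at order `n`, and zero above. -/
def cut (n : ℕ) (h : Fam A) (x : Component → ℕ × ℤ → ℝ → A) : Fam A :=
  fun m => if m < n then h m else if m = n then x else 0

theorem cut_lt {n m : ℕ} (hm : m < n) (h : Fam A) (x : Component → ℕ × ℤ → ℝ → A) :
    cut n h x m = h m := if_pos hm

theorem cut_self (n : ℕ) (h : Fam A) (x : Component → ℕ × ℤ → ℝ → A) : cut n h x n = x := by
  simp [cut]

/-- Regularity of a level. -/
structure RegLevel (x : Component → ℕ × ℤ → ℝ → A) : Prop where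
  smooth : ∀ c k, ContDiffOn ℝ ∞ (x c k) 𝕀
  log : ∀ c k, ∀ e ∈ 𝕊, LogAt e (x c k)

theorem regLevel_zero : RegLevel (0 : Component → ℕ × ℤ → ℝ → A) :=
  ⟨fun _ _ => contDiffOn_const, fun _ _ e _ => logAt_const e 0⟩

theorem regLevel_cut {n : ℕ} {h : Fam A} {x : Component → ℕ × ℤ → ℝ → A}
    (hh : ∀ m < n, RegLevel (h m)) (hx : RegLevel x) (m : ℕ) : RegLevel (cut n h x m) := by
  unfold cut
  split_ifs with h1 h2
  · exact hh m h1
  · exact hx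
  · exact regLevel_zero

/-- The modes of the source terms of a regular family are regular. -/
theorem regular_modeCoeff_src {σ : A →L[ℝ] A} {w : Fam A} (hw : ∀ m, RegLevel (w m)) (q : ℝ)
    (n : ℕ) (c : Component) (k : ℕ × ℤ) :
    ContDiffOn ℝ ∞ (fun τ => modeCoeff c.weight n k fun o => coeff n (src q τ (vals σ w τ o) c))
      𝕀 ∧
    ∀ e ∈ 𝕊, LogAt e fun τ => (1 - e * τ) •
      modeCoeff c.weight n k fun o => coeff n (src q τ (vals σ w τ o) c) := by
  constructor
  · exact srcClass_contDiff.sum _ fun o _ => srcClass_contDiff.smul _ _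
      ((vReg_vals srcClass_contDiff (fun m c k => (hw m).smooth c k)
        (fun m k => σ.contDiff.comp_contDiffOn ((hw m).smooth .phi k))
        (fun m k => contDiffOn_deriv ((hw m).smooth .phi k))
        (fun m k => σ.contDiff.comp_contDiffOn (contDiffOn_deriv ((hw m).smooth .phi k))) o).src
        srcClass_contDiff q c n)
  · intro e he
    refine (srcClass_logAt e).sum₁ _ fun o _ => (srcClass_logAt e).smul₁ _ _
      ((vReg_vals (srcClass_logAt e) (fun m c k => (hw m).log c k e he)
        (fun m k => ((hw m).log .phi k e he).map σ)
        (fun m k => LogAt.smul_deriv he ((hw m).smooth .phi k) ((hw m).log .phi k e he))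
        (fun m k => ?_) o).src (srcClass_logAt e) q c n)
    have := (LogAt.smul_deriv he ((hw m).smooth .phi k) ((hw m).log .phi k e he)).map σ
    simpa only [map_smul] using this

theorem exists_exponent {n : ℕ} (hn : n ≠ 0) (c : Component) {e : ℝ} (he : e ∈ 𝕊) :
    ∃ N : ℕ, 2 * ((n : ℝ) - 1) + e * (-2 * c.drift) = 2 * ((N : ℝ) - 1) := by
  obtain ⟨m, rfl⟩ := Nat.exists_eq_succ_of_ne_zero hn
  have key : ∀ j : ℕ, (j : ℝ) = 1 - e * c.drift → ∃ N : ℕ,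
      2 * (((m + 1 : ℕ) : ℝ) - 1) + e * (-2 * c.drift) = 2 * ((N : ℝ) - 1) := fun j hj =>
    ⟨m + j, by push_cast; rw [hj]; ring⟩
  rcases he with rfl | rfl <;> cases c
  · exact key 1 (by simp [Component.drift])
  · exact key 0 (by simp [Component.drift])
  · exact key 2 (by simp [Component.drift]; norm_num)
  · exact key 1 (by simp [Component.drift])
  · exact key 1 (by simp [Component.drift])
  · exact key 1 (by simp [Component.drift])
  · exact key 2 (by simp [Component.drift]; norm_num)
  · exact key 0 (by simp [Component.drift])
  · exact key 1 (by simp [Component.drift])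
  · exact key 1 (by simp [Component.drift])

theorem exists_regular_mode {n : ℕ} (hn : n ≠ 0) (c : Component) (κ : A) {S : ℝ → A}
    (hS : ContDiffOn ℝ ∞ S 𝕀)
    (hS' : ∀ e ∈ 𝕊, LogAt e fun τ => (1 - e * τ) • S τ) (a : A) :
    ∃ f : ℝ → A, ContDiffOn ℝ ∞ f 𝕀 ∧ (∀ e ∈ 𝕊, LogAt e f) ∧ f 0 = a ∧
      deriv f 0 = 0 ∧ ∀ τ ∈ 𝕀, sing (2 * (n - 1)) (-2 * c.drift) κ f τ = S τ := by
  obtain ⟨f, hf, hf0, hf1, hs⟩ := exists_sing_solution (2 * ((n : ℝ) - 1)) (-2 * c.drift) κ hS a 0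
  refine ⟨f, hf, fun e he => ?_, hf0, hf1, hs⟩
  obtain ⟨N, hN⟩ := exists_exponent hn c he
  exact logAt_of_sing he hN hf hs (hS' e he)

theorem sing_add_kappa (β γ : ℝ) (κ κ' : A) (f : ℝ → A) (τ : ℝ) :
    sing β γ κ f τ = sing β γ (κ + κ') f τ + κ' * f τ := by
  simp only [sing, add_mul]; abel

theorem coeff_zero_vals {σ : A →L[ℝ] A} (u : Fam A) (τ : ℝ) (o : Sph) :
    coeff 0 (vals σ u τ o).φ = nrm 0 (0, 0) • u 0 .phi (0, 0) τ ∧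
    coeff 0 (vals σ u τ o).χ = conj (nrm 0 (0, 0)) • σ (u 0 .phi (0, 0) τ) := by
  have : Y 0 (0, 0) o = nrm 0 (0, 0) := by
    rw [Y, sY_eq]; simp [gH]
  constructor <;> simp [vals, coeff_ser, modes_zero_zero, this]

end JetA

section Existence

open PowerSeries (coeff)

variable {A : Type*} [NormedCommRing A] [NormedAlgebra ℂ A] [CompleteSpace A]

theorem Component.drift_phi : -2 * Component.phi.drift = 0 := by simp [Component.drift]

/-- Admissible levels of order `n` with history `h`. -/
structure IsLevel (σ : A →L[ℝ] A) (q : ℝ) (v : Coeffs A) (n : ℕ) (h : Fam A)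
    (x : Component → ℕ × ℤ → ℝ → A) : Prop where
  reg : RegLevel x
  init : ∀ c k, x c k 0 = v n c k
  init_deriv : ∀ c k, deriv (x c k) 0 = 0
  zero : n = 0 → (∀ k τ, x .phi k τ = v 0 .phi k) ∧ ∀ c ≠ Component.phi, x c = 0
  eq : ∀ c, ∀ τ ∈ 𝕀, ∀ o : Sph, ∑ k ∈ modes c.weight n, Y c.weight k o •
    sing (2 * (n - 1)) (-2 * c.drift) (kap A n k.1) (x c k) τ =
      coeff n (src q τ (vals σ (cut n h x) τ o) c)

theorem staticLevel_of {x : Component → ℕ × ℤ → ℝ → A} {a : A} (h1 : ∀ τ, x .phi (0, 0) τ = a)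
    (h2 : ∀ c ≠ Component.phi, x c = 0) : StaticLevel x where
  phi τ _ := by rw [show x .phi (0, 0) = fun _ => a from funext h1]; exact deriv_const τ a
  zero c hc k _ τ _ := by rw [h2 c hc]; rfl

theorem IsLevel.staticLevel {σ : A →L[ℝ] A} {q : ℝ} {v : Coeffs A} {h : Fam A}
    {x : Component → ℕ × ℤ → ℝ → A} (hx : IsLevel σ q v 0 h x) : StaticLevel x :=
  staticLevel_of (fun τ => (hx.zero rfl).1 (0, 0) τ) (hx.zero rfl).2

theorem exists_isLevel_zero (σ : A →L[ℝ] A) (q : ℝ) {v : Coeffs A}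
    (hv : NoPotential v) (h : Fam A) : ∃ x, IsLevel σ q v 0 h x := by
  let x : Component → ℕ × ℤ → ℝ → A := fun c k _ => v 0 c k
  have h2 : ∀ c ≠ Component.phi, x c = 0 := fun c hc => by
    ext k τ; exact hv c hc k
  have hst : StaticLevel (cut 0 h x 0) := by
    rw [cut_self]; exact staticLevel_of (fun _ => rfl) h2
  refine ⟨x, ⟨fun _ _ => contDiffOn_const, fun _ _ e _ => logAt_const e _⟩, fun _ _ => rfl,
    fun c k => deriv_const _ _, fun _ => ⟨fun _ _ => rfl, h2⟩, fun c τ hτ o => ?_⟩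
  obtain ⟨s1, s2, s3, s4⟩ := hst.static (σ := σ) hτ o
  rw [coeff_zero_src s1 s2 s3 s4]
  refine sum_eq_zero fun k hk => ?_
  obtain ⟨-, rfl⟩ := mem_modes_zero hk
  have hd : deriv (x c (0, 0)) = fun _ => 0 := by ext τ; exact deriv_const _ _
  simp [sing, hd, kap]

theorem exists_isLevel (σ : A →L[ℝ] A) (q : ℝ) {v : Coeffs A} {n : ℕ} (hn : n ≠ 0)
    {h : Fam A} (hh : ∀ m < n, IsLevel σ q v m h (h m)) : ∃ x, IsLevel σ q v n h x := by
  have hreg : ∀ m < n, RegLevel (h m) := fun m hm => (hh m hm).reg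
  have hn0 : 0 < n := Nat.pos_of_ne_zero hn
  have hst : ∀ x, StaticLevel (cut n h x 0) := fun x => by
    rw [cut_lt hn0]; exact (hh 0 hn0).staticLevel
  have hw0 := regLevel_cut hreg regLevel_zero
  choose f hf hflog hf0 hf1 hfs using fun k : ℕ × ℤ =>
    exists_regular_mode hn .phi (kap A n k.1) (regular_modeCoeff_src (σ := σ) hw0 q n .phi k).1
      (regular_modeCoeff_src (σ := σ) hw0 q n .phi k).2 (v n .phi k)
  let x₁ : Component → ℕ × ℤ → ℝ → A := fun c => match c with
    | .phi => f
    | _ => 0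
  have hx₁ : RegLevel x₁ := by
    constructor
    · intro c k
      cases c with
      | phi => exact hf k
      | _ => exact contDiffOn_const
    · intro c k e he
      cases c with
      | phi => exact hflog k e he
      | _ => exact logAt_const e 0
  have hw1 := regLevel_cut hreg hx₁
  set a : A := v 0 .phi (0, 0)
  set K : A := (2 * q ^ 2 : ℂ) • ((nrm 0 (0, 0) • a) * (conj (nrm 0 (0, 0)) • σ a)) with hK
  choose g hg hglog hg0 hg1 hgs using fun (c : Component) (k : ℕ × ℤ) =>
    exists_regular_mode hn c (kap A n k.1 + K) (regular_modeCoeff_src (σ := σ) hw1 q n c k).1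
      (regular_modeCoeff_src (σ := σ) hw1 q n c k).2 (v n c k)
  let x : Component → ℕ × ℤ → ℝ → A := fun c => match c with
    | .phi => f
    | c => g c
  have hxc : ∀ c ≠ Component.phi, x c = g c := fun c hc => by
    cases c with
    | phi => exact absurd rfl hc
    | _ => rfl
  have agree0 : ∀ m < n, cut n h x m = cut n h 0 m := fun m hm => by rw [cut_lt hm, cut_lt hm]
  have agree1 : ∀ m < n, cut n h x m = cut n h x₁ m := fun m hm => by rw [cut_lt hm, cut_lt hm]
  have agree1' : ∀ m < n + 1, cut n h x m .phi = cut n h x₁ m .phi := fun m hm => by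
    rcases Nat.lt_succ_iff_lt_or_eq.mp hm with hm | rfl
    · rw [agree1 m hm]
    · rw [cut_self, cut_self]
  refine ⟨x, ⟨fun c k => ?_, fun c k e he => ?_⟩, fun c k => ?_, fun c k => ?_,
    fun h0 => absurd h0 hn, fun c τ hτ o => ?_⟩
  · cases c with
    | phi => exact hf k
    | _ => exact hg _ k
  · cases c with
    | phi => exact hflog k e he
    | _ => exact hglog _ k e he
  · cases c with
    | phi => exact hf0 k
    | _ => exact hg0 _ k
  · cases c with
    | phi => exact hf1 k
    | _ => exact hg1 _ k
  · by_cases hc : c = .phi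
    · subst hc
      rw [coeff_src_phi_congr hn
        (agreePhi_vals (u' := cut n h 0) (fun m hm k _ => by rw [agree0 m hm]; exact fun _ _ => rfl)
          hτ o)
        (fun c => cong_vals_comp (u' := cut n h 0)
          (fun m hm k _ => by rw [agree0 m hm]; exact fun _ _ => rfl) hτ o)
        ((hst x).static hτ o).1,
        ((vHarm_vals σ (cut n h 0) τ).src q τ .phi n).eq_sum_modeCoeff o]
      exact sum_congr rfl fun k _ => congrArg _ (hfs k τ hτ)
    · have h0 := coeff_zero_vals (σ := σ) (cut n h x) τ o
      have h00 : cut n h x 0 .phi (0, 0) τ = a := by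
        rw [cut_lt hn0]; exact ((hh 0 hn0).zero rfl).1 (0, 0) τ
      have hx1 : coeff n ((vals σ (cut n h x₁) τ o).comp c) = 0 := by
        rw [vals_comp, coeff_ser]
        refine sum_eq_zero fun k _ => ?_
        have : x₁ c k τ = 0 := by
          cases c with
          | phi => exact absurd rfl hc
          | _ => rfl
        rw [cut_self, this, smul_zero]
      have hx2 : coeff n ((vals σ (cut n h x) τ o).comp c) =
          ∑ k ∈ modes c.weight n, Y c.weight k o • g c k τ := by
        rw [vals_comp, coeff_ser]
        exact sum_congr rfl fun k _ => by rw [cut_self, hxc c hc]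
      rw [coeff_src_congr
        (agreePhi_vals (u' := cut n h x₁)
          (fun m hm k _ => by rw [agree1' m hm]; exact fun _ _ => rfl) hτ o) hc
        (cong_vals_comp (u' := cut n h x₁)
          (fun m hm k _ => by rw [agree1 m hm]; exact fun _ _ => rfl) hτ o),
        ((vHarm_vals σ (cut n h x₁) τ).src q τ c n).eq_sum_modeCoeff o, hx1, hx2, h0.1, h0.2, h00,
        sub_zero, ← mul_smul_comm (2 * q ^ 2 : ℂ), ← hK, mul_comm _ K, mul_sum, ← sum_add_distrib, hxc c hc]
      refine sum_congr rfl fun k _ => ?_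
      rw [sing_add_kappa _ _ _ K, hgs c k τ hτ, smul_add, mul_smul_comm]

theorem src_cong {q τ : ℝ} {n : ℕ} {V V' : Vals A} (h : AgreePhi (n + 1) V V')
    (hc : ∀ c, Cong (n + 1) (V.comp c) (V'.comp c)) (c : Component) :
    coeff n (src q τ V c) = coeff n (src q τ V' c) := by
  by_cases h0 : c = .phi
  · subst h0
    have hp : Cong (n + 1) V.p V'.p := hc .alphaPlus
    have hm : Cong (n + 1) V.m V'.m := hc .alphaMinus
    have ha0 : Cong (n + 1) V.a0 V'.a0 := hc .alpha0
    have ha2 : Cong (n + 1) V.a2 V'.a2 := hc .alpha2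
    refine Cong.add (n := n + 1) ?_ ?_ n (Nat.lt_succ_self n)
    · exact (h.φ.mul (((hp.mul hm).smul _).add ((ha0.mul ha2).smul _))).smul _
    · exact (((((hp.mul ((h.φt.smul _).add h.φ.xD)).smul _).add
        ((hm.mul ((h.φt.smul _).add (h.φ.xD.smul _))).smul _)).add (ha0.mul h.bφ)).add
        ((ha2.mul h.eφ).smul _)).smul _
  · rw [coeff_src_congr h h0 (fun m hm => hc c m (hm.trans (Nat.lt_succ_self n))),
      hc c n (Nat.lt_succ_self n), sub_self, zero_mul, smul_zero, add_zero]

/-- Solution jets exist, and all coefficients are represented by log series at both ends. -/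
theorem exists_isJetA (σ : A →L[ℝ] A) (q : ℝ) {v : Coeffs A}
    (hv : NoPotential v) : ∃ u : Fam A, IsJetA σ q v u ∧ StaticLevel (u 0) ∧
      ∀ n c k, ∀ e ∈ 𝕊, LogAt e (u n c k) := by
  have : Inhabited (Component → ℕ × ℤ → ℝ → A) := ⟨0⟩
  obtain ⟨u, hu⟩ := exists_seq (α := Component → ℕ × ℤ → ℝ → A) (IsLevel σ q v)
    (fun n h h' x heq hx => by
      have : cut n h x = cut n h' x := by
        ext m : 1
        unfold cut
        split_ifs with h1
        · exact heq m h1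
        · rfl
        · rfl
      exact ⟨hx.reg, hx.init, hx.init_deriv, hx.zero, this ▸ hx.eq⟩)
    (fun n h hh => by
      rcases eq_or_ne n 0 with rfl | hn
      · exact exists_isLevel_zero σ q hv h
      · exact exists_isLevel σ q hn hh)
  refine ⟨u, ⟨fun n c k _ => (hu n).reg.smooth c k, fun n c k _ => (hu n).init c k,
    fun n c k _ => (hu n).init_deriv c k, fun n c τ hτ o => ?_⟩, (hu 0).staticLevel,
    fun n c k e he => (hu n).reg.log c k e he⟩
  have hag : ∀ m < n + 1, cut n u (u n) m = u m := fun m hm => by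
    rcases Nat.lt_succ_iff_lt_or_eq.mp hm with hm | rfl
    · rw [cut_lt hm]
    · rw [cut_self]
  rw [(hu n).eq c τ hτ o]
  exact src_cong
    (agreePhi_vals (fun m hm k _ => by rw [hag m hm]; exact fun _ _ => rfl) hτ o)
    (fun c => cong_vals_comp (fun m hm k _ => by rw [hag m hm]; exact fun _ _ => rfl) hτ o) c

end Existence

section Mapping

open PowerSeries (coeff coeff_smul coeff_map)

variable {A : Type*} [NormedCommRing A] [NormedAlgebra ℂ A]
variable {B : Type*} [NormedCommRing B] [NormedAlgebra ℂ B]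

/-- Application of an algebra homomorphism to values. -/
def Vals.map (T : A →ₐ[ℂ] B) (V : Vals A) : Vals B where
  φ := PowerSeries.map T.toRingHom V.φ
  φt := PowerSeries.map T.toRingHom V.φt
  eφ := PowerSeries.map T.toRingHom V.eφ
  bφ := PowerSeries.map T.toRingHom V.bφ
  χ := PowerSeries.map T.toRingHom V.χ
  χt := PowerSeries.map T.toRingHom V.χt
  eχ := PowerSeries.map T.toRingHom V.eχ
  bχ := PowerSeries.map T.toRingHom V.bχ
  p := PowerSeries.map T.toRingHom V.p
  m := PowerSeries.map T.toRingHom V.m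
  a0 := PowerSeries.map T.toRingHom V.a0
  a2 := PowerSeries.map T.toRingHom V.a2

theorem powerSeries_map_smul (T : A →ₐ[ℂ] B) (c : ℂ) (F : PowerSeries A) :
    PowerSeries.map T.toRingHom (c • F) = c • PowerSeries.map T.toRingHom F := by
  ext; simp

theorem powerSeries_map_xD (T : A →ₐ[ℂ] B) (F : PowerSeries A) :
    PowerSeries.map T.toRingHom (xD F) = xD (PowerSeries.map T.toRingHom F) := by
  ext n
  rw [coeff_map, coeff_xD, coeff_xD, coeff_map]
  exact T.map_smul_of_tower _ _

theorem src_map (T : A →ₐ[ℂ] B) (q τ : ℝ) (V : Vals A) (c : Component) :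
    src q τ (V.map T) c = PowerSeries.map T.toRingHom (src q τ V c) := by
  cases c <;> simp only [src, cubic, current, Vals.comp, Vals.map, map_add, map_mul,
    powerSeries_map_smul, powerSeries_map_xD]

theorem ser_congr {s : ℤ} {b : ℕ × ℤ → ℂ} {v v' : ℕ → ℕ × ℤ → A}
    (h : ∀ n, ∀ k ∈ modes s n, v n k = v' n k) : ser s b v = ser s b v' := by
  ext n
  exact ser_cong (n := n + 1) (fun m _ k hk => h m k hk) n (Nat.lt_succ_self n)

theorem powerSeries_map_ser (T : A →ₐ[ℂ] B) (s : ℤ) (b : ℕ × ℤ → ℂ) (v : ℕ → ℕ × ℤ → A) :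
    PowerSeries.map T.toRingHom (ser s b v) = ser s b fun n k => T (v n k) := by
  ext n
  rw [coeff_map, coeff_ser, coeff_ser]
  simp

theorem hasDerivAt_map {T : A →ₐ[ℂ] B} (hT : Continuous T) {f : ℝ → A} {f' : A} {τ : ℝ}
    (hf : HasDerivAt f f' τ) : HasDerivAt (fun τ => T (f τ)) (T f') τ := by
  let T' : A →L[ℝ] B := (⟨T.toLinearMap, hT⟩ : A →L[ℂ] B).restrictScalars ℝ
  exact T'.hasFDerivAt.comp_hasDerivAt τ hf

theorem deriv_map {T : A →ₐ[ℂ] B} (hT : Continuous T) {f : ℝ → A}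
    (hf : ContDiffOn ℝ ∞ f 𝕀) {τ : ℝ} (hτ : τ ∈ 𝕀) :
    deriv (fun τ => T (f τ)) τ = T (deriv f τ) :=
  (hasDerivAt_map hT (hasDerivAt_of_contDiffOn hf hτ)).deriv

theorem sing_map {T : A →ₐ[ℂ] B} (hT : Continuous T) {f : ℝ → A} (β γ : ℝ) (κ : A)
    (hf : ContDiffOn ℝ ∞ f 𝕀) {τ : ℝ} (hτ : τ ∈ 𝕀) :
    sing β γ (T κ) (fun τ => T (f τ)) τ = T (sing β γ κ f τ) := by
  have h1 : deriv (fun τ => T (f τ)) =ᶠ[𝓝 τ] fun τ => T (deriv f τ) :=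
    Filter.eventuallyEq_of_mem (isOpen_Ioo.mem_nhds hτ) fun t ht => deriv_map hT hf ht
  have hr : ∀ (r : ℝ) (a : A), T (r • a) = r • T a := fun r a => by
    rw [← Complex.coe_smul, ← Complex.coe_smul, map_smul]
  rw [sing, sing, h1.deriv_eq, h1.eq_of_nhds, deriv_map hT (contDiffOn_deriv hf) hτ, map_sub, map_add,
    map_mul, hr, hr]

theorem vals_map {T : A →ₐ[ℂ] B} (hT : Continuous T) {σ : A →L[ℝ] A} {σ' : B →L[ℝ] B}
    (hσ : ∀ a, T (σ a) = σ' (T a)) {u : Fam A}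
    (hu : ∀ n, ∀ k ∈ modes 0 n, ContDiffOn ℝ ∞ (u n .phi k) 𝕀) {τ : ℝ}
    (hτ : τ ∈ 𝕀) (o : Sph) :
    vals σ' (fun n c k τ => T (u n c k τ)) τ o = (vals σ u τ o).map T := by
  simp only [vals, Vals.map, powerSeries_map_ser, hσ, Vals.mk.injEq, true_and, and_true]
  exact ⟨ser_congr fun n k hk => deriv_map hT (hu n k hk) hτ,
    ser_congr fun n k hk => congrArg σ' (deriv_map hT (hu n k hk) hτ)⟩

theorem IsJetA.map {T : A →ₐ[ℂ] B} (hT : Continuous T) {σ : A →L[ℝ] A} {σ' : B →L[ℝ] B}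
    (hσ : ∀ a, T (σ a) = σ' (T a)) {q : ℝ} {v : Coeffs A} {u : Fam A}
    (h : IsJetA σ q v u) :
    IsJetA σ' q (fun n c k => T (v n c k)) (fun n c k τ => T (u n c k τ)) where
  smooth n c k hk :=
    ((⟨T.toLinearMap, hT⟩ : A →L[ℂ] B).restrictScalars ℝ).contDiff.comp_contDiffOn (h.smooth n c k hk)
  init n c k hk := congrArg T (h.init n c k hk)
  init_deriv n c k hk := by
    rw [deriv_map hT (h.smooth n c k hk) (by simp), h.init_deriv n c k hk, map_zero]
  eq n c τ hτ o := by
    rw [vals_map hT hσ (fun n k hk => h.smooth n .phi k hk) hτ, src_map, coeff_map,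
      ← h.eq n c τ hτ o]
    refine Eq.trans (sum_congr rfl fun k hk => ?_) (map_sum T _ _).symm
    have : kap B n k.1 = T (kap A n k.1) := by simp [kap]
    rw [this, sing_map hT _ _ _ (h.smooth n c k hk) hτ, map_smul]

end Mapping

section UniqueC

open PowerSeries (coeff coeff_smul coeff_map)

/-- Complex conjugation as a continuous real-linear map. -/
def conjL : ℂ →L[ℝ] ℂ := Complex.conjCLE.toContinuousLinearMap

theorem conjL_apply (a : ℂ) : conjL a = conj a := rfl

/-- A coupled linear system with vanishing data has only the zero solution. -/
theorem eq_zero_of_coupled {f P P' M M' a₁ a₂ b₁ b₂ b₃ b₄ c₁ c₂ c₃ c₄ : ℝ → ℂ}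
    (hf : ∀ t ∈ 𝕀, HasDerivAt f (a₁ t * f t + a₂ t * P t) t)
    (hP : ∀ t ∈ 𝕀, HasDerivAt P (P' t) t)
    (hP' : ∀ t ∈ 𝕀, HasDerivAt P'
      (b₁ t * P' t + b₂ t * P t + b₃ t * f t + b₄ t * conj (f t)) t)
    (hM : ∀ t ∈ 𝕀, HasDerivAt M (M' t) t)
    (hM' : ∀ t ∈ 𝕀, HasDerivAt M'
      (c₁ t * M' t + c₂ t * M t + c₃ t * f t + c₄ t * conj (f t)) t)
    (hK : ContinuousOn (fun t => 1 + ‖a₁ t‖ + ‖a₂ t‖ + ‖b₁ t‖ + ‖b₂ t‖ + ‖b₃ t‖ + ‖b₄ t‖ + ‖c₁ t‖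
      + ‖c₂ t‖ + ‖c₃ t‖ + ‖c₄ t‖) 𝕀)
    (hf0 : f 0 = 0) (hP0 : P 0 = 0) (hP0' : P' 0 = 0) (hM0 : M 0 = 0) (hM0' : M' 0 = 0) :
    ∀ t ∈ 𝕀, f t = 0 ∧ P t = 0 ∧ M t = 0 := by
  have key := eq_zero_of_norm_deriv_le (a := -1) (b := 1) (t₀ := 0)
    (z := fun t => (f t, P t, P' t, M t, M' t))
    (z' := fun t => (a₁ t * f t + a₂ t * P t, P' t,
      b₁ t * P' t + b₂ t * P t + b₃ t * f t + b₄ t * conj (f t), M' t,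
      c₁ t * M' t + c₂ t * M t + c₃ t * f t + c₄ t * conj (f t)))
    (fun t ht => (hf t ht).prodMk ((hP t ht).prodMk ((hP' t ht).prodMk ((hM t ht).prodMk (hM' t ht)))))
    hK (fun t ht => by
      set Z : ℂ × ℂ × ℂ × ℂ × ℂ := (f t, P t, P' t, M t, M' t) with hZ
      have z1 : ‖f t‖ ≤ ‖Z‖ := norm_fst_le Z
      have z2 : ‖P t‖ ≤ ‖Z‖ := (norm_fst_le Z.2).trans (norm_snd_le Z)
      have z3 : ‖P' t‖ ≤ ‖Z‖ := (norm_fst_le Z.2.2).trans ((norm_snd_le Z.2).trans (norm_snd_le Z))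
      have z4 : ‖M t‖ ≤ ‖Z‖ := (norm_fst_le Z.2.2.2).trans
        ((norm_snd_le Z.2.2).trans ((norm_snd_le Z.2).trans (norm_snd_le Z)))
      have z5 : ‖M' t‖ ≤ ‖Z‖ := (norm_snd_le Z.2.2.2).trans
        ((norm_snd_le Z.2.2).trans ((norm_snd_le Z.2).trans (norm_snd_le Z)))
      have m : ∀ {a x : ℂ}, ‖x‖ ≤ ‖Z‖ → ‖a * x‖ ≤ ‖a‖ * ‖Z‖ := fun {a x} hx => by
        rw [norm_mul]; exact mul_le_mul_of_nonneg_left hx (norm_nonneg a)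
      have z1' : ‖conj (f t)‖ ≤ ‖Z‖ := by rwa [Complex.norm_conj]
      have n0 := norm_nonneg Z
      have four : ∀ {a b c d x y z w : ℂ}, ‖x‖ ≤ ‖Z‖ → ‖y‖ ≤ ‖Z‖ → ‖z‖ ≤ ‖Z‖ → ‖w‖ ≤ ‖Z‖ →
          ‖a * x + b * y + c * z + d * w‖ ≤ (‖a‖ + ‖b‖ + ‖c‖ + ‖d‖) * ‖Z‖ := fun {a b c d _ _ _ _} hx hy hz hw => by
        refine (norm_add_le _ _).trans ((add_le_add_left ((norm_add_le _ _).trans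
          (add_le_add_left (norm_add_le _ _) _)) _).trans ?_)
        linarith [m (a := a) hx, m (a := b) hy, m (a := c) hz, m (a := d) hw]
      have le : ∀ {r K : ℝ} {x : ℂ}, ‖x‖ ≤ r * ‖Z‖ → r ≤ K → ‖x‖ ≤ K * ‖Z‖ := fun h1 h2 =>
        h1.trans (mul_le_mul_of_nonneg_right h2 n0)
      have p1 := norm_nonneg (a₁ t); have p2 := norm_nonneg (a₂ t)
      have p3 := norm_nonneg (b₁ t); have p4 := norm_nonneg (b₂ t)
      have p5 := norm_nonneg (b₃ t); have p6 := norm_nonneg (b₄ t)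
      have p7 := norm_nonneg (c₁ t); have p8 := norm_nonneg (c₂ t)
      have p9 := norm_nonneg (c₃ t); have p10 := norm_nonneg (c₄ t)
      refine norm_prod_le_iff.mpr ⟨?_, norm_prod_le_iff.mpr ⟨?_, norm_prod_le_iff.mpr ⟨?_,
        norm_prod_le_iff.mpr ⟨?_, ?_⟩⟩⟩⟩
      · refine le (r := ‖a₁ t‖ + ‖a₂ t‖) ((norm_add_le _ _).trans ?_) (by linarith)
        linarith [m (a := a₁ t) z1, m (a := a₂ t) z2]
      · exact le (r := 1) (by rwa [one_mul]) (by linarith)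
      · exact le (four z3 z2 z1 z1') (by linarith)
      · exact le (r := 1) (by rwa [one_mul]) (by linarith)
      · exact le (four z5 z4 z1 z1') (by linarith))
    (by simp) (by simp [hf0, hP0, hP0', hM0, hM0'])
  intro t ht
  have := key t ht
  simp only [Prod.mk_eq_zero] at this
  exact ⟨this.1, this.2.1, this.2.2.2.1⟩

theorem IsJetA.staticLevel {q : ℝ} {v : Coeffs ℂ} {u : Fam ℂ}
    (hu : IsJetA conjL q v u) (hv : NoPotential v) : StaticLevel (u 0) := by
  set f := u 0 .phi (0, 0) with hfdef
  set P := u 0 .alphaPlus (0, 0) with hPdef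
  set M := u 0 .alphaMinus (0, 0) with hMdef
  have m0 : ((0, 0) : ℕ × ℤ) ∈ modes 0 0 := by simp [modes_zero_zero]
  have sf : ContDiffOn ℝ ∞ f 𝕀 := hu.smooth 0 .phi (0, 0) m0
  have sP : ContDiffOn ℝ ∞ P 𝕀 := hu.smooth 0 .alphaPlus (0, 0) m0
  have sM : ContDiffOn ℝ ∞ M 𝕀 := hu.smooth 0 .alphaMinus (0, 0) m0
  set y := nrm 0 (0, 0) with hy
  have hy0 : y ≠ 0 := nrm_ne_zero _ _
  let o : Sph := ⟨(1, 0), by simp⟩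
  have hY : Y 0 (0, 0) o = y := by rw [Y, sY_eq]; simp [gH, hy]
  have hk : kap ℂ 0 0 = 0 := by simp [kap]
  have m1 : modes 1 0 = ∅ := rfl
  have m2 : modes (-1) 0 = ∅ := rfl
  have hE := fun c t (ht : t ∈ 𝕀) => hu.eq 0 c t ht o
  have c1 : ∀ t, (coeff 0 (vals conjL u t o).φ = y * f t ∧
      coeff 0 (vals conjL u t o).φt = y * deriv f t) ∧
      (coeff 0 (vals conjL u t o).χ = conj y * conj (f t) ∧
      coeff 0 (vals conjL u t o).χt = conj y * conj (deriv f t)) ∧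
      (coeff 0 (vals conjL u t o).p = y * P t ∧ coeff 0 (vals conjL u t o).m = y * M t) ∧
      coeff 0 (vals conjL u t o).a0 = 0 ∧ coeff 0 (vals conjL u t o).a2 = 0 := fun t => by
    simp [vals, coeff_ser, modes_zero_zero, hY, hfdef, hPdef, hMdef, conjL_apply, m1, m2]
  have hw0 : ∀ t ∈ 𝕀, (1 - (t : ℂ) ^ 2) ≠ 0 := fun t ht => by exact_mod_cast (one_sub_sq_pos ht).ne'
  have D0 : ContinuousOn (fun t : ℝ => ((1 - (t : ℂ) ^ 2))⁻¹) 𝕀 := ContinuousOn.inv₀ (by fun_prop) hw0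
  have kf := sf.continuousOn
  have kP := sP.continuousOn
  have kM := sM.continuousOn
  have kcf : ContinuousOn (fun t => conj (f t)) 𝕀 :=
    Complex.continuous_conj.comp_continuousOn kf
  have key := eq_zero_of_coupled (f := deriv f) (P := P) (P' := deriv P) (M := M) (M' := deriv M)
    (a₁ := fun t => (1 - (t : ℂ) ^ 2)⁻¹ * (2 * t + coup q * (1 / 2 * y * P t * (1 - t)
      + 1 / 2 * y * M t * (1 + t))))
    (a₂ := fun t => (1 - (t : ℂ) ^ 2)⁻¹ * (q ^ 2 * f t * (1 / 2) * y ^ 2 * M t))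
    (b₁ := fun t => (1 - (t : ℂ) ^ 2)⁻¹ * (2 * t + 2))
    (b₂ := fun t => (1 - (t : ℂ) ^ 2)⁻¹ * (2 * q ^ 2 * y * conj y * f t * conj (f t)))
    (b₃ := fun t => (1 - (t : ℂ) ^ 2)⁻¹ * (coup q * (1 + t) * conj y * conj (f t)))
    (b₄ := fun t => (1 - (t : ℂ) ^ 2)⁻¹ * (-coup q * (1 + t) * conj y * f t))
    (c₁ := fun t => (1 - (t : ℂ) ^ 2)⁻¹ * (2 * t - 2))
    (c₂ := fun t => (1 - (t : ℂ) ^ 2)⁻¹ * (2 * q ^ 2 * y * conj y * f t * conj (f t)))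
    (c₃ := fun t => (1 - (t : ℂ) ^ 2)⁻¹ * (coup q * (1 - t) * conj y * conj (f t)))
    (c₄ := fun t => (1 - (t : ℂ) ^ 2)⁻¹ * (-coup q * (1 - t) * conj y * f t))
    (fun t ht => ?_) (fun t ht => hasDerivAt_of_contDiffOn sP ht) (fun t ht => ?_)
    (fun t ht => hasDerivAt_of_contDiffOn sM ht) (fun t ht => ?_)
    (by fun_prop)
    (hu.init_deriv 0 .phi (0, 0) m0)
    ((hu.init 0 .alphaPlus (0, 0) m0).trans (hv _ (by simp) _))
    (hu.init_deriv 0 .alphaPlus (0, 0) m0)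
    ((hu.init 0 .alphaMinus (0, 0) m0).trans (hv _ (by simp) _))
    (hu.init_deriv 0 .alphaMinus (0, 0) m0)
  · refine ⟨fun t ht => (key t ht).1, fun c hc k hk t ht => ?_⟩
    obtain ⟨hs, rfl⟩ := mem_modes_zero hk
    cases c with
    | phi => exact absurd rfl hc
    | alphaPlus => exact (key t ht).2.1
    | alphaMinus => exact (key t ht).2.2
    | alpha0 => simp [Component.weight] at hs
    | alpha2 => simp [Component.weight] at hs
  · refine (hasDerivAt_of_contDiffOn (contDiffOn_deriv sf) ht).congr_deriv ?_
    have hw := mul_inv_cancel₀ (hw0 t ht)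
    have E := hE .phi t ht
    simp only [Component.weight, modes_zero_zero, Finset.sum_singleton, hY, src, cubic, current, map_add,
      coeff_smul, coeff_zero_mul, c1, coeff_zero_xD, sing, hk,
      Component.drift, real_smul, smul_eq_mul, ← hfdef, Nat.cast_zero] at E
    push_cast at E
    apply mul_left_cancel₀ (mul_ne_zero hy0 (hw0 t ht))
    linear_combination E - y * ((2 * t + coup q * (1 / 2 * y * P t * (1 - t)
      + 1 / 2 * y * M t * (1 + t))) * deriv f t + (q ^ 2 * f t * (1 / 2) * y ^ 2 * M t) * P t) * hw
  · refine (hasDerivAt_of_contDiffOn (contDiffOn_deriv sP) ht).congr_deriv ?_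
    have hw := mul_inv_cancel₀ (hw0 t ht)
    have E := hE .alphaPlus t ht
    simp only [Component.weight, modes_zero_zero, Finset.sum_singleton, hY, src, cubic, current, map_add,
      coeff_smul, coeff_zero_mul, c1, coeff_zero_xD, sing, hk, Vals.comp,
      Component.drift, real_smul, smul_eq_mul, ← hPdef, Nat.cast_zero] at E
    push_cast at E
    apply mul_left_cancel₀ (mul_ne_zero hy0 (hw0 t ht))
    linear_combination E - y * ((2 * t + 2) * deriv P t + (2 * q ^ 2 * y * conj y * f t * conj (f t))
      * P t + (coup q * (1 + t) * conj y * conj (f t)) * deriv f t +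
      (-coup q * (1 + t) * conj y * f t) * conj (deriv f t)) * hw
  · refine (hasDerivAt_of_contDiffOn (contDiffOn_deriv sM) ht).congr_deriv ?_
    have hw := mul_inv_cancel₀ (hw0 t ht)
    have E := hE .alphaMinus t ht
    simp only [Component.weight, modes_zero_zero, Finset.sum_singleton, hY, src, cubic, current, map_add,
      coeff_smul, coeff_zero_mul, c1, coeff_zero_xD, sing, hk, Vals.comp,
      Component.drift, real_smul, smul_eq_mul, ← hMdef, Nat.cast_zero] at E
    push_cast at E
    apply mul_left_cancel₀ (mul_ne_zero hy0 (hw0 t ht))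
    linear_combination E - y * ((2 * t - 2) * deriv M t + (2 * q ^ 2 * y * conj y * f t * conj (f t))
      * M t + (coup q * (1 - t) * conj y * conj (f t)) * deriv f t +
      (-coup q * (1 - t) * conj y * f t) * conj (deriv f t)) * hw

theorem IsJetA.phi_zero {q : ℝ} {v : Coeffs ℂ} {u : Fam ℂ}
    (hu : IsJetA conjL q v u) (hv : NoPotential v) {τ : ℝ}
    (hτ : τ ∈ 𝕀) : u 0 .phi (0, 0) τ = v 0 .phi (0, 0) := by
  have m0 : ((0, 0) : ℕ × ℤ) ∈ modes 0 0 := by simp [modes_zero_zero]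
  have := eq_zero_of_norm_deriv_le (a := -1) (b := 1) (t₀ := 0)
    (z := fun t => u 0 .phi (0, 0) t - v 0 .phi (0, 0)) (K := fun _ => 0)
    (fun t ht => (hasDerivAt_of_contDiffOn (hu.smooth 0 .phi (0, 0) m0) ht).sub_const _)
    continuousOn_const (fun t ht => by rw [(hu.staticLevel hv).phi t ht]; simp) (by simp)
    (sub_eq_zero.mpr (hu.init 0 .phi (0, 0) m0)) τ hτ
  exact sub_eq_zero.mp this

/-- Solution jets of order at most `N` are determined by the data of order at most `N`. -/
theorem IsJetA.unique {q : ℝ} {v v' : Coeffs ℂ} {u u' : Fam ℂ}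
    (hu : IsJetA conjL q v u) (hu' : IsJetA conjL q v' u')
    (hv : NoPotential v) (hv' : NoPotential v')
    {N : ℕ} (hvv : ∀ n ≤ N, ∀ c, ∀ k ∈ modes c.weight n, v n c k = v' n c k) (n : ℕ) (hnN : n ≤ N)
    (c : Component) : ∀ k ∈ modes c.weight n, EqOn (u n c k) (u' n c k) 𝕀 := by
  induction n using Nat.strong_induction_on generalizing c with
  | _ n ih' =>
    have ih : ∀ m < n, ∀ c, ∀ k ∈ modes c.weight m, EqOn (u m c k) (u' m c k) 𝕀 :=
      fun m hm => ih' m hm (hm.le.trans hnN)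
    have hfin : ∀ c, ∀ κ : ℂ, ∀ k ∈ modes c.weight n, (∀ τ ∈ 𝕀,
        sing (2 * (n - 1)) (-2 * c.drift) (kap ℂ n k.1 + κ) (u n c k) τ =
        sing (2 * (n - 1)) (-2 * c.drift) (kap ℂ n k.1 + κ) (u' n c k) τ) →
        EqOn (u n c k) (u' n c k) 𝕀 := fun c κ k hk h =>
      sing_unique (hu.smooth n c k hk) (hu'.smooth n c k hk) h
        (((hu.init n c k hk).trans (hvv n hnN c k hk)).trans (hu'.init n c k hk).symm)
        ((hu.init_deriv n c k hk).trans (hu'.init_deriv n c k hk).symm)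
    rcases eq_or_ne n 0 with rfl | hn
    · intro k hk τ hτ
      by_cases hc : c = .phi
      · subst hc
        obtain ⟨-, rfl⟩ := mem_modes_zero hk
        rw [hu.phi_zero hv hτ, hu'.phi_zero hv' hτ, hvv 0 hnN .phi (0, 0) hk]
      · rw [(hu.staticLevel hv).zero c hc k hk τ hτ, (hu'.staticLevel hv').zero c hc k hk τ hτ]
    have hphi : ∀ k ∈ modes 0 n, EqOn (u n .phi k) (u' n .phi k) 𝕀 := by
      intro k hk
      refine hfin .phi 0 k hk fun τ hτ => ?_
      rw [add_zero]
      refine expansion_injective (s := 0) (n := n)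
        (v := fun k => sing (2 * (n - 1)) (-2 * Component.phi.drift) (kap ℂ n k.1) (u n .phi k) τ)
        (v' := fun k => sing (2 * (n - 1)) (-2 * Component.phi.drift) (kap ℂ n k.1) (u' n .phi k) τ)
        (fun o => ?_) k hk
      have e1 := hu.eq n .phi τ hτ o
      have e2 := hu'.eq n .phi τ hτ o
      rw [coeff_src_phi_congr hn (agreePhi_vals (fun m hm k hk => ih m hm .phi k hk) hτ o)
        (fun c => cong_vals_comp (fun m hm k hk => ih m hm c k hk) hτ o)
        ((hu.staticLevel hv).static hτ o).1] at e1
      exact e1.trans e2.symm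
    by_cases hc : c = .phi
    · subst hc; exact hphi
    intro k hk
    set a := v 0 .phi (0, 0)
    refine hfin c ((2 * q ^ 2 : ℂ) • ((nrm 0 (0, 0) • a) * (conj (nrm 0 (0, 0)) • conjL a))) k hk
      fun τ hτ => ?_
    refine expansion_injective (s := c.weight) (n := n)
      (v := fun k => sing (2 * (n - 1)) (-2 * c.drift) (kap ℂ n k.1 + _) (u n c k) τ)
      (v' := fun k => sing (2 * (n - 1)) (-2 * c.drift) (kap ℂ n k.1 + _) (u' n c k) τ)
      (fun o => ?_) k hk
    have e1 := hu.eq n c τ hτ o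
    have e2 := hu'.eq n c τ hτ o
    have h0 := coeff_zero_vals (σ := conjL) u τ o
    have hag : AgreePhi (n + 1) (vals conjL u τ o) (vals conjL u' τ o) :=
      agreePhi_vals (fun m hm k' hk' => by
        rcases Nat.lt_succ_iff_lt_or_eq.mp hm with hm | hm
        · exact ih m hm .phi k' hk'
        · subst hm
          exact hphi k' hk') hτ o
    rw [coeff_src_congr hag hc (cong_vals_comp (fun m hm k hk => ih m hm c k hk) hτ o),
      h0.1, h0.2, hu.phi_zero hv hτ, vals_comp, vals_comp, coeff_ser, coeff_ser, ← e2] at e1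
    set K : ℂ := (2 * q ^ 2 : ℂ) • ((nrm 0 (0, 0) • a) * (conj (nrm 0 (0, 0)) • conjL a)) with hK
    have hs : ∀ (β γ : ℝ) (κ : ℂ) (f : ℝ → ℂ), sing β γ (κ + K) f τ =
        sing β γ κ f τ - K * f τ := by
      intro β γ κ f
      simp only [sing]
      ring
    simp only [hs, smul_eq_mul] at e1 ⊢
    simp only [mul_sub, sum_sub_distrib] at e1 ⊢
    have hf : ∀ f : ℕ × ℤ → ℝ → ℂ, ∑ k ∈ modes c.weight n, Y c.weight k o * (K * f k τ) =
        K * ∑ k ∈ modes c.weight n, Y c.weight k o * f k τ := fun f => by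
      rw [mul_sum]
      exact sum_congr rfl fun k _ => by ring
    rw [hf, hf, hK, smul_eq_mul, smul_eq_mul, smul_eq_mul]
    linear_combination e1

end UniqueC

/-! ### Solution jets as jets with values in `ℂ` -/

section Bridge

open PowerSeries (coeff coeff_mk coeff_smul coeff_map coeff_C_mul)

/-- Evaluation of a series at a point of the cylinder. -/
def evS (τ : ℝ) (o : Sph) : PowerSeries Fn →+* PowerSeries ℂ :=
  PowerSeries.map (((Pi.evalRingHom (fun _ : ℂ => ℂ) o.1.2).comp
    (Pi.evalRingHom (fun _ : ℂ => ℂ → ℂ) o.1.1)).comp (Pi.evalRingHom (fun _ : ℝ => ℂ → ℂ → ℂ) τ))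

theorem coeff_evS (τ : ℝ) (o : Sph) (F : PowerSeries Fn) (n : ℕ) :
    coeff n (evS τ o F) = coeff n F τ o.1.1 o.1.2 := by
  rw [evS, coeff_map]; rfl

theorem eqOnCylinder_iff {F G : PowerSeries Fn} :
    EqOnCylinder F G ↔ ∀ τ ∈ 𝕀, ∀ o : Sph, evS τ o F = evS τ o G := by
  constructor
  · intro h τ hτ o
    ext n
    rw [coeff_evS, coeff_evS, h n τ _ _ hτ.1 hτ.2 o.2]
  · intro h n τ z w h1 h2 h3
    have := h τ ⟨h1, h2⟩ ⟨(z, w), h3⟩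
    have := congrArg (coeff n) this
    rwa [coeff_evS, coeff_evS] at this

theorem evS_smul (τ : ℝ) (o : Sph) (a : ℂ) (F : PowerSeries Fn) :
    evS τ o (a • F) = a • evS τ o F := by
  ext n
  rw [coeff_evS, coeff_smul, coeff_smul, coeff_evS]
  rfl

theorem evS_dR (τ : ℝ) (o : Sph) (F : PowerSeries Fn) :
    evS τ o (dR F) = PowerSeries.derivative ℂ (evS τ o F) := by
  ext n
  rw [coeff_evS, PowerSeries.coeff_derivative, coeff_evS, dR, PowerSeries.coeff_derivative]
  rfl

theorem evS_rho (τ : ℝ) (o : Sph) : evS τ o rho = PowerSeries.X := PowerSeries.map_X _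

theorem X_mul_derivative (F : PowerSeries ℂ) :
    PowerSeries.X * PowerSeries.derivative ℂ F = xD F := rfl

theorem evS_tau (τ : ℝ) (o : Sph) : evS τ o tau = PowerSeries.C (τ : ℂ) := by
  rw [evS, tau, PowerSeries.map_C]; rfl

/-- The field with given coefficients and angular dependence. -/
def fieldG (s : ℤ) (h : ℕ × ℤ → ℂ → ℂ → ℂ) (c : ℕ → ℕ × ℤ → ℝ → ℂ) : PowerSeries Fn :=
  PowerSeries.mk fun n => fun τ z w =>
    (n.factorial : ℂ)⁻¹ * ∑ k ∈ modes s n, c n k τ * h k z w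

theorem field_eq (s : ℤ) (c : ℕ → ℕ × ℤ → ℝ → ℂ) :
    field s c = fieldG s (fun k => sY s k.1 k.2) c := rfl

theorem evS_fieldG (s : ℤ) (h : ℕ × ℤ → ℂ → ℂ → ℂ) (c : ℕ → ℕ × ℤ → ℝ → ℂ) (τ : ℝ) (o : Sph) :
    evS τ o (fieldG s h c) =
      ser s (fun k => h k o.1.1 o.1.2) fun n k => (n.factorial : ℂ)⁻¹ * c n k τ := by
  ext n
  rw [coeff_evS, coeff_ser, fieldG, coeff_mk, mul_sum]
  exact sum_congr rfl fun k _ => by rw [smul_eq_mul]; ring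

theorem lift_fieldG {s : ℤ} {h e b : ℕ × ℤ → ℂ → ℂ → ℂ}
    (H : ∀ n, ∀ k ∈ modes s n, HasEth (h k) (e k) (b k)) (c : ℕ → ℕ × ℤ → ℝ → ℂ) :
    lift eth (fieldG s h c) = fieldG s e c ∧ lift ethBar (fieldG s h c) = fieldG s b c := by
  have key : ∀ n τ, HasEth (coeff n (fieldG s h c) τ) (coeff n (fieldG s e c) τ)
      (coeff n (fieldG s b c) τ) := by
    intro n τ
    simp only [fieldG, coeff_mk]
    exact (HasEth.sum fun k hk => (H n k hk).const_mul (c n k τ)).const_mul _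
  constructor
  · ext n τ z w
    rw [lift, coeff_mk]
    exact ((key n τ).eth_eq z w).1
  · ext n τ z w
    rw [lift, coeff_mk]
    exact ((key n τ).eth_eq z w).2

theorem cj_fieldG (s : ℤ) (h : ℕ × ℤ → ℂ → ℂ → ℂ) (c : ℕ → ℕ × ℤ → ℝ → ℂ) :
    cj (fieldG s h c) = fieldG s (fun k z w => conj (h k z w)) fun n k τ => conj (c n k τ) := by
  ext n τ z w
  rw [cj, coeff_map]
  simp only [fieldG, coeff_mk]
  change conj _ = _
  simp [map_mul, map_sum]

theorem EqOnCylinder.dT {F G : PowerSeries Fn} (h : EqOnCylinder F G) :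
    EqOnCylinder (dT F) (dT G) := by
  intro n τ z w h1 h2 h3
  simp only [MaxwellScalar.dT, lift, coeff_mk, dtau]
  exact (Filter.eventuallyEq_of_mem (isOpen_Ioo.mem_nhds ⟨h1, h2⟩)
    fun t ht => h n t z w ht.1 ht.2 h3).deriv_eq

theorem dT_fieldG {s : ℤ} {h : ℕ × ℤ → ℂ → ℂ → ℂ} {c : ℕ → ℕ × ℤ → ℝ → ℂ}
    (hc : ∀ n, ∀ k ∈ modes s n, ContDiffOn ℝ ∞ (c n k) 𝕀) :
    EqOnCylinder (dT (fieldG s h c)) (fieldG s h fun n k => deriv (c n k)) := by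
  intro n τ z w h1 h2 h3
  simp only [MaxwellScalar.dT, lift, coeff_mk, dtau, fieldG]
  exact (HasDerivAt.const_mul _ (HasDerivAt.fun_sum fun k hk =>
    (hasDerivAt_of_contDiffOn (hc n k hk) ⟨h1, h2⟩).mul_const _)).deriv

theorem dT_dT_fieldG {s : ℤ} {h : ℕ × ℤ → ℂ → ℂ → ℂ} {c : ℕ → ℕ × ℤ → ℝ → ℂ}
    (hc : ∀ n, ∀ k ∈ modes s n, ContDiffOn ℝ ∞ (c n k) 𝕀) :
    EqOnCylinder (dT (dT (fieldG s h c))) (fieldG s h fun n k => deriv (deriv (c n k))) := by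
  have h1 := (dT_fieldG (h := h) hc).dT
  have h2 := dT_fieldG (s := s) (h := h) (c := fun n k => deriv (c n k))
    fun n k hk => contDiffOn_deriv (hc n k hk)
  exact fun n τ z w a b d => (h1 n τ z w a b d).trans (h2 n τ z w a b d)

theorem deriv_const_mul' (a : ℂ) (f : ℝ → ℂ) (τ : ℝ) :
    deriv (fun t => a * f t) τ = a * deriv f τ := by
  simp [deriv_const_mul_field]

/-- The left hand side of the equation for a component, without the lower order terms. -/
def waveSer (s : ℤ) (γ : ℝ) (u : ℕ → ℕ × ℤ → ℝ → ℂ) (τ : ℝ) (o : Sph) : PowerSeries ℂ :=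
  PowerSeries.mk fun n => ∑ k ∈ modes s n, Y s k o • sing (2 * (n - 1)) γ (kap ℂ n k.1) (u n k) τ

theorem evS_box {s : ℤ} {c : ℕ → ℕ × ℤ → ℝ → ℂ}
    (hc : ∀ n, ∀ k ∈ modes s n, ContDiffOn ℝ ∞ (c n k) 𝕀) {τ : ℝ}
    (hτ : τ ∈ 𝕀) (o : Sph) :
    evS τ o (box (field s c)) + (s ^ 2 : ℂ) • evS τ o (field s c) =
      waveSer s 0 (fun n k t => (n.factorial : ℂ)⁻¹ * c n k t) τ o := by
  choose! e b e' b' H using fun k : ℕ × ℤ => exists_hasEth_ethY (s := s) (k := k)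
  have hk : ∀ n, ∀ k ∈ modes s n, s.natAbs ≤ k.1 := fun n k hk => (mem_modes.mp hk).1
  obtain ⟨l1, l2⟩ := lift_fieldG (fun n k _ => hasEth_sY s k) c
  obtain ⟨-, l3⟩ := lift_fieldG (fun n k h => (H k (hk n k h)).1) c
  obtain ⟨l4, -⟩ := lift_fieldG (fun n k h => (H k (hk n k h)).2.1) c
  rw [← field_eq] at l1 l2
  have d1 := eqOnCylinder_iff.mp (dT_fieldG (h := fun k => sY s k.1 k.2) hc) τ hτ o
  have d2 := eqOnCylinder_iff.mp (dT_dT_fieldG (h := fun k => sY s k.1 k.2) hc) τ hτ o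
  rw [← field_eq] at d1 d2
  have r1 : 2 * tau * rho * dR (dT (field s c)) = 2 * tau * (rho * dR (dT (field s c))) := by ring
  have r2 : ∀ F : PowerSeries Fn, rho ^ 2 * dR (dR F) = rho * dR (rho * dR F) - rho * dR F := by
    intro F
    have : dR (rho * dR F) = dR F + rho * dR (dR F) := by
      simp only [dR, rho, Derivation.leibniz, PowerSeries.derivative_X, smul_eq_mul]
      ring
    rw [this]; ring
  rw [box, l1, l2, l3, l4, r1, r2]
  simp only [map_add, map_sub, map_mul, map_pow, map_one, map_ofNat, evS_smul, evS_dR,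
    evS_rho, evS_tau, X_mul_derivative, d1, d2, evS_fieldG]
  ext n
  have c1 : ∀ (a : ℂ) (F : PowerSeries ℂ), coeff n ((1 - PowerSeries.C a ^ 2) * F) =
      (1 - a ^ 2) * coeff n F := fun a F => by
    rw [← map_pow, ← map_one (PowerSeries.C (R := ℂ)), ← map_sub, coeff_C_mul]
  have c2 : ∀ (a : ℂ) (F : PowerSeries ℂ), coeff n (2 * PowerSeries.C a * F) =
      2 * a * coeff n F := fun a F => by
    rw [← map_ofNat (PowerSeries.C (R := ℂ)), ← map_mul, coeff_C_mul]
  simp only [map_add, map_sub, coeff_smul, c1, c2, coeff_xD, field_eq, evS_fieldG,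
    coeff_ser, waveSer, coeff_mk, smul_eq_mul, mul_sum,
    ← sum_add_distrib, ← sum_sub_distrib]
  refine sum_congr rfl fun k h => ?_
  have hh := (H k (hk n k h)).2.2 o.1.1 o.1.2
  have e1 : deriv (fun t => (n.factorial : ℂ)⁻¹ * c n k t) =
      fun t => (n.factorial : ℂ)⁻¹ * deriv (c n k) t := funext fun t => deriv_const_mul' _ _ t
  rw [sing, e1, deriv_const_mul', kap, real_smul, real_smul, Y]
  simp only [Algebra.algebraMap_self, RingHom.id_apply]
  push_cast
  linear_combination (n.factorial : ℂ)⁻¹ * c n k τ * hh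

end Bridge

section Bridge

open PowerSeries (coeff coeff_mk coeff_C_mul C X derivative smul_eq_C_mul)

/-- The coefficients of the Taylor expansion in `ρ` which belongs to a sequence of jets. -/
def Jets.fam (J : Jets) : Fam ℂ := fun n c k τ => (n.factorial : ℂ)⁻¹ * J.elt c n k τ

/-- Smoothness of the coefficients of all orders. -/
def SmoothFam (s : ℤ) (c : ℕ → ℕ × ℤ → ℝ → ℂ) : Prop :=
  ∀ n, ∀ k ∈ modes s n, ContDiffOn ℝ ∞ (c n k) 𝕀

structure Jets.Smooth (J : Jets) : Prop where
  phi : SmoothFam 0 J.phi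
  alpha : SmoothFam 0 J.alpha
  alpha1 : SmoothFam 0 J.alpha1
  alpha0 : SmoothFam 1 J.alpha0
  alpha2 : SmoothFam (-1) J.alpha2

theorem sing_comb {f g : ℝ → ℂ} (hf : ContDiffOn ℝ ∞ f 𝕀)
    (hg : ContDiffOn ℝ ∞ g 𝕀) (β γ : ℝ) (κ a b : ℂ) {τ : ℝ} (hτ : τ ∈ 𝕀) :
    sing β γ κ (fun t => a * f t + b * g t) τ = a * sing β γ κ f τ + b * sing β γ κ g τ := by
  have h1 : ∀ t ∈ 𝕀, deriv (fun t => a * f t + b * g t) t =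
      a * deriv f t + b * deriv g t := fun t ht =>
    (((hasDerivAt_of_contDiffOn hf ht).const_mul a).add
      ((hasDerivAt_of_contDiffOn hg ht).const_mul b)).deriv
  have h2 : deriv (deriv (fun t => a * f t + b * g t)) τ =
      a * deriv (deriv f) τ + b * deriv (deriv g) τ := by
    rw [(Filter.eventuallyEq_of_mem (isOpen_Ioo.mem_nhds hτ) h1).deriv_eq]
    exact (((hasDerivAt_of_contDiffOn (contDiffOn_deriv hf) hτ).const_mul a).add
      ((hasDerivAt_of_contDiffOn (contDiffOn_deriv hg) hτ).const_mul b)).deriv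
  rw [sing, h1 τ hτ, h2, sing, sing]
  simp only [real_smul]
  ring

/-- The values of the fields of a jet at a point. -/
theorem evS_field_eq (s : ℤ) (c : ℕ → ℕ × ℤ → ℝ → ℂ) (τ : ℝ) (o : Sph) :
    evS τ o (field s c) = ser s (fun k => Y s k o) fun n k => (n.factorial : ℂ)⁻¹ * c n k τ := by
  rw [field_eq, evS_fieldG]; rfl

structure PhiVals (F : PowerSeries Fn) (V : Vals ℂ) (τ : ℝ) (o : Sph) : Prop where
  φ : evS τ o F = V.φ
  φt : evS τ o (dT F) = V.φt
  eφ : evS τ o (lift eth F) = V.eφ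
  bφ : evS τ o (lift ethBar F) = V.bφ
  χ : evS τ o (cj F) = V.χ
  χt : evS τ o (dT (cj F)) = V.χt
  eχ : evS τ o (lift eth (cj F)) = V.eχ
  bχ : evS τ o (lift ethBar (cj F)) = V.bχ

theorem Jets.phiVals {J : Jets} (hJ : SmoothFam 0 J.phi) {τ : ℝ} (hτ : τ ∈ 𝕀)
    (o : Sph) : PhiVals (field 0 J.phi) (vals conjL J.fam τ o) τ o := by
  have l := lift_fieldG (s := 0) (fun n k _ => hasEth_sY 0 k) J.phi
  have lc := lift_fieldG (s := 0) (fun n k _ => (hasEth_sY 0 k).conj) fun n k t => conj (J.phi n k t)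
  rw [← field_eq] at l
  have hc := cj_fieldG 0 (fun k => sY 0 k.1 k.2) J.phi
  rw [← field_eq] at hc
  have sc : SmoothFam 0 fun n k t => conj (J.phi n k t) := fun n k hk =>
    Complex.conjCLE.contDiff.comp_contDiffOn (hJ n k hk)
  have hd : ∀ n k, deriv (J.fam n .phi k) τ = (n.factorial : ℂ)⁻¹ * deriv (J.phi n k) τ :=
    fun n k => deriv_const_mul' _ _ _
  refine ⟨evS_field_eq _ _ _ _, ?_, ?_, ?_, ?_, ?_, ?_, ?_⟩
  · rw [field_eq, eqOnCylinder_iff.mp (dT_fieldG hJ) τ hτ o, evS_fieldG]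
    simp only [vals, hd]
    rfl
  · rw [l.1, evS_fieldG]; rfl
  · rw [l.2, evS_fieldG]; rfl
  · rw [hc, evS_fieldG]
    simp only [vals, conjL_apply, Jets.fam, map_mul, map_inv₀, Complex.conj_natCast]
    rfl
  · rw [hc, eqOnCylinder_iff.mp (dT_fieldG sc) τ hτ o, evS_fieldG]
    simp only [vals, conjL_apply, hd, map_mul, map_inv₀, Complex.conj_natCast]
    ext n
    rw [coeff_ser, coeff_ser]
    refine sum_congr rfl fun k hk => ?_
    rw [(hasDerivAt_conj_comp (hasDerivAt_of_contDiffOn (hJ n k hk) hτ)).deriv]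
    rfl
  · rw [hc, lc.1, evS_fieldG]
    simp only [vals, conjL_apply, Jets.fam, map_mul, map_inv₀, Complex.conj_natCast]
    rfl
  · rw [hc, lc.2, evS_fieldG]
    simp only [vals, conjL_apply, Jets.fam, map_mul, map_inv₀, Complex.conj_natCast]
    rfl

/-- The left hand side of the equation of a component of a jet. -/
def wave (u : Fam ℂ) (τ : ℝ) (o : Sph) (c : Component) : PowerSeries ℂ :=
  waveSer c.weight (-2 * c.drift) (fun n k => u n c k) τ o

theorem Jets.wave_eq {J : Jets} (hJ : J.Smooth) {τ : ℝ} (hτ : τ ∈ 𝕀) (o : Sph) :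
    evS τ o (box (field 0 J.phi)) = wave J.fam τ o .phi ∧
    evS τ o (box (field 0 J.alpha) - 4 * dT (field 0 J.alpha1)) +
      2 * evS τ o (box (field 0 J.alpha1) - dT (field 0 J.alpha)) = wave J.fam τ o .alphaPlus ∧
    evS τ o (box (field 0 J.alpha) - 4 * dT (field 0 J.alpha1)) -
      2 * evS τ o (box (field 0 J.alpha1) - dT (field 0 J.alpha)) = wave J.fam τ o .alphaMinus ∧
    evS τ o (box (field 1 J.alpha0) + field 1 J.alpha0) = wave J.fam τ o .alpha0 ∧
    evS τ o (box (field (-1) J.alpha2) + field (-1) J.alpha2) = wave J.fam τ o .alpha2 := by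
  have b := evS_box hJ.phi hτ o
  have ba := evS_box hJ.alpha hτ o
  have b1 := evS_box hJ.alpha1 hτ o
  have b0 := evS_box hJ.alpha0 hτ o
  have b2 := evS_box hJ.alpha2 hτ o
  have da := eqOnCylinder_iff.mp (dT_fieldG (h := fun k => sY 0 k.1 k.2) hJ.alpha) τ hτ o
  have d1 := eqOnCylinder_iff.mp (dT_fieldG (h := fun k => sY 0 k.1 k.2) hJ.alpha1) τ hτ o
  rw [← field_eq, ← field_eq, evS_field_eq] at da d1
  simp only [Int.cast_zero, Int.cast_one, Int.cast_neg, ne_eq, OfNat.ofNat_ne_zero, not_false_eq_true,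
    zero_pow, zero_smul, add_zero, one_pow, even_two, Even.neg_pow, one_smul] at b ba b1 b0 b2
  have key : ∀ (s : ℝ) (n : ℕ), ∀ k ∈ modes 0 n,
      sing (2 * (n - 1)) (-2 * s) (kap ℂ n k.1)
        (fun t => (n.factorial : ℂ)⁻¹ * (J.alpha n k t + 2 * s * J.alpha1 n k t)) τ =
      sing (2 * (n - 1)) 0 (kap ℂ n k.1) (fun t => (n.factorial : ℂ)⁻¹ * J.alpha n k t) τ
      - 4 * s ^ 2 * ((n.factorial : ℂ)⁻¹ * deriv (J.alpha1 n k) τ) + 2 * s *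
      (sing (2 * (n - 1)) 0 (kap ℂ n k.1) (fun t => (n.factorial : ℂ)⁻¹ * J.alpha1 n k t) τ
      - (n.factorial : ℂ)⁻¹ * deriv (J.alpha n k) τ) := by
    intro s n k hk
    have h1 := hJ.alpha n k hk
    have h2 := hJ.alpha1 n k hk
    have e1 := sing_comb h1 h2 (2 * (n - 1)) (-2 * s) (kap ℂ n k.1) (n.factorial : ℂ)⁻¹
      ((n.factorial : ℂ)⁻¹ * (2 * s)) hτ
    have e2 := sing_comb h1 h2 (2 * (n - 1)) 0 (kap ℂ n k.1) (n.factorial : ℂ)⁻¹ 0 hτ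
    have e3 := sing_comb h1 h2 (2 * (n - 1)) 0 (kap ℂ n k.1) 0 (n.factorial : ℂ)⁻¹ hτ
    simp only [zero_mul, add_zero, zero_add] at e2 e3
    rw [e2, e3]
    have : (fun t => (n.factorial : ℂ)⁻¹ * (J.alpha n k t + 2 * s * J.alpha1 n k t)) =
        fun t => (n.factorial : ℂ)⁻¹ * J.alpha n k t +
          (n.factorial : ℂ)⁻¹ * (2 * s) * J.alpha1 n k t := by
      funext t; ring
    rw [this, e1]
    simp only [sing, real_smul]
    push_cast
    ring
  have c2 : ∀ (n : ℕ) (F : PowerSeries ℂ), coeff n (2 * F) = 2 * coeff n F := fun n F => by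
    rw [← map_ofNat (C (R := ℂ)), coeff_C_mul]
  have c4 : ∀ (n : ℕ) (F : PowerSeries ℂ), coeff n (4 * F) = 4 * coeff n F := fun n F => by
    rw [← map_ofNat (C (R := ℂ)), coeff_C_mul]
  refine ⟨b.trans ?_, ?plus, ?minus, ?_, ?_⟩
  case' plus => have key := key 1
  case' minus => have key := key (-1)
  case plus | minus =>
    simp only [map_sub, map_mul, map_ofNat, ba, b1, da, d1]
    ext n
    simp only [map_add, map_sub, c2, c4, wave, waveSer, coeff_mk, coeff_ser, mul_sum, ← sum_add_distrib,
      ← sum_sub_distrib, smul_eq_mul]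
    refine sum_congr rfl fun k hk => ?_
    have := key n k hk
    simp only [Complex.ofReal_neg, ofReal_one, mul_neg, mul_one, neg_mul, ← sub_eq_add_neg] at this
    simp only [Component.drift, Component.weight, mul_neg, mul_one]
    refine Eq.trans ?_ (congrArg (Y 0 k o * ·) this.symm)
    ring
  · simp only [wave, Component.drift, mul_zero]
    rfl
  · rw [map_add, b0]
    simp only [wave, Component.drift, mul_zero]
    rfl
  · rw [map_add, b2]
    simp only [wave, Component.drift, mul_zero]
    rfl

theorem Jets.src_eq {J : Jets} (hJ : J.Smooth) (q : ℝ) {τ : ℝ} (hτ : τ ∈ 𝕀) (o : Sph)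
    {φ α α₁ α₀ α₂ : PowerSeries Fn} (hφ : φ = field 0 J.phi) (hα : α = field 0 J.alpha)
    (hα₁ : α₁ = field 0 J.alpha1) (hα₀ : α₀ = field 1 J.alpha0) (hα₂ : α₂ = field (-1) J.alpha2) :
    (evS τ o ((q ^ 2 : ℂ) • (φ * ((1 / 2 : ℂ) • α ^ 2 - 2 * α₁ ^ 2 + 2 * α₀ * α₂))
      + (I * Real.sqrt 2 * q) •
        (2 * α₁ * rho * dR φ + α * dT φ - 2 * tau * α₁ * dT φ
          + α₀ * lift ethBar φ - α₂ * lift eth φ)) = src q τ (vals conjL J.fam τ o) .phi) ∧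
    (evS τ o ((2 * q ^ 2 : ℂ) • (α * (φ * cj φ))
      + (I * Real.sqrt 2 * q) • (dT φ * cj φ - dT (cj φ) * φ)) +
    2 * evS τ o ((2 * q ^ 2 : ℂ) • (α₁ * (φ * cj φ))
      + (I * q / Real.sqrt 2) • (rho * (φ * dR (cj φ) - cj φ * dR φ))
      + (I * q / Real.sqrt 2) • (tau * (cj φ * dT φ - φ * dT (cj φ)))) =
        src q τ (vals conjL J.fam τ o) .alphaPlus) ∧
    (evS τ o ((2 * q ^ 2 : ℂ) • (α * (φ * cj φ))
      + (I * Real.sqrt 2 * q) • (dT φ * cj φ - dT (cj φ) * φ)) -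
    2 * evS τ o ((2 * q ^ 2 : ℂ) • (α₁ * (φ * cj φ))
      + (I * q / Real.sqrt 2) • (rho * (φ * dR (cj φ) - cj φ * dR φ))
      + (I * q / Real.sqrt 2) • (tau * (cj φ * dT φ - φ * dT (cj φ)))) =
        src q τ (vals conjL J.fam τ o) .alphaMinus) ∧
    (evS τ o ((2 * q ^ 2 : ℂ) • (α₀ * (φ * cj φ))
      + (I * q / Real.sqrt 2) • (φ * lift eth (cj φ) - cj φ * lift eth φ)) =
        src q τ (vals conjL J.fam τ o) .alpha0) ∧
    (evS τ o ((2 * q ^ 2 : ℂ) • (α₂ * (φ * cj φ))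
      + (I * q / Real.sqrt 2) • (cj φ * lift ethBar φ - φ * lift ethBar (cj φ))) =
        src q τ (vals conjL J.fam τ o) .alpha2) := by
  have h := J.phiVals hJ.phi hτ o
  rw [← hφ] at h
  have h0 : evS τ o α₀ = (vals conjL J.fam τ o).a0 := by rw [hα₀, evS_field_eq]; rfl
  have h2 : evS τ o α₂ = (vals conjL J.fam τ o).a2 := by rw [hα₂, evS_field_eq]; rfl
  have hp : (vals conjL J.fam τ o).p = evS τ o α + 2 * evS τ o α₁ := by
    rw [hα, hα₁, evS_field_eq, evS_field_eq]
    ext n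
    rw [map_add, ← map_ofNat (C (R := ℂ)), coeff_C_mul]
    simp only [vals, coeff_ser, mul_sum, ← sum_add_distrib, smul_eq_mul, Jets.fam,
      Jets.elt]
    exact sum_congr rfl fun k _ => by ring
  have hm : (vals conjL J.fam τ o).m = evS τ o α - 2 * evS τ o α₁ := by
    rw [hα, hα₁, evS_field_eq, evS_field_eq]
    ext n
    rw [map_sub, ← map_ofNat (C (R := ℂ)), coeff_C_mul]
    simp only [vals, coeff_ser, mul_sum, ← sum_sub_distrib, smul_eq_mul, Jets.fam,
      Jets.elt]
    exact sum_congr rfl fun k _ => by ring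
  have hI : I * q / Real.sqrt 2 = coup q / 2 := by
    have h2 := ofReal_sqrt_two_sq
    have : ((Real.sqrt 2 : ℝ) : ℂ) ≠ 0 := fun h => by rw [h] at h2; norm_num at h2
    rw [coup]
    field_simp
    linear_combination -q * h2
  have hc : I * Real.sqrt 2 * q = coup q := rfl
  have half : (2 : PowerSeries ℂ) * C (1 / 2 : ℂ) = 1 := by
    rw [← map_ofNat (C (R := ℂ)), ← map_mul]; norm_num
  have cs : ∀ a b : ℂ, (C (a - b) : PowerSeries ℂ) = C a - C b :=
    fun a b => map_sub _ _ _
  have ca : ∀ a b : ℂ, (C (a + b) : PowerSeries ℂ) = C a + C b :=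
    fun a b => map_add _ _ _
  have cneg : (C (-1 : ℂ)) = (-1 : PowerSeries ℂ) := by rw [map_neg, map_one]
  have ch : (C (coup q / 2) : PowerSeries ℂ) =
      C (coup q) * C (1 / 2) := by rw [← map_mul]; congr 1; ring
  have c1 : (C (1 : ℂ)) = (1 : PowerSeries ℂ) := map_one _
  rw [hI, hc]
  simp only [src, cubic, current, Vals.comp, hp, hm, map_add, map_sub, map_mul, map_pow, map_ofNat,
    evS_smul, evS_dR, evS_rho, evS_tau, h.φ, h.φt, h.eφ, h.bφ, h.χ, h.χt, h.eχ, h.bχ, h0, h2, xD,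
    smul_eq_C_mul, ch, cneg, c1, Complex.ofReal_sub, Complex.ofReal_add,
    ofReal_one]
  set V := vals conjL J.fam τ o
  set a := evS τ o α
  set b := evS τ o α₁
  set T : PowerSeries ℂ := C (τ : ℂ)
  set K : PowerSeries ℂ := C (coup q)
  set x : PowerSeries ℂ := X
  set D := derivative ℂ
  refine ⟨?_, ?_, ?_, ?_, ?_⟩
  · linear_combination (2 * C (q : ℂ) ^ 2 * V.φ * b ^ 2 -
      K * (2 * b * x * D V.φ + a * V.φt - 2 * T * b * V.φt)) * half
  · linear_combination K * (x * (V.φ * D V.χ - V.χ * D V.φ) + T * (V.χ * V.φt - V.φ * V.χt)) * half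
  · linear_combination -K * (x * (V.φ * D V.χ - V.χ * D V.φ) + T * (V.χ * V.φt - V.φ * V.χt)) * half
  · ring
  · ring

theorem Jets.system_iff {J : Jets} (hJ : J.Smooth) (q : ℝ) :
    System q (field 0 J.phi) (field 0 J.alpha) (field 0 J.alpha1) (field 1 J.alpha0)
      (field (-1) J.alpha2) ↔ ∀ τ ∈ 𝕀, ∀ o c,
        wave J.fam τ o c = src q τ (vals conjL J.fam τ o) c := by
  have two : ∀ F : PowerSeries ℂ, F = (1 / 2 : ℂ) • (2 * F) := fun F => by
    rw [two_mul, smul_add, ← add_smul]; norm_num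
  have four : ∀ F : PowerSeries ℂ, F = (1 / 4 : ℂ) • (4 * F) := fun F => by
    rw [show (4 : PowerSeries ℂ) * F = F + F + F + F by ring, smul_add, smul_add, smul_add,
      ← add_smul, ← add_smul, ← add_smul]
    norm_num
  constructor
  · intro h τ hτ o c
    obtain ⟨w1, w2, w3, w4, w5⟩ := J.wave_eq hJ hτ o
    obtain ⟨s1, s2, s3, s4, s5⟩ := J.src_eq hJ q hτ o rfl rfl rfl rfl rfl
    have e1 := eqOnCylinder_iff.mp h.phi τ hτ o
    have e2 := eqOnCylinder_iff.mp h.alpha τ hτ o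
    have e3 := eqOnCylinder_iff.mp h.alpha1 τ hτ o
    have e4 := eqOnCylinder_iff.mp h.alpha0 τ hτ o
    have e5 := eqOnCylinder_iff.mp h.alpha2 τ hτ o
    cases c with
    | phi => rw [← w1, e1, s1]
    | alphaPlus => rw [← w2, e2, e3, s2]
    | alphaMinus => rw [← w3, e2, e3, s3]
    | alpha0 => rw [← w4, e4, s4]
    | alpha2 => rw [← w5, e5, s5]
  · intro h
    refine ⟨?_, ?_, ?_, ?_, ?_⟩ <;> rw [eqOnCylinder_iff] <;> intro τ hτ o <;>
      obtain ⟨w1, w2, w3, w4, w5⟩ := J.wave_eq hJ hτ o <;>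
      obtain ⟨s1, s2, s3, s4, s5⟩ := J.src_eq hJ q hτ o rfl rfl rfl rfl rfl
    · rw [w1, s1, h τ hτ o]
    · rw [two (evS τ o (_ - _)), two (evS τ o (_ + _))]
      congr 1
      have a := w2.trans ((h τ hτ o .alphaPlus).trans s2.symm)
      have b := w3.trans ((h τ hτ o .alphaMinus).trans s3.symm)
      linear_combination a + b
    · rw [w4, s4, h τ hτ o]
    · rw [four (evS τ o (_ - _)), four (evS τ o (_ + _))]
      congr 1
      have a := w2.trans ((h τ hτ o .alphaPlus).trans s2.symm)
      have b := w3.trans ((h τ hτ o .alphaMinus).trans s3.symm)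
      linear_combination a - b
    · rw [w5, s5, h τ hτ o]

/-- The data for the Taylor coefficients of the components. -/
def InitialData.comp (d : InitialData) (c : Component) (n : ℕ) (k : ℕ × ℤ) : ℂ :=
  match c with
  | .phi => d.phi n k
  | .alphaPlus => 2 * d.alpha1 n k
  | .alphaMinus => -2 * d.alpha1 n k
  | .alpha0 => d.alpha0 n k
  | .alpha2 => d.alpha2 n k

open Classical in
/-- The initial values of the Taylor coefficients of the components. -/
def InitialData.vec (d : InitialData) (n : ℕ) (c : Component) (k : ℕ × ℤ) : ℂ :=
  if k ∈ modes c.weight n then (n.factorial : ℂ)⁻¹ * d.comp c n k else 0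

theorem InitialData.vec_zero (d : InitialData) : ∀ c ≠ Component.phi, ∀ k, d.vec 0 c k = 0 := by
  intro c hc k
  unfold InitialData.vec
  split_ifs with h
  · obtain ⟨hw, rfl⟩ := mem_modes_zero h
    cases c with
    | phi => exact absurd rfl hc
    | alphaPlus => simp [InitialData.comp, d.leading]
    | alphaMinus => simp [InitialData.comp, d.leading]
    | alpha0 => simp [Component.weight] at hw
    | alpha2 => simp [Component.weight] at hw
  · rfl

theorem IsSolutionJet.smooth {q : ℝ} {d : InitialData} {J : Jets} (h : IsSolutionJet q d J) :
    J.Smooth :=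
  ⟨fun n k hk => (h.data_phi n k hk).1, fun n k hk => (h.data_alpha n k hk).1,
    fun n k hk => (h.data_alpha1 n k hk).1, fun n k hk => (h.data_alpha0 n k hk).1,
    fun n k hk => (h.data_alpha2 n k hk).1⟩

theorem IsSolutionJet.isJetA {q : ℝ} {d : InitialData} {J : Jets} (h : IsSolutionJet q d J) :
    IsJetA conjL q d.vec J.fam := by
  have hd : ∀ n c k τ, deriv (J.fam n c k) τ = (n.factorial : ℂ)⁻¹ * deriv (J.elt c n k) τ :=
    fun n c k τ => deriv_const_mul' _ _ _
  have z0 : (0 : ℝ) ∈ 𝕀 := by norm_num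
  have hcomb : ∀ n, ∀ k ∈ modes 0 n, ∀ a : ℂ, ContDiffOn ℝ ∞ (fun t => J.alpha n k t + a * J.alpha1 n k t)
      𝕀 ∧ deriv (fun t => J.alpha n k t + a * J.alpha1 n k t) 0 = 0 := fun n k hk a => by
    have h1 := h.smooth.alpha n k hk
    have h2 := h.smooth.alpha1 n k hk
    refine ⟨h1.add (contDiffOn_const.mul h2), ?_⟩
    rw [((hasDerivAt_of_contDiffOn h1 z0).fun_add ((hasDerivAt_of_contDiffOn h2 z0).const_mul a)).deriv,
      (h.data_alpha n k hk).2.2, (h.data_alpha1 n k hk).2.2, mul_zero, add_zero]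
  have em : ∀ n k, J.elt .alphaMinus n k = fun t => J.alpha n k t + (-2) * J.alpha1 n k t :=
    fun n k => funext fun t => by simp only [Jets.elt]; ring
  refine ⟨fun n c k hk => ?_, fun n c k hk => ?_, fun n c k hk => ?_, fun n c τ hτ o => ?_⟩
  · refine contDiffOn_const.mul ?_
    cases c with
    | phi => exact h.smooth.phi n k hk
    | alphaPlus => exact (hcomb n k hk 2).1
    | alphaMinus => rw [em]; exact (hcomb n k hk _).1
    | alpha0 => exact h.smooth.alpha0 n k hk
    | alpha2 => exact h.smooth.alpha2 n k hk
  · rw [InitialData.vec, if_pos hk, Jets.fam]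
    congr 1
    cases c with
    | phi => exact (h.data_phi n k hk).2.1
    | alphaPlus =>
      simp [Jets.elt, InitialData.comp, (h.data_alpha n k hk).2.1, (h.data_alpha1 n k hk).2.1]
    | alphaMinus =>
      simp [Jets.elt, InitialData.comp, (h.data_alpha n k hk).2.1, (h.data_alpha1 n k hk).2.1]
    | alpha0 => exact (h.data_alpha0 n k hk).2.1
    | alpha2 => exact (h.data_alpha2 n k hk).2.1
  · rw [hd]
    refine mul_eq_zero_of_right _ ?_
    cases c with
    | phi => exact (h.data_phi n k hk).2.2
    | alphaPlus => exact (hcomb n k hk 2).2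
    | alphaMinus => rw [em]; exact (hcomb n k hk _).2
    | alpha0 => exact (h.data_alpha0 n k hk).2.2
    | alpha2 => exact (h.data_alpha2 n k hk).2.2
  · have := (Jets.system_iff h.smooth q).mp h.system τ hτ o c
    rw [← this, wave, waveSer, coeff_mk]

/-- The jets which belong to a family of Taylor coefficients. -/
def Fam.jets (u : Fam ℂ) : Jets where
  phi n k τ := n.factorial * u n .phi k τ
  alpha n k τ := n.factorial * ((u n .alphaPlus k τ + u n .alphaMinus k τ) / 2)
  alpha1 n k τ := n.factorial * ((u n .alphaPlus k τ - u n .alphaMinus k τ) / 4)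
  alpha0 n k τ := n.factorial * u n .alpha0 k τ
  alpha2 n k τ := n.factorial * u n .alpha2 k τ

theorem Fam.jets_fam (u : Fam ℂ) : (Fam.jets u).fam = u := by
  funext n c k τ
  have : (n.factorial : ℂ) ≠ 0 := by exact_mod_cast n.factorial_ne_zero
  cases c <;> simp only [Jets.fam, Jets.elt, Fam.jets] <;> field_simp <;> ring

theorem IsJetA.isSolutionJet {q : ℝ} {d : InitialData} {u : Fam ℂ} (h : IsJetA conjL q d.vec u) :
    IsSolutionJet q d (Fam.jets u) := by
  have z0 : (0 : ℝ) ∈ 𝕀 := by norm_num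
  have key : ∀ n (c c' : Component) (hc : c.weight = c'.weight) (a b : ℂ), ∀ k ∈ modes c.weight n,
      ContDiffOn ℝ ∞ (fun t => n.factorial * (a * u n c k t + b * u n c' k t)) 𝕀 ∧
      (fun t => n.factorial * (a * u n c k t + b * u n c' k t)) 0 =
        a * d.comp c n k + b * d.comp c' n k ∧
      deriv (fun t => n.factorial * (a * u n c k t + b * u n c' k t)) 0 = 0 := by
    intro n c c' hc a b k hk
    have hk' := hk
    rw [hc] at hk'
    have h1 := h.smooth n c k hk
    have h2 := h.smooth n c' k hk'
    have hn : (n.factorial : ℂ) ≠ 0 := by exact_mod_cast n.factorial_ne_zero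
    refine ⟨contDiffOn_const.mul ((contDiffOn_const.mul h1).add (contDiffOn_const.mul h2)), ?_, ?_⟩
    · simp only [h.init n c k hk, h.init n c' k hk', InitialData.vec, if_pos hk, if_pos hk']
      field_simp
    · rw [((((hasDerivAt_of_contDiffOn h1 z0).const_mul a).fun_add
        ((hasDerivAt_of_contDiffOn h2 z0).const_mul b)).const_mul _).deriv, h.init_deriv n c k hk,
        h.init_deriv n c' k hk']
      simp
  have stat : ∀ {s : ℤ} (c c' : Component) (hc : c.weight = c'.weight) (a b : ℂ)
      (f : ℕ → ℕ × ℤ → ℝ → ℂ) (v : ℕ → ℕ × ℤ → ℂ), c.weight = s →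
      (∀ n k t, f n k t = n.factorial * (a * u n c k t + b * u n c' k t)) →
      (∀ n k, v n k = a * d.comp c n k + b * d.comp c' n k) → HasStaticData s f v := by
    intro s c c' hc a b f v hs hf hv n k hk
    rw [← hs] at hk
    have e : f n k = fun t => n.factorial * (a * u n c k t + b * u n c' k t) := funext (hf n k)
    rw [e, hv]
    exact key n c c' hc a b k hk
  have dp : HasStaticData 0 (Fam.jets u).phi d.phi :=
    stat .phi .phi rfl 1 0 _ _ rfl (fun n k t => by simp [Fam.jets])
      fun n k => by simp [InitialData.comp]
  have da : HasStaticData 0 (Fam.jets u).alpha 0 :=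
    stat .alphaPlus .alphaMinus rfl (1 / 2) (1 / 2) _ _ rfl
      (fun n k t => by simp only [Fam.jets]; ring) fun n k => by simp [InitialData.comp]
  have d1 : HasStaticData 0 (Fam.jets u).alpha1 d.alpha1 :=
    stat .alphaPlus .alphaMinus rfl (1 / 4) (-1 / 4) _ _ rfl
      (fun n k t => by simp only [Fam.jets]; ring) fun n k => by
        simp only [InitialData.comp]; ring
  have d0 : HasStaticData 1 (Fam.jets u).alpha0 d.alpha0 :=
    stat .alpha0 .alpha0 rfl 1 0 _ _ rfl (fun n k t => by simp [Fam.jets])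
      fun n k => by simp [InitialData.comp]
  have d2 : HasStaticData (-1) (Fam.jets u).alpha2 d.alpha2 :=
    stat .alpha2 .alpha2 rfl 1 0 _ _ rfl (fun n k t => by simp [Fam.jets])
      fun n k => by simp [InitialData.comp]
  have hs : (Fam.jets u).Smooth := ⟨fun n k hk => (dp n k hk).1, fun n k hk => (da n k hk).1,
    fun n k hk => (d1 n k hk).1, fun n k hk => (d0 n k hk).1, fun n k hk => (d2 n k hk).1⟩
  refine ⟨dp, da, d1, d0, d2, (Jets.system_iff hs q).mpr fun τ hτ o c => ?_⟩
  rw [Fam.jets_fam]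
  ext n
  rw [← h.eq n c τ hτ o, wave, waveSer, coeff_mk]

end Bridge

/-! ### Logarithmic terms in families of solution jets -/

section Families

variable {A : Type*} [NormedCommRing A] [NormedAlgebra ℂ A] [CompleteSpace A]

/-- The log series of a family of solution jets describes those of its members. -/
theorem exists_coeff_family (σ : A →L[ℝ] A) (q : ℝ) {v : Coeffs A}
    (hv : NoPotential v) {n : ℕ} {c : Component} {k : ℕ × ℤ}
    (hk : k ∈ modes c.weight n) {e : ℝ} (he : e ∈ 𝕊) :
    ∃ F : ℕ → Polynomial A, ∀ T : A →ₐ[ℂ] ℂ, Continuous T → (∀ a, T (σ a) = conj (T a)) →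
      ∀ v' : Coeffs ℂ, NoPotential v' →
      (∀ m ≤ n, ∀ c, ∀ k ∈ modes c.weight m, T (v m c k) = v' m c k) →
      ∀ u', IsJetA conjL q v' u' → ∀ K,
        HasLogTerm (u' n c k) e K ↔ ∃ i j, K ≤ j ∧ T ((F i).coeff j) ≠ 0 := by
  obtain ⟨u, hu, -, hlog⟩ := exists_isJetA σ q hv
  obtain ⟨M, F, hF, hFu⟩ := hlog n c k e he
  refine ⟨F, fun T hT hTσ v' hv' hvv u' hu' K => ?_⟩
  have h1 := hu.map hT (σ' := conjL) hTσ
  have h2 := h1.unique hu' (fun c hc k => (congrArg T (hv c hc k)).trans (map_zero T)) hv' hvv n le_rfl c k hk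
  let T' : A →L[ℝ] ℂ := ((⟨T.toLinearMap, hT⟩ : A →L[ℂ] ℂ)).restrictScalars ℝ
  obtain ⟨hG, hGl⟩ := hF.lev_map (G := fun i => (F i).map T.toRingHom) T'
    fun i j => Polynomial.coeff_map _ _
  have hG' : ∀ᶠ x in 𝓝₊, u' n c k (e * (1 - x)) =
      lev M (fun i => (F i).map T.toRingHom) x := by
    filter_upwards [hFu, hGl, Ioo_zero_one_mem_nhdsGT] with x e1 e2 hx
    rw [e2, ← e1, ← h2 (mem_Ioo_of_endpoint he hx)]
    rfl
  constructor
  · intro h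
    obtain ⟨i, j, hj, hne⟩ := h.exists_coeff_ne_zero hG hG'
    rw [Polynomial.coeff_map] at hne
    exact ⟨i, j, hj, hne⟩
  · rintro ⟨i, j, hj, hne⟩
    refine hasLogTerm_of_coeff_ne_zero hG hG' (i := i) hj ?_
    rw [Polynomial.coeff_map]
    exact hne

end Families

section Solution

/-- The Taylor coefficients of the solution jets for given data. -/
def solFam (q : ℝ) (d : InitialData) : Fam ℂ := (exists_isJetA conjL q d.vec_zero).choose

theorem solFam_isJetA (q : ℝ) (d : InitialData) : IsJetA conjL q d.vec (solFam q d) :=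
  (exists_isJetA conjL q d.vec_zero).choose_spec.1

theorem solFam_logAt (q : ℝ) (d : InitialData) (n : ℕ) (c : Component) (k : ℕ × ℤ) {e : ℝ}
    (he : e ∈ 𝕊) : LogAt e (solFam q d n c k) :=
  (exists_isJetA conjL q d.vec_zero).choose_spec.2.2 n c k e he

theorem IsSolutionJet.elt_eq {q : ℝ} {d : InitialData} {J : Jets} (h : IsSolutionJet q d J) (n : ℕ)
    (c : Component) {k : ℕ × ℤ} (hk : k ∈ modes c.weight n) :
    EqOn (J.elt c n k) (fun τ => n.factorial * solFam q d n c k τ) 𝕀 := by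
  intro τ hτ
  have hn : (n.factorial : ℂ) ≠ 0 := by exact_mod_cast n.factorial_ne_zero
  have := h.isJetA.unique (solFam_isJetA q d) d.vec_zero d.vec_zero (fun _ _ _ _ _ => rfl) n le_rfl c
    k hk hτ
  change _ = _ * solFam q d n c k τ
  rw [← this, Jets.fam, mul_inv_cancel_left₀ hn]

theorem HasLogExpansion.const_mul {f : ℝ → ℂ} {e : ℝ} {N : ℕ} {a : ℕ → ℝ → ℂ}
    (h : HasLogExpansion f e N a) (b : ℂ) :
    HasLogExpansion (fun τ => b * f τ) e N fun j x => b * a j x := by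
  refine ⟨fun j => analyticAt_const.mul (h.1 j), ?_⟩
  filter_upwards [h.2] with x hx
  rw [hx, mul_sum]
  exact sum_congr rfl fun j _ => by ring

theorem HasLogTerm.const_mul {f : ℝ → ℂ} {e : ℝ} {K : ℕ} (h : HasLogTerm f e K) {b : ℂ}
    (hb : b ≠ 0) : HasLogTerm (fun τ => b * f τ) e K := by
  obtain ⟨N, a, ha, i, j, hK, hN, hne⟩ := h
  refine ⟨N, _, ha.const_mul b, i, j, hK, hN, ?_⟩
  rw [iteratedDeriv_const_mul_field]
  exact mul_ne_zero hb hne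

/-- The data for which a given coefficient of the jets has a given power of the logarithm. -/
def logSet (q : ℝ) (n : ℕ) (c : Component) (k : ℕ × ℤ) (e : ℝ) (K : ℕ) : Set InitialData :=
  {d | HasLogTerm (solFam q d n c k) e K}

theorem IsSolutionJet.hasLogTerm_iff {q : ℝ} {d : InitialData} {J : Jets} (h : IsSolutionJet q d J)
    {n : ℕ} {c : Component} {k : ℕ × ℤ} (hk : k ∈ modes c.weight n) {e : ℝ}
    (he : e ∈ 𝕊) {K : ℕ} :
    HasLogTerm (J.elt c n k) e K ↔ d ∈ logSet q n c k e K := by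
  have hn : (n.factorial : ℂ) ≠ 0 := by exact_mod_cast n.factorial_ne_zero
  constructor
  · intro H
    refine (H.const_mul (inv_ne_zero hn)).congr he fun τ hτ => ?_
    simp only [h.elt_eq n c hk hτ]
    rw [inv_mul_cancel_left₀ hn]
  · intro H
    exact (HasLogTerm.const_mul H hn).congr he (h.elt_eq n c hk)

theorem exists_isSolutionJet (q : ℝ) (d : InitialData) : ∃ J, IsSolutionJet q d J :=
  ⟨_, (solFam_isJetA q d).isSolutionJet⟩

theorem IsSolutionJet.exists_hasLogExpansion {q : ℝ} {d : InitialData} {J : Jets}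
    (h : IsSolutionJet q d J) {n : ℕ} {c : Component} {k : ℕ × ℤ} (hk : k ∈ modes c.weight n) {e : ℝ}
    (he : e ∈ 𝕊) : ∃ N a, HasLogExpansion (J.elt c n k) e N a := by
  obtain ⟨N, a, ha⟩ := (solFam_logAt q d n c k he).exists_hasLogExpansion
  have := ha.const_mul (n.factorial : ℂ)
  refine ⟨N, _, this.1, ?_⟩
  filter_upwards [this.2, Ioo_zero_one_mem_nhdsGT] with x hx hx1
  exact (h.elt_eq n c hk (mem_Ioo_of_endpoint he hx1)).trans hx

theorem isLogSer_zero (M : ℕ) : IsLogSer M fun _ => (0 : Polynomial ℂ) where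
  deg _ := by intro j _; simp
  bdd j := by simpa using GeomBdd.zero

theorem lev_zero (M : ℕ) (x : ℝ) : lev M (fun _ => (0 : Polynomial ℂ)) x = 0 := by
  simp [lev, powSer_const_zero]

/-- Without charge, only the first power of the logarithm occurs. -/
theorem not_mem_logSet_of_charge_zero (d : InitialData) {n : ℕ} {c : Component} {k : ℕ × ℤ}
    (hk : k ∈ modes c.weight n) {e : ℝ} (he : e ∈ 𝕊) : d ∉ logSet 0 n c k e 2 := by
  intro hd
  have hu := solFam_isJetA 0 d
  have hs : ∀ c τ (V : Vals ℂ), src 0 τ V c = 0 := by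
    intro c τ V
    cases c <;> simp [src, cubic, current, coup]
  have hsing : ∀ τ ∈ 𝕀,
      sing (2 * (n - 1)) (-2 * c.drift) (kap ℂ n k.1) (solFam 0 d n c k) τ = 0 := by
    intro τ hτ
    refine expansion_injective (s := c.weight) (n := n)
      (v := fun k => sing (2 * (n - 1)) (-2 * c.drift) (kap ℂ n k.1) (solFam 0 d n c k) τ)
      (v' := fun _ => 0) (fun o => ?_) k hk
    rw [hu.eq n c τ hτ o, hs]
    simp
  obtain ⟨F, hF, hf⟩ : ∃ F, IsLogSer 2 F ∧
      ∀ᶠ x in 𝓝₊, solFam 0 d n c k (e * (1 - x)) = lev 2 F x := by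
    by_cases hc : n ≠ 0 ∨ c = .phi
    · obtain ⟨N, hN⟩ : ∃ N : ℕ, 2 * ((n : ℝ) - 1) + e * (-2 * c.drift) = 2 * ((N : ℝ) - 1) := by
        rcases hc with hn | rfl
        · exact exists_exponent hn c he
        · exact ⟨n, by simp [Component.drift]⟩
      refine exists_logSer_of_sing he hN (hu.smooth n c k hk) (g := fun _ => 0) hsing (isLogSer_zero 0) ?_
      exact Filter.Eventually.of_forall fun x => by simp [lev]
    · push Not at hc
      obtain ⟨rfl, hc⟩ := hc
      refine ⟨_, isLogSer_zero 2, ?_⟩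
      filter_upwards [Ioo_zero_one_mem_nhdsGT] with x hx
      rw [(hu.staticLevel d.vec_zero).zero c hc k hk _ (mem_Ioo_of_endpoint he hx)]
      simp [lev, powSer]
  obtain ⟨i, j, hj, hne⟩ := HasLogTerm.exists_coeff_ne_zero hd hF hf
  exact hne (hF.deg i j hj)

/-! ### Openness -/

theorem InitialData.Near.vec {r ε : ℝ} {d d' : InitialData} (h : InitialData.Near r ε d d')
    (hr : 0 < r) (n : ℕ) (c : Component) (k : ℕ × ℤ) :
    ‖d.vec n c k - d'.vec n c k‖ ≤ 2 * (r ^ n)⁻¹ * |ε| := by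
  have hrn : 0 < r ^ n := pow_pos hr n
  have hf : (0 : ℝ) < n.factorial := by exact_mod_cast n.factorial_pos
  unfold InitialData.vec
  split_ifs with hk
  · have key : ∀ {x y a : ℂ}, r ^ n / (n.factorial : ℝ) * ‖x - y‖ ≤ ε → ‖a‖ ≤ 2 →
        ‖(n.factorial : ℂ)⁻¹ * (a * x) - (n.factorial : ℂ)⁻¹ * (a * y)‖ ≤
          2 * (r ^ n)⁻¹ * |ε| := by
      intro x y a hxy ha
      rw [← mul_sub, ← mul_sub, norm_mul, norm_mul, norm_inv, Complex.norm_natCast]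
      have h1 : (n.factorial : ℝ)⁻¹ * ‖x - y‖ ≤ (r ^ n)⁻¹ * |ε| := by
        rw [le_inv_mul_iff₀ hrn]
        refine le_trans (le_of_eq ?_) (hxy.trans (le_abs_self ε))
        field_simp
      calc (n.factorial : ℝ)⁻¹ * (‖a‖ * ‖x - y‖) = ‖a‖ * ((n.factorial : ℝ)⁻¹ * ‖x - y‖) := by ring
        _ ≤ 2 * ((r ^ n)⁻¹ * |ε|) := mul_le_mul ha h1 (by positivity) (by norm_num)
        _ = _ := by ring
    cases c with
    | phi => simpa [InitialData.comp] using key (a := 1) (h.1 n k hk) (by norm_num)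
    | alphaPlus => exact key (a := 2) (h.2.1 n k hk) (by norm_num)
    | alphaMinus => exact key (a := -2) (h.2.1 n k hk) (by norm_num)
    | alpha0 => simpa [InitialData.comp] using key (a := 1) (h.2.2.1 n k hk) (by norm_num)
    | alpha2 => simpa [InitialData.comp] using key (a := 1) (h.2.2.2 n k hk) (by norm_num)
  · rw [sub_self, norm_zero]; positivity

theorem logSet_open {q : ℝ} {n : ℕ} {c : Component} {k : ℕ × ℤ} (hk : k ∈ modes c.weight n) {e : ℝ}
    (he : e ∈ 𝕊) {K : ℕ} {r : ℝ} (hr : 0 < r) {d : InitialData}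
    (hd : d ∈ logSet q n c k e K) :
    ∃ ε > (0 : ℝ), ∀ d', InitialData.Near r ε d d' → d' ∈ logSet q n c k e K := by
  by_contra! hcon
  choose D hD hDn using fun j : ℕ => hcon (1 / ((j : ℝ) + 1)) (by positivity)
  have hlim : ∀ m c k, Tendsto (fun j => (D j).vec m c k) atTop (𝓝 (d.vec m c k)) := by
    intro m c k
    rw [tendsto_iff_norm_sub_tendsto_zero]
    have h0 : Tendsto (fun j : ℕ => 2 * (r ^ m)⁻¹ * |1 / ((j : ℝ) + 1)|) atTop (𝓝 0) := by
      have := (tendsto_one_div_add_atTop_nhds_zero_nat (𝕜 := ℝ)).abs.const_mul (2 * (r ^ m)⁻¹)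
      simpa using this
    refine squeeze_zero (fun _ => norm_nonneg _) (fun j => ?_) h0
    rw [norm_sub_rev]
    exact (hD j).vec hr m c k
  let v : Coeffs (C(OnePoint ℕ, ℂ)) := fun m c k =>
    OnePoint.continuousMapMkNat (fun j => (D j).vec m c k) (d.vec m c k) (hlim m c k)
  have hv : NoPotential v := by
    intro c hc k
    ext x
    induction x using OnePoint.rec with
    | infty => exact d.vec_zero c hc k
    | coe j => exact (D j).vec_zero c hc k
  obtain ⟨F, hF⟩ := exists_coeff_family (starL' ℝ : C(OnePoint ℕ, ℂ) ≃L[ℝ] C(OnePoint ℕ, ℂ)).toContinuousLinearMap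
    q hv hk he
  have ev : ∀ x : OnePoint ℕ, Continuous (ContinuousMap.evalAlgHom ℂ ℂ x : C(OnePoint ℕ, ℂ) →ₐ[ℂ] ℂ) :=
    fun x => continuous_eval_const x
  obtain ⟨i, j, hj, hne⟩ := (hF _ (ev OnePoint.infty) (fun _ => rfl) d.vec d.vec_zero
    (fun _ _ _ _ _ => rfl) _ (solFam_isJetA q d) K).mp hd
  set a := (F i).coeff j
  have ha : ∀ᶠ x in 𝓝 (OnePoint.infty : OnePoint ℕ), a x ≠ 0 := a.continuous.continuousAt.eventually_ne hne
  have : Tendsto (fun j : ℕ => (j : OnePoint ℕ)) atTop (𝓝 OnePoint.infty) := by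
    have := OnePoint.tendsto_coe_infty (X := ℕ)
    rwa [coclosedCompact_eq_cocompact, cocompact_eq_cofinite, Nat.cofinite_eq_atTop] at this
  obtain ⟨l, hl⟩ := (this.eventually ha).exists
  exact hDn l ((hF _ (ev l) (fun _ => rfl) (D l).vec (D l).vec_zero
    (fun _ _ _ _ _ => rfl) _ (solFam_isJetA q (D l)) K).mpr ⟨i, j, hj, hl⟩)

end Solution

/-! ### Holomorphic families -/

section Holomorphic

open Classical in
/-- The extension by zero of a function on the closed disc of radius `3`. -/
def extend (f : C(Metric.closedBall (0 : ℂ) 3, ℂ)) (z : ℂ) : ℂ :=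
  if h : z ∈ Metric.closedBall (0 : ℂ) 3 then f ⟨z, h⟩ else 0

theorem extend_eq (f : C(Metric.closedBall (0 : ℂ) 3, ℂ)) {z : ℂ}
    (h : z ∈ Metric.closedBall (0 : ℂ) 3) : extend f z = f ⟨z, h⟩ := dif_pos h

/-- The continuous functions on the closed disc of radius `3` which are holomorphic inside. -/
def discAlgebra : Subalgebra ℂ C(Metric.closedBall (0 : ℂ) 3, ℂ) where
  carrier := {f | DifferentiableOn ℂ (extend f) (Metric.ball 0 3)}
  mul_mem' {f g} hf hg := (DifferentiableOn.mul hf hg).congr fun z hz => by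
    have h := Metric.ball_subset_closedBall hz
    simp [extend_eq _ h]
  add_mem' {f g} hf hg := (DifferentiableOn.add hf hg).congr fun z hz => by
    have h := Metric.ball_subset_closedBall hz
    simp [extend_eq _ h]
  algebraMap_mem' c := (differentiableOn_const c).congr fun z hz => by
    have h := Metric.ball_subset_closedBall hz
    simp [extend_eq _ h]

theorem isClosed_discAlgebra : IsClosed (discAlgebra : Set C(Metric.closedBall (0 : ℂ) 3, ℂ)) := by
  refine IsSeqClosed.isClosed fun f g hf hfg => ?_
  have h1 : TendstoLocallyUniformlyOn (fun n => extend (f n)) (extend g) atTop (Metric.ball 0 3) := by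
    refine TendstoUniformlyOn.tendstoLocallyUniformlyOn ?_
    rw [Metric.tendstoUniformlyOn_iff]
    intro ε hε
    filter_upwards [Metric.tendsto_nhds.mp hfg ε hε] with n hn z hz
    have h := Metric.ball_subset_closedBall hz
    rw [extend_eq _ h, extend_eq _ h, dist_comm]
    exact (ContinuousMap.dist_apply_le_dist _).trans_lt hn
  exact h1.differentiableOn (Filter.Eventually.of_forall hf) Metric.isOpen_ball

instance : CompleteSpace discAlgebra := isClosed_discAlgebra.completeSpace_coe

/-- Complex conjugation of the closed disc. -/
def conjDisc : C(Metric.closedBall (0 : ℂ) 3, Metric.closedBall (0 : ℂ) 3) where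
  toFun z := ⟨conj z.1, by
    have := mem_closedBall_zero_iff.mp z.2
    rwa [mem_closedBall_zero_iff, Complex.norm_conj]⟩
  continuous_toFun := by fun_prop

theorem star_comp_mem {f : C(Metric.closedBall (0 : ℂ) 3, ℂ)} (h : f ∈ discAlgebra) :
    star (f.comp conjDisc) ∈ discAlgebra := by
  have hf : DifferentiableOn ℂ (extend f) (Metric.ball 0 3) := h
  have hext : ∀ z ∈ Metric.ball (0 : ℂ) 3, extend (star (f.comp conjDisc)) z =
      (conj ∘ extend f ∘ conj) z := by
    intro z hz
    have h := Metric.ball_subset_closedBall hz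
    rw [extend_eq _ h]
    exact congrArg conj (extend_eq f (conjDisc ⟨z, h⟩).2).symm
  intro z hz
  have hz' : conj z ∈ Metric.ball (0 : ℂ) 3 := by
    rw [mem_ball_zero_iff, Complex.norm_conj]; exact mem_ball_zero_iff.mp hz
  have h1 := (hf.differentiableAt (Metric.isOpen_ball.mem_nhds hz')).conj_conj
  rw [conj_conj] at h1
  exact h1.differentiableWithinAt.congr hext (hext z hz)

theorem norm_star_comp_le (f : C(Metric.closedBall (0 : ℂ) 3, ℂ)) :
    ‖star (f.comp conjDisc)‖ ≤ ‖f‖ := by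
  rw [ContinuousMap.norm_le _ (norm_nonneg _)]
  intro z
  rw [ContinuousMap.star_apply, norm_star, ContinuousMap.comp_apply]
  exact f.norm_coe_le_norm _

/-- The map `f ↦ conj ∘ f ∘ conj`, as a linear map. -/
def conjDiscLinear : discAlgebra →ₗ[ℝ] discAlgebra where
  toFun f := ⟨star (f.1.comp conjDisc), star_comp_mem f.2⟩
  map_add' f g := Subtype.ext (star_add (f.1.comp conjDisc) (g.1.comp conjDisc))
  map_smul' r f := Subtype.ext (star_smul r (f.1.comp conjDisc))

/-- The map `f ↦ conj ∘ f ∘ conj`. -/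
def conjDiscAlgebra : discAlgebra →L[ℝ] discAlgebra :=
  conjDiscLinear.mkContinuous 1 fun f => by
    rw [one_mul]
    exact norm_star_comp_le f.1

theorem mem_disc {t : ℝ} (ht : |t| ≤ 3) : (t : ℂ) ∈ Metric.closedBall (0 : ℂ) 3 := by simpa using ht

/-- Evaluation at a real point. -/
def evDisc {t : ℝ} (ht : |t| ≤ 3) : discAlgebra →ₐ[ℂ] ℂ :=
  (ContinuousMap.evalAlgHom ℂ ℂ ⟨(t : ℂ), mem_disc ht⟩).comp discAlgebra.val

theorem continuous_evDisc {t : ℝ} (ht : |t| ≤ 3) : Continuous (evDisc ht) :=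
  (continuous_eval_const (F := C(Metric.closedBall (0 : ℂ) 3, ℂ)) _).comp continuous_subtype_val

theorem evDisc_conj {t : ℝ} (ht : |t| ≤ 3) (f : discAlgebra) :
    evDisc ht (conjDiscAlgebra f) = conj (evDisc ht f) := by
  have : conjDisc ⟨(t : ℂ), mem_disc ht⟩ = ⟨(t : ℂ), mem_disc ht⟩ :=
    Subtype.ext (conj_ofReal t)
  change conj (f.1 (conjDisc ⟨(t : ℂ), mem_disc ht⟩)) = conj (f.1 _)
  rw [this]

theorem evDisc_eq_extend {t : ℝ} (ht : |t| ≤ 3) (f : discAlgebra) :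
    evDisc ht f = extend f.1 t := (extend_eq _ _).symm

/-- A member of the disc algebra which vanishes at small positive reals vanishes at `1`. -/
theorem evDisc_one_eq_zero (f : discAlgebra) {δ : ℝ} (hδ : 0 < δ)
    (h : ∀ t (ht : |t| ≤ 3), 0 < t → t < δ → evDisc ht f = 0) :
    evDisc (t := 1) (by norm_num) f = 0 := by
  have hf : DifferentiableOn ℂ (extend f.1) (Metric.ball 0 3) := f.2
  have ha := hf.analyticOnNhd Metric.isOpen_ball
  rw [evDisc_eq_extend]
  refine ha.eqOn_zero_of_preconnected_of_frequently_eq_zero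
    (convex_ball (0 : ℂ) 3).isPreconnected (z₀ := 0) (by simp) ?_ (by simp)
  have hc : Tendsto (fun t : ℝ => (t : ℂ)) (𝓝[>] 0) (𝓝[≠] 0) := by
    refine tendsto_nhdsWithin_iff.mpr ⟨?_, ?_⟩
    · exact (Complex.continuous_ofReal.tendsto' 0 0 (by simp)).mono_left nhdsWithin_le_nhds
    · filter_upwards [self_mem_nhdsWithin] with t ht
      simpa using ne_of_gt ht
  refine hc.frequently (Filter.Eventually.frequently ?_)
  have : ∀ᶠ t : ℝ in 𝓝[>] 0, t < min δ 3 :=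
    eventually_nhdsWithin_of_eventually_nhds (eventually_lt_nhds (by positivity))
  filter_upwards [self_mem_nhdsWithin, this] with t ht ht2
  have ht0 : 0 < t := ht
  have h3 : |t| ≤ 3 := by rw [abs_of_pos ht0]; exact (ht2.trans_le (min_le_right _ _)).le
  rw [← evDisc_eq_extend h3]
  exact h t h3 ht0 (ht2.trans_le (min_le_left _ _))

/-- The affine function `a + t b`. -/
def affDisc (a b : ℂ) : discAlgebra :=
  ⟨⟨fun z => a + z.1 * b, by fun_prop⟩, by
    have : DifferentiableOn ℂ (fun z : ℂ => a + z * b) (Metric.ball 0 3) := by fun_prop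
    exact this.congr fun z hz => by rw [extend_eq _ (Metric.ball_subset_closedBall hz)]; rfl⟩

theorem evDisc_aff {t : ℝ} (ht : |t| ≤ 3) (a b : ℂ) : evDisc ht (affDisc a b) = a + t * b := rfl

end Holomorphic

/-! ### Constraints on the data, order by order -/

section Data

open PowerSeries (coeff coeff_map coeff_C_mul)

/-- The conditions on the data of order `n`. -/
structure OrderCond (n : ℕ) (a1 a0 a2 : ℕ × ℤ → ℂ) : Prop where
  real1 : ∀ z w : ℂ, ‖z‖ ^ 2 + ‖w‖ ^ 2 = 1 → conj (∑ k ∈ modes 0 n, a1 k * sY 0 k.1 k.2 z w) =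
    ∑ k ∈ modes 0 n, a1 k * sY 0 k.1 k.2 z w
  real02 : ∀ z w : ℂ, ‖z‖ ^ 2 + ‖w‖ ^ 2 = 1 → ∑ k ∈ modes (-1) n, a2 k * sY (-1) k.1 k.2 z w =
    -conj (∑ k ∈ modes 1 n, a0 k * sY 1 k.1 k.2 z w)
  lorenz : ∀ z w : ℂ, ‖z‖ ^ 2 + ‖w‖ ^ 2 = 1 →
    2 * ((n : ℂ) - 1) * ∑ k ∈ modes 0 n, a1 k * sY 0 k.1 k.2 z w +
      ∑ k ∈ modes 1 n, a0 k * ethBarY 1 k z w - ∑ k ∈ modes (-1) n, a2 k * ethY (-1) k z w = 0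

theorem coeff_dataField (s : ℤ) (c : ℕ → ℕ × ℤ → ℂ) (n : ℕ) (τ : ℝ) (z w : ℂ) :
    coeff n (dataField s c) τ z w =
      (n.factorial : ℂ)⁻¹ * ∑ k ∈ modes s n, c n k * sY s k.1 k.2 z w := by
  simp [dataField, field]

theorem coeff_lorenz (a1 a0 a2 : ℕ → ℕ × ℤ → ℂ) (n : ℕ) (τ : ℝ) (z w : ℂ) :
    coeff (R := Fn) n (2 * (rho * dR (dataField 0 a1)) - 2 * dataField 0 a1
      + lift ethBar (dataField 1 a0) - lift eth (dataField (-1) a2)) τ z w =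
    (n.factorial : ℂ)⁻¹ * (2 * ((n : ℂ) - 1) * ∑ k ∈ modes 0 n, a1 n k * sY 0 k.1 k.2 z w +
      ∑ k ∈ modes 1 n, a0 n k * ethBarY 1 k z w - ∑ k ∈ modes (-1) n, a2 n k * ethY (-1) k z w) := by
  have h0 := (lift_fieldG (s := 1) (fun n k _ => hasEth_sY 1 k) fun n k _ => a0 n k).2
  have h2 := (lift_fieldG (s := -1) (fun n k _ => hasEth_sY (-1) k) fun n k _ => a2 n k).1
  rw [← field_eq] at h0 h2
  have e1 : coeff n (rho * dR (dataField 0 a1)) τ z w = n * coeff n (dataField 0 a1) τ z w := by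
    rw [rho, dR]
    rcases n with _ | n
    · simp
    · rw [PowerSeries.coeff_succ_X_mul, PowerSeries.coeff_derivative, mul_comm]
      push_cast
      rfl
  have e2 : ∀ F : PowerSeries Fn, coeff (R := Fn) n (2 * F) τ z w = 2 * coeff n F τ z w := fun F => by
    rw [← map_ofNat (PowerSeries.C (R := Fn)), coeff_C_mul]; rfl
  have e3 : ∀ F G : PowerSeries Fn, coeff n (F - G) τ z w = coeff n F τ z w - coeff n G τ z w :=
    fun F G => by rw [map_sub]; rfl
  have e4 : ∀ F G : PowerSeries Fn, coeff n (F + G) τ z w = coeff n F τ z w + coeff n G τ z w :=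
    fun F G => by rw [map_add]; rfl
  have e5 : coeff n (lift ethBar (dataField 1 a0)) τ z w =
      (n.factorial : ℂ)⁻¹ * ∑ k ∈ modes 1 n, a0 n k * ethBarY 1 k z w := by
    rw [dataField, h0]; simp [fieldG]
  have e6 : coeff n (lift eth (dataField (-1) a2)) τ z w =
      (n.factorial : ℂ)⁻¹ * ∑ k ∈ modes (-1) n, a2 n k * ethY (-1) k z w := by
    rw [dataField, h2]; simp [fieldG]
  rw [e3, e4, e3, e2, e1, e2, e5, e6, coeff_dataField]
  ring

theorem orderCond_iff (a1 a0 a2 : ℕ → ℕ × ℤ → ℂ) :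
    (EqOnCylinder (cj (dataField 0 a1)) (dataField 0 a1) ∧
      EqOnCylinder (dataField (-1) a2) (-cj (dataField 1 a0)) ∧
      EqOnCylinder (2 * (rho * dR (dataField 0 a1)) - 2 * dataField 0 a1
        + lift ethBar (dataField 1 a0) - lift eth (dataField (-1) a2)) 0) ↔
    ∀ n, OrderCond n (a1 n) (a0 n) (a2 n) := by
  have hn : ∀ n : ℕ, (n.factorial : ℂ)⁻¹ ≠ 0 := fun n =>
    inv_ne_zero (by exact_mod_cast n.factorial_ne_zero)
  have hcj : ∀ (F : PowerSeries Fn) (n τ z w), coeff n (cj F) τ z w = conj (coeff n F τ z w) :=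
    fun F n τ z w => by rw [cj, coeff_map]; rfl
  have hneg : ∀ (F : PowerSeries Fn) (n τ z w), coeff n (-F) τ z w = -(coeff n F τ z w) :=
    fun F n τ z w => by rw [map_neg]; rfl
  have hc : ∀ n : ℕ, conj (n.factorial : ℂ)⁻¹ = (n.factorial : ℂ)⁻¹ := fun n => by
    rw [map_inv₀, Complex.conj_natCast]
  constructor
  · rintro ⟨h1, h2, h3⟩ n
    refine ⟨fun z w hzw => ?_, fun z w hzw => ?_, fun z w hzw => ?_⟩
    · have := h1 n 0 z w (by norm_num) (by norm_num) hzw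
      rw [hcj, coeff_dataField, map_mul, hc] at this
      exact mul_left_cancel₀ (hn n) this
    · have := h2 n 0 z w (by norm_num) (by norm_num) hzw
      rw [hneg, hcj, coeff_dataField, coeff_dataField, map_mul, hc, ← mul_neg] at this
      exact mul_left_cancel₀ (hn n) this
    · have := h3 n 0 z w (by norm_num) (by norm_num) hzw
      rw [coeff_lorenz, map_zero] at this
      exact (mul_eq_zero.mp this).resolve_left (hn n)
  · intro h
    refine ⟨fun n τ z w _ _ hzw => ?_, fun n τ z w _ _ hzw => ?_, fun n τ z w _ _ hzw => ?_⟩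
    · rw [hcj, coeff_dataField, map_mul, hc, (h n).real1 z w hzw]
    · rw [hneg, hcj, coeff_dataField, coeff_dataField, map_mul, hc, ← mul_neg, (h n).real02 z w hzw]
    · rw [coeff_lorenz, (h n).lorenz z w hzw, mul_zero, map_zero]
      rfl

theorem InitialData.orderCond (d : InitialData) (n : ℕ) :
    OrderCond n (d.alpha1 n) (d.alpha0 n) (d.alpha2 n) :=
  (orderCond_iff _ _ _).mp ⟨d.real_alpha1, d.real_alpha02, d.lorenz⟩ n

theorem OrderCond.comb {n : ℕ} {a1 a0 a2 b1 b0 b2 : ℕ × ℤ → ℂ} (ha : OrderCond n a1 a0 a2)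
    (hb : OrderCond n b1 b0 b2) (t : ℝ) :
    OrderCond n (fun k => a1 k + t * (b1 k - a1 k)) (fun k => a0 k + t * (b0 k - a0 k))
      (fun k => a2 k + t * (b2 k - a2 k)) := by
  have key : ∀ (s : ℤ) (a b : ℕ × ℤ → ℂ) (Z : ℕ × ℤ → ℂ),
      ∑ k ∈ modes s n, (a k + t * (b k - a k)) * Z k =
      (1 - t) * ∑ k ∈ modes s n, a k * Z k + t * ∑ k ∈ modes s n, b k * Z k := fun s a b Z => by
    rw [mul_sum, mul_sum, ← sum_add_distrib]
    exact sum_congr rfl fun k _ => by ring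
  refine ⟨fun z w h => ?_, fun z w h => ?_, fun z w h => ?_⟩
  · simp only [key]
    rw [map_add, map_mul, map_mul, ha.real1 z w h, hb.real1 z w h, map_sub, map_one,
      conj_ofReal]
  · simp only [key]
    rw [map_add, map_mul, map_mul, ha.real02 z w h, hb.real02 z w h, map_sub, map_one,
      conj_ofReal]
    ring
  · simp only [key]
    linear_combination (1 - (t : ℂ)) * ha.lorenz z w h + t * hb.lorenz z w h

/-- Modification of finitely many orders of analytic data. -/
theorem IsAnalyticData.of_eventually_eq {s : ℤ} {c c' : ℕ → ℕ × ℤ → ℂ} (h : IsAnalyticData s c)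
    {p : ℕ} (hc : ∀ n, p < n → c' n = c n) : IsAnalyticData s c' := by
  obtain ⟨r, hr, M, hM⟩ := h
  refine ⟨r, hr, |M| + ∑ n ∈ Finset.range (p + 1), ∑ k ∈ modes s n,
    r ^ n / (n.factorial : ℝ) * ‖c' n k‖, fun n k hk => ?_⟩
  have hpos : ∀ n k, 0 ≤ r ^ n / (n.factorial : ℝ) * ‖c' n k‖ := fun n k => by positivity
  rcases lt_or_ge p n with hn | hn
  · rw [hc n hn]
    exact (hM n k hk).trans ((le_abs_self M).trans (le_add_of_nonneg_right
      (sum_nonneg fun i _ => sum_nonneg fun j _ => hpos i j)))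
  · refine le_trans ?_ (le_add_of_nonneg_left (abs_nonneg M))
    refine (single_le_sum (f := fun k => r ^ n / (n.factorial : ℝ) * ‖c' n k‖)
      (fun k _ => hpos n k) hk).trans ?_
    exact single_le_sum (f := fun n => ∑ k ∈ modes s n, r ^ n / (n.factorial : ℝ) * ‖c' n k‖)
      (fun n _ => sum_nonneg fun k _ => hpos n k) (Finset.mem_range.mpr (by omega))

/-- The coefficients of order at most `p` are moved on a line. -/
def moveCoeff (p : ℕ) (t : ℝ) (c c' : ℕ → ℕ × ℤ → ℂ) : ℕ → ℕ × ℤ → ℂ :=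
  fun n k => if n ≤ p then c n k + t * (c' n k - c n k) else c n k

theorem moveCoeff_of_lt {p : ℕ} {t : ℝ} {c c' : ℕ → ℕ × ℤ → ℂ} {n : ℕ} (h : p < n) :
    moveCoeff p t c c' n = c n := by
  funext k; simp [moveCoeff, not_le.mpr h]

theorem moveCoeff_of_le {p : ℕ} {t : ℝ} {c c' : ℕ → ℕ × ℤ → ℂ} {n : ℕ} (h : n ≤ p) :
    moveCoeff p t c c' n = fun k => c n k + t * (c' n k - c n k) := by
  funext k; simp [moveCoeff, h]

theorem orderCond_move (d d' : InitialData) (p : ℕ) (t : ℝ) (n : ℕ) :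
    OrderCond n (moveCoeff p t d.alpha1 d'.alpha1 n) (moveCoeff p t d.alpha0 d'.alpha0 n)
      (moveCoeff p t d.alpha2 d'.alpha2 n) := by
  rcases le_or_gt n p with h | h
  · rw [moveCoeff_of_le h, moveCoeff_of_le h, moveCoeff_of_le h]
    exact (d.orderCond n).comb (d'.orderCond n) t
  · rw [moveCoeff_of_lt h, moveCoeff_of_lt h, moveCoeff_of_lt h]
    exact d.orderCond n

/-- The data of order at most `p` are moved from `d` towards `d'`. -/
def InitialData.move (d d' : InitialData) (p : ℕ) (t : ℝ) : InitialData where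
  phi := moveCoeff p t d.phi d'.phi
  alpha1 := moveCoeff p t d.alpha1 d'.alpha1
  alpha0 := moveCoeff p t d.alpha0 d'.alpha0
  alpha2 := moveCoeff p t d.alpha2 d'.alpha2
  analytic_phi := d.analytic_phi.of_eventually_eq fun _ h => moveCoeff_of_lt h
  analytic_alpha1 := d.analytic_alpha1.of_eventually_eq fun _ h => moveCoeff_of_lt h
  analytic_alpha0 := d.analytic_alpha0.of_eventually_eq fun _ h => moveCoeff_of_lt h
  analytic_alpha2 := d.analytic_alpha2.of_eventually_eq fun _ h => moveCoeff_of_lt h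
  real_alpha1 := ((orderCond_iff _ _ _).mpr (orderCond_move d d' p t)).1
  real_alpha02 := ((orderCond_iff _ _ _).mpr (orderCond_move d d' p t)).2.1
  lorenz := ((orderCond_iff _ _ _).mpr (orderCond_move d d' p t)).2.2
  leading := by simp [moveCoeff, d.leading, d'.leading]

theorem InitialData.move_vec (d d' : InitialData) {p n : ℕ} (t : ℝ) (hn : n ≤ p) (c : Component)
    (k : ℕ × ℤ) : (d.move d' p t).vec n c k = d.vec n c k + t * (d'.vec n c k - d.vec n c k) := by
  unfold InitialData.vec
  split_ifs with hk
  · cases c <;> simp only [InitialData.comp, InitialData.move, moveCoeff, if_pos hn] <;> ring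
  · simp

theorem exists_near_moveCoeff (s : ℤ) (c c' : ℕ → ℕ × ℤ → ℂ) (p : ℕ) {r ε : ℝ} (hr : 0 < r)
    (hε : 0 < ε) : ∃ δ > 0, ∀ t : ℝ, 0 < t → t < δ → ∀ n, ∀ k ∈ modes s n,
      r ^ n / (n.factorial : ℝ) * ‖c n k - moveCoeff p t c c' n k‖ ≤ ε := by
  set B := ∑ n ∈ Finset.range (p + 1), ∑ k ∈ modes s n,
    r ^ n / (n.factorial : ℝ) * ‖c' n k - c n k‖ with hB
  have hpos : ∀ n k, 0 ≤ r ^ n / (n.factorial : ℝ) * ‖c' n k - c n k‖ := fun n k => by positivity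
  have hB0 : 0 ≤ B := sum_nonneg fun i _ => sum_nonneg fun j _ => hpos i j
  refine ⟨ε / (B + 1), by positivity, fun t ht htδ n k hk => ?_⟩
  rcases le_or_gt n p with hn | hn
  · have h1 : r ^ n / (n.factorial : ℝ) * ‖c' n k - c n k‖ ≤ B :=
      (single_le_sum (f := fun k => r ^ n / (n.factorial : ℝ) * ‖c' n k - c n k‖)
        (fun k _ => hpos n k) hk).trans (single_le_sum
          (f := fun n => ∑ k ∈ modes s n, r ^ n / (n.factorial : ℝ) * ‖c' n k - c n k‖)
          (fun n _ => sum_nonneg fun k _ => hpos n k) (Finset.mem_range.mpr (by omega)))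
    rw [lt_div_iff₀ (by positivity)] at htδ
    rw [moveCoeff, if_pos hn, sub_add_cancel_left, norm_neg, norm_mul, norm_real,
      Real.norm_of_nonneg ht.le]
    calc r ^ n / (n.factorial : ℝ) * (t * ‖c' n k - c n k‖)
        = t * (r ^ n / (n.factorial : ℝ) * ‖c' n k - c n k‖) := by ring
      _ ≤ t * B := mul_le_mul_of_nonneg_left h1 ht.le
      _ ≤ ε := by nlinarith
  · rw [moveCoeff, if_neg (not_le.mpr hn), sub_self, norm_zero, mul_zero]
    exact hε.le

theorem InitialData.exists_near_move (d d' : InitialData) (p : ℕ) {r ε : ℝ} (hr : 0 < r)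
    (hε : 0 < ε) : ∃ δ > 0, ∀ t : ℝ, 0 < t → t < δ → InitialData.Near r ε d (d.move d' p t) := by
  obtain ⟨a, ha, h1⟩ := exists_near_moveCoeff 0 d.phi d'.phi p hr hε
  obtain ⟨b, hb, h2⟩ := exists_near_moveCoeff 0 d.alpha1 d'.alpha1 p hr hε
  obtain ⟨c, hc, h3⟩ := exists_near_moveCoeff 1 d.alpha0 d'.alpha0 p hr hε
  obtain ⟨f, hf, h4⟩ := exists_near_moveCoeff (-1) d.alpha2 d'.alpha2 p hr hε
  refine ⟨min (min a b) (min c f), by positivity, fun t h0 ht => ?_⟩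
  simp only [lt_min_iff] at ht
  exact ⟨h1 t h0 ht.1.1, h2 t h0 ht.1.2, h3 t h0 ht.2.1, h4 t h0 ht.2.2⟩

/-! ### Density -/

theorem logSet_dense {q : ℝ} {n : ℕ} {c : Component} {k : ℕ × ℤ} (hk : k ∈ modes c.weight n) {e : ℝ}
    (he : e ∈ 𝕊) {K : ℕ} (hne : (logSet q n c k e K).Nonempty) {r ε : ℝ} (hr : 0 < r)
    (hε : 0 < ε) (d : InitialData) : ∃ d' ∈ logSet q n c k e K, InitialData.Near r ε d d' := by
  obtain ⟨D, hD⟩ := hne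
  let v : Coeffs discAlgebra := fun m c k =>
    affDisc (d.vec m c k) (D.vec m c k - d.vec m c k)
  have hv : NoPotential v := by
    intro c hc k
    ext z
    simp [v, d.vec_zero c hc, D.vec_zero c hc, affDisc]
  obtain ⟨F, hF⟩ := exists_coeff_family conjDiscAlgebra q hv hk he
  have h1 : |(1 : ℝ)| ≤ 3 := by norm_num
  obtain ⟨i, j, hj, hne⟩ := (hF (evDisc h1) (continuous_evDisc h1) (evDisc_conj h1) D.vec D.vec_zero
    (fun m _ c k _ => by simp [v, evDisc_aff]) _ (solFam_isJetA q D) K).mp hD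
  obtain ⟨δ, hδ, hnear⟩ := d.exists_near_move D n hr hε
  by_contra! hcon
  refine hne (evDisc_one_eq_zero _ hδ fun t ht h0 htδ => ?_)
  by_contra hne'
  refine hcon (d.move D n t) ?_ (hnear t h0 htδ)
  exact (hF (evDisc ht) (continuous_evDisc ht) (evDisc_conj ht) _ (d.move D n t).vec_zero
    (fun m hm c k _ => (d.move_vec D t hm c k).symm) _ (solFam_isJetA q _) K).mpr ⟨i, j, hj, hne'⟩

theorem logSet_openDense {q : ℝ} {n : ℕ} {c : Component} {k : ℕ × ℤ} (hk : k ∈ modes c.weight n)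
    {e : ℝ} (he : e ∈ 𝕊) {K : ℕ} (hne : (logSet q n c k e K).Nonempty) :
    OpenDense (logSet q n c k e K) := fun _ hr =>
  ⟨fun _ hd => logSet_open hk he hr hd, fun d _ hε => logSet_dense hk he hne hr hε d⟩

theorem InitialData.Near.mono {r ε ε' : ℝ} {d d' : InitialData} (h : InitialData.Near r ε d d')
    (hε : ε ≤ ε') : InitialData.Near r ε' d d' :=
  ⟨fun n k hk => (h.1 n k hk).trans hε, fun n k hk => (h.2.1 n k hk).trans hε,
    fun n k hk => (h.2.2.1 n k hk).trans hε, fun n k hk => (h.2.2.2 n k hk).trans hε⟩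

theorem InitialData.Near.trans {r ε ε' : ℝ} (hr : 0 < r) {d d' d'' : InitialData}
    (h : InitialData.Near r ε d d') (h' : InitialData.Near r ε' d' d'') :
    InitialData.Near r (ε + ε') d d'' := by
  have key : ∀ {n : ℕ} {x y z : ℂ}, r ^ n / (n.factorial : ℝ) * ‖x - y‖ ≤ ε →
      r ^ n / (n.factorial : ℝ) * ‖y - z‖ ≤ ε' → r ^ n / (n.factorial : ℝ) * ‖x - z‖ ≤ ε + ε' := by
    intro n x y z h1 h2
    have h3 : 0 ≤ r ^ n / (n.factorial : ℝ) := by positivity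
    have := mul_le_mul_of_nonneg_left (norm_sub_le_norm_sub_add_norm_sub x y z) h3
    linarith
  exact ⟨fun n k hk => key (h.1 n k hk) (h'.1 n k hk), fun n k hk => key (h.2.1 n k hk) (h'.2.1 n k hk),
    fun n k hk => key (h.2.2.1 n k hk) (h'.2.2.1 n k hk),
    fun n k hk => key (h.2.2.2 n k hk) (h'.2.2.2 n k hk)⟩

theorem InitialData.near_self {r ε : ℝ} (hε : 0 < ε) (d : InitialData) :
    InitialData.Near r ε d d := by
  refine ⟨?_, ?_, ?_, ?_⟩ <;> intro n k _ <;> simpa using hε.le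

theorem OpenDense.inter {S S' : Set InitialData} (h : OpenDense S) (h' : OpenDense S') :
    OpenDense (S ∩ S') := by
  intro r hr
  refine ⟨fun d hd => ?_, fun d ε hε => ?_⟩
  · obtain ⟨a, ha, h1⟩ := (h r hr).1 d hd.1
    obtain ⟨b, hb, h2⟩ := (h' r hr).1 d hd.2
    exact ⟨min a b, lt_min ha hb, fun d' hd' => ⟨h1 d' (hd'.mono (min_le_left _ _)),
      h2 d' (hd'.mono (min_le_right _ _))⟩⟩
  · obtain ⟨d1, hd1, n1⟩ := (h r hr).2 d (ε / 2) (by positivity)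
    obtain ⟨a, ha, h1⟩ := (h r hr).1 d1 hd1
    obtain ⟨d2, hd2, n2⟩ := (h' r hr).2 d1 (min (ε / 2) a) (by positivity)
    refine ⟨d2, ⟨h1 d2 (n2.mono (min_le_right _ _)), hd2⟩, (n1.trans hr n2).mono ?_⟩
    linarith [min_le_left (ε / 2) a]

theorem openDense_univ : OpenDense univ := fun r _ =>
  ⟨fun _ _ => ⟨1, one_pos, fun _ _ => trivial⟩, fun d _ hε => ⟨d, trivial, d.near_self hε⟩⟩

theorem openDense_biInter {ι : Type*} (t : Finset ι) {S : ι → Set InitialData}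
    (h : ∀ i ∈ t, OpenDense (S i)) : OpenDense {d | ∀ i ∈ t, d ∈ S i} := by
  classical
  induction t using Finset.induction_on with
  | empty => simpa using openDense_univ
  | insert i t hi ih =>
    have := (h i (by simp)).inter (ih fun j hj => h j (by simp [hj]))
    convert! this using 1
    ext d
    simp

end Data

/-! ### Growth of solutions towards the end points -/

section Growth

theorem monotone_of_deriv_nonneg {f f' : ℝ → ℝ} {a b : ℝ}
    (h : ∀ t ∈ Ico a b, HasDerivAt f (f' t) t) (h0 : ∀ t ∈ Ioo a b, 0 ≤ f' t) :
    MonotoneOn f (Ico a b) := by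
  refine monotoneOn_of_deriv_nonneg (convex_Ico a b) (fun t ht => (h t ht).continuousAt.continuousWithinAt)
    (fun t ht => ?_) fun t ht => ?_
  · rw [interior_Ico] at ht
    exact (h t (Ioo_subset_Ico_self ht)).differentiableAt.differentiableWithinAt
  · rw [interior_Ico] at ht
    rw [(h t (Ioo_subset_Ico_self ht)).deriv]
    exact h0 t ht

theorem hasDerivAt_re {f : ℝ → ℂ} {f' : ℂ} {t : ℝ} (h : HasDerivAt f f' t) :
    HasDerivAt (fun t => (f t).re) f'.re t :=
  Complex.reCLM.hasFDerivAt.comp_hasDerivAt t h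

theorem conj_mul_self_re (z : ℂ) : (conj z * z).re = ‖z‖ ^ 2 := by
  rw [mul_comm, mul_conj, normSq_eq_norm_sq]; norm_cast

/-- Solutions of the singular equation with a positive zeroth order term grow away from `0`. -/
theorem growth {y y' y'' : ℝ → ℂ} {β γ lam : ℝ} (hlam : 0 ≤ lam)
    (h1 : ∀ t ∈ Ico (0 : ℝ) 1, HasDerivAt y (y' t) t)
    (h2 : ∀ t ∈ Ico (0 : ℝ) 1, HasDerivAt y' (y'' t) t)
    (heq : ∀ t ∈ Ico (0 : ℝ) 1, (1 - (t : ℂ) ^ 2) * y'' t + (β * t + γ) * y' t = lam * y t)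
    (h0 : y' 0 = 0) : (∀ t ∈ Ico (0 : ℝ) 1, 0 ≤ (conj (y t) * y' t).re) ∧
      MonotoneOn (fun t => (conj (y t) * y t).re) (Ico 0 1) := by
  set W : ℝ → ℝ := fun t => (conj (y t) * y' t).re with hW
  have dW : ∀ t ∈ Ico (0 : ℝ) 1, HasDerivAt W (conj (y' t) * y' t + conj (y t) * y'' t).re t :=
    fun t ht => hasDerivAt_re ((hasDerivAt_conj_comp (h1 t ht)).mul (h2 t ht))
  have hsq : ∀ z : ℂ, 0 ≤ (conj z * z).re := fun z => by
    rw [mul_comm, mul_conj]; exact_mod_cast Complex.normSq_nonneg z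
  have hWpos : ∀ t ∈ Ico (0 : ℝ) 1, 0 ≤ W t := by
    set μ : ℝ → ℝ := fun t => Real.exp (-((β + γ) / 2) * Real.log (1 - t) +
      ((γ - β) / 2) * Real.log (1 + t)) with hμ
    have dμ : ∀ t ∈ Ico (0 : ℝ) 1, HasDerivAt μ (μ t * ((β * t + γ) / (1 - t ^ 2))) t := by
      intro t ht
      have p1 : 0 < 1 - t := by linarith [ht.2]
      have p2 : 0 < 1 + t := by linarith [ht.1]
      have d1 := (((hasDerivAt_id t).const_sub 1).log p1.ne').const_mul (-((β + γ) / 2))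
      have d2 := (((hasDerivAt_id t).const_add 1).log p2.ne').const_mul ((γ - β) / 2)
      refine (d1.add d2).exp.congr_deriv ?_
      have e : 1 - t ^ 2 = (1 - t) * (1 + t) := by ring
      simp only [hμ, id, Pi.add_apply]
      congr 1
      rw [e]
      field_simp
      ring
    have hm : MonotoneOn (fun t => μ t * W t) (Ico 0 1) := by
      refine monotone_of_deriv_nonneg (fun t ht => (dμ t ht).mul (dW t ht)) fun t ht' => ?_
      have ht := Ioo_subset_Ico_self ht'
      have p : 0 < 1 - t ^ 2 := by nlinarith [ht.1, ht.2]
      have pμ : 0 < μ t := Real.exp_pos _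
      have hc := congrArg (fun z => (conj (y t) * z).re) (heq t ht)
      have e1 : (conj (y t) * ((1 - (t : ℂ) ^ 2) * y'' t + (β * t + γ) * y' t)).re =
          (1 - t ^ 2) * (conj (y t) * y'' t).re + (β * t + γ) * W t := by
        rw [show conj (y t) * ((1 - (t : ℂ) ^ 2) * y'' t + (β * t + γ) * y' t) =
          ((1 - t ^ 2 : ℝ) : ℂ) * (conj (y t) * y'' t) + ((β * t + γ : ℝ) : ℂ) * (conj (y t) * y' t) by
            push_cast; ring, Complex.add_re, re_ofReal_mul, re_ofReal_mul]
      have e2 : (conj (y t) * (lam * y t)).re = lam * (conj (y t) * y t).re := by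
        rw [show conj (y t) * (lam * y t) = (lam : ℂ) * (conj (y t) * y t) by ring,
          re_ofReal_mul]
      simp only [e1, e2] at hc
      have e3 : (conj (y t) * y'' t).re + (β * t + γ) / (1 - t ^ 2) * W t =
          lam * (conj (y t) * y t).re / (1 - t ^ 2) := by
        rw [← hc]; field_simp
      have e4 : 0 ≤ lam * (conj (y t) * y t).re / (1 - t ^ 2) :=
        div_nonneg (mul_nonneg hlam (hsq _)) p.le
      rw [Complex.add_re]
      have := hsq (y' t)
      nlinarith [mul_nonneg pμ.le (add_nonneg this e4)]
    intro t ht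
    have := hm ⟨le_rfl, one_pos⟩ ht ht.1
    have e : W 0 = 0 := by simp [hW, h0]
    simp only [e, mul_zero] at this
    exact nonneg_of_mul_nonneg_right this (Real.exp_pos _)
  refine ⟨hWpos, monotone_of_deriv_nonneg
    (fun t ht => hasDerivAt_re ((hasDerivAt_conj_comp (h1 t ht)).mul (h1 t ht))) fun t ht => ?_⟩
  have := hWpos t (Ioo_subset_Ico_self ht)
  rw [Complex.add_re, show (conj (y' t) * y t).re = W t by
    simp only [hW, Complex.mul_re, Complex.conj_re, Complex.conj_im]; ring]
  linarith

/-- Solutions grow without bound if the drift is directed towards the end point. -/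
theorem growth_unbounded {y y' y'' : ℝ → ℂ} {m lam : ℝ} (hm : 1 ≤ m) (hlam : 0 < lam)
    (h1 : ∀ t ∈ Ico (0 : ℝ) 1, HasDerivAt y (y' t) t)
    (h2 : ∀ t ∈ Ico (0 : ℝ) 1, HasDerivAt y' (y'' t) t)
    (heq : ∀ t ∈ Ico (0 : ℝ) 1, (1 - (t : ℂ) ^ 2) * y'' t - 2 * m * y' t = lam * y t)
    (h0 : y' 0 = 0) (hy : y 0 ≠ 0) :
    Tendsto (fun x => ‖y (1 - x)‖) (𝓝[>] 0) atTop := by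
  obtain ⟨hW, hN⟩ := growth (β := 0) (γ := -2 * m) hlam.le h1 h2 (fun t ht => by
    rw [← heq t ht]; push_cast; ring) h0
  simp only [conj_mul_self_re] at hN
  set N0 := ‖y 0‖ ^ 2 with hN0
  have hN0p : 0 < N0 := by have := norm_pos_iff.mpr hy; positivity
  have hNge : ∀ t ∈ Ico (0 : ℝ) 1, N0 ≤ ‖y t‖ ^ 2 := fun t ht => hN ⟨le_rfl, one_pos⟩ ht ht.1
  set W : ℝ → ℝ := fun t => (conj (y t) * y' t).re with hWd
  have dW : ∀ t ∈ Ico (0 : ℝ) 1, HasDerivAt W (conj (y' t) * y' t + conj (y t) * y'' t).re t :=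
    fun t ht => hasDerivAt_re ((hasDerivAt_conj_comp (h1 t ht)).mul (h2 t ht))
  have hZ : MonotoneOn (fun t => (1 - t) * W t - lam * N0 / 2 * t) (Ico 0 1) := by
    refine monotone_of_deriv_nonneg (fun t ht => (((hasDerivAt_id t).const_sub 1).mul (dW t ht)).sub
      ((hasDerivAt_id t).const_mul _)) fun t ht' => ?_
    have ht := Ioo_subset_Ico_self ht'
    have p : 0 < 1 + t := by linarith [ht.1]
    have p' : 0 < 1 - t := by linarith [ht.2]
    have hc := congrArg (fun z => (conj (y t) * z).re) (heq t ht)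
    have e1 : (conj (y t) * ((1 - (t : ℂ) ^ 2) * y'' t - 2 * m * y' t)).re =
        (1 - t ^ 2) * (conj (y t) * y'' t).re - 2 * m * W t := by
      rw [show conj (y t) * ((1 - (t : ℂ) ^ 2) * y'' t - 2 * m * y' t) =
        ((1 - t ^ 2 : ℝ) : ℂ) * (conj (y t) * y'' t) - ((2 * m : ℝ) : ℂ) * (conj (y t) * y' t) by
          push_cast; ring, Complex.sub_re, re_ofReal_mul, re_ofReal_mul]
    have e2 : (conj (y t) * (lam * y t)).re = lam * ‖y t‖ ^ 2 := by
      rw [show conj (y t) * (lam * y t) = (lam : ℂ) * (conj (y t) * y t) by ring,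
        re_ofReal_mul, conj_mul_self_re]
    simp only [e1, e2] at hc
    have e3 : (1 - t) * (conj (y t) * y'' t).re = (lam * ‖y t‖ ^ 2 + 2 * m * W t) / (1 + t) := by
      rw [eq_div_iff p.ne']; linarith
    have e4 : lam * N0 / 2 + W t ≤ (lam * ‖y t‖ ^ 2 + 2 * m * W t) / (1 + t) := by
      rw [le_div_iff₀ p]
      have a1 := mul_le_mul_of_nonneg_left (hNge t ht) hlam.le
      have a2 : 0 ≤ lam * N0 := by positivity
      have a3 : 0 ≤ W t := hW t ht
      nlinarith [ht.2, ht.1, mul_nonneg a3 (by linarith : 0 ≤ m - 1), mul_nonneg a3 p'.le,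
        mul_nonneg a2 p'.le]
    simp only [id, Complex.add_re, conj_mul_self_re]
    have := mul_nonneg p'.le (sq_nonneg ‖y' t‖)
    linarith
  have hWge : ∀ t ∈ Ico (0 : ℝ) 1, lam * N0 / 2 * t ≤ (1 - t) * W t := fun t ht => by
    have := hZ ⟨le_rfl, one_pos⟩ ht ht.1
    simp only [hWd, h0, mul_zero, Complex.zero_re, sub_zero] at this
    linarith
  set c := lam * N0 / 2 with hc
  have hcp : 0 < c := by positivity
  have hM : MonotoneOn (fun t => ‖y t‖ ^ 2 + c * Real.log (1 - t)) (Ico (1 / 2) 1) := by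
    refine monotone_of_deriv_nonneg (f' := fun t => 2 * W t + c * (-1 / (1 - t))) (fun t ht => ?_)
      fun t ht => ?_
    · have ht' : t ∈ Ico (0 : ℝ) 1 := ⟨by linarith [ht.1], ht.2⟩
      have p' : 0 < 1 - t := by linarith [ht.2]
      have d1 := hasDerivAt_re ((hasDerivAt_conj_comp (h1 t ht')).mul (h1 t ht'))
      have d2 := (((hasDerivAt_id t).const_sub 1).log p'.ne').const_mul c
      have e : (fun t => (conj (y t) * y t).re) = fun t => ‖y t‖ ^ 2 := funext fun t => conj_mul_self_re _
      simp only [Pi.mul_apply, e] at d1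
      refine (d1.add d2).congr_deriv ?_
      rw [Complex.add_re, show (conj (y' t) * y t).re = W t by
        simp only [hWd, Complex.mul_re, Complex.conj_re, Complex.conj_im]; ring]
      simp only [id]
      ring
    · have ht' : t ∈ Ico (0 : ℝ) 1 := ⟨by linarith [ht.1], ht.2⟩
      have p' : 0 < 1 - t := by linarith [ht.2]
      have := hWge t ht'
      have e : 2 * W t + c * (-1 / (1 - t)) = (2 * ((1 - t) * W t) - c) / (1 - t) := by
        field_simp; ring
      rw [e]
      exact div_nonneg (by nlinarith [ht.1]) p'.le
  have hlog : Tendsto (fun x : ℝ => -c * Real.log x) (𝓝[>] 0) atTop := by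
    have := Real.tendsto_log_nhdsGT_zero.const_mul_atBot_of_neg (neg_lt_zero.mpr hcp)
    exact this
  have hsq : Tendsto (fun x => ‖y (1 - x)‖ ^ 2) (𝓝[>] 0) atTop := by
    refine tendsto_atTop_mono' _ ?_ (tendsto_atTop_add_const_right _ (c * Real.log (1 / 2)) hlog)
    filter_upwards [Ioo_mem_nhdsGT (show (0 : ℝ) < 1 / 2 by norm_num)] with x hx
    have := hM (a := 1 / 2) (b := 1 - x) ⟨le_rfl, by norm_num⟩ ⟨by linarith [hx.2], by linarith [hx.1]⟩
      (by linarith [hx.2])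
    simp only [sub_sub_cancel] at this
    have e : (1 : ℝ) - 1 / 2 = 1 / 2 := by norm_num
    rw [e] at this
    nlinarith [sq_nonneg ‖y (1 / 2)‖]
  refine (Real.tendsto_sqrt_atTop.comp hsq).congr fun x => ?_
  exact Real.sqrt_sq (norm_nonneg _)

end Growth

/-! ### The recursion for the log series of a solution -/

section Recursion

open Polynomial

theorem lev_theta_of_lev {e : ℝ} (he : e ∈ 𝕊) {f : ℝ → ℂ} {M : ℕ} {F : ℕ → ℂ[X]}
    (hf : ContDiffOn ℝ ∞ f 𝕀) (hF : IsLogSer M F)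
    (h : ∀ᶠ x in 𝓝₊, f (e * (1 - x)) = lev M F x) :
    ∀ᶠ x in 𝓝₊, (x * -e) • deriv f (e * (1 - x)) = lev M (theta F) x := by
  filter_upwards [eventually_nhds_of_nhdsGT h, hF.hasDerivAt_lev, Ioo_zero_one_mem_nhdsGT]
    with x h1 h2 hx
  have := (hasDerivAt_comp_endpoint he hf hx).unique (h2.congr_of_eventuallyEq h1)
  rw [mul_smul, this, smul_inv_smul₀ hx.1.ne']

theorem isFrobenius_of_sing {e : ℝ} (he : e ∈ 𝕊) {n N M : ℕ} {β γ : ℝ} {κ : ℂ}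
    {f g : ℝ → ℂ} {h F : ℕ → ℂ[X]} (hn : β + e * γ = 2 * (n - 1))
    (hf : ContDiffOn ℝ ∞ f 𝕀) (hs : ∀ τ ∈ 𝕀, sing β γ κ f τ = g τ)
    (hh : IsLogSer N h) (hg : ∀ᶠ x in 𝓝₊, x • g (e * (1 - x)) = lev N h x)
    (hF : IsLogSer M F) (hfF : ∀ᶠ x in 𝓝₊, f (e * (1 - x)) = lev M F x) :
    IsFrobenius n (β + 1) κ h F := by
  wlog hNM : N ≤ M generalizing M
  · exact this (M := max M N) (hF.mono (le_max_left _ _)) (by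
      filter_upwards [hfF] with x hx
      rw [hx, hF.lev_mono (le_max_left M N)]) (le_max_right _ _)
  have hh' := hh.mono hNM
  have t1 := hF.theta
  have t2 := t1.theta
  have q1 := (t2.add (t1.smul (-(β + 1))))
  have q := q1.add (hF.C_mul κ)
  have l := (t2.smul 2).add (t1.smul (-(2 * n)))
  have d1 := lev_theta_of_lev he hf hF hfF
  set R : ℕ → ℂ[X] := fun i => h i + xmul (fun i => theta (theta F) i + (-(β + 1)) • theta F i +
    C κ * F i) i with hR
  have hRs : IsLogSer M R := hh'.add q.xmul
  set Lh : ℕ → ℂ[X] := fun i => (2 : ℝ) • theta (theta F) i + (-(2 * n) : ℝ) • theta F i with hL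
  have key : Lh = R := by
    refine l.congr_of_lev hRs ?_
    have he2 := endpoint_mul_self he
    filter_upwards [hfF, d1, eventually_nhds_of_nhdsGT d1, t1.hasDerivAt_lev, hg, eventually_pos,
      Ioo_zero_one_mem_nhdsGT,
      (t2.smul 2).lev_add (t1.smul (-(2 * n))), t2.lev_smul 2, t1.lev_smul (-(2 * n) : ℝ),
      hh'.lev_add q.xmul, q.lev_xmul, q1.lev_add (hF.C_mul κ), t2.lev_add (t1.smul (-(β + 1))),
      t1.lev_smul (-(β + 1)), hF.lev_C_mul κ] with x h0 h1 h1' h2 hgx hx hx1 e1 e2 e3 e4 e5 e6 e7 e8 e9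
    rw [e1, e2, e3, e4, e5, e6, e7, e8, e9, hh.lev_mono hNM, ← hgx, ← hs _ (mem_Ioo_of_endpoint he hx1),
      sing, ← h0]
    have d2 := ((hasDerivAt_id x).mul_const (-e)).smul
      (hasDerivAt_comp_endpoint he (contDiffOn_deriv hf) hx1)
    have h3 := d2.unique (h2.congr_of_eventuallyEq h1')
    rw [eq_inv_smul_iff₀ hx.ne'] at h3
    simp only [id] at h3
    rw [← h3, ← h1]
    set D1 := deriv f (e * (1 - x))
    set D2 := deriv (deriv f) (e * (1 - x))
    set f0 := f (e * (1 - x))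
    simp only [real_smul]
    have he2' : (e : ℂ) * e = 1 := by exact_mod_cast he2
    have hn' : (β : ℂ) + e * γ = 2 * (n - 1) := by exact_mod_cast hn
    push_cast
    linear_combination (-(e : ℂ) * x * D1) * hn' +
      ((x : ℂ) * γ * D1 + 2 * x ^ 2 * D2 - x ^ 3 * D2 + x * (1 - x) ^ 2 * D2) * he2'
  have hi : ∀ i, indicial n i (F i) = R i := by
    intro i
    rw [← key, hL]
    simp only [indicial, theta, dil, derivative_add, derivative_smul]
    module
  refine ⟨(hi 0).trans ?_, fun i => (hi (i + 1)).trans ?_⟩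
  · simp [hR, xmul]
  · simp [hR, xmul, lowerOp, theta]

end Recursion

/-! ### Logarithms in solutions of the homogeneous equation -/

section Homogeneous

open Polynomial

theorem eq_C_of_not_hasLogTerm {e : ℝ} {M : ℕ} {f : ℝ → ℂ} {F : ℕ → ℂ[X]} (hF : IsLogSer M F)
    (hf : ∀ᶠ x in 𝓝₊, f (e * (1 - x)) = lev M F x) (h : ¬ HasLogTerm f e 1) (i : ℕ) :
    F i = C ((F i).coeff 0) := by
  ext j
  rw [coeff_C]
  split_ifs with hj
  · rw [hj]
  · by_contra hne
    exact h (hasLogTerm_of_coeff_ne_zero hF hf (Nat.one_le_iff_ne_zero.mpr hj) hne)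

theorem dil_C (c : ℝ) (a : ℂ) : dil c (C a) = C (c * a) := by
  simp [dil, smul_C]

theorem indicial_C (n i : ℕ) (a : ℂ) : indicial n i (C a) = C (2 * i * (i - n) * a) := by
  rw [indicial, dil_C, dil_C, smul_C]
  congr 1
  push_cast [real_smul]
  ring

theorem lowerOp_C (b : ℝ) (κ : ℂ) (i : ℕ) (a : ℂ) :
    lowerOp b κ i (C a) = C ((i ^ 2 - b * i + κ) * a) := by
  rw [lowerOp, dil_C, dil_C, smul_C, ← C_mul, ← C_add, ← C_add]
  congr 1
  push_cast [real_smul]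
  ring

variable {e : ℝ} (he : e ∈ 𝕊) {β γ lam : ℝ} {f : ℝ → ℂ}
  (hf : ContDiffOn ℝ ∞ f 𝕀)

include he hf

theorem reflect_hasDerivAt {t : ℝ} (ht : t ∈ Ico (0 : ℝ) 1) :
    HasDerivAt (fun t => f (e * t)) (e * deriv f (e * t)) t ∧
    HasDerivAt (fun t => (e : ℂ) * deriv f (e * t)) (deriv (deriv f) (e * t)) t := by
  have hm : e * t ∈ 𝕀 := by
    rcases he with rfl | h
    · constructor <;> linarith [ht.1, ht.2]
    · rw [mem_singleton_iff] at h; subst h; constructor <;> linarith [ht.1, ht.2]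
  have hl : HasDerivAt (fun t => e * t) e t := by simpa using (hasDerivAt_id t).const_mul e
  have d1 := (hasDerivAt_of_contDiffOn hf hm).scomp t hl
  have d2 := ((hasDerivAt_of_contDiffOn (contDiffOn_deriv hf) hm).scomp t hl).const_mul (e : ℂ)
  refine ⟨d1.congr_deriv (by simp), d2.congr_deriv ?_⟩
  have : (e : ℂ) * e = 1 := by exact_mod_cast endpoint_mul_self he
  rw [real_smul, ← mul_assoc, this, one_mul]

theorem reflect_eq (hs : ∀ τ ∈ 𝕀, sing β γ (lam : ℂ) f τ = 0) {t : ℝ}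
    (ht : t ∈ Ico (0 : ℝ) 1) : (1 - (t : ℂ) ^ 2) * deriv (deriv f) (e * t) +
      (β * t + (e * γ : ℝ)) * (e * deriv f (e * t)) = lam * f (e * t) := by
  have hm : e * t ∈ 𝕀 := by
    rcases he with rfl | h
    · constructor <;> linarith [ht.1, ht.2]
    · rw [mem_singleton_iff] at h; subst h; constructor <;> linarith [ht.1, ht.2]
  have h := hs _ hm
  simp only [sing, real_smul] at h
  push_cast at h ⊢
  have h1 : (e : ℂ) * e = 1 := by exact_mod_cast endpoint_mul_self he
  linear_combination h + (γ * deriv f (e * t) + t ^ 2 * deriv (deriv f) (e * t)) * h1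

theorem norm_le_of_sing (hlam : 0 ≤ lam) (hs : ∀ τ ∈ 𝕀, sing β γ (lam : ℂ) f τ = 0)
    (h0 : deriv f 0 = 0) : ∀ᶠ x in 𝓝₊, ‖f 0‖ ≤ ‖f (e * (1 - x))‖ := by
  have h := (growth (y := fun t => f (e * t)) (β := β) (γ := e * γ) hlam
    (fun t ht => (reflect_hasDerivAt he hf ht).1) (fun t ht => (reflect_hasDerivAt he hf ht).2)
    (fun t ht => reflect_eq he hf hs ht) (by simp [h0])).2
  filter_upwards [Ioo_zero_one_mem_nhdsGT] with x hx
  have := h (a := 0) (b := 1 - x) ⟨le_rfl, one_pos⟩ ⟨by linarith [hx.2], by linarith [hx.1]⟩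
    (by linarith [hx.2])
  simp only [conj_mul_self_re, mul_zero] at this
  exact (sq_le_sq₀ (norm_nonneg _) (norm_nonneg _)).mp this

theorem tendsto_norm_of_sing {m : ℝ} (hm : 1 ≤ m) (hlam : 0 < lam) (hγ : e * γ = -2 * m)
    (hs : ∀ τ ∈ 𝕀, sing 0 γ (lam : ℂ) f τ = 0) (h0 : deriv f 0 = 0) (hf0 : f 0 ≠ 0) :
    Tendsto (fun x => ‖f (e * (1 - x))‖) (𝓝[>] 0) atTop := by
  refine growth_unbounded (y := fun t => f (e * t)) hm hlam
    (fun t ht => (reflect_hasDerivAt he hf ht).1) (fun t ht => (reflect_hasDerivAt he hf ht).2)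
    (fun t ht => ?_) (by simp [h0]) (by simpa using hf0)
  rw [← reflect_eq he hf hs ht, hγ]
  push_cast
  ring

/-- Solutions without logarithms of the homogeneous equation vanish to the order of the larger
exponent. -/
theorem exists_logSer_of_not_hasLogTerm {n p : ℕ} (hp : 1 ≤ p) (hlam : (p : ℝ) ^ 2 < lam)
    (hn : 2 * ((p : ℝ) - 1) + e * γ = 2 * (n - 1))
    (hs : ∀ τ ∈ 𝕀, sing (2 * (p - 1)) γ (lam : ℂ) f τ = 0)
    (hlog : ¬ HasLogTerm f e 1) : ∃ F, IsLogSer 2 F ∧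
      (∀ᶠ x in 𝓝₊, f (e * (1 - x)) = lev 2 F x) ∧ (∀ i, F i = C ((F i).coeff 0)) ∧
      ∀ i < n, F i = 0 := by
  have hz : ∀ᶠ x in 𝓝₊, x • (fun _ : ℝ => (0 : ℂ)) (e * (1 - x)) =
      lev 0 (fun _ => (0 : ℂ[X])) x := by simp [lev_zero]
  obtain ⟨F, hF, hfF⟩ := exists_logSer_of_sing he hn hf hs (isLogSer_zero 0) hz
  refine ⟨F, hF, hfF, eq_C_of_not_hasLogTerm hF hfF hlog, ?_⟩
  have hC := eq_C_of_not_hasLogTerm hF hfF hlog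
  have hr := (isFrobenius_of_sing he hn hf hs (isLogSer_zero 0) hz hF hfF).2
  have hstep : ∀ i, i + 1 ≤ n → F (i + 1) = 0 ∨ i + 1 = n → F i = 0 := by
    intro i hi h1
    have h := hr i
    rw [hC i, hC (i + 1), indicial_C, lowerOp_C, zero_add, C_inj] at h
    have hl : (2 * ((i + 1 : ℕ) : ℂ) * (((i + 1 : ℕ) : ℂ) - n) * (F (i + 1)).coeff 0) = 0 := by
      rcases h1 with h1 | h1
      · simp [h1]
      · rw [h1]; simp
    rw [hl, eq_comm, mul_eq_zero] at h
    rcases h with h | h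
    · exfalso
      have h' : ((i : ℝ) ^ 2 - (2 * (p - 1) + 1) * i + lam : ℝ) = 0 := by exact_mod_cast h
      have : (1 : ℝ) ≤ p := by exact_mod_cast hp
      nlinarith [sq_nonneg ((i : ℝ) - (2 * p - 1) / 2)]
    · rw [hC i, h, C_0]
  have hall : ∀ j, j < n → F (n - 1 - j) = 0 := by
    intro j
    induction j with
    | zero => intro h; exact hstep _ (by omega) (Or.inr (by omega))
    | succ j ih =>
      intro h
      refine hstep _ (by omega) (Or.inl ?_)
      rw [show n - 1 - (j + 1) + 1 = n - 1 - j by omega]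
      exact ih (by omega)
  intro i hi
  have := hall (n - 1 - i) (by omega)
  rwa [show n - 1 - (n - 1 - i) = i by omega] at this

theorem hasLogTerm_of_sing {n p : ℕ} (hn0 : n ≠ 0) (hp : 1 ≤ p) (hlam : (p : ℝ) ^ 2 < lam)
    (hn : 2 * ((p : ℝ) - 1) + e * γ = 2 * (n - 1))
    (hs : ∀ τ ∈ 𝕀, sing (2 * (p - 1)) γ (lam : ℂ) f τ = 0) (h0 : deriv f 0 = 0)
    (hf0 : f 0 ≠ 0) : HasLogTerm f e 1 := by
  by_contra hlog
  obtain ⟨F, hF, hfF, -, hF0⟩ := exists_logSer_of_not_hasLogTerm he hf hp hlam hn hs hlog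
  have ht := hF.tendsto_lev (c := 0) (by rw [hF0 0 (Nat.pos_of_ne_zero hn0), C_0])
  have h1 := norm_le_of_sing he hf ((sq_nonneg (p : ℝ)).trans hlam.le) hs h0
  have h2 : Tendsto (fun x => ‖lev 2 F x‖) (𝓝[>] 0) (𝓝 0) := by simpa using ht.norm
  have h3 : ‖f 0‖ ≤ 0 := ge_of_tendsto h2 (by
    filter_upwards [h1, hfF] with x hx hx'
    rwa [← hx'])
  exact hf0 (norm_le_zero_iff.mp h3)

/-- The leading coefficient of the logarithmic series of an unbounded solution. -/
theorem coeff_one_ne_zero_of_sing (hlam : 0 < lam) (hγ : e * γ = -2)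
    (hs : ∀ τ ∈ 𝕀, sing 0 γ (lam : ℂ) f τ = 0) (h0 : deriv f 0 = 0) (hf0 : f 0 ≠ 0) :
    ∃ F, IsLogSer 2 F ∧ (∀ᶠ x in 𝓝₊, f (e * (1 - x)) = lev 2 F x) ∧
      (F 0).coeff 1 ≠ 0 := by
  have hz : ∀ᶠ x in 𝓝₊, x • (fun _ : ℝ => (0 : ℂ)) (e * (1 - x)) =
      lev 0 (fun _ => (0 : ℂ[X])) x := by simp [lev_zero]
  obtain ⟨F, hF, hfF⟩ := exists_logSer_of_sing (n := 0) he (by rw [hγ]; norm_num) hf hs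
    (isLogSer_zero 0) hz
  refine ⟨F, hF, hfF, fun h1 => ?_⟩
  have hC : F 0 = C ((F 0).coeff 0) := by
    ext j
    rw [coeff_C]
    split_ifs with hj
    · rw [hj]
    · rcases Nat.lt_or_ge j 2 with h | h
      · rw [show j = 1 by omega, h1]
      · exact hF.deg 0 j h
  have ht := (hF.tendsto_lev hC).norm
  have hu := tendsto_norm_of_sing he hf le_rfl hlam (by rw [hγ]; norm_num) hs h0 hf0
  exact not_tendsto_atTop_of_tendsto_nhds (ht.congr' (by
    filter_upwards [hfF] with x hx
    rw [hx])) hu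

end Homogeneous

/-! ### Jets of special data -/

section Special

open PowerSeries (coeff)

/-- The constant harmonic. -/
def y0 : ℝ := Real.sqrt (1 / (4 * Real.pi))

theorem nrm_zero : nrm 0 (0, 0) = (y0 : ℂ) := by simp [nrm, y0]

theorem y0_ne_zero : y0 ≠ 0 := fun h => nrm_ne_zero 0 (0, 0) (by rw [nrm_zero, h, Complex.ofReal_zero])

theorem Y_zero (o : Sph) : Y 0 (0, 0) o = (y0 : ℂ) := by
  rw [Y, sY_eq, nrm_zero]
  simp [gH]

/-- The mass which the potential acquires from the scalar field at `ρ = 0`. -/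
def mass (q : ℝ) (a : ℂ) : ℝ := 2 * q ^ 2 * (y0 ^ 2 * ‖a‖ ^ 2)

theorem ofReal_mass (q : ℝ) (a : ℂ) :
    (mass q a : ℂ) = (2 * q ^ 2 : ℂ) • ((nrm 0 (0, 0) • a) * (conj (nrm 0 (0, 0)) • conjL a)) := by
  simp only [mass, nrm_zero, conjL_apply, conj_ofReal, smul_eq_mul]
  have := mul_conj a
  rw [normSq_eq_norm_sq] at this
  push_cast at this ⊢
  rw [← this]
  ring

theorem eq_zero_of_sing {β γ : ℝ} {κ : ℂ} {f : ℝ → ℂ} (hf : ContDiffOn ℝ ∞ f 𝕀)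
    (hs : ∀ τ ∈ 𝕀, sing β γ κ f τ = 0) (h0 : f 0 = 0) (h0' : deriv f 0 = 0) :
    EqOn f 0 𝕀 :=
  sing_unique hf contDiffOn_const (fun τ hτ => by
    rw [hs τ hτ, sing, show deriv (0 : ℝ → ℂ) = 0 from funext fun x => deriv_const x 0,
      show deriv (0 : ℝ → ℂ) = 0 from funext fun x => deriv_const x 0]
    simp) h0 (by rw [h0']; exact (deriv_const (0 : ℝ) (0 : ℂ)).symm)

open Classical in
/-- The family which consists of the scalar field at order `0`. -/
def leadingFam (u : Fam ℂ) : Fam ℂ := fun m c => if m = 0 ∧ c = .phi then u m c else 0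

theorem coeff_src_leadingFam {q : ℝ} {u : Fam ℂ} (h : StaticLevel (u 0)) {τ : ℝ} (hτ : τ ∈ 𝕀)
    (o : Sph) (n : ℕ) (c : Component) :
    coeff n (src q τ (vals conjL (leadingFam u) τ o) c) = 0 := by
  have hw : ∀ m c, c ≠ .phi → leadingFam u m c = 0 := fun m c hc => by simp [leadingFam, hc]
  have hz : ∀ m, m ≠ 0 → leadingFam u m .phi = 0 := fun m hm => by simp [leadingFam, hm]
  have h0 : leadingFam u 0 .phi = u 0 .phi := by simp [leadingFam]
  have hd : ∀ m k, deriv (leadingFam u m .phi k) τ = 0 ∨ k ≠ (0, 0) := by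
    intro m k
    rcases eq_or_ne m 0 with rfl | hm
    · by_cases hk : k = (0, 0)
      · left; rw [h0, hk, h.phi τ hτ]
      · exact Or.inr hk
    · left
      rw [hz m hm]
      exact deriv_const τ (0 : ℂ)
  set V := vals conjL (leadingFam u) τ o with hV
  have hcomp : ∀ c, c ≠ .phi → V.comp c = 0 := fun c hc => by
    ext m
    rw [hV, vals_comp, coeff_ser]
    simp [hw _ c hc]
  have hp : V.p = 0 := hcomp .alphaPlus (by simp)
  have hm : V.m = 0 := hcomp .alphaMinus (by simp)
  have h2 : V.a0 = 0 := hcomp .alpha0 (by simp)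
  have h3 : V.a2 = 0 := hcomp .alpha2 (by simp)
  have hS : ∀ (b : ℕ × ℤ → ℂ) (g : ℕ → ℕ × ℤ → ℂ), (∀ m ≠ 0, ∀ k, g m k = 0) → b (0, 0) = 0 ∨ g 0 (0, 0) = 0 →
      ser 0 b g = 0 := by
    intro b g hg hb
    ext m
    rw [coeff_ser, map_zero]
    rcases eq_or_ne m 0 with rfl | hm
    · rcases hb with hb | hb <;> simp [modes_zero_zero, hb]
    · simp [hg m hm]
  have hdz : ∀ m ≠ 0, ∀ k, deriv (leadingFam u m .phi k) τ = 0 := fun m hm k => by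
    rw [hz m hm]; exact deriv_const τ (0 : ℂ)
  have hφt : V.φt = 0 := hS _ _ hdz (Or.inr ((hd 0 (0, 0)).resolve_right (by simp)))
  have hχt : V.χt = 0 := hS _ (fun m k => conjL (deriv (leadingFam u m .phi k) τ))
    (fun m hm k => by rw [hdz m hm, map_zero])
    (Or.inr (by rw [(hd 0 (0, 0)).resolve_right (by simp), map_zero]))
  have hφz : ∀ m ≠ 0, ∀ k, leadingFam u m .phi k τ = 0 := fun m hm k => by rw [hz m hm]; rfl
  have heφ : V.eφ = 0 := hS _ _ hφz (Or.inl (by simp [ethY]))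
  have hbφ : V.bφ = 0 := hS _ _ hφz (Or.inl (by simp [ethBarY]))
  have heχ : V.eχ = 0 := hS _ (fun m k => conjL (leadingFam u m .phi k τ))
    (fun m hm k => by rw [hφz m hm, map_zero]) (Or.inl (by simp [ethBarY]))
  have hbχ : V.bχ = 0 := hS _ (fun m k => conjL (leadingFam u m .phi k τ))
    (fun m hm k => by rw [hφz m hm, map_zero]) (Or.inl (by simp [ethY]))
  have hxφ : xD V.φ = 0 := by
    ext m
    rw [coeff_xD, map_zero]
    rcases eq_or_ne m 0 with rfl | hm
    · simp
    · rw [hV, vals, coeff_ser]; simp [hφz m hm]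
  have hxχ : xD V.χ = 0 := by
    ext m
    rw [coeff_xD, map_zero]
    rcases eq_or_ne m 0 with rfl | hm
    · simp
    · rw [hV, vals, coeff_ser]; simp [hφz m hm]
  cases c <;> simp [src, cubic, current, Vals.comp, hp, hm, h2, h3, hφt, hχt, heφ, hbφ, heχ, hbχ, hxφ,
    hxχ]

variable {q : ℝ} {v : Coeffs ℂ} {u : Fam ℂ} (hu : IsJetA conjL q v u)
  (hv : NoPotential v)

include hu hv

theorem IsJetA.phi_eq {n : ℕ} (hn : n ≠ 0) {w : Fam ℂ}
    (hw : ∀ m < n, ∀ c, ∀ k ∈ modes c.weight m, EqOn (u m c k) (w m c k) 𝕀) {τ : ℝ}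
    (hτ : τ ∈ 𝕀) (o : Sph) : ∑ k ∈ modes 0 n, Y 0 k o •
      sing (2 * (n - 1)) 0 (kap ℂ n k.1) (u n .phi k) τ = coeff n (src q τ (vals conjL w τ o) .phi) := by
  have e1 := hu.eq n .phi τ hτ o
  rw [coeff_src_phi_congr hn (agreePhi_vals (fun m hm k hk => hw m hm .phi k hk) hτ o)
    (fun c => cong_vals_comp (fun m hm k hk => hw m hm c k hk) hτ o)
    ((hu.staticLevel hv).static hτ o).1, Component.drift_phi] at e1
  exact e1

theorem IsJetA.comp_eq {n : ℕ} {c : Component} (hc : c ≠ .phi) {w : Fam ℂ}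
    (hw : ∀ m < n, ∀ c, ∀ k ∈ modes c.weight m, EqOn (u m c k) (w m c k) 𝕀)
    (hwn : ∀ k ∈ modes 0 n, EqOn (u n .phi k) (w n .phi k) 𝕀) {τ : ℝ}
    (hτ : τ ∈ 𝕀) (o : Sph) : ∑ k ∈ modes c.weight n, Y c.weight k o •
      (sing (2 * (n - 1)) (-2 * c.drift) (kap ℂ n k.1) (u n c k) τ -
        mass q (v 0 .phi (0, 0)) * (u n c k τ - w n c k τ)) =
      coeff n (src q τ (vals conjL w τ o) c) := by
  have e1 := hu.eq n c τ hτ o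
  have h0 := coeff_zero_vals (σ := conjL) u τ o
  have hag : AgreePhi (n + 1) (vals conjL u τ o) (vals conjL w τ o) :=
    agreePhi_vals (fun m hm k hk => by
      rcases Nat.lt_succ_iff_lt_or_eq.mp hm with hm | rfl
      · exact hw m hm .phi k hk
      · exact hwn k hk) hτ o
  rw [coeff_src_congr hag hc (cong_vals_comp (fun m hm k hk => hw m hm c k hk) hτ o), h0.1, h0.2,
    hu.phi_zero hv hτ, vals_comp, vals_comp, coeff_ser, coeff_ser] at e1
  rw [← sub_eq_iff_eq_add.mpr e1, ofReal_mass]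
  simp only [smul_eq_mul, mul_sub, sum_sub_distrib]
  have hf : ∀ (K : ℂ) (f : ℕ × ℤ → ℝ → ℂ), ∑ k ∈ modes c.weight n, Y c.weight k o * (K * f k τ) =
      K * ∑ k ∈ modes c.weight n, Y c.weight k o * f k τ := fun K f => by
    rw [mul_sum]
    exact sum_congr rfl fun k _ => by ring
  rw [hf, hf]
  ring

theorem IsJetA.eqOn_leadingFam {n : ℕ}
    (h : ∀ m, 0 < m → m < n → ∀ c, ∀ k ∈ modes c.weight m, EqOn (u m c k) 0 𝕀) (m : ℕ)
    (hm : m < n) (c : Component) : ∀ k ∈ modes c.weight m,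
      EqOn (u m c k) (leadingFam u m c k) 𝕀 := by
  intro k hk
  by_cases h0 : m = 0 ∧ c = .phi
  · simp only [leadingFam, h0, and_self, if_true]; exact fun _ _ => rfl
  · simp only [leadingFam, h0, if_false]
    rcases Nat.eq_zero_or_pos m with rfl | hm0
    · exact fun τ hτ => (hu.staticLevel hv).zero c (fun h => h0 ⟨rfl, h⟩) k hk τ hτ
    · exact h m hm0 hm c k hk

theorem IsJetA.phi_sing_of_gap {n : ℕ} (hn : n ≠ 0)
    (h : ∀ m, 0 < m → m < n → ∀ c, ∀ k ∈ modes c.weight m, EqOn (u m c k) 0 𝕀) {τ : ℝ}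
    (hτ : τ ∈ 𝕀) : ∀ k ∈ modes 0 n,
      sing (2 * (n - 1)) 0 (kap ℂ n k.1) (u n .phi k) τ = 0 := by
  refine expansion_injective (v' := fun _ => (0 : ℂ)) fun o => ?_
  rw [hu.phi_eq hv hn (hu.eqOn_leadingFam hv h) hτ o, coeff_src_leadingFam (hu.staticLevel hv) hτ o]
  simp

theorem IsJetA.comp_sing_of_gap {n : ℕ} (hn : n ≠ 0)
    (h : ∀ m, 0 < m → m < n → ∀ c, ∀ k ∈ modes c.weight m, EqOn (u m c k) 0 𝕀)
    (hφ : ∀ k ∈ modes 0 n, EqOn (u n .phi k) 0 𝕀) {c : Component} (hc : c ≠ .phi) {τ : ℝ}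
    (hτ : τ ∈ 𝕀) : ∀ k ∈ modes c.weight n,
      sing (2 * (n - 1)) (-2 * c.drift) (kap ℂ n k.1 + mass q (v 0 .phi (0, 0))) (u n c k) τ = 0 := by
  refine expansion_injective (v' := fun _ => (0 : ℂ))
    (v := fun k => sing (2 * (n - 1)) (-2 * c.drift) (kap ℂ n k.1 + mass q (v 0 .phi (0, 0))) (u n c k) τ)
    fun o => ?_
  have e := hu.comp_eq hv hc (hu.eqOn_leadingFam hv h) (fun k hk => by
    simpa [leadingFam, hn] using hφ k hk) hτ o
  rw [coeff_src_leadingFam (hu.staticLevel hv) hτ o] at e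
  simp only [smul_zero, Finset.sum_const_zero]
  rw [← e]
  refine sum_congr rfl fun k _ => ?_
  simp only [leadingFam, hn, false_and, if_false, Pi.zero_apply, sing]
  congr 1
  ring

/-- The jets vanish up to the first order at which the data do not. -/
theorem IsJetA.eq_zero_of_gap {p : ℕ}
    (h : ∀ m, 0 < m → m < p → ∀ c, ∀ k ∈ modes c.weight m, v m c k = 0) (m : ℕ) (hm0 : 0 < m)
    (hm : m < p) : ∀ c, ∀ k ∈ modes c.weight m, EqOn (u m c k) 0 𝕀 := by
  induction m using Nat.strong_induction_on with
  | _ n ih =>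
    have ih' : ∀ m, 0 < m → m < n → ∀ c, ∀ k ∈ modes c.weight m, EqOn (u m c k) 0 𝕀 :=
      fun m h1 h2 => ih m h2 h1 (h2.trans hm)
    have hφ : ∀ k ∈ modes 0 n, EqOn (u n .phi k) 0 𝕀 := fun k hk =>
      eq_zero_of_sing (hu.smooth n .phi k hk) (fun τ hτ => hu.phi_sing_of_gap hv hm0.ne' ih' hτ k hk)
        ((hu.init n .phi k hk).trans (h n hm0 hm .phi k hk)) (hu.init_deriv n .phi k hk)
    intro c k hk
    by_cases hc : c = .phi
    · subst hc; exact hφ k hk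
    · exact eq_zero_of_sing (hu.smooth n c k hk)
        (fun τ hτ => hu.comp_sing_of_gap hv hm0.ne' ih' hφ hc hτ k hk)
        ((hu.init n c k hk).trans (h n hm0 hm c k hk)) (hu.init_deriv n c k hk)

end Special

/-! ### Spherically symmetric jets -/

section Radial

open PowerSeries (coeff coeff_mk)

/-- The spherically symmetric part of a family. -/
def radialFam (u : Fam ℂ) : Fam ℂ := fun m c k => if k = (0, 0) then u m c k else 0

/-- The series of a spherically symmetric family. -/
def radialVals (u : Fam ℂ) (τ : ℝ) : Vals ℂ where
  φ := PowerSeries.mk fun n => y0 * u n .phi (0, 0) τ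
  φt := PowerSeries.mk fun n => y0 * deriv (u n .phi (0, 0)) τ
  eφ := 0
  bφ := 0
  χ := PowerSeries.mk fun n => y0 * conj (u n .phi (0, 0) τ)
  χt := PowerSeries.mk fun n => y0 * conj (deriv (u n .phi (0, 0)) τ)
  eχ := 0
  bχ := 0
  p := PowerSeries.mk fun n => y0 * u n .alphaPlus (0, 0) τ
  m := PowerSeries.mk fun n => y0 * u n .alphaMinus (0, 0) τ
  a0 := 0
  a2 := 0

theorem zero_mem_modes (n : ℕ) : ((0, 0) : ℕ × ℤ) ∈ modes 0 n := by simp [mem_modes]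

theorem zero_not_mem_modes {s : ℤ} (hs : s ≠ 0) (n : ℕ) : ((0, 0) : ℕ × ℤ) ∉ modes s n := by
  simp [mem_modes, hs]

theorem ser_of_radial {b : ℕ × ℤ → ℂ} {g : ℕ → ℕ × ℤ → ℂ} (hg : ∀ m k, k ≠ (0, 0) → g m k = 0) :
    ser 0 b g = PowerSeries.mk fun m => b (0, 0) * g m (0, 0) := by
  ext m
  rw [coeff_ser, coeff_mk, Finset.sum_eq_single_of_mem _ (zero_mem_modes m)
    fun k _ hk => by rw [hg m k hk, smul_zero], smul_eq_mul]

theorem ser_of_radial_of_ne {s : ℤ} (hs : s ≠ 0) {b : ℕ × ℤ → ℂ} {g : ℕ → ℕ × ℤ → ℂ}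
    (hg : ∀ m k, k ≠ (0, 0) → g m k = 0) : ser s b g = 0 := by
  ext m
  rw [coeff_ser, map_zero]
  refine sum_eq_zero fun k hk => ?_
  rw [hg m k (fun h => zero_not_mem_modes hs m (h ▸ hk)), smul_zero]

theorem radialFam_zero (u : Fam ℂ) (m : ℕ) (c : Component) : radialFam u m c (0, 0) = u m c (0, 0) :=
  if_pos rfl

theorem radialFam_of_ne (u : Fam ℂ) (m : ℕ) (c : Component) {k : ℕ × ℤ} (hk : k ≠ (0, 0)) :
    radialFam u m c k = 0 := if_neg hk

theorem vals_radialFam (u : Fam ℂ) (τ : ℝ) (o : Sph) :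
    vals conjL (radialFam u) τ o = radialVals u τ := by
  have h1 : ∀ c m k, k ≠ (0, 0) → radialFam u m c k τ = 0 := fun c m k hk => by
    rw [radialFam_of_ne u m c hk]; rfl
  have h2 : ∀ c m k, k ≠ (0, 0) → deriv (radialFam u m c k) τ = 0 := fun c m k hk => by
    rw [radialFam_of_ne u m c hk]; exact deriv_const τ (0 : ℂ)
  have h1' : ∀ c m k, k ≠ (0, 0) → conj (radialFam u m c k τ) = 0 := fun c m k hk => by
    rw [h1 c m k hk, map_zero]
  have h2' : ∀ c m k, k ≠ (0, 0) → conj (deriv (radialFam u m c k) τ) = 0 := fun c m k hk => by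
    rw [h2 c m k hk, map_zero]
  have hz : (PowerSeries.mk fun _ => (0 : ℂ)) = 0 := by ext; simp
  have e1 : ethY 0 (0, 0) o.1.1 o.1.2 = 0 := by simp [ethY]
  have e2 : ethBarY 0 (0, 0) o.1.1 o.1.2 = 0 := by simp [ethBarY]
  simp only [vals, radialVals, ser_of_radial (h1 _), ser_of_radial (h2 _), ser_of_radial (h1' _),
    ser_of_radial (h2' _), ser_of_radial_of_ne one_ne_zero (h1 _),
    ser_of_radial_of_ne (by decide : (-1 : ℤ) ≠ 0) (h1 _), Y_zero, radialFam_zero, conjL_apply, e1, e2,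
    conj_ofReal, map_zero, zero_mul, hz]

theorem expansion_radial {n : ℕ} {f : ℕ × ℤ → ℂ} {S : ℂ}
    (h : ∀ o, ∑ k ∈ modes 0 n, Y 0 k o • f k = S) :
    f (0, 0) = (y0 : ℂ)⁻¹ * S ∧ ∀ k ∈ modes 0 n, k ≠ (0, 0) → f k = 0 := by
  have hy : (y0 : ℂ) ≠ 0 := by exact_mod_cast y0_ne_zero
  have := expansion_injective (s := 0) (n := n) (v := f)
    (v' := fun k => if k = (0, 0) then (y0 : ℂ)⁻¹ * S else 0) fun o => by
      rw [h o, Finset.sum_eq_single_of_mem _ (zero_mem_modes n) fun k _ hk => by simp [hk], Y_zero,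
        if_pos rfl, smul_eq_mul, mul_inv_cancel_left₀ hy]
  exact ⟨by simpa using this _ (zero_mem_modes n), fun k hk h0 => by simpa [h0] using this k hk⟩

theorem coeff_src_radial_eq_zero (q τ : ℝ) (u : Fam ℂ) (n : ℕ) {c : Component} (hc : c.weight ≠ 0) :
    coeff n (src q τ (radialVals u τ) c) = 0 := by
  cases c <;> first | exact absurd rfl hc | simp [src, cubic, current, Vals.comp, radialVals]

variable {q : ℝ} {v : Coeffs ℂ} {u : Fam ℂ} (hu : IsJetA conjL q v u)
  (hv : NoPotential v)
  (hr : ∀ n c, ∀ k ∈ modes c.weight n, k ≠ (0, 0) → v n c k = 0)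

include hu hv hr

theorem IsJetA.eq_zero_of_radial (n : ℕ) : ∀ c, ∀ k ∈ modes c.weight n, k ≠ (0, 0) →
    EqOn (u n c k) 0 𝕀 := by
  induction n using Nat.strong_induction_on with
  | _ n ih =>
    rcases eq_or_ne n 0 with rfl | hn
    · exact fun c k hk hk0 => absurd (mem_modes_zero hk).2 hk0
    have hw : ∀ m < n, ∀ c, ∀ k ∈ modes c.weight m,
        EqOn (u m c k) (radialFam u m c k) 𝕀 := fun m hm c k hk => by
      by_cases h : k = (0, 0)
      · subst h; rw [radialFam_zero]; exact fun _ _ => rfl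
      · rw [radialFam_of_ne u m c h]; exact ih m hm c k hk h
    have hφ : ∀ k ∈ modes 0 n, k ≠ (0, 0) → EqOn (u n .phi k) 0 𝕀 := by
      intro k hk hk0
      refine eq_zero_of_sing (β := 2 * (n - 1)) (γ := 0) (κ := kap ℂ n k.1) (hu.smooth n .phi k hk)
        (fun τ hτ => ?_) ((hu.init n .phi k hk).trans (hr n .phi k hk hk0)) (hu.init_deriv n .phi k hk)
      have h := fun o => hu.phi_eq hv hn hw hτ o
      simp only [vals_radialFam] at h
      exact (expansion_radial h).2 k hk hk0
    intro c k hk hk0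
    by_cases hc : c = .phi
    · subst hc; exact hφ k hk hk0
    have hwn : ∀ k ∈ modes 0 n, EqOn (u n .phi k) (radialFam u n .phi k) 𝕀 := by
      intro k hk
      by_cases h : k = (0, 0)
      · subst h; rw [radialFam_zero]; exact fun _ _ => rfl
      · rw [radialFam_of_ne u n .phi h]; exact hφ k hk h
    refine eq_zero_of_sing (β := 2 * (n - 1)) (γ := -2 * c.drift)
      (κ := kap ℂ n k.1 + mass q (v 0 .phi (0, 0))) (hu.smooth n c k hk) (fun τ hτ => ?_)
      ((hu.init n c k hk).trans (hr n c k hk hk0)) (hu.init_deriv n c k hk)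
    have key : sing (2 * (n - 1)) (-2 * c.drift) (kap ℂ n k.1) (u n c k) τ -
        mass q (v 0 .phi (0, 0)) * (u n c k τ - radialFam u n c k τ) = 0 := by
      by_cases hs : c.weight = 0
      · have h := fun o => hu.comp_eq hv hc hw hwn hτ o
        simp only [vals_radialFam, hs] at h
        exact (expansion_radial h).2 k (hs ▸ hk) hk0
      · refine expansion_injective (v := fun k =>
          sing (2 * (n - 1)) (-2 * c.drift) (kap ℂ n k.1) (u n c k) τ -
            mass q (v 0 .phi (0, 0)) * (u n c k τ - radialFam u n c k τ))
          (v' := fun _ => (0 : ℂ)) (fun o => ?_) k hk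
        rw [hu.comp_eq hv hc hw hwn hτ o, vals_radialFam, coeff_src_radial_eq_zero _ _ _ _ hs]
        simp
    rw [radialFam_of_ne u n c hk0] at key
    rw [← key, sing, sing, Pi.zero_apply]
    ring

theorem IsJetA.radial_eq {n : ℕ} (hn : n ≠ 0) {c : Component} (hc : c.weight = 0) {τ : ℝ}
    (hτ : τ ∈ 𝕀) : sing (2 * (n - 1)) (-2 * c.drift) (kap ℂ n 0) (u n c (0, 0)) τ =
      (y0 : ℂ)⁻¹ * coeff n (src q τ (radialVals u τ) c) := by
  have hw : ∀ m, ∀ c, ∀ k ∈ modes c.weight m,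
      EqOn (u m c k) (radialFam u m c k) 𝕀 := fun m c k hk => by
    by_cases h : k = (0, 0)
    · subst h; rw [radialFam_zero]; exact fun _ _ => rfl
    · rw [radialFam_of_ne u m c h]; exact hu.eq_zero_of_radial hv hr m c k hk h
  by_cases h : c = .phi
  · subst h
    have h := fun o => hu.phi_eq hv hn (fun m _ => hw m) hτ o
    simp only [vals_radialFam] at h
    rw [Component.drift_phi]
    exact (expansion_radial h).1
  · have h := fun o => hu.comp_eq hv h (fun m _ => hw m) (hw n .phi) hτ o
    simp only [vals_radialFam, hc] at h
    have := (expansion_radial h).1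
    simpa [radialFam_zero] using this

end Radial

/-! ### Admissible potentials in a given harmonic sector -/

section Potentials

theorem HasEth.add {h e b h' e' b' : ℂ → ℂ → ℂ} (H : HasEth h e b) (H' : HasEth h' e' b') :
    HasEth (fun z w => h z w + h' z w) (fun z w => e z w + e' z w) (fun z w => b z w + b' z w) := by
  intro c z w
  refine ((H c z w).add (H' c z w)).congr_deriv ?_
  ring

theorem HasEth.unique {h e b h' e' b' : ℂ → ℂ → ℂ} (H : HasEth h e b) (H' : HasEth h' e' b')
    (h0 : ∀ z w, ‖z‖ ^ 2 + ‖w‖ ^ 2 = 1 → h z w = h' z w) (z w : ℂ) (hzw : ‖z‖ ^ 2 + ‖w‖ ^ 2 = 1) :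
    e z w = e' z w ∧ b z w = b' z w := by
  have D := H.add (H'.const_mul (-1))
  have hz : ∀ z w, ‖z‖ ^ 2 + ‖w‖ ^ 2 = 1 → h z w + -1 * h' z w = 0 := fun z w hzw => by
    rw [h0 z w hzw]; ring
  have h1 := D.eq_zero hz z w hzw
  have h2 := D.conj.eq_zero (fun z w hzw => by rw [hz z w hzw, map_zero]) z w hzw
  rw [map_eq_zero] at h2
  exact ⟨by linear_combination h1, by linear_combination h2⟩

/-- The factor in `ð Y = c ₁Y`. -/
def raiseFactor (k : ℕ × ℤ) : ℂ := nrm 0 k * k.1 / nrm 1 k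

/-- The factor in `ð̄ Y = c ₋₁Y`. -/
def lowerFactor (k : ℕ × ℤ) : ℂ := -(nrm 0 k * k.1 / nrm (-1) k)

theorem raiseFactor_ne_zero {k : ℕ × ℤ} (hk : 1 ≤ k.1) : raiseFactor k ≠ 0 :=
  div_ne_zero (mul_ne_zero (nrm_ne_zero _ _) (by exact_mod_cast (by omega : k.1 ≠ 0))) (nrm_ne_zero _ _)

theorem lowerFactor_ne_zero {k : ℕ × ℤ} (hk : 1 ≤ k.1) : lowerFactor k ≠ 0 :=
  neg_ne_zero.mpr (div_ne_zero (mul_ne_zero (nrm_ne_zero _ _)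
    (by exact_mod_cast (by omega : k.1 ≠ 0))) (nrm_ne_zero _ _))

theorem ethY_zero {k : ℕ × ℤ} (hk : 1 ≤ k.1) (z w : ℂ) :
    ethY 0 k z w = raiseFactor k * sY 1 k.1 k.2 z w := by
  rw [sY_eq, ethY, raiseFactor, show ((k.1 : ℤ) - 0).toNat = k.1 by omega,
    show ((k.1 : ℤ) + 0).toNat = k.1 by omega, show ((k.1 : ℤ) + 1).toNat = k.1 + 1 by omega,
    show ((k.1 : ℤ) - 1).toNat = k.1 - 1 by omega]
  field_simp [nrm_ne_zero 1 k]

theorem ethBarY_zero {k : ℕ × ℤ} (hk : 1 ≤ k.1) (z w : ℂ) :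
    ethBarY 0 k z w = lowerFactor k * sY (-1) k.1 k.2 z w := by
  rw [sY_eq, ethBarY, lowerFactor, show ((k.1 : ℤ) - 0).toNat = k.1 by omega,
    show ((k.1 : ℤ) + 0).toNat = k.1 by omega, show ((k.1 : ℤ) + -1).toNat = k.1 - 1 by omega,
    show ((k.1 : ℤ) - -1).toNat = k.1 + 1 by omega]
  field_simp [nrm_ne_zero (-1) k]

theorem raise_lower {k : ℕ × ℤ} (hk : 1 ≤ k.1) (z w : ℂ) :
    raiseFactor k * ethBarY 1 k z w = -(k.1 * (k.1 + 1)) * sY 0 k.1 k.2 z w := by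
  rw [sY_eq, ethBarY, raiseFactor, show ((k.1 : ℤ) - 0).toNat = k.1 by omega,
    show ((k.1 : ℤ) + 0).toNat = k.1 by omega, show ((k.1 : ℤ) + 1).toNat = k.1 + 1 by omega,
    show ((k.1 : ℤ) - 1).toNat = k.1 - 1 by omega, show k.1 + 1 - 1 = k.1 by omega,
    show k.1 - 1 + 1 = k.1 by omega]
  field_simp [nrm_ne_zero 1 k]
  push_cast
  ring

theorem lower_raise {k : ℕ × ℤ} (hk : 1 ≤ k.1) (z w : ℂ) :
    lowerFactor k * ethY (-1) k z w = -(k.1 * (k.1 + 1)) * sY 0 k.1 k.2 z w := by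
  rw [sY_eq, ethY, lowerFactor, show ((k.1 : ℤ) - 0).toNat = k.1 by omega,
    show ((k.1 : ℤ) + 0).toNat = k.1 by omega, show ((k.1 : ℤ) + -1).toNat = k.1 - 1 by omega,
    show ((k.1 : ℤ) - -1).toNat = k.1 + 1 by omega, show k.1 + 1 - 1 = k.1 by omega,
    show k.1 - 1 + 1 = k.1 by omega]
  field_simp [nrm_ne_zero (-1) k]
  push_cast
  ring

theorem modeCoeff_comb {s : ℤ} {n : ℕ} {k : ℕ × ℤ} (f g : Sph → ℂ) (a b : ℂ) :
    modeCoeff s n k (fun o => a * f o + b * g o) = a * modeCoeff s n k f + b * modeCoeff s n k g := by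
  simp only [modeCoeff, smul_eq_mul, mul_sum, ← sum_add_distrib]
  exact sum_congr rfl fun o _ => by ring

theorem modeCoeff_Y {s : ℤ} {n : ℕ} {k : ℕ × ℤ} (hk : k ∈ modes s n) : modeCoeff s n k (Y s k) = 1 := by
  have := modeCoeff_expansion hk (fun k' => if k' = k then (1 : ℂ) else 0)
  simpa [hk] using this

theorem eq_sum_modeCoeff_of_mem {s : ℤ} {n : ℕ} {f : Sph → ℂ} (hf : f ∈ Hs s n) (o : Sph) :
    ∑ k ∈ modes s n, modeCoeff s n k f * Y s k o = f o := by
  have := (harmA_of_mem hf (1 : ℂ)).eq_sum_modeCoeff o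
  simp only [smul_eq_mul, mul_one] at this
  rw [this]
  exact sum_congr rfl fun k _ => mul_comm _ _

/-- The real part of a multiple of a harmonic, with the normalisation appropriate for `α₁`. -/
def pot1 (k : ℕ × ℤ) (c : ℂ) (z w : ℂ) : ℂ :=
  (k.1 * (k.1 + 1) * c) * sY 0 k.1 k.2 z w + (k.1 * (k.1 + 1) * conj c) * conj (sY 0 k.1 k.2 z w)

/-- The component `α₀` which belongs to `pot1`. -/
def pot0 (p : ℕ) (k : ℕ × ℤ) (c : ℂ) (z w : ℂ) : ℂ :=
  ((p - 1 + I) * c) * ethY 0 k z w + ((p - 1 + I) * conj c) * conj (ethBarY 0 k z w)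

/-- The component `α₂` which belongs to `pot1`. -/
def pot2 (p : ℕ) (k : ℕ × ℤ) (c : ℂ) (z w : ℂ) : ℂ :=
  (-(p - 1 - I) * c) * ethBarY 0 k z w + (-(p - 1 - I) * conj c) * conj (ethY 0 k z w)

/-- The harmonic coefficients of a function on the sphere. -/
def harm (s : ℤ) (n : ℕ) (f : ℂ → ℂ → ℂ) (k : ℕ × ℤ) : ℂ := modeCoeff s n k fun o => f o.1.1 o.1.2

theorem conj_pot0 (p : ℕ) (k : ℕ × ℤ) (c z w : ℂ) : pot2 p k c z w = -conj (pot0 p k c z w) := by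
  simp only [pot0, pot2, map_add, map_mul, conj_conj, map_sub, map_one, conj_I,
    map_natCast]
  ring

theorem comb_mem_Hs {s : ℤ} {n : ℕ} {f g : Sph → ℂ} (hf : f ∈ Hs s n) (hg : g ∈ Hs s n) (a b : ℂ) :
    (fun o => a * f o + b * g o) ∈ Hs s n :=
  add_mem (Submodule.smul_mem _ a hf) (Submodule.smul_mem _ b hg)

theorem pot_mem {p : ℕ} {k : ℕ × ℤ} (hk : k ∈ modes 0 p) (c : ℂ) :
    (fun o : Sph => pot1 k c o.1.1 o.1.2) ∈ Hs 0 p ∧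
    (fun o : Sph => pot0 p k c o.1.1 o.1.2) ∈ Hs 1 p ∧
    (fun o : Sph => pot2 p k c o.1.1 o.1.2) ∈ Hs (-1) p := by
  have h1 := Y_mem_Hs hk
  have h2 : (fun o : Sph => ethY 0 k o.1.1 o.1.2) ∈ Hs 1 p := by simpa using ethY_mem_Hs hk
  have h3 : (fun o : Sph => ethBarY 0 k o.1.1 o.1.2) ∈ Hs (-1) p := by simpa using ethBarY_mem_Hs hk
  have h1' : (fun o : Sph => conj (Y 0 k o)) ∈ Hs 0 p := by simpa using conj_mem_Hs h1
  have h2' : (fun o : Sph => conj (ethY 0 k o.1.1 o.1.2)) ∈ Hs (-1) p := conj_mem_Hs h2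
  have h3' : (fun o : Sph => conj (ethBarY 0 k o.1.1 o.1.2)) ∈ Hs 1 p := by
    simpa using conj_mem_Hs h3
  exact ⟨comb_mem_Hs h1 h1' _ _, comb_mem_Hs h2 h3' _ _, comb_mem_Hs h3 h2' _ _⟩

theorem hasEth_pot0 (p : ℕ) {k : ℕ × ℤ} (hl : 1 ≤ k.1) (c : ℂ) : ∃ e, HasEth (pot0 p k c) e
    fun z w => -(p - 1 + I) * pot1 k c z w := by
  have h1 := (hasEth_sY 1 k).const_mul (raiseFactor k)
  have h2 := (hasEth_sY (-1) k).const_mul (lowerFactor k)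
  simp only [raise_lower hl, lower_raise hl, ← ethY_zero hl, ← ethBarY_zero hl] at h1 h2
  have := (h1.const_mul ((p - 1 + I) * c)).add
    (h2.conj.const_mul ((p - 1 + I) * conj c))
  have e : (fun z w => -(p - 1 + I) * pot1 k c z w) = fun z w =>
      (p - 1 + I) * c * (-(k.1 * (k.1 + 1)) * sY 0 k.1 k.2 z w) +
        (p - 1 + I) * conj c * conj (-(k.1 * (k.1 + 1)) * sY 0 k.1 k.2 z w) := by
    funext z w
    simp only [pot1, map_mul, map_neg, map_add, map_natCast, map_one]
    ring
  rw [e]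
  exact ⟨_, this⟩

theorem conj_pot1 (k : ℕ × ℤ) (c z w : ℂ) : conj (pot1 k c z w) = pot1 k c z w := by
  simp only [pot1, map_mul, map_add, map_natCast, map_one, conj_conj]
  ring

theorem orderCond_pot {p : ℕ} {k : ℕ × ℤ} (hk : k ∈ modes 0 p) (hl : 1 ≤ k.1) (c : ℂ) :
    OrderCond p (harm 0 p (pot1 k c)) (harm 1 p (pot0 p k c)) (harm (-1) p (pot2 p k c)) := by
  obtain ⟨m1, m0, m2⟩ := pot_mem hk c
  have s1 : ∀ z w : ℂ, ‖z‖ ^ 2 + ‖w‖ ^ 2 = 1 →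
      ∑ k' ∈ modes 0 p, harm 0 p (pot1 k c) k' * sY 0 k'.1 k'.2 z w = pot1 k c z w :=
    fun z w h => eq_sum_modeCoeff_of_mem m1 ⟨(z, w), h⟩
  have s0 : ∀ z w : ℂ, ‖z‖ ^ 2 + ‖w‖ ^ 2 = 1 →
      ∑ k' ∈ modes 1 p, harm 1 p (pot0 p k c) k' * sY 1 k'.1 k'.2 z w = pot0 p k c z w :=
    fun z w h => eq_sum_modeCoeff_of_mem m0 ⟨(z, w), h⟩
  have s2 : ∀ z w : ℂ, ‖z‖ ^ 2 + ‖w‖ ^ 2 = 1 →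
      ∑ k' ∈ modes (-1) p, harm (-1) p (pot2 p k c) k' * sY (-1) k'.1 k'.2 z w = pot2 p k c z w :=
    fun z w h => eq_sum_modeCoeff_of_mem m2 ⟨(z, w), h⟩
  refine ⟨fun z w h => ?_, fun z w h => ?_, fun z w h => ?_⟩
  · rw [s1 z w h, conj_pot1]
  · rw [s2 z w h, s0 z w h, conj_pot0]
  · obtain ⟨e, he⟩ := hasEth_pot0 p hl c
    have b0 := ((HasEth.sum fun k' (_ : k' ∈ modes 1 p) =>
      (hasEth_sY 1 k').const_mul (harm 1 p (pot0 p k c) k')).unique he s0 z w h).2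
    have b2 := ((HasEth.sum fun k' (_ : k' ∈ modes (-1) p) =>
      (hasEth_sY (-1) k').const_mul (harm (-1) p (pot2 p k c) k')).unique (he.conj.const_mul (-1))
        (fun z w h => by rw [s2 z w h, conj_pot0]; ring) z w h).1
    rw [s1 z w h, b0, b2]
    simp only [map_mul, map_neg, map_add, map_sub, map_natCast, map_one, conj_I, conj_pot1]
    ring

theorem exists_add_conj_ne_zero {a : ℂ} (ha : a ≠ 0) (b : ℂ) : ∃ c : ℂ, c * a + conj c * b ≠ 0 := by
  by_contra! h
  have h1 := h 1
  have h2 := h I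
  simp only [map_one, conj_I, one_mul] at h1 h2
  have : (2 * I) * a = 0 := by linear_combination I * h1 + h2
  exact ha ((mul_eq_zero.mp this).resolve_left (by simp))

/-- There are potentials with a contribution of any given sector. -/
theorem exists_orderCond {p : ℕ} {k : ℕ × ℤ} (hk : k ∈ modes 0 p) (hl : 1 ≤ k.1) :
    (∃ a1 a0 a2, OrderCond p a1 a0 a2 ∧ a1 k ≠ 0) ∧ (∃ a1 a0 a2, OrderCond p a1 a0 a2 ∧ a0 k ≠ 0) ∧
      ∃ a1 a0 a2, OrderCond p a1 a0 a2 ∧ a2 k ≠ 0 := by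
  obtain ⟨-, hkp, hkm⟩ := mem_modes.mp hk
  have k1 : k ∈ modes 1 p := mem_modes.mpr ⟨by simpa using hl, hkp, hkm⟩
  have k2 : k ∈ modes (-1) p := mem_modes.mpr ⟨by simpa using hl, hkp, hkm⟩
  have hL : (k.1 * (k.1 + 1) : ℂ) ≠ 0 := by
    exact_mod_cast (by positivity : k.1 * (k.1 + 1) ≠ 0)
  have hP : (p - 1 + I : ℂ) ≠ 0 := fun h => by simpa using congrArg Complex.im h
  have hM : (-(p - 1 - I) : ℂ) ≠ 0 := fun h => by simpa using congrArg Complex.im h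
  refine ⟨?_, ?_, ?_⟩
  · obtain ⟨c, hc⟩ := exists_add_conj_ne_zero one_ne_zero
      (modeCoeff 0 p k fun o : Sph => conj (Y 0 k o))
    refine ⟨_, _, _, orderCond_pot hk hl c, ?_⟩
    have : harm 0 p (pot1 k c) k = (k.1 * (k.1 + 1)) *
        (c * 1 + conj c * modeCoeff 0 p k fun o : Sph => conj (Y 0 k o)) := by
      refine (modeCoeff_comb (Y 0 k) (fun o : Sph => conj (Y 0 k o)) _ _).trans ?_
      rw [modeCoeff_Y hk]
      ring
    rw [this]
    exact mul_ne_zero hL hc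
  · obtain ⟨c, hc⟩ := exists_add_conj_ne_zero (raiseFactor_ne_zero hl)
      (modeCoeff 1 p k fun o : Sph => conj (ethBarY 0 k o.1.1 o.1.2))
    refine ⟨_, _, _, orderCond_pot hk hl c, ?_⟩
    have : harm 1 p (pot0 p k c) k = (p - 1 + I) *
        (c * raiseFactor k + conj c * modeCoeff 1 p k fun o : Sph => conj (ethBarY 0 k o.1.1 o.1.2)) := by
      have e : (fun o : Sph => pot0 p k c o.1.1 o.1.2) = fun o : Sph =>
          ((p - 1 + I) * c * raiseFactor k) * Y 1 k o +
            ((p - 1 + I) * conj c) * conj (ethBarY 0 k o.1.1 o.1.2) := by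
        funext o
        rw [pot0, ethY_zero hl, Y]
        ring
      rw [harm, e, modeCoeff_comb, modeCoeff_Y k1]
      ring
    rw [this]
    exact mul_ne_zero hP hc
  · obtain ⟨c, hc⟩ := exists_add_conj_ne_zero (lowerFactor_ne_zero hl)
      (modeCoeff (-1) p k fun o : Sph => conj (ethY 0 k o.1.1 o.1.2))
    refine ⟨_, _, _, orderCond_pot hk hl c, ?_⟩
    have : harm (-1) p (pot2 p k c) k = (-(p - 1 - I)) *
        (c * lowerFactor k + conj c * modeCoeff (-1) p k fun o : Sph => conj (ethY 0 k o.1.1 o.1.2)) := by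
      have e : (fun o : Sph => pot2 p k c o.1.1 o.1.2) = fun o : Sph =>
          (-(p - 1 - I) * c * lowerFactor k) * Y (-1) k o +
            (-(p - 1 - I) * conj c) * conj (ethY 0 k o.1.1 o.1.2) := by
        funext o
        rw [pot2, ethBarY_zero hl, Y]
        ring
      rw [harm, e, modeCoeff_comb, modeCoeff_Y k2]
      ring
    rw [this]
    exact mul_ne_zero hM hc

end Potentials

/-! ### Data at order zero and at one further order -/

section Witness

theorem isAnalyticData_zero (s : ℤ) : IsAnalyticData s fun _ _ => 0 :=
  ⟨1, one_pos, 0, fun n k _ => by simp⟩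

theorem orderCond_zero (n : ℕ) : OrderCond n (fun _ => 0) (fun _ => 0) fun _ => 0 :=
  ⟨fun z w _ => by simp, fun z w _ => by simp, fun z w _ => by simp⟩

/-- Coefficients concentrated at the order `p`. -/
def atOrder (p : ℕ) (a : ℕ × ℤ → ℂ) (n : ℕ) (k : ℕ × ℤ) : ℂ := if n = p then a k else 0

theorem atOrder_of_ne {p n : ℕ} (h : n ≠ p) (a : ℕ × ℤ → ℂ) : atOrder p a n = fun _ => 0 := by
  funext k; simp [atOrder, h]

theorem atOrder_self (p : ℕ) (a : ℕ × ℤ → ℂ) : atOrder p a p = a := by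
  funext k; simp [atOrder]

theorem isAnalyticData_atOrder (s : ℤ) (p : ℕ) (a : ℕ × ℤ → ℂ) : IsAnalyticData s (atOrder p a) :=
  (isAnalyticData_zero s).of_eventually_eq fun _ h => atOrder_of_ne h.ne' a

/-- Coefficients of a spherically symmetric scalar field concentrated at the orders `0` and `p`. -/
def phiData (p : ℕ) (a b : ℂ) (n : ℕ) (k : ℕ × ℤ) : ℂ :=
  if k = (0, 0) then if n = 0 then a else if n = p then p.factorial * b else 0 else 0

theorem orderCond_atOrder {p : ℕ} {a1 a0 a2 : ℕ × ℤ → ℂ} (h : OrderCond p a1 a0 a2) (n : ℕ) :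
    OrderCond n (atOrder p a1 n) (atOrder p a0 n) (atOrder p a2 n) := by
  by_cases hn : n = p
  · subst hn; simpa only [atOrder_self] using h
  · simpa only [atOrder_of_ne hn] using orderCond_zero n

/-- Data with a spherically symmetric scalar field at the orders `0` and `p` and a potential at the
order `p`. -/
def specialData {p : ℕ} (hp : p ≠ 0) (a b : ℂ) {a1 a0 a2 : ℕ × ℤ → ℂ} (h : OrderCond p a1 a0 a2) :
    InitialData where
  phi := phiData p a b
  alpha1 := atOrder p a1
  alpha0 := atOrder p a0
  alpha2 := atOrder p a2
  analytic_phi := (isAnalyticData_zero 0).of_eventually_eq (p := p) fun n hn => by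
    funext k; simp [phiData, hn.ne', (Nat.zero_lt_of_lt hn).ne']
  analytic_alpha1 := isAnalyticData_atOrder _ _ _
  analytic_alpha0 := isAnalyticData_atOrder _ _ _
  analytic_alpha2 := isAnalyticData_atOrder _ _ _
  real_alpha1 := ((orderCond_iff _ _ _).mpr (orderCond_atOrder h)).1
  real_alpha02 := ((orderCond_iff _ _ _).mpr (orderCond_atOrder h)).2.1
  lorenz := ((orderCond_iff _ _ _).mpr (orderCond_atOrder h)).2.2
  leading := by simp [atOrder, hp.symm]

section

variable {p : ℕ} (hp : p ≠ 0) (a b : ℂ) {a1 a0 a2 : ℕ × ℤ → ℂ} (h : OrderCond p a1 a0 a2)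

theorem specialData_vec_zero : (specialData hp a b h).vec 0 .phi (0, 0) = a := by
  simp [InitialData.vec, Component.weight, zero_mem_modes, InitialData.comp, specialData, phiData]

theorem specialData_vec_phi : (specialData hp a b h).vec p .phi (0, 0) = b := by
  simp only [InitialData.vec, Component.weight, zero_mem_modes, if_true, InitialData.comp, specialData,
    phiData, hp, if_false]
  rw [inv_mul_cancel_left₀ (by exact_mod_cast p.factorial_ne_zero)]

theorem specialData_vec_phi_of_ne (n : ℕ) {k : ℕ × ℤ} (hk : k ≠ (0, 0)) :
    (specialData hp a b h).vec n .phi k = 0 := by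
  simp [InitialData.vec, InitialData.comp, specialData, phiData, hk]

theorem specialData_vec_of_ne {n : ℕ} (hn : n ≠ 0) (hnp : n ≠ p) (c : Component) (k : ℕ × ℤ) :
    (specialData hp a b h).vec n c k = 0 := by
  unfold InitialData.vec
  split_ifs
  · cases c <;> simp [InitialData.comp, specialData, phiData, atOrder, hn, hnp]
  · rfl

end

theorem mass_ofReal (q a : ℝ) : mass q (a : ℂ) = 2 * q ^ 2 * (y0 ^ 2 * a ^ 2) := by
  rw [mass, norm_real, Real.norm_eq_abs, sq_abs]

/-- The factor of the leading term of the mass in the component equations can be made large. -/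
theorem exists_mass_gt {q : ℝ} (hq : q ≠ 0) (B : ℝ) : ∃ a : ℝ, a ≠ 0 ∧ B < mass q a := by
  have hc : 0 < 2 * q ^ 2 * y0 ^ 2 := by
    have := y0_ne_zero
    positivity
  refine ⟨|B| / (2 * q ^ 2 * y0 ^ 2) + 1, by positivity, ?_⟩
  rw [mass_ofReal]
  set c := 2 * q ^ 2 * y0 ^ 2 with hcd
  have e : 2 * q ^ 2 * (y0 ^ 2 * (|B| / c + 1) ^ 2) = c * (|B| / c + 1) ^ 2 := by rw [hcd]; ring
  have e2 : c * (|B| / c) = |B| := by field_simp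
  rw [e]
  have h1 : 0 ≤ |B| / c := by positivity
  nlinarith [le_abs_self B, mul_nonneg hc.le h1, mul_nonneg hc.le (sq_nonneg (|B| / c))]

theorem kap_add_mass (q : ℝ) (a : ℂ) (p l : ℕ) :
    kap ℂ p l + mass q a = ((p * (p - 1) - l * (l + 1) + mass q a : ℝ) : ℂ) := by
  simp [kap]

theorem exists_natCast_exponent {p : ℕ} (hp : p ≠ 0) (c : Component) {e : ℝ}
    (he : e ∈ 𝕊) : ∃ N : ℕ, 2 * ((p : ℝ) - 1) + e * (-2 * c.drift) = 2 * ((N : ℝ) - 1) ∧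
      (N = 0 → p = 1 ∧ e * (-2 * c.drift) = -2) := by
  obtain ⟨N, hN⟩ := exists_exponent hp c he
  refine ⟨N, hN, ?_⟩
  rintro rfl
  have h1 : (1 : ℝ) ≤ p := by exact_mod_cast Nat.one_le_iff_ne_zero.mpr hp
  have h2 : -2 ≤ e * (-2 * c.drift) := by
    rcases he with rfl | he
    · cases c <;> simp [Component.drift]
    · rw [mem_singleton_iff.mp he]
      cases c <;> simp [Component.drift]
  rw [Nat.cast_zero] at hN
  have h3 : (p : ℝ) = 1 := by linarith
  exact ⟨by exact_mod_cast h3, by linarith⟩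

theorem hasLogTerm_of_homogeneous {p : ℕ} (hp : p ≠ 0) (c : Component) {e : ℝ}
    (he : e ∈ 𝕊) {lam : ℝ} (hlam : (p : ℝ) ^ 2 < lam) {f : ℝ → ℂ}
    (hf : ContDiffOn ℝ ∞ f 𝕀)
    (hs : ∀ τ ∈ 𝕀, sing (2 * (p - 1)) (-2 * c.drift) (lam : ℂ) f τ = 0)
    (h0 : deriv f 0 = 0) (hf0 : f 0 ≠ 0) : HasLogTerm f e 1 := by
  obtain ⟨N, hN, hN0⟩ := exists_natCast_exponent hp c he
  by_cases h : N = 0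
  · obtain ⟨rfl, hγ⟩ := hN0 h
    obtain ⟨F, hF, hfF, hne⟩ := coeff_one_ne_zero_of_sing he hf
      ((sq_nonneg ((1 : ℕ) : ℝ)).trans_lt hlam) hγ (fun τ hτ => by simpa using hs τ hτ) h0 hf0
    exact hasLogTerm_of_coeff_ne_zero hF hfF le_rfl hne
  · exact hasLogTerm_of_sing he hf h (Nat.one_le_iff_ne_zero.mpr hp) hlam hN hs h0 hf0

theorem logSet_nonempty_of_orderCond {q : ℝ} (hq : q ≠ 0) {p : ℕ} (hp : p ≠ 0)
    {a1 a0 a2 : ℕ × ℤ → ℂ} (h : OrderCond p a1 a0 a2) {c : Component} (hc : c ≠ .phi) {k : ℕ × ℤ}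
    (hk : k ∈ modes c.weight p)
    (hne : ∀ a : ℂ, (specialData hp a 0 h).vec p c k ≠ 0) {e : ℝ} (he : e ∈ 𝕊) :
    (logSet q p c k e 1).Nonempty := by
  obtain ⟨a, -, ha⟩ := exists_mass_gt hq ((p : ℝ) ^ 2 - (p * (p - 1) - k.1 * (k.1 + 1)))
  set d := specialData hp (a : ℂ) 0 h with hd
  have hu := solFam_isJetA q d
  have hgap : ∀ m, 0 < m → m < p → ∀ c, ∀ k ∈ modes c.weight m,
      EqOn (solFam q d m c k) 0 𝕀 := fun m h0 hm =>
    hu.eq_zero_of_gap d.vec_zero (fun m h0 hm c k _ => specialData_vec_of_ne hp _ _ h h0.ne' hm.ne c k)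
      m h0 hm
  have hφ : ∀ k ∈ modes 0 p, EqOn (solFam q d p .phi k) 0 𝕀 := fun k hk =>
    eq_zero_of_sing (hu.smooth p .phi k hk)
      (fun τ hτ => hu.phi_sing_of_gap d.vec_zero hp hgap hτ k hk) (by
        rw [hu.init p .phi k hk]
        by_cases h0 : k = (0, 0)
        · rw [h0, hd, specialData_vec_phi]
        · exact specialData_vec_phi_of_ne hp _ _ h p h0) (hu.init_deriv p .phi k hk)
  refine ⟨d, hasLogTerm_of_homogeneous hp c he (lam := p * (p - 1) - k.1 * (k.1 + 1) + mass q a)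
    (by linarith) (hu.smooth p c k hk) (fun τ hτ => ?_) (hu.init_deriv p c k hk)
    (by rw [hu.init p c k hk]; exact hne a)⟩
  rw [← kap_add_mass]
  have := hu.comp_sing_of_gap d.vec_zero hp hgap hφ hc hτ k hk
  rwa [specialData_vec_zero] at this

/-- A constant spatial potential at first order. -/
theorem orderCond_one (a : ℝ) :
    OrderCond 1 (fun k => if k = (0, 0) then (a : ℂ) else 0) (fun _ => 0) fun _ => 0 where
  real1 z w hzw := by
    have : sY 0 0 0 z w = (y0 : ℂ) := Y_zero ⟨(z, w), hzw⟩
    simp [zero_mem_modes, this]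
  real02 z w _ := by simp
  lorenz z w _ := by simp

theorem logSet_nonempty_of_one_le {q : ℝ} (hq : q ≠ 0) {p : ℕ} (hp : p ≠ 0) {c : Component}
    (hc : c ≠ .phi) {k : ℕ × ℤ} (hk : k ∈ modes c.weight p) (hl : 1 ≤ k.1) {e : ℝ}
    (he : e ∈ 𝕊) : (logSet q p c k e 1).Nonempty := by
  obtain ⟨-, hkp, hkm⟩ := mem_modes.mp hk
  obtain ⟨⟨a1, a0, a2, h1, n1⟩, ⟨b1, b0, b2, h0, n0⟩, c1, c0, c2, h2, n2⟩ :=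
    exists_orderCond (mem_modes.mpr ⟨by simp, hkp, hkm⟩ : k ∈ modes 0 p) hl
  have hf : ((p.factorial : ℂ)⁻¹) ≠ 0 := inv_ne_zero (by exact_mod_cast p.factorial_ne_zero)
  have hv : ∀ (d : InitialData), d.comp c p k ≠ 0 → d.vec p c k ≠ 0 := fun d hd => by
    rw [InitialData.vec, if_pos hk]
    exact mul_ne_zero hf hd
  cases c with
  | phi => exact absurd rfl hc
  | alphaPlus =>
    exact logSet_nonempty_of_orderCond hq hp h1 hc hk (fun a => hv _ (by
      simpa [InitialData.comp, specialData, atOrder_self] using n1)) he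
  | alphaMinus =>
    exact logSet_nonempty_of_orderCond hq hp h1 hc hk (fun a => hv _ (by
      simpa [InitialData.comp, specialData, atOrder_self] using n1)) he
  | alpha0 =>
    exact logSet_nonempty_of_orderCond hq hp h0 hc hk (fun a => hv _ (by
      simpa [InitialData.comp, specialData, atOrder_self] using n0)) he
  | alpha2 =>
    exact logSet_nonempty_of_orderCond hq hp h2 hc hk (fun a => hv _ (by
      simpa [InitialData.comp, specialData, atOrder_self] using n2)) he

theorem logSet_nonempty_one {q : ℝ} (hq : q ≠ 0) {c : Component} (hc : c ≠ .phi) (hw : c.weight = 0)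
    {e : ℝ} (he : e ∈ 𝕊) : (logSet q 1 c (0, 0) e 1).Nonempty := by
  refine logSet_nonempty_of_orderCond hq one_ne_zero (orderCond_one 1) hc (hw ▸ zero_mem_modes 1)
    (fun a => ?_) he
  rw [InitialData.vec, if_pos (hw ▸ zero_mem_modes 1)]
  cases c <;> first
    | exact absurd rfl hc
    | (simp [InitialData.comp, specialData, atOrder_self]; done)
    | simp [Component.weight] at hw

end Witness

/-! ### Logarithms in the spherically symmetric sector -/

section Power

open Polynomial

theorem sing_mul {h g : ℝ → ℂ} (hh : ContDiffOn ℝ ∞ h 𝕀)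
    (hg : ContDiffOn ℝ ∞ g 𝕀) (β γ : ℝ) (κ : ℂ) {τ : ℝ} (hτ : τ ∈ 𝕀) :
    sing β γ κ (fun t => h t * g t) τ = (1 - τ ^ 2 : ℂ) * (deriv (deriv h) τ * g τ +
      2 * deriv h τ * deriv g τ + h τ * deriv (deriv g) τ) +
      (β * τ + γ) * (deriv h τ * g τ + h τ * deriv g τ) - κ * (h τ * g τ) := by
  have d1 : ∀ t ∈ 𝕀, deriv (fun t => h t * g t) t = deriv h t * g t + h t * deriv g t :=
    fun t ht => ((hasDerivAt_of_contDiffOn hh ht).mul (hasDerivAt_of_contDiffOn hg ht)).deriv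
  have d2 : deriv (deriv fun t => h t * g t) τ = deriv (deriv h) τ * g τ + deriv h τ * deriv g τ +
      (deriv h τ * deriv g τ + h τ * deriv (deriv g) τ) := by
    have : deriv (fun t => h t * g t) =ᶠ[𝓝 τ] fun t => deriv h t * g t + h t * deriv g t := by
      filter_upwards [isOpen_Ioo.mem_nhds hτ] with t ht using d1 t ht
    rw [this.deriv_eq]
    exact (((hasDerivAt_of_contDiffOn (contDiffOn_deriv hh) hτ).mul
      (hasDerivAt_of_contDiffOn hg hτ)).add ((hasDerivAt_of_contDiffOn hh hτ).mul
      (hasDerivAt_of_contDiffOn (contDiffOn_deriv hg) hτ))).deriv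
  rw [sing, d1 τ hτ, d2]
  simp only [real_smul]
  push_cast
  ring

/-- The function `(1 - s τ)ᵐ`. -/
def powFn (s : ℝ) (m : ℕ) (τ : ℝ) : ℂ := (1 - s * τ : ℂ) ^ m

theorem contDiff_powFn (s : ℝ) (m : ℕ) : ContDiff ℝ ∞ (powFn s m) := by
  have : ContDiff ℝ ∞ fun τ : ℝ => (τ : ℂ) := Complex.ofRealCLM.contDiff
  exact (contDiff_const.sub (contDiff_const.mul this)).pow m

theorem deriv_powFn (s : ℝ) (m : ℕ) : deriv (powFn s m) = fun τ => -(s * m) * powFn s (m - 1) τ := by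
  funext τ
  have h1 : HasDerivAt (fun τ : ℝ => (τ : ℂ)) 1 τ := Complex.ofRealCLM.hasDerivAt
  have h2 := ((h1.const_mul (s : ℂ)).const_sub 1).pow m
  refine (show HasDerivAt (powFn s m) _ τ from h2).deriv.trans ?_
  simp only [powFn]
  ring

theorem powFn_succ (s : ℝ) (m : ℕ) (τ : ℝ) : powFn s (m + 1) τ = powFn s m τ * (1 - s * τ) :=
  pow_succ _ _

theorem mul_deriv_powFn (s : ℝ) (m : ℕ) (τ : ℝ) :
    (1 - s * τ) * deriv (powFn s m) τ = -(s * m) * powFn s m τ := by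
  rw [deriv_powFn]
  cases m with
  | zero => simp
  | succ m => simp only [Nat.add_sub_cancel, powFn_succ]; ring

theorem mul_deriv_deriv_powFn (s : ℝ) (m : ℕ) (τ : ℝ) :
    (1 - s * τ) * deriv (deriv (powFn s m)) τ = -(s * (m - 1)) * deriv (powFn s m) τ := by
  rw [deriv_powFn, deriv_const_mul']
  cases m with
  | zero => simp
  | succ m =>
    simp only [Nat.add_sub_cancel]
    have := mul_deriv_powFn s m τ
    push_cast
    linear_combination (-(s * (m + 1)) : ℂ) * this

theorem powFn_eq {s : ℝ} (hs : s * s = 1) (m : ℕ) (τ : ℝ) :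
    (1 - τ ^ 2 : ℂ) * deriv (deriv (powFn s m)) τ + (2 * m * τ - 2 * s) * deriv (powFn s m) τ =
      ((m + 1) * m) * powFn s m τ := by
  have h1 := mul_deriv_deriv_powFn s m τ
  have h2 := mul_deriv_powFn s m τ
  have hs' : (s : ℂ) * s = 1 := by exact_mod_cast hs
  linear_combination (1 + s * τ : ℂ) * h1 - (s * (m + 1) : ℂ) * h2 +
    (m * (m + 1) * powFn s m τ - 2 * τ * m * deriv (powFn s m) τ +
      τ ^ 2 * deriv (deriv (powFn s m)) τ) * hs'

theorem HasLogTerm.add_analytic {f h : ℝ → ℂ} {e : ℝ} {K : ℕ} (hK : 1 ≤ K) (hf : HasLogTerm f e K)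
    (hh : AnalyticAt ℝ (fun x => h (e * (1 - x))) 0) : HasLogTerm (fun τ => f τ + h τ) e K := by
  obtain ⟨N, a, ⟨ha, hfa⟩, μ₁, μ₂, h1, h2, h3⟩ := hf
  refine ⟨N, fun j => if j = 0 then fun x => a 0 x + h (e * (1 - x)) else a j, ⟨fun j => ?_, ?_⟩,
    μ₁, μ₂, h1, h2, ?_⟩
  · by_cases hj : j = 0
    · simp only [hj, if_true]; exact (ha 0).add hh
    · simpa only [hj, if_false] using ha j
  · filter_upwards [hfa] with x hx
    rw [hx, Finset.sum_range_succ', Finset.sum_range_succ' (n := N)]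
    simp
    ring
  · simpa only [if_neg (show μ₂ ≠ 0 by omega)] using h3

/-- The homogeneous solutions which are multiples of `(1 - s τ)ᵐ` have logarithms. -/
theorem hasLogTerm_powFn_mul {s e : ℝ} (hs : s ∈ 𝕊) (he : e ∈ 𝕊)
    {m : ℕ} (hm : m ≠ 0) {lam : ℝ} (hlam : ((m + 1 : ℕ) : ℝ) < lam) {g : ℝ → ℂ}
    (hg : ContDiffOn ℝ ∞ g 𝕀) (hg0 : g 0 = 1) (hg0' : deriv g 0 = 0)
    (hge : ∀ τ ∈ 𝕀, sing 0 (-2 * (m + 1) * s) (lam : ℂ) g τ = 0)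
    (hwe : ∀ τ ∈ 𝕀, sing (2 * ((m + 1 : ℕ) - 1)) (-2 * s)
      (((m + 1) * m + lam : ℝ) : ℂ) (fun t => powFn s m t * g t) τ = 0) :
    HasLogTerm (fun t => powFn s m t * g t) e 1 := by
  by_contra hlog
  have hw := (contDiff_powFn s m).contDiffOn.mul hg
  have hlam0 : 0 < lam := lt_of_le_of_lt (by positivity) hlam
  have hss := endpoint_mul_self hs
  have hee := endpoint_mul_self he
  have hex : ∀ n : ℕ, (n : ℝ) = m + 1 - e * s → ∃ F, IsLogSer 2 F ∧
      (∀ᶠ x in 𝓝₊, powFn s m (e * (1 - x)) * g (e * (1 - x)) = lev 2 F x) ∧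
      (∀ i, F i = C ((F i).coeff 0)) ∧ ∀ i < n, F i = 0 := fun n hn =>
    exists_logSer_of_not_hasLogTerm he hw (p := m + 1) (by omega) (by push_cast at hlam ⊢; nlinarith)
      (by rw [hn]; push_cast; ring) hwe hlog
  have hes : e * s = 1 ∨ e * s = -1 := by
    have : (e * s - 1) * (e * s + 1) = 0 := by linear_combination (e * e) * hss + hee
    rcases mul_eq_zero.mp this with h | h
    · left; linarith
    · right; linarith
  rcases hes with hes | hes
  · obtain ⟨F, hF, hfF, hC, h0⟩ := hex m (by rw [hes]; ring)
    have ht := (hF.shift m).tendsto_lev (c := (F m).coeff 0) (by simpa using hC m)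
    have hu := tendsto_norm_of_sing he hg (m := m + 1) (by simp) hlam0
      (by linear_combination (-2 * (m + 1) : ℝ) * hes) hge hg0' (by simp [hg0])
    refine not_tendsto_atTop_of_tendsto_nhds (ht.norm.congr' ?_) hu
    filter_upwards [hfF, eventually_pos] with x hx hx0
    rw [lev_pow_smul h0] at hx
    have e1 : powFn s m (e * (1 - x)) = (x ^ m : ℝ) := by
      have : (s : ℂ) * e = 1 := by rw [mul_comm]; exact_mod_cast hes
      rw [powFn]
      push_cast
      congr 1
      linear_combination (-(1 - x) : ℂ) * this
    rw [e1, real_smul] at hx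
    rw [mul_left_cancel₀ (by exact_mod_cast (pow_pos hx0 m).ne') hx]
  · obtain ⟨F, hF, hfF, hC, h0⟩ := hex (m + 2) (by rw [hes]; push_cast; ring)
    have ht := (hF.tendsto_lev (c := 0) (by rw [h0 0 (by omega), C_0])).norm
    rw [norm_zero] at ht
    have : (1 : ℝ) ≤ 0 := by
      refine ge_of_tendsto ht ?_
      filter_upwards [hfF, norm_le_of_sing he hg hlam0.le hge hg0', Ioo_zero_one_mem_nhdsGT]
        with x hx hx' hx1
      rw [hg0, norm_one] at hx'
      rw [← hx, norm_mul]
      have e1 : powFn s m (e * (1 - x)) = ((2 - x) ^ m : ℝ) := by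
        have : (s : ℂ) * e = -1 := by rw [mul_comm]; exact_mod_cast hes
        rw [powFn]
        push_cast
        congr 1
        linear_combination (-(1 - x) : ℂ) * this
      rw [e1, norm_real, Real.norm_eq_abs]
      have : (1 : ℝ) ≤ (2 - x) ^ m := one_le_pow₀ (by linarith [hx1.2])
      nlinarith [le_abs_self ((2 - x) ^ m)]
    norm_num at this

/-- Sources proportional to `(1 - s τ)ᵐ` produce logarithms. -/
theorem hasLogTerm_of_powFn_source {s e : ℝ} (hs : s ∈ 𝕊)
    (he : e ∈ 𝕊) {m : ℕ} (hm : m ≠ 0) {lam : ℝ} (hlam : ((m + 1 : ℕ) : ℝ) < lam)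
    {S : ℂ} (hS : S ≠ 0) {f : ℝ → ℂ} (hf : ContDiffOn ℝ ∞ f 𝕀)
    (hfe : ∀ τ ∈ 𝕀, sing (2 * ((m + 1 : ℕ) - 1)) (-2 * s)
      (((m + 1) * m + lam : ℝ) : ℂ) f τ = S * powFn s m τ) (hf0 : f 0 = 0) (hf0' : deriv f 0 = 0) :
    HasLogTerm f e 1 := by
  obtain ⟨g, hg, hg0, hg0', hge⟩ := exists_sing_solution 0 (-2 * (m + 1) * s) (lam : ℂ)
    (contDiffOn_const (c := (0 : ℂ))) 1 0
  have hss := endpoint_mul_self hs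
  have hss' : (s : ℂ) * s = 1 := by exact_mod_cast hss
  have hh : ContDiffOn ℝ ∞ (powFn s m) 𝕀 := (contDiff_powFn s m).contDiffOn
  have hw := hh.mul hg
  have hwe : ∀ τ ∈ 𝕀, sing (2 * ((m + 1 : ℕ) - 1)) (-2 * s)
      (((m + 1) * m + lam : ℝ) : ℂ) (fun t => powFn s m t * g t) τ = 0 := by
    intro τ hτ
    rw [sing_mul hh hg _ _ _ hτ]
    have h1 := powFn_eq hss m τ
    have h2 := mul_deriv_powFn s m τ
    have h3 := hge τ hτ
    simp only [sing, real_smul] at h3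
    push_cast at h3 ⊢
    linear_combination g τ * h1 + powFn s m τ * h3 + (2 * (1 + s * τ) * deriv g τ) * h2 +
      (2 * τ ^ 2 * deriv (powFn s m) τ * deriv g τ - 2 * m * τ * powFn s m τ * deriv g τ) * hss'
  have hl := hasLogTerm_powFn_mul hs he hm hlam hg hg0 hg0' hge hwe
  have hlam0 : (lam : ℂ) ≠ 0 := by
    exact_mod_cast (lt_of_le_of_lt (by positivity) hlam : (0 : ℝ) < lam).ne'
  set K : ℂ := S / lam with hK
  have hK0 : K ≠ 0 := div_ne_zero hS hlam0
  have heq : EqOn f (fun t => K * (powFn s m t * g t) + -K * powFn s m t) 𝕀 := by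
    refine sing_unique (β := 2 * ((m + 1 : ℕ) - 1)) (γ := -2 * s)
      (κ := (((m + 1) * m + lam : ℝ) : ℂ)) hf ((contDiffOn_const.mul hw).add (contDiffOn_const.mul hh))
      (fun τ hτ => ?_) ?_ ?_
    · rw [hfe τ hτ, sing_comb hw hh _ _ _ _ _ hτ, hwe τ hτ]
      have h1 := powFn_eq hss m τ
      have h4 : K * lam = S := div_mul_cancel₀ _ hlam0
      simp only [sing, real_smul]
      push_cast
      linear_combination K * h1 - powFn s m τ * h4
    · simp [hf0, hg0]
    · have hz : (0 : ℝ) ∈ 𝕀 := by norm_num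
      have := (((hasDerivAt_of_contDiffOn hh hz).mul (hasDerivAt_of_contDiffOn hg hz)).const_mul K).add
        ((hasDerivAt_of_contDiffOn hh hz).const_mul (-K))
      refine hf0'.trans (Eq.trans ?_ this.deriv.symm)
      rw [hg0, hg0']
      ring
  refine HasLogTerm.congr he ((hl.const_mul hK0).add_analytic le_rfl (h := fun t => -K * powFn s m t) ?_) heq
  have hx : AnalyticAt ℝ (fun x : ℝ => (x : ℂ)) 0 := Complex.ofRealCLM.analyticAt _
  simp only [powFn]
  push_cast
  exact analyticAt_const.mul
    ((analyticAt_const.sub (analyticAt_const.mul (analyticAt_const.mul (analyticAt_const.sub hx)))).pow m)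

end Power

section RadialWitness

open PowerSeries (coeff coeff_mk coeff_smul)

theorem coeff_mul_of_gap {F G : PowerSeries ℂ} {n : ℕ} (hn : n ≠ 0)
    (hF : ∀ m, 0 < m → m < n → coeff m F = 0) :
    coeff n (F * G) = coeff 0 F * coeff n G + coeff n F * coeff 0 G := by
  obtain ⟨m, rfl⟩ := Nat.exists_eq_succ_of_ne_zero hn
  rw [PowerSeries.coeff_mul,
    Finset.Nat.sum_antidiagonal_eq_sum_range_succ (fun i j => coeff i F * coeff j G),
    sum_range_succ, Finset.sum_range_succ', sum_eq_zero fun i hi => ?_]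
  · simp
  · have := Finset.mem_range.mp hi
    rw [hF (i + 1) (by omega) (by omega), zero_mul]

theorem coeff_src_of_gap {n : ℕ} (hn : n ≠ 0) (q τ : ℝ) {V : Vals ℂ} {r : ℂ} {c : Component}
    (hc : c ≠ .phi) (hw : c.weight = 0)
    (h : ∀ i, 0 < i → i < n → coeff i V.φ = 0 ∧ coeff i V.χ = 0 ∧ coeff i (V.comp c) = 0)
    (hφ : coeff 0 V.φ = r) (hχ : coeff 0 V.χ = r) (hp : coeff 0 (V.comp c) = 0)
    (hφt : coeff 0 V.φt = 0) (hχt : coeff 0 V.χt = 0) :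
    coeff n (src q τ V c) = 2 * q ^ 2 * (coeff n (V.comp c) * r ^ 2) + coup q * r *
      ((1 + c.drift * τ) * (coeff n V.φt - coeff n V.χt) +
        c.drift * (n * (coeff n V.χ - coeff n V.φ))) := by
  cases c with
  | phi => exact absurd rfl hc
  | alpha0 | alpha2 => simp [Component.weight] at hw
  | alphaPlus | alphaMinus =>
    simp only [Vals.comp, Component.drift] at h hp ⊢
    simp only [src, cubic, current, Vals.comp, map_add, coeff_smul,
      coeff_mul_of_gap hn fun i h0 hi => (h i h0 hi).1,
      coeff_mul_of_gap hn fun i h0 hi => (h i h0 hi).2.1,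
      coeff_mul_of_gap hn fun i h0 hi => (h i h0 hi).2.2, coeff_zero_mul, coeff_xD, hφ, hχ, hp, hφt,
      hχt, smul_eq_mul]
    push_cast
    ring

theorem specialData_radial {p : ℕ} (hp : p ≠ 0) (a b : ℂ) {a1 : ℕ × ℤ → ℂ}
    (h : OrderCond p a1 (fun _ => 0) fun _ => 0) (h1 : ∀ k, k ≠ (0, 0) → a1 k = 0) (n : ℕ)
    (c : Component) (k : ℕ × ℤ) (hk : k ≠ (0, 0)) : (specialData hp a b h).vec n c k = 0 := by
  unfold InitialData.vec
  split_ifs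
  · cases c <;> simp [InitialData.comp, specialData, phiData, atOrder, hk, h1 k hk]
  · rfl

theorem ofReal_mass_ofReal (q a : ℝ) : (mass q (a : ℂ) : ℂ) = 2 * q ^ 2 * (y0 ^ 2 * a ^ 2) := by
  rw [mass_ofReal]
  push_cast
  ring

theorem kap_zero (n : ℕ) : kap ℂ n 0 = ((n * (n - 1) : ℝ) : ℂ) := by simp [kap]

theorem sing_powFn_succ {s : ℝ} (hs : s * s = 1) (m : ℕ) (τ : ℝ) :
    sing (2 * ((m + 1 : ℕ) - 1)) 0 (kap ℂ (m + 1) 0) (powFn s (m + 1)) τ = 0 := by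
  have h1 := mul_deriv_deriv_powFn s (m + 1) τ
  have h2 := mul_deriv_powFn s (m + 1) τ
  have hs' : (s : ℂ) * s = 1 := by exact_mod_cast hs
  rw [kap_zero]
  simp only [sing, real_smul]
  push_cast at h1 h2 ⊢
  linear_combination (1 + s * τ : ℂ) * h1 - (s * m : ℂ) * h2 +
    (τ ^ 2 * deriv (deriv (powFn s (m + 1))) τ - 2 * m * τ * deriv (powFn s (m + 1)) τ +
      (m + 1) * m * powFn s (m + 1) τ) * hs'

theorem conj_powFn (s : ℝ) (m : ℕ) (τ : ℝ) : conj (powFn s m τ) = powFn s m τ := by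
  simp [powFn]

/-- The imaginary part of the scalar field at the order `m + 1`. -/
def imPhi (m : ℕ) (τ : ℝ) : ℂ :=
  (I / 2) * powFn 1 (m + 1) τ + (I / 2) * powFn (-1) (m + 1) τ

theorem contDiff_imPhi (m : ℕ) : ContDiff ℝ ∞ (imPhi m) :=
  (contDiff_const.mul (contDiff_powFn _ _)).add (contDiff_const.mul (contDiff_powFn _ _))

theorem deriv_imPhi (m : ℕ) (τ : ℝ) : deriv (imPhi m) τ =
    (I / 2) * (-(m + 1) * powFn 1 m τ) + (I / 2) * ((m + 1) * powFn (-1) m τ) := by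
  have h : ∀ s, HasDerivAt (powFn s (m + 1)) (deriv (powFn s (m + 1)) τ) τ := fun s =>
    ((contDiff_powFn s (m + 1)).differentiable (by simp) τ).hasDerivAt
  refine (((h 1).const_mul _).add ((h (-1)).const_mul _)).deriv.trans ?_
  simp only [deriv_powFn, Nat.add_sub_cancel]
  push_cast
  ring

theorem sing_imPhi (m : ℕ) {τ : ℝ} (hτ : τ ∈ 𝕀) :
    sing (2 * ((m + 1 : ℕ) - 1)) 0 (kap ℂ (m + 1) 0) (imPhi m) τ = 0 := by
  unfold imPhi
  rw [sing_comb (contDiff_powFn _ _).contDiffOn (contDiff_powFn _ _).contDiffOn _ _ _ _ _ hτ,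
    sing_powFn_succ (by norm_num), sing_powFn_succ (by norm_num)]
  simp

theorem conj_imPhi (m : ℕ) (τ : ℝ) : conj (imPhi m τ) = -imPhi m τ := by
  simp only [imPhi, map_add, map_mul, map_div₀, conj_I, conj_powFn, map_ofNat]
  ring

theorem conj_deriv_imPhi (m : ℕ) (τ : ℝ) : conj (deriv (imPhi m) τ) = -deriv (imPhi m) τ := by
  simp only [deriv_imPhi, map_add, map_mul, map_div₀, conj_I, conj_powFn, map_ofNat, map_neg,
    map_natCast, map_one]
  ring

theorem imPhi_current {s : ℝ} (hs : s ∈ 𝕊) (m : ℕ) (τ : ℝ) :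
    (1 + s * τ) * deriv (imPhi m) τ - s * (m + 1) * imPhi m τ =
      -(s * (m + 1) * I) * powFn s m τ := by
  rcases hs with rfl | hs
  · simp only [deriv_imPhi, imPhi, powFn_succ]
    push_cast
    ring
  · rw [mem_singleton_iff.mp hs]
    simp only [deriv_imPhi, imPhi, powFn_succ]
    push_cast
    ring

section

variable {q : ℝ} {m : ℕ} {a s e : ℝ}

theorem hasLogTerm_of_radial_source (hq : q ≠ 0) (hm : m ≠ 0) (ha0 : a ≠ 0)
    (ha : ((m + 1 : ℕ) : ℝ) < mass q a) (hs : s ∈ 𝕊) (he : e ∈ 𝕊)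
    {f S : ℝ → ℂ} (hf : ContDiffOn ℝ ∞ f 𝕀) (hf0 : f 0 = 0) (hf0' : deriv f 0 = 0)
    (hfe : ∀ τ ∈ 𝕀, sing (2 * ((m + 1 : ℕ) - 1)) (-2 * s) (kap ℂ (m + 1) 0) f τ =
      (y0 : ℂ)⁻¹ * S τ)
    (hS : ∀ τ ∈ 𝕀, S τ = 2 * q ^ 2 * ((y0 * f τ) * (y0 * a) ^ 2) + coup q * (y0 * a) *
      (2 * y0 * ((1 + s * τ) * deriv (imPhi m) τ - s * (m + 1) * imPhi m τ))) : HasLogTerm f e 1 := by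
  have h4 : (y0 : ℂ) ≠ 0 := by exact_mod_cast y0_ne_zero
  refine hasLogTerm_of_powFn_source hs he hm ha (S := -2 * s * (m + 1) * I * coup q * y0 * a)
    ?_ hf (fun τ hτ => ?_) hf0 hf0'
  · have hs0 : (s : ℂ) ≠ 0 := by
      rcases hs with rfl | hs
      · simp
      · rw [mem_singleton_iff.mp hs]; simp
    have h2 : ((m : ℂ) + 1) ≠ 0 := by exact_mod_cast m.succ_ne_zero
    have h3 : coup q ≠ 0 := by simp [coup, hq]
    have h5 : (a : ℂ) ≠ 0 := by exact_mod_cast ha0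
    simp [hs0, h2, h3, h4, h5]
  · have h := hfe τ hτ
    rw [kap_zero, sing_add_kappa _ _ _ (mass q a : ℂ), hS τ hτ, imPhi_current hs, ofReal_mass_ofReal] at h
    have e1 : (((m + 1) * m + mass q a : ℝ) : ℂ) =
        (((m + 1 : ℕ) * ((m + 1 : ℕ) - 1) : ℝ) : ℂ) + 2 * q ^ 2 * (y0 ^ 2 * a ^ 2) := by
      rw [← ofReal_mass_ofReal]
      push_cast
      ring
    rw [e1, eq_sub_of_add_eq h]
    field_simp
    ring

end

set_option maxHeartbeats 800000 in
theorem IsJetA.hasLogTerm_of_radial {q : ℝ} {v : Coeffs ℂ} {u : Fam ℂ}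
    (hu : IsJetA conjL q v u) (hv : NoPotential v) (hq : q ≠ 0) {m : ℕ}
    (hm : m ≠ 0) (hr : ∀ n c, ∀ k ∈ modes c.weight n, k ≠ (0, 0) → v n c k = 0)
    (hz : ∀ n, n ≠ 0 → n ≠ m + 1 → ∀ c k, v n c k = 0) {a : ℝ} (ha0 : a ≠ 0)
    (ha : ((m + 1 : ℕ) : ℝ) < mass q a) (h0 : v 0 .phi (0, 0) = a)
    (h1 : v (m + 1) .phi (0, 0) = I) {c : Component} (hc : c ≠ .phi)
    (h2 : v (m + 1) c (0, 0) = 0) (hw : c.weight = 0) {e : ℝ} (he : e ∈ 𝕊) :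
    HasLogTerm (u (m + 1) c (0, 0)) e 1 := by
  have hp : m + 1 ≠ 0 := m.succ_ne_zero
  have hgap : ∀ i, 0 < i → i < m + 1 → ∀ c, ∀ k ∈ modes c.weight i, EqOn (u i c k) 0 𝕀 :=
    fun i h0 hi => hu.eq_zero_of_gap hv (fun i h0 hi c k _ => hz i h0.ne' hi.ne c k) i h0 hi
  have hφ0 : ∀ τ ∈ 𝕀, u 0 .phi (0, 0) τ = a := fun τ hτ => by rw [hu.phi_zero hv hτ, h0]
  have hφ : EqOn (u (m + 1) .phi (0, 0)) (imPhi m) 𝕀 := by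
    refine sing_unique (β := 2 * ((m + 1 : ℕ) - 1)) (γ := 0) (κ := kap ℂ (m + 1) 0)
      (hu.smooth (m + 1) .phi (0, 0) (zero_mem_modes _)) (contDiff_imPhi m).contDiffOn (fun τ hτ => ?_) ?_ ?_
    · rw [hu.phi_sing_of_gap hv hp hgap hτ _ (zero_mem_modes _), sing_imPhi m hτ]
    · rw [hu.init _ .phi _ (zero_mem_modes _), h1]
      simp [imPhi, powFn]
    · rw [hu.init_deriv _ .phi _ (zero_mem_modes _), deriv_imPhi]
      simp [powFn]
      ring
  have hφd : ∀ τ ∈ 𝕀, deriv (u (m + 1) .phi (0, 0)) τ = deriv (imPhi m) τ := fun τ hτ =>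
    Filter.EventuallyEq.deriv_eq (by
      filter_upwards [isOpen_Ioo.mem_nhds hτ] with t ht using hφ ht)
  have hst := hu.staticLevel hv
  have hmem : ((0, 0) : ℕ × ℤ) ∈ modes c.weight (m + 1) := hw ▸ zero_mem_modes _
  have hf0 : u (m + 1) c (0, 0) 0 = 0 := (hu.init _ c _ hmem).trans h2
  have hfe := fun τ (hτ : τ ∈ 𝕀) => hu.radial_eq hv hr hp hw hτ
  have hcomp : ∀ τ i, coeff i ((radialVals u τ).comp c) = y0 * u i c (0, 0) τ := by
    clear * - hc hw
    cases c <;> simp_all [radialVals, Vals.comp, Component.weight]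
  refine hasLogTerm_of_radial_source hq hm ha0 ha (s := c.drift) (by
    clear * - hc hw
    cases c <;> simp_all [Component.drift, Component.weight]) he (hu.smooth _ c _ hmem) hf0
    (hu.init_deriv _ c _ hmem) hfe fun τ hτ => ?_
  have hgap' := fun i h0 hi c hk => hgap i h0 hi c (0, 0) hk hτ
  rw [coeff_src_of_gap hp q τ hc hw (r := y0 * a) (fun i h0 hi => by
      simp only [hcomp, hgap' i h0 hi c (hw ▸ zero_mem_modes i)]
      simp [radialVals, hgap' i h0 hi .phi (zero_mem_modes i)])
    (hp := by rw [hcomp, hst.zero c hc (0, 0) (hw ▸ zero_mem_modes 0) τ hτ, mul_zero]), hcomp]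
  · simp only [radialVals, coeff_mk, hφ hτ, hφd τ hτ, conj_imPhi, conj_deriv_imPhi]
    push_cast
    ring
  all_goals simp [radialVals, hφ0 τ hτ, hst.phi τ hτ]

theorem logSet_nonempty_radial {q : ℝ} (hq : q ≠ 0) {m : ℕ} (hm : m ≠ 0) {c : Component}
    (hc : c ≠ .phi) (hw : c.weight = 0) {e : ℝ} (he : e ∈ 𝕊) :
    (logSet q (m + 1) c (0, 0) e 1).Nonempty := by
  obtain ⟨a, ha0, ha⟩ := exists_mass_gt hq ((m + 1 : ℕ) : ℝ)
  have hp : m + 1 ≠ 0 := m.succ_ne_zero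
  refine ⟨specialData hp (a : ℂ) I (orderCond_zero (m + 1)),
    (solFam_isJetA q _).hasLogTerm_of_radial (InitialData.vec_zero _) hq hm
    (fun n c k _ hk => specialData_radial hp _ _ _ (fun _ _ => rfl) n c k hk)
    (fun n h0 hn c k => specialData_vec_of_ne hp _ _ _ h0 hn c k) ha0 ha
    (specialData_vec_zero _ _ _ _) (specialData_vec_phi _ _ _ _) hc ?_ hw he⟩
  rw [InitialData.vec]
  split_ifs
  · cases c <;> first
      | exact absurd rfl hc
      | simp [InitialData.comp, specialData, atOrder]
  · rfl

end RadialWitness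

section LogSquared

open Polynomial

theorem coeff_indicial (n i : ℕ) (P : ℂ[X]) (j : ℕ) : (indicial n i P).coeff j =
    2 * (i * ((i - n) * P.coeff j + (j + 1) * P.coeff (j + 1)) +
      (j + 1) * ((i - n) * P.coeff (j + 1) + (j + 2) * P.coeff (j + 2))) := by
  simp only [indicial, coeff_smul, coeff_dil, real_smul]
  push_cast
  ring

theorem coeff_lowerOp_zero (b : ℝ) (κ : ℂ) (P : ℂ[X]) (j : ℕ) : (lowerOp b κ 0 P).coeff j =
    (j + 1) * ((j + 2) * P.coeff (j + 2)) - b * ((j + 1) * P.coeff (j + 1)) + κ * P.coeff j := by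
  simp only [lowerOp, coeff_add, coeff_smul, coeff_dil, coeff_C_mul, real_smul]
  push_cast
  ring

variable {s lam : ℝ} {A B D f : ℝ → ℂ} {c₁ c₂ c₃ μ : ℂ}

/-- The second power of the logarithm in solutions of a coupled system at an exceptional exponent. -/
theorem hasLogTerm_two_of_system (hs : s ∈ 𝕊) (hlam : 0 < lam)
    (hA : ContDiffOn ℝ ∞ A 𝕀) (hB : ContDiffOn ℝ ∞ B 𝕀)
    (hD : ContDiffOn ℝ ∞ D 𝕀) (hf : ContDiffOn ℝ ∞ f 𝕀)
    (eA : ∀ τ ∈ 𝕀, sing 0 (-2 * s) (lam : ℂ) A τ = 0) (A0 : A 0 ≠ 0)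
    (A0' : deriv A 0 = 0) (eB : ∀ τ ∈ 𝕀, sing 0 (2 * s) (lam : ℂ) B τ = 0)
    (eD : ∀ τ ∈ 𝕀, sing 2 0 2 D τ = c₁ * (A τ - B τ))
    (ef : ∀ τ ∈ 𝕀, sing 2 (-2 * s) μ f τ =
      c₂ * A τ + c₃ * ((1 + s * τ) * deriv D τ - 2 * s * D τ))
    (hne : c₂ + s * c₁ * c₃ ≠ 0) : HasLogTerm f s 2 := by
  have hs2 : s * s = 1 := endpoint_mul_self hs
  have hs2' : (s : ℂ) * s = 1 := by exact_mod_cast hs2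
  obtain ⟨F, hF, hFA, hl⟩ := coeff_one_ne_zero_of_sing hs hA hlam (by linear_combination -2 * hs2)
    eA A0' A0
  have hz : ∀ᶠ x in 𝓝₊, x • (fun _ : ℝ => (0 : ℂ)) (s * (1 - x)) =
      lev 0 (fun _ => (0 : ℂ[X])) x := by simp [lev_zero]
  have hnB : (0 : ℝ) + s * (2 * s) = 2 * ((2 : ℕ) - 1) := by push_cast; linear_combination 2 * hs2
  obtain ⟨G, hG, hGB⟩ := exists_logSer_of_sing hs hnB hB eB (isLogSer_zero 0) hz
  have hG1 : (G 0).coeff 1 = 0 := by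
    have h := congrArg (fun P => P.coeff 0) (isFrobenius_of_sing hs hnB hB eB (isLogSer_zero 0) hz hG hGB).1
    have h2 := hG.deg 0 2 le_rfl
    simp only [coeff_indicial, coeff_zero] at h
    push_cast at h
    linear_combination (-1 / 4) * h + h2
  have hFG := ((hF.add (hG.smul (-1))).C_mul c₁)
  have hgD : ∀ᶠ x in 𝓝₊, x • (fun τ => c₁ * (A τ - B τ)) (s * (1 - x)) =
      lev 2 (xmul fun i => C c₁ * (F i + (-1 : ℝ) • G i)) x := by
    filter_upwards [hFA, hGB, hFG.lev_xmul, (hF.add (hG.smul (-1))).lev_C_mul c₁,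
      hF.lev_add (hG.smul (-1)), hG.lev_smul (-1)] with x h1 h2 h3 h4 h5 h6
    rw [h3, h4, h5, h6, h1, h2]
    simp only [neg_smul, one_smul]
    rw [sub_eq_add_neg]
  have hnD : (2 : ℝ) + s * 0 = 2 * ((2 : ℕ) - 1) := by norm_num
  obtain ⟨H, hH, hHD⟩ := exists_logSer_of_sing hs hnD hD eD hFG.xmul hgD
  have hfD := isFrobenius_of_sing hs hnD hD eD hFG.xmul hgD hH hHD
  have hH0 : (H 0).coeff 1 = 0 ∧ (H 0).coeff 2 = 0 ∧ (H 0).coeff 3 = 0 := by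
    have h := fun j => congrArg (fun P => P.coeff j) hfD.1
    have h0 := h 0
    have h1 := h 1
    have h2 := h 2
    have h4 := hH.deg 0 4 le_rfl
    simp only [coeff_indicial, xmul, coeff_zero] at h0 h1 h2
    push_cast at h0 h1 h2
    norm_num at h0 h1 h2
    have h3 : (H 0).coeff 3 = 0 := by linear_combination (-1 / 2) * h2 + 2 * h4
    have h2' : (H 0).coeff 2 = 0 := by linear_combination (-1 / 2) * h1 + (3 / 2) * h3
    exact ⟨by linear_combination (-1 / 2) * h0 + h2', h2', h3⟩
  have hH1 : (H 1).coeff 1 = -(1 / 2) * c₁ * (F 0).coeff 1 ∧ (H 1).coeff 2 = 0 := by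
    have h := fun j => congrArg (fun P => P.coeff j) (hfD.2 0)
    have h1 := h 1
    have h2 := h 2
    have h3 := h 3
    have e4 := hH.deg 1 4 le_rfl
    have e5 := hH.deg 1 5 (by norm_num)
    have a4 := hH.deg 0 4 le_rfl
    have a5 := hH.deg 0 5 (by norm_num)
    simp only [coeff_indicial, xmul, coeff_add, coeff_lowerOp_zero, coeff_C_mul, coeff_smul,
      hF.deg 0 2 le_rfl, hG.deg 0 2 le_rfl, hF.deg 0 3 (by norm_num), hG.deg 0 3 (by norm_num), hG1, hH0,
      zero_add, e4, e5, a4, a5, smul_zero] at h1 h2 h3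
    push_cast at h1 h2 h3
    norm_num at h1 h2 h3
    exact ⟨by linear_combination (-1 / 2) * h1 + 6 * h3, h2⟩
  have hnf : (2 : ℝ) + s * (-2 * s) = 2 * ((1 : ℕ) - 1) := by push_cast; linear_combination -2 * hs2
  have hF4 := hF.mono (show 2 ≤ 4 by norm_num)
  have l1 := hF4.C_mul c₂
  have l2 := hH.theta.C_mul (-2 * s * c₃)
  have l3 := hH.theta.C_mul (s * c₃)
  have l4 := hH.C_mul (-2 * s * c₃)
  have hgf : ∀ᶠ x in 𝓝₊, x • (fun τ : ℝ => c₂ * A τ + c₃ * ((1 + s * τ) * deriv D τ -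
      2 * s * D τ)) (s * (1 - x)) = lev 4 (fun i => C (-2 * s * c₃) * theta H i +
        xmul (fun i => C c₂ * F i + (C (s * c₃) * theta H i + C (-2 * s * c₃) * H i)) i) x := by
    filter_upwards [hFA, hHD, lev_theta_of_lev hs hD hH hHD, l2.lev_add (l1.add (l3.add l4)).xmul,
      (l1.add (l3.add l4)).lev_xmul, l1.lev_add (l3.add l4), l3.lev_add l4, hF4.lev_C_mul c₂,
      hH.theta.lev_C_mul (-2 * s * c₃), hH.theta.lev_C_mul (s * c₃), hH.lev_C_mul (-2 * s * c₃)]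
      with x h1 h2 h3 h4 h5 h6 h7 h8 h9 h10 h11
    rw [h4, h5, h6, h7, h8, h9, h10, h11, ← h3, ← h2, hF.lev_mono (by norm_num), ← h1]
    simp only [real_smul]
    push_cast
    linear_combination (c₃ * deriv D (s * (1 - x)) * x * (1 - x - 2 + x)) * hs2'
  by_contra hlog
  obtain ⟨K, hK, hKf⟩ := exists_logSer_of_sing hs hnf hf ef (l2.add (l1.add (l3.add l4)).xmul) hgf
  have hff := isFrobenius_of_sing hs hnf hf ef (l2.add (l1.add (l3.add l4)).xmul) hgf hK hKf
  have hK2 : ∀ i j, 2 ≤ j → (K i).coeff j = 0 := fun i j hj => by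
    by_contra h
    exact hlog (hasLogTerm_of_coeff_ne_zero hK hKf hj h)
  have hK0 : (K 0).coeff 1 = 0 := by
    have h := congrArg (fun P => P.coeff 0) hff.1
    simp only [coeff_indicial, xmul, theta, coeff_add, coeff_C_mul, coeff_dil, coeff_zero, hH0,
      hK2 0 2 le_rfl, smul_zero] at h
    push_cast at h
    norm_num at h
    exact h
  have h := congrArg (fun P => P.coeff 1) (hff.2 0)
  simp only [coeff_indicial, xmul, theta, coeff_add, coeff_C_mul, coeff_dil, coeff_lowerOp_zero, hH0, hH1,
    hK2 _ 2 le_rfl, hK2 _ 3 (by norm_num), hK0, smul_zero, real_smul] at h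
  push_cast at h
  norm_num at h
  refine mul_ne_zero hne hl ?_
  linear_combination -h

end LogSquared

section LogSquaredWitness

open PowerSeries (coeff coeff_mk coeff_smul)

theorem sing_conj (β γ : ℝ) (κ : ℂ) (f : ℝ → ℂ) (τ : ℝ) :
    sing β γ (conj κ) (fun t => conj (f t)) τ = conj (sing β γ κ f τ) := by
  have h : ∀ g : ℝ → ℂ, deriv (fun t => conj (g t)) = fun t => conj (deriv g t) := fun g => by
    ext t; exact deriv.star
  simp only [sing, h, map_sub, map_add, map_mul, real_smul, conj_ofReal]

theorem contDiffOn_conj {f : ℝ → ℂ} (hf : ContDiffOn ℝ ∞ f 𝕀) :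
    ContDiffOn ℝ ∞ (fun t => conj (f t)) 𝕀 :=
  Complex.conjCLE.contDiff.comp_contDiffOn hf

theorem conj_coup (q : ℝ) : conj (coup q) = -coup q := by
  simp [coup]

theorem coup_sq (q : ℝ) : coup q ^ 2 = -2 * q ^ 2 := by
  simp only [coup]
  linear_combination (I ^ 2 * q ^ 2) * ofReal_sqrt_two_sq + 2 * q ^ 2 * Complex.I_sq

theorem coeff_two_mul (F G : PowerSeries ℂ) : coeff 2 (F * G) =
    coeff 0 F * coeff 2 G + coeff 1 F * coeff 1 G + coeff 2 F * coeff 0 G := by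
  rw [PowerSeries.coeff_mul, Finset.Nat.sum_antidiagonal_eq_sum_range_succ
    (fun i j => coeff i F * coeff j G)]
  simp [sum_range_succ]

theorem coeff_one_mul' (F G : PowerSeries ℂ) : coeff 1 (F * G) =
    coeff 0 F * coeff 1 G + coeff 1 F * coeff 0 G :=
  coeff_mul_of_gap one_ne_zero fun m h0 h1 => by omega

variable {q : ℝ} {v : Coeffs ℂ} {u : Fam ℂ} {a b : ℝ}

theorem IsJetA.phi_one_eq (hu : IsJetA conjL q v u) (hv : NoPotential v)
    (h1 : v 1 .phi (0, 0) = b) : EqOn (u 1 .phi (0, 0)) (fun _ => (b : ℂ)) 𝕀 := by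
  refine sing_unique (β := 2 * ((1 : ℕ) - 1)) (γ := 0) (κ := kap ℂ 1 0)
    (hu.smooth 1 .phi _ (zero_mem_modes 1)) contDiffOn_const (fun τ hτ => ?_) ?_ ?_
  · rw [hu.phi_sing_of_gap hv one_ne_zero (fun m _ _ => by omega) hτ _ (zero_mem_modes 1)]
    simp [sing, kap]
  · rw [hu.init 1 .phi _ (zero_mem_modes 1), h1]
  · rw [hu.init_deriv 1 .phi _ (zero_mem_modes 1), deriv_const]

/-- The equations of the first two orders for spherically symmetric jets of real data. -/
theorem IsJetA.equations_of_radial (hu : IsJetA conjL q v u)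
    (hv : NoPotential v)
    (hr : ∀ n c, ∀ k ∈ modes c.weight n, k ≠ (0, 0) → v n c k = 0)
    (h0 : v 0 .phi (0, 0) = a) (h1 : v 1 .phi (0, 0) = b) {τ : ℝ} (hτ : τ ∈ 𝕀) :
    (∀ c ≠ Component.phi, c.weight = 0 →
      sing 0 (-2 * c.drift) (mass q a : ℂ) (u 1 c (0, 0)) τ = 0) ∧
    sing 2 0 2 (u 2 .phi (0, 0)) τ = q ^ 2 / 2 * y0 ^ 2 * a * u 1 .alphaPlus (0, 0) τ *
      u 1 .alphaMinus (0, 0) τ + coup q * y0 * b / 2 *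
        (u 1 .alphaPlus (0, 0) τ - u 1 .alphaMinus (0, 0) τ) ∧
    ∀ c ≠ Component.phi, c.weight = 0 → sing 2 (-2 * c.drift) (2 + mass q a : ℂ) (u 2 c (0, 0)) τ =
      4 * q ^ 2 * y0 ^ 2 * a * b * u 1 c (0, 0) τ + coup q * y0 * a *
        ((1 + c.drift * τ) * (deriv (u 2 .phi (0, 0)) τ - conj (deriv (u 2 .phi (0, 0)) τ)) -
          2 * c.drift * (u 2 .phi (0, 0) τ - conj (u 2 .phi (0, 0) τ))) := by
  have hy : (y0 : ℂ) ≠ 0 := by exact_mod_cast y0_ne_zero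
  have hst := hu.staticLevel hv
  have f0 : u 0 .phi (0, 0) τ = a := by rw [hu.phi_zero hv hτ, h0]
  have f0' := hst.phi τ hτ
  have f1 : u 1 .phi (0, 0) τ = b := hu.phi_one_eq hv h1 hτ
  have f1' : deriv (u 1 .phi (0, 0)) τ = 0 := by
    rw [Filter.EventuallyEq.deriv_eq (Filter.eventuallyEq_of_mem (isOpen_Ioo.mem_nhds hτ)
      (hu.phi_one_eq hv h1)), deriv_const]
  have p0 := hst.zero .alphaPlus (by simp) (0, 0) (zero_mem_modes 0) τ hτ
  have m0 := hst.zero .alphaMinus (by simp) (0, 0) (zero_mem_modes 0) τ hτ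
  have key := fun n (hn : n ≠ 0) c (hw : c.weight = 0) => hu.radial_eq hv hr (c := c) hn hw hτ
  have k1 : kap ℂ 1 0 = 0 := by simp [kap]
  have k2 : kap ℂ 2 0 = 2 := by simp [kap]; norm_num
  refine ⟨fun c hc hw => ?_, ?_, fun c hc hw => ?_⟩
  · have h := key 1 one_ne_zero c hw
    rw [sing_add_kappa _ _ _ (mass q a : ℂ), k1, zero_add,
      show (2 : ℝ) * ((1 : ℕ) - 1) = 0 by norm_num] at h
    generalize sing 0 (-2 * c.drift) (mass q a : ℂ) (u 1 c (0, 0)) τ = Z at h ⊢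
    rw [ofReal_mass_ofReal] at h
    cases c with
    | phi => exact absurd rfl hc
    | alphaPlus | alphaMinus =>
      simp only [src, cubic, current, Vals.comp, radialVals, map_add, coeff_smul,
        coeff_one_mul', coeff_zero_mul, coeff_xD, coeff_mk, smul_eq_mul, f0, f0', f1, f1', p0,
        m0, conj_ofReal, map_zero] at h
      push_cast at h
      norm_num at h
      field_simp at h
      linear_combination h
    | alpha0 | alpha2 => simp [Component.weight] at hw
  · have h := key 2 two_ne_zero .phi rfl
    rw [k2] at h
    simp only [src, cubic, current, radialVals, map_add, coeff_smul, coeff_two_mul,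
      coeff_one_mul', coeff_zero_mul, coeff_xD, coeff_mk, smul_eq_mul, f0, f0', f1, f1', p0, m0,
      map_zero, Component.drift] at h
    push_cast at h
    norm_num at h
    field_simp at h
    linear_combination h / 2
  · have h := key 2 two_ne_zero c hw
    rw [sing_add_kappa _ _ _ (mass q a : ℂ), k2,
      show (2 : ℝ) * ((2 : ℕ) - 1) = 2 by norm_num] at h
    generalize sing 2 (-2 * c.drift) (2 + mass q a : ℂ) (u 2 c (0, 0)) τ = Z at h ⊢
    rw [ofReal_mass_ofReal] at h
    cases c with
    | phi => exact absurd rfl hc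
    | alphaPlus | alphaMinus =>
      simp only [src, cubic, current, Vals.comp, radialVals, map_add, coeff_smul,
        coeff_two_mul, coeff_one_mul', coeff_zero_mul, coeff_xD, coeff_mk, smul_eq_mul, f0,
        f0', f1, f1', p0, m0, conj_ofReal, map_zero, Component.drift] at h ⊢
      push_cast at h ⊢
      norm_num at h ⊢
      field_simp at h
      linear_combination h
    | alpha0 | alpha2 => simp [Component.weight] at hw

/-- The component with the singular first order at `τ = e` has the square of the logarithm at the
second order. -/
theorem IsJetA.hasLogTerm_two (hu : IsJetA conjL q v u) (hq : q ≠ 0)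
    (hv : NoPotential v)
    (hr : ∀ n c, ∀ k ∈ modes c.weight n, k ≠ (0, 0) → v n c k = 0)
    (h0 : v 0 .phi (0, 0) = a) (ha : a ≠ 0) (h1 : v 1 .phi (0, 0) = b) (hb : b ≠ 0)
    {w : Component → ℝ} (hw : ∀ c ≠ Component.phi, v 1 c (0, 0) = w c) {s : ℝ}
    (hs : s ∈ 𝕊) {c c' : Component} (hc : c.drift = s) (hc' : c'.drift = -s)
    (hw0 : w c ≠ 0) : HasLogTerm (u 2 c (0, 0)) s 2 := by
  have hs0 : s ≠ 0 := by rcases hs with rfl | hs; exacts [one_ne_zero, by rw [mem_singleton_iff.mp hs]; simp]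
  have hphi : ∀ {c : Component}, c.drift ≠ 0 → c ≠ .phi ∧ c.weight = 0 := fun {c} h => by
    cases c <;> simp_all [Component.drift, Component.weight]
  obtain ⟨n1, w1⟩ := hphi (c := c) (by rwa [hc])
  obtain ⟨n2, w2⟩ := hphi (c := c') (by rw [hc']; exact neg_ne_zero.mpr hs0)
  have eq := fun τ (hτ : τ ∈ 𝕀) => hu.equations_of_radial hv hr h0 h1 hτ
  have hmem : ∀ {c : Component} (_ : c.weight = 0) n, ((0, 0) : ℕ × ℤ) ∈ modes c.weight n :=
    fun h n => h ▸ zero_mem_modes n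
  have hreal : ∀ c : Component, c ≠ .phi → c.weight = 0 → ∀ τ ∈ 𝕀,
      conj (u 1 c (0, 0) τ) = u 1 c (0, 0) τ := fun c hc hcw => by
    refine sing_unique (β := 0) (γ := -2 * c.drift) (κ := (mass q a : ℂ))
      (contDiffOn_conj (hu.smooth 1 c _ (hmem hcw 1))) (hu.smooth 1 c _ (hmem hcw 1))
      (fun τ hτ => ?_) ?_ ?_
    · have := sing_conj 0 (-2 * c.drift) (mass q a : ℂ) (u 1 c (0, 0)) τ
      rwa [conj_ofReal, (eq τ hτ).1 c hc hcw, map_zero, ← (eq τ hτ).1 c hc hcw] at this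
    · rw [hu.init 1 c _ (hmem hcw 1), hw c hc, conj_ofReal]
    · have : deriv (fun t => conj (u 1 c (0, 0) t)) 0 = conj (deriv (u 1 c (0, 0)) 0) := deriv.star
      rw [this, hu.init_deriv 1 c _ (hmem hcw 1), map_zero]
  have hy := y0_ne_zero
  have sφ := hu.smooth 2 .phi _ (zero_mem_modes 2)
  have hdiff : (u 1 .alphaPlus (0, 0) - u 1 .alphaMinus (0, 0) : ℝ → ℂ) =
      (s : ℂ) • (u 1 c (0, 0) - u 1 c' (0, 0)) := by
    rcases hs with rfl | hs
    · cases c <;> cases c' <;> first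
        | (exfalso; norm_num [Component.drift] at hc; done)
        | (exfalso; norm_num [Component.drift] at hc'; done)
        | simp
    · obtain rfl := mem_singleton_iff.mp hs
      cases c <;> cases c' <;> first
        | (exfalso; norm_num [Component.drift] at hc; done)
        | (exfalso; norm_num [Component.drift] at hc'; done)
        | simp
  have hdd : ∀ τ ∈ 𝕀, deriv (fun t => 1 * u 2 .phi (0, 0) t + (-1) *
      conj (u 2 .phi (0, 0) t)) τ = deriv (u 2 .phi (0, 0)) τ - conj (deriv (u 2 .phi (0, 0)) τ) := by
    intro τ hτ
    have h := hasDerivAt_of_contDiffOn sφ hτ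
    refine ((h.const_mul 1).add (h.star.const_mul (-1))).deriv.trans ?_
    simp [sub_eq_add_neg]
  refine hasLogTerm_two_of_system (lam := mass q a) (A := u 1 c (0, 0)) (B := u 1 c' (0, 0))
    (D := fun t => 1 * u 2 .phi (0, 0) t + (-1) * conj (u 2 .phi (0, 0) t))
    (c₁ := coup q * y0 * b * s) (c₂ := 4 * q ^ 2 * y0 ^ 2 * a * b) (c₃ := coup q * y0 * a)
    (μ := 2 + mass q a) hs ?_ (hu.smooth 1 c _ (hmem w1 1)) (hu.smooth 1 c' _ (hmem w2 1))
    ((contDiffOn_const.mul sφ).add (contDiffOn_const.mul (contDiffOn_conj sφ)))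
    (hu.smooth 2 c _ (hmem w1 2)) (fun τ hτ => hc ▸ (eq τ hτ).1 c n1 w1) ?_
    (hu.init_deriv 1 c _ (hmem w1 1)) (fun τ hτ => ?_) (fun τ hτ => ?_) (fun τ hτ => ?_) ?_
  · rw [mass_ofReal]
    positivity
  · rw [hu.init 1 c _ (hmem w1 1), hw c n1]
    exact_mod_cast hw0
  · have := (eq τ hτ).1 c' n2 w2
    rwa [hc', mul_neg, neg_mul, neg_neg] at this
  · have h := sing_conj 2 0 2 (u 2 .phi (0, 0)) τ
    rw [show conj (2 : ℂ) = 2 from map_ofNat _ 2] at h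
    have hd := congrFun hdiff τ
    simp only [Pi.sub_apply, Pi.smul_apply, smul_eq_mul] at hd
    rw [sing_comb sφ (contDiffOn_conj sφ) _ _ _ _ _ hτ, h, (eq τ hτ).2.1]
    simp only [map_add, map_sub, map_mul, map_div₀, map_pow, map_ofNat, conj_ofReal, conj_coup,
      hreal .alphaPlus (by simp) rfl τ hτ, hreal .alphaMinus (by simp) rfl τ hτ]
    linear_combination coup q * y0 * b * hd
  · rw [hdd τ hτ, ← hc, (eq τ hτ).2.2 c n1 w1]
    ring
  · have hs2 : (s : ℂ) * s = 1 := by exact_mod_cast endpoint_mul_self hs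
    have : (4 * q ^ 2 * y0 ^ 2 * a * b + s * (coup q * y0 * b * s) * (coup q * y0 * a) : ℂ) =
        2 * q ^ 2 * y0 ^ 2 * a * b := by
      linear_combination (coup q ^ 2 * y0 ^ 2 * a * b) * hs2 + (y0 ^ 2 * a * b : ℂ) * coup_sq q
    rw [this]
    exact_mod_cast (by positivity : 2 * q ^ 2 * y0 ^ 2 * a * b ≠ 0)

theorem exists_logSet_two_nonempty {q : ℝ} (hq : q ≠ 0) {e : ℝ} (he : e ∈ 𝕊) :
    ∃ c : Component, ((0, 0) : ℕ × ℤ) ∈ modes c.weight 2 ∧ (logSet q 2 c (0, 0) e 2).Nonempty := by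
  have main : ∀ c c' : Component, c.drift = e → c'.drift = -e → c ≠ .phi → c.weight = 0 →
      (logSet q 2 c (0, 0) e 2).Nonempty := fun c c' h h' hc hcw => by
    refine ⟨specialData one_ne_zero 1 1 (orderCond_one 1),
      (solFam_isJetA q _).hasLogTerm_two (a := 1) (b := 1) (w := fun c => 2 * c.drift) hq
      (InitialData.vec_zero _) (fun n c k _ hk => specialData_radial _ _ _ _ (fun k hk => if_neg hk) n c k hk)
      ?_ one_ne_zero ?_ one_ne_zero (fun c hc => ?_) he h h' ?_⟩
    · rw [specialData_vec_zero, ofReal_one]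
    · rw [specialData_vec_phi, ofReal_one]
    · rw [InitialData.vec]
      split_ifs with hk
      · cases c <;> first
          | exact absurd rfl hc
          | simp [InitialData.comp, specialData, atOrder_self, Component.drift]
      · cases c <;> simp_all [Component.drift, Component.weight, zero_mem_modes]
    · rw [h]
      rcases he with rfl | he
      · norm_num
      · rw [mem_singleton_iff.mp he]; norm_num
  rcases he with rfl | he
  · exact ⟨.alphaPlus, zero_mem_modes 2, main .alphaPlus .alphaMinus rfl rfl (by simp) rfl⟩
  · obtain rfl := mem_singleton_iff.mp he
    exact ⟨.alphaMinus, zero_mem_modes 2, main .alphaMinus .alphaPlus rfl (by simp [Component.drift])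
      (by simp) rfl⟩

theorem openDense_hasLogTerm_two {q : ℝ} (hq : q ≠ 0) : OpenDense {d | ∀ J, IsSolutionJet q d J →
    ∀ e ∈ 𝕊, ∃ c : Component, ∃ k ∈ modes c.weight 2, HasLogTerm (J.elt c 2 k) e 2} := by
  have key : ∀ e ∈ 𝕊, OpenDense {d | ∃ c : Component, ∃ k ∈ modes c.weight 2,
      d ∈ logSet q 2 c k e 2} := fun e he r hr => by
    refine ⟨fun d ⟨c, k, hk, hd⟩ => ?_, fun d ε hε => ?_⟩
    · obtain ⟨ε, hε, h⟩ := logSet_open hk he hr hd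
      exact ⟨ε, hε, fun d' hd' => ⟨c, k, hk, h d' hd'⟩⟩
    · obtain ⟨c, hk, hne⟩ := exists_logSet_two_nonempty hq he
      obtain ⟨d', hd', hn⟩ := logSet_dense hk he hne hr hε d
      exact ⟨d', ⟨c, _, hk, hd'⟩, hn⟩
  convert (key 1 (by simp)).inter (key (-1) (by simp)) using 1
  ext d
  constructor
  · intro h
    obtain ⟨J, hJ⟩ := exists_isSolutionJet q d
    have h' : ∀ e ∈ 𝕊, ∃ c : Component, ∃ k ∈ modes c.weight 2,
        d ∈ logSet q 2 c k e 2 := fun e he => by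
      obtain ⟨c, k, hk, hl⟩ := h J hJ e he
      exact ⟨c, k, hk, (hJ.hasLogTerm_iff hk he).mp hl⟩
    exact ⟨h' 1 (by simp), h' (-1) (by simp)⟩
  · intro h J hJ e he
    have h' : ∃ c : Component, ∃ k ∈ modes c.weight 2, d ∈ logSet q 2 c k e 2 := by
      rcases he with rfl | he
      · exact h.1
      · rw [mem_singleton_iff.mp he]; exact h.2
    obtain ⟨c, k, hk, hl⟩ := h'
    exact ⟨c, k, hk, (hJ.hasLogTerm_iff hk he).mpr hl⟩

theorem openDense_hasLogTerm {q : ℝ} (hq : q ≠ 0) {p : ℕ} (hp : 1 ≤ p) :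
    OpenDense {d | ∀ J, IsSolutionJet q d J → ∀ c : Component, c ≠ .phi → ∀ k ∈ modes c.weight p,
      ∀ e ∈ 𝕊, HasLogTerm (J.elt c p k) e 1} := by
  classical
  have hp0 : p ≠ 0 := Nat.one_le_iff_ne_zero.mp hp
  have key : ∀ c ≠ Component.phi, ∀ k ∈ modes c.weight p, ∀ e ∈ 𝕊,
      OpenDense (logSet q p c k e 1) := by
    intro c hc k hk e he
    refine logSet_openDense hk he ?_
    rcases Nat.eq_zero_or_pos k.1 with h | h
    · obtain ⟨h1, -, h2⟩ := mem_modes.mp hk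
      rw [h] at h1 h2
      have hw : c.weight = 0 := by simpa using h1
      obtain rfl : k = (0, 0) := Prod.ext h (by simpa using h2)
      obtain ⟨m, rfl⟩ := Nat.exists_eq_succ_of_ne_zero hp0
      rcases eq_or_ne m 0 with rfl | hm
      · exact logSet_nonempty_one hq hc hw he
      · exact logSet_nonempty_radial hq hm hc hw he
    · exact logSet_nonempty_of_one_le hq hp0 hc hk h he
  convert openDense_biInter {.alphaPlus, .alphaMinus, .alpha0, .alpha2}
    (S := fun c : Component => {d | ∀ k ∈ modes c.weight p, d ∈ logSet q p c k 1 1 ∩ logSet q p c k (-1) 1})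
    (fun c hc => openDense_biInter _ fun k hk => have hc : c ≠ .phi := by rintro rfl; simp at hc
      (key c hc k hk 1 (by simp)).inter (key c hc k hk (-1) (by simp))) using 1
  ext d
  constructor
  · intro h c hc k hk
    obtain ⟨J, hJ⟩ := exists_isSolutionJet q d
    have hc : c ≠ .phi := by rintro rfl; simp at hc
    exact ⟨(hJ.hasLogTerm_iff hk (by simp)).mp (h J hJ c hc k hk 1 (by simp)),
      (hJ.hasLogTerm_iff hk (by simp)).mp (h J hJ c hc k hk (-1) (by simp))⟩
  · intro h J hJ c hc k hk e he
    refine (hJ.hasLogTerm_iff hk he).mpr ?_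
    have h' := h c (by cases c <;> simp_all) k hk
    rcases he with rfl | he
    · exact h'.1
    · rw [mem_singleton_iff.mp he]; exact h'.2

end LogSquaredWitness

end MaxwellScalar

end

theorem mainTheorem1 :
    -- every initial data set has solution jets, for every charge
    (∀ (q : ℝ) (d : MaxwellScalar.InitialData), ∃ J, MaxwellScalar.IsSolutionJet q d J) ∧
    -- the only singularities at the critical sets are sums of powers times powers of logarithms
    (∀ (q : ℝ) (d : MaxwellScalar.InitialData) (J : MaxwellScalar.Jets),
      MaxwellScalar.IsSolutionJet q d J →
      ∀ (p : ℕ) (c : MaxwellScalar.Component), ∀ k ∈ MaxwellScalar.modes c.weight p,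
        ∀ e ∈ ({1, -1} : Set ℝ), ∃ N a, MaxwellScalar.HasLogExpansion (J.elt c p k) e N a) ∧
    -- for generic data logarithms occur at every order, in every sector, at both critical sets
    (∀ q : ℝ, q ≠ 0 → ∀ p : ℕ, 1 ≤ p →
      MaxwellScalar.OpenDense {d | ∀ J, MaxwellScalar.IsSolutionJet q d J →
        ∀ c : MaxwellScalar.Component, c ≠ .phi → ∀ k ∈ MaxwellScalar.modes c.weight p,
          ∀ e ∈ ({1, -1} : Set ℝ), MaxwellScalar.HasLogTerm (J.elt c p k) e 1}) ∧
    -- for generic data second or higher powers of the logarithm occur at both critical sets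
    (∀ q : ℝ, q ≠ 0 →
      MaxwellScalar.OpenDense {d | ∀ J, MaxwellScalar.IsSolutionJet q d J →
        ∀ e ∈ ({1, -1} : Set ℝ), ∃ c : MaxwellScalar.Component,
          ∃ k ∈ MaxwellScalar.modes c.weight 2, MaxwellScalar.HasLogTerm (J.elt c 2 k) e 2}) ∧
    -- in the decoupled case only the first power of the logarithm can occur
    (∀ (d : MaxwellScalar.InitialData) (J : MaxwellScalar.Jets),
      MaxwellScalar.IsSolutionJet 0 d J →
      ∀ (p : ℕ) (c : MaxwellScalar.Component), ∀ k ∈ MaxwellScalar.modes c.weight p,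
        ∀ e ∈ ({1, -1} : Set ℝ), ¬ MaxwellScalar.HasLogTerm (J.elt c p k) e 2) := by
  refine ⟨MaxwellScalar.exists_isSolutionJet,
    fun q d J h p c k hk e he => h.exists_hasLogExpansion hk he,
    fun q hq p hp => MaxwellScalar.openDense_hasLogTerm hq hp,
    fun q hq => MaxwellScalar.openDense_hasLogTerm_two hq,
    fun d J h p c k hk e he hlog =>
      MaxwellScalar.not_mem_logSet_of_charge_zero d hk he ((h.hasLogTerm_iff hk he).mp hlog)⟩
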